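/- Let $\Lambda$ be a commutative noetherian ring of positive characteristic in which $2$ is invertible. Let $D^b_{ctf}((\mathrm{Spec}\,\mathbb{R})_{\acute et},\Lambda)$ be the full subcategory of the derived category of étale sheaves of $\Lambda$-modules on $\mathrm{Spec}\,\mathbb{R}$ consisting of the complexes with bounded and constructible cohomology sheaves and of finite Tor-dimension. Let $D^b(\mathrm{Proj}\,\Lambda[\mathbb{Z}/2\mathbb{Z}])$ be the bounded homotopy category of complexes of finitely generated projective $\Lambda[\mathbb{Z}/2\mathbb{Z}]$-modules, with the duality $\mathrm{Hom}(-,\Lambda)$ that sends $P$ termwise to $\mathrm{Hom}_\Lambda(P,\Lambda)$ with the contragredient action of $\mathbb{Z}/2\mathbb{Z}$. Then $D^b_{ctf}((\mathrm{Spec}\,\mathbb{R})_{\acute et},\Lambda)$ is a triangulated subcategory, the functor $R\mathcal{H}om(-,\Lambda)$ exists on it, and $$\bigl(D^b_{ctf}((\mathrm{Spec}\,\mathbb{R})_{\acute et},\Lambda),\,R\mathcal{H}om(-,\Lambda)\bigr)\quad\text{and}\quad\bigl(D^b(\mathrm{Proj}\,\Lambda[\mathbb{Z}/2\mathbb{Z}]),\,\mathrm{Hom}(-,\Lambda)\bigr),$$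 with the biduality morphisms given by evaluation, are triangulated categories with duality. Passing to the stalk at the geometric point $\mathrm{Spec}\,\mathbb{C}\to\mathrm{Spec}\,\mathbb{R}$, with the action of $\mathrm{Gal}(\mathbb{C}/\mathbb{R})=\mathbb{Z}/2\mathbb{Z}$, induces an equivalence of triangulated categories with duality $$\Phi:\bigl(D^b_{ctf}((\mathrm{Spec}\,\mathbb{R})_{\acute et},\Lambda),\,R\mathcal{H}om(-,\Lambda)\bigr)\xrightarrow{\ \simeq\ }\bigl(D^b(\mathrm{Proj}\,\Lambda[\mathbb{Z}/2\mathbb{Z}]),\,\mathrm{Hom}(-,\Lambda)\bigr),$$ that is, $\Phi$ is an exact equivalence that commutes with the dualities up to a natural isomorphism compatible with the shifts and the biduality morphisms, and its composition with the functor to the derived category of $\Lambda[\mathbb{Z}/2\mathbb{Z}]$-modules is isomorphic to the stalk functor. For every $i\in\mathbb{Z}$, $[P,\varphi]\mapsto[\Phi P,\Phi\varphi]$ defines an isomorphism from the constructible Witt group $W^i_c((\mathrm{Spec}\,\mathbb{R})_{\acute et},\Lambda)$ to the $\mathbb{Z}/2\mathbb{Z}$-equivariant Witt group $W^i_{lf}(\Lambda[\mathbb{Z}/2\mathbb{Z}])$.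 These are Balmer's shifted Witt groups $W^i$ of the two triangulated categories with duality above. -/

import Mathlib

open CategoryTheory CategoryTheory.Limits CategoryTheory.Pretriangulated
open AlgebraicGeometry MonoidalCategory Opposite

noncomputable section

/-! ### Dualities on categories with a shift -/

section Duality

universe v u v' u'

/-- The data of a duality `(♯, ω)` on an additive category with shift `T`: a contravariant additive
functor `♯`, natural identifications `(T^n X)^♯ ≅ T^{-n} (X^♯)` and a natural transformation
`ω : X ⟶ X^♯♯`. The axioms are in `DualityData.IsDuality`. -/
structure DualityData (K : Type u) [Category.{v} K] [Preadditive K] [HasShift K ℤ] where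
  /-- the contravariant functor `♯` -/
  D : Kᵒᵖ ⥤ K
  additive : D.Additive
  /-- `(T^n X)^♯ ≅ T^m (X^♯)` for `m = -n` -/
  shiftIso (n m : ℤ) (h : n + m = 0) : (shiftFunctor K n).op ⋙ D ≅ D ⋙ shiftFunctor K m
  /-- the biduality morphism -/
  ω : 𝟭 K ⟶ D.rightOp ⋙ D

namespace DualityData

attribute [instance] DualityData.additive

variable {K : Type u} [Category.{v} K] [Preadditive K] [HasShift K ℤ]

section

variable (𝒟 : DualityData K)

/-- The dual `X^♯` of an object. -/
abbrev dual (X : K) : K := 𝒟.D.obj (op X)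

/-- The transpose `f^♯ : Y^♯ ⟶ X^♯` of `f : X ⟶ Y`. -/
def dualMap {X Y : K} (f : X ⟶ Y) : 𝒟.dual Y ⟶ 𝒟.dual X := 𝒟.D.map f.op

@[simp] lemma dualMap_id (X : K) : 𝒟.dualMap (𝟙 X) = 𝟙 _ := by simp [dualMap]

lemma dualMap_comp {X Y Z : K} (f : X ⟶ Y) (g : Y ⟶ Z) :
    𝒟.dualMap (f ≫ g) = 𝒟.dualMap g ≫ 𝒟.dualMap f := by simp [dualMap]

lemma dualMap_comp_assoc {X Y Z W : K} (f : X ⟶ Y) (g : Y ⟶ Z) (h : 𝒟.dual X ⟶ W) :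
    𝒟.dualMap (f ≫ g) ≫ h = 𝒟.dualMap g ≫ 𝒟.dualMap f ≫ h := by simp [dualMap]

@[simp] lemma dualMap_add {X Y : K} (f g : X ⟶ Y) :
    𝒟.dualMap (f + g) = 𝒟.dualMap f + 𝒟.dualMap g := by simp [dualMap]

@[simp] lemma dualMap_zero {X Y : K} : 𝒟.dualMap (0 : X ⟶ Y) = 0 := by simp [dualMap]

/-- The biduality morphism `X ⟶ X^♯♯`. -/
def bidual (X : K) : X ⟶ 𝒟.dual (𝒟.dual X) := 𝒟.ω.app X

lemma bidual_naturality {X Y : K} (f : X ⟶ Y) :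
    f ≫ 𝒟.bidual Y = 𝒟.bidual X ≫ 𝒟.dualMap (𝒟.dualMap f) := 𝒟.ω.naturality f

/-- The identification `(T^n X)^♯ ≅ T^m (X^♯)` for `n + m = 0`. -/
def dualShift (X : K) (n m : ℤ) (h : n + m = 0) :
    𝒟.dual (X⟦n⟧) ≅ (𝒟.dual X)⟦m⟧ :=
  (𝒟.shiftIso n m h).app (op X)

/-- The identification of the bidual `T^n ((T^n (X^♯))^♯)` for `T^n ∘ ♯` with the bidual
`X^♯♯` for `♯`. -/
def shiftedBidualIso (n : ℤ) (X : K) :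
    (𝒟.dual ((𝒟.dual X)⟦n⟧))⟦n⟧ ≅ 𝒟.dual (𝒟.dual X) :=
  (shiftFunctor K n).mapIso (𝒟.dualShift (𝒟.dual X) n (-n) (by lia)) ≪≫
    (shiftFunctorCompIsoId K (-n) n (by lia)).app _

lemma shiftedBidualIso_inv_naturality (n : ℤ) {X Y : K} (f : X ⟶ Y) :
    𝒟.dualMap (𝒟.dualMap f) ≫ (𝒟.shiftedBidualIso n Y).inv =
      (𝒟.shiftedBidualIso n X).inv ≫ (𝒟.dualMap ((𝒟.dualMap f)⟦n⟧'))⟦n⟧' := by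
  have h2 := (shiftFunctorCompIsoId K (-n) n (by lia)).inv.naturality
    (𝒟.D.map (𝒟.D.map f.op).op)
  have h3 := (𝒟.shiftIso n (-n) (by lia)).inv.naturality (𝒟.D.map f.op).op
  dsimp at h2 h3
  simp only [shiftedBidualIso, dualShift, dualMap, Iso.trans_inv, Functor.mapIso_inv, Iso.app_inv, Category.assoc,
    reassoc_of% h2, ← Functor.map_comp]
  rw [h3]

/-- The sign `(-1)^{n(n+1)/2}`. -/
def shiftSign (n : ℤ) : ℤˣ := (n * (n + 1) / 2).negOnePow

/-- The shifted duality `T^n (K, ♯, ω) = (K, T^n ∘ ♯, (-1)^{n(n+1)/2} ω)`. -/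
def shift (n : ℤ) [∀ n : ℤ, (shiftFunctor K n).Additive] : DualityData K where
  D := 𝒟.D ⋙ shiftFunctor K n
  additive := inferInstance
  shiftIso a b h := Functor.isoWhiskerRight (𝒟.shiftIso a b h) (shiftFunctor K n) ≪≫
    Functor.associator _ _ _ ≪≫ Functor.isoWhiskerLeft 𝒟.D (shiftFunctorComm K b n) ≪≫
    (Functor.associator _ _ _).symm
  ω :=
    { app X := shiftSign n • (𝒟.bidual X ≫ (𝒟.shiftedBidualIso n X).inv)
      naturality X Y f := by
        have h := 𝒟.ω.naturality f
        have h' := 𝒟.shiftedBidualIso_inv_naturality n f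
        dsimp [bidual, dualMap] at h h' ⊢
        rw [Linear.comp_units_smul, Linear.units_smul_comp, reassoc_of% h, h', Category.assoc] }

/-- A symmetric space `(P, φ)`: an isomorphism `φ : P ≅ P^♯` with `φ^♯ ∘ ω_P = φ`. -/
structure SymSpace where
  /-- the underlying object -/
  obj : K
  /-- the symmetric form -/
  form : obj ≅ 𝒟.dual obj
  symm : 𝒟.bidual obj ≫ 𝒟.dualMap form.hom = form.hom

variable {𝒟}

namespace SymSpace

/-- An isometry `(P, φ) ≅ (Q, ψ)` is an isomorphism `f : P ≅ Q` with `f^♯ ψ f = φ`. -/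
def Isometric (P Q : 𝒟.SymSpace) : Prop :=
  ∃ f : P.obj ≅ Q.obj, f.hom ≫ Q.form.hom ≫ 𝒟.dualMap f.hom = P.form.hom

lemma Isometric.refl (P : 𝒟.SymSpace) : P.Isometric P := ⟨Iso.refl _, by simp⟩

lemma Isometric.symm {P Q : 𝒟.SymSpace} (h : P.Isometric Q) : Q.Isometric P := by
  obtain ⟨f, hf⟩ := h
  refine ⟨f.symm, ?_⟩
  simp [← hf, ← dualMap_comp]

lemma Isometric.trans {P Q R : 𝒟.SymSpace} (h : P.Isometric Q) (h' : Q.Isometric R) :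
    P.Isometric R := by
  obtain ⟨f, hf⟩ := h
  obtain ⟨g, hg⟩ := h'
  exact ⟨f ≪≫ g, by simp [← hf, ← hg, dualMap_comp]⟩

variable (𝒟) in
/-- Isometry as an equivalence relation. -/
instance setoid : Setoid 𝒟.SymSpace where
  r := Isometric
  iseqv := ⟨Isometric.refl, Isometric.symm, Isometric.trans⟩

section

variable [HasBinaryBiproducts K]

/-- The orthogonal sum of two symmetric spaces. -/
def sum (P Q : 𝒟.SymSpace) : 𝒟.SymSpace where
  obj := P.obj ⊞ Q.obj
  form :=
    { hom := biprod.fst ≫ P.form.hom ≫ 𝒟.dualMap biprod.fst +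
        biprod.snd ≫ Q.form.hom ≫ 𝒟.dualMap biprod.snd
      inv := 𝒟.dualMap biprod.inl ≫ P.form.inv ≫ biprod.inl +
        𝒟.dualMap biprod.inr ≫ Q.form.inv ≫ biprod.inr
      hom_inv_id := by
        simp only [Preadditive.add_comp, Preadditive.comp_add, Category.assoc,
          ← 𝒟.dualMap_comp_assoc]
        simp
      inv_hom_id := by
        simp only [Preadditive.add_comp, Preadditive.comp_add, Category.assoc]
        simp [← 𝒟.dualMap_comp, ← 𝒟.dualMap_add] }
  symm := by
    have hP := 𝒟.bidual_naturality (biprod.fst : P.obj ⊞ Q.obj ⟶ P.obj)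
    have hQ := 𝒟.bidual_naturality (biprod.snd : P.obj ⊞ Q.obj ⟶ Q.obj)
    simp only [dualMap_add, dualMap_comp, Preadditive.comp_add, Category.assoc,
      ← reassoc_of% hP, ← reassoc_of% hQ,
      reassoc_of% P.symm, reassoc_of% Q.symm]

lemma sum_congr {P P' Q Q' : 𝒟.SymSpace} (h : P.Isometric P') (h' : Q.Isometric Q') :
    (P.sum Q).Isometric (P'.sum Q') := by
  obtain ⟨f, hf⟩ := h
  obtain ⟨g, hg⟩ := h'
  refine ⟨biprod.mapIso f g, ?_⟩
  dsimp [sum]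
  simp [← hf, ← hg, ← 𝒟.dualMap_comp]

lemma sum_comm (P Q : 𝒟.SymSpace) : (P.sum Q).Isometric (Q.sum P) := by
  refine ⟨biprod.braiding _ _, ?_⟩
  dsimp [sum]
  simp [← 𝒟.dualMap_comp, add_comm]

lemma sum_assoc (P Q R : 𝒟.SymSpace) : ((P.sum Q).sum R).Isometric (P.sum (Q.sum R)) := by
  refine ⟨biprod.associator _ _ _, ?_⟩
  dsimp [sum]
  simp [← 𝒟.dualMap_comp, add_assoc]

end

variable [HasZeroObject K]

open scoped ZeroObject

variable (𝒟) in
/-- The zero symmetric space. -/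
def zero : 𝒟.SymSpace where
  obj := 0
  form := (isZero_zero K).iso (𝒟.D.map_isZero (isZero_zero K).op)
  symm := (isZero_zero K).eq_of_src _ _

lemma zero_sum [HasBinaryBiproducts K] (P : 𝒟.SymSpace) : ((zero 𝒟).sum P).Isometric P := by
  let e : (0 : K) ⊞ P.obj ≅ P.obj := ⟨biprod.snd, biprod.inr, by
    ext; simp, by simp⟩
  refine ⟨e, ?_⟩
  have h : (biprod.fst : (0 : K) ⊞ P.obj ⟶ 0) = 0 := (isZero_zero K).eq_of_tgt _ _
  dsimp [sum, e, zero]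
  simp [h]

end SymSpace

end

section Witt

variable [HasZeroObject K] [HasBinaryBiproducts K] (𝒟 : DualityData K)

/-- The Witt monoid: isometry classes of symmetric spaces with the orthogonal sum. -/
def WittMonoid : Type _ := Quotient (SymSpace.setoid 𝒟)

variable {𝒟} in
/-- The isometry class of a symmetric space. -/
def SymSpace.isometryClass (P : 𝒟.SymSpace) : 𝒟.WittMonoid := Quotient.mk _ P

instance : Add 𝒟.WittMonoid :=
  ⟨Quotient.map₂ SymSpace.sum (fun _ _ h _ _ h' ↦ SymSpace.sum_congr h h')⟩

instance : Zero 𝒟.WittMonoid := ⟨(SymSpace.zero 𝒟).isometryClass⟩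

instance : AddCommMonoid 𝒟.WittMonoid where
  add_assoc := by
    rintro ⟨P⟩ ⟨Q⟩ ⟨R⟩
    exact Quotient.sound (SymSpace.sum_assoc P Q R)
  add_comm := by
    rintro ⟨P⟩ ⟨Q⟩
    exact Quotient.sound (SymSpace.sum_comm P Q)
  zero_add := by
    rintro ⟨P⟩
    exact Quotient.sound (SymSpace.zero_sum P)
  add_zero := by
    rintro ⟨P⟩
    exact Quotient.sound ((SymSpace.sum_comm P _).trans (SymSpace.zero_sum P))
  nsmul := nsmulRec

end Witt

section Triangulated

variable [HasZeroObject K] [∀ n : ℤ, (shiftFunctor K n).Additive] [Pretriangulated K]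

/-- For `w : T⁻¹ (L^♯) ⟶ L`, the morphism `T⁻¹ (w^♯) : T⁻¹ (L^♯) ⟶ L^♯♯`, where
`T⁻¹ ((T⁻¹ (L^♯))^♯)` is identified with `L^♯♯`. -/
def lagrangianTranspose (𝒟 : DualityData K) {L : K} (w : (𝒟.dual L)⟦(-1 : ℤ)⟧ ⟶ L) :
    (𝒟.dual L)⟦(-1 : ℤ)⟧ ⟶ 𝒟.dual (𝒟.dual L) :=
  (𝒟.dualMap w)⟦(-1 : ℤ)⟧' ≫ ((𝒟.dualShift (𝒟.dual L) (-1) 1 (by lia)).hom)⟦(-1 : ℤ)⟧' ≫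
    (shiftFunctorCompIsoId K 1 (-1) (by lia)).hom.app _

/-- A symmetric space `(P, φ)` for a `δ`-duality is metabolic (or neutral) if it has a lagrangian:
an exact triangle `T⁻¹ (L^♯) --w--> L --α--> P --α^♯ φ--> L^♯` such that `T⁻¹ (w^♯) = δ w`
(up to the identification `ω_L : L ≅ L^♯♯`). -/
def SymSpace.IsMetabolic {𝒟 : DualityData K} (δ : ℤˣ) (P : 𝒟.SymSpace) : Prop :=
  ∃ (L : K) (α : L ⟶ P.obj) (w : (𝒟.dual L)⟦(-1 : ℤ)⟧ ⟶ L),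
    Triangle.mk w α (P.form.hom ≫ 𝒟.dualMap α ≫
      (shiftFunctorCompIsoId K (-1) 1 (by lia)).inv.app (𝒟.dual L)) ∈ distTriang K ∧
    𝒟.lagrangianTranspose w = δ • (w ≫ 𝒟.bidual L)

/-- The Witt group of a triangulated category with `δ`-duality: the quotient of the
monoid of isometry classes of symmetric spaces by the classes of the metabolic spaces. -/
def WittGroupOf (𝒟 : DualityData K) (δ : ℤˣ) : Type _ :=
  (addConGen (fun x y : 𝒟.WittMonoid ↦
    (∃ P : 𝒟.SymSpace, P.IsMetabolic δ ∧ x = P.isometryClass) ∧ y = 0)).Quotient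

instance (𝒟 : DualityData K) (δ : ℤˣ) : AddCommMonoid (𝒟.WittGroupOf δ) :=
  inferInstanceAs (AddCommMonoid (AddCon.Quotient _))

/-- The shifted Witt group `W^n (K, ♯, ω) = W (T^n (K, ♯, ω))` of a triangulated category with
`1`-duality; `T^n (K, ♯, ω)` is a triangulated category with `(-1)^n`-duality. -/
abbrev WittGroup (𝒟 : DualityData K) (n : ℤ) : Type _ :=
  (𝒟.shift n).WittGroupOf n.negOnePow

/-- The class of a symmetric space in the Witt group. -/
def SymSpace.wittClass {𝒟 : DualityData K} (δ : ℤˣ) (P : 𝒟.SymSpace) : 𝒟.WittGroupOf δ :=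
  AddCon.toQuotient P.isometryClass

/-- The axioms of a triangulated category with duality (`δ = 1`). -/
structure IsDuality (𝒟 : DualityData K) : Prop where
  half (X : K) : ∃ f : X ⟶ X, f + f = 𝟙 X
  dualShift_zero (X : K) : (𝒟.dualShift X 0 0 (by lia)).hom =
    𝒟.dualMap ((shiftFunctorZero K ℤ).inv.app X) ≫ (shiftFunctorZero K ℤ).inv.app (𝒟.dual X)
  dualShift_add (X : K) (a b a' b' : ℤ) (ha : a + a' = 0) (hb : b + b' = 0) :
    (𝒟.dualShift X (a + b) (a' + b') (by lia)).hom =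
      𝒟.dualMap ((shiftFunctorAdd K a b).inv.app X) ≫ (𝒟.dualShift (X⟦a⟧) b b' hb).hom ≫
        ((𝒟.dualShift X a a' ha).hom)⟦b'⟧' ≫ (shiftFunctorAdd K a' b').inv.app (𝒟.dual X)
  /-- `♯` is exact: `C^♯ --v^♯--> B^♯ --u^♯--> A^♯ --T (w^♯)--> T (C^♯)` is exact whenever
  `A --u--> B --v--> C --w--> T A` is. -/
  exact (Δ : Triangle K) (hΔ : Δ ∈ distTriang K) :
    Triangle.mk (𝒟.dualMap Δ.mor₂) (𝒟.dualMap Δ.mor₁)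
      ((shiftFunctorCompIsoId K (-1) 1 (by lia)).inv.app (𝒟.dual Δ.obj₁) ≫
        ((𝒟.dualShift Δ.obj₁ 1 (-1) (by lia)).inv)⟦(1 : ℤ)⟧' ≫
          (𝒟.dualMap Δ.mor₃)⟦(1 : ℤ)⟧') ∈ distTriang K
  isIso_bidual (X : K) : IsIso (𝒟.bidual X)
  /-- `ω_{T X} = T (ω_X)` -/
  bidual_shift (X : K) : 𝒟.bidual (X⟦(1 : ℤ)⟧) =
    (𝒟.bidual X)⟦(1 : ℤ)⟧' ≫ (𝒟.dualShift (𝒟.dual X) (-1) 1 (by lia)).inv ≫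
      𝒟.dualMap (𝒟.dualShift X 1 (-1) (by lia)).hom
  /-- `(ω_X)^♯ ∘ ω_{X^♯} = id` -/
  bidual_dual (X : K) : 𝒟.bidual (𝒟.dual X) ≫ 𝒟.dualMap (𝒟.bidual X) = 𝟙 _

end Triangulated

section Morphism

variable {K₁ : Type u} [Category.{v} K₁] [Preadditive K₁] [HasShift K₁ ℤ] [HasZeroObject K₁]
  [∀ n : ℤ, (shiftFunctor K₁ n).Additive] [Pretriangulated K₁]
  {K₂ : Type u'} [Category.{v'} K₂] [Preadditive K₂] [HasShift K₂ ℤ] [HasZeroObject K₂]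
  [∀ n : ℤ, (shiftFunctor K₂ n).Additive] [Pretriangulated K₂]
  {𝒟₁ : DualityData K₁} {𝒟₂ : DualityData K₂}

/-- A functor `F` together with `η : F ∘ ♯₁ ≅ ♯₂ ∘ F` is a morphism of triangulated categories with
duality: `F` is exact and `η` is compatible with the shifts and with `ω₁`, `ω₂`. -/
structure IsMorphism (F : K₁ ⥤ K₂) [F.CommShift ℤ] (η : 𝒟₁.D ⋙ F ≅ F.op ⋙ 𝒟₂.D) : Prop where
  isTriangulated : F.IsTriangulated
  shift (X : K₁) (n m : ℤ) (h : n + m = 0) :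
    F.map (𝒟₁.dualShift X n m h).hom ≫ (F.commShiftIso m).hom.app (𝒟₁.dual X) ≫
        (η.hom.app (op X))⟦m⟧' =
      η.hom.app (op (X⟦n⟧)) ≫ 𝒟₂.dualMap ((F.commShiftIso n).inv.app X) ≫
        (𝒟₂.dualShift (F.obj X) n m h).hom
  bidual (X : K₁) :
    F.map (𝒟₁.bidual X) ≫ η.hom.app (op (𝒟₁.dual X)) =
      𝒟₂.bidual (F.obj X) ≫ 𝒟₂.dualMap (η.hom.app (op X))

/-- The symmetric space `S₂` for `T^n ∘ ♯₂` is isometric to the image `(F P, F φ)` of the symmetric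
space `S₁ = (P, φ)` for `T^n ∘ ♯₁`, where `F (T^n (P^♯))` is identified with `T^n ((F P)^♯)`. -/
def IsImage (F : K₁ ⥤ K₂) [F.CommShift ℤ] (η : 𝒟₁.D ⋙ F ≅ F.op ⋙ 𝒟₂.D) {n : ℤ}
    (S₁ : (𝒟₁.shift n).SymSpace) (S₂ : (𝒟₂.shift n).SymSpace) : Prop :=
  ∃ e : F.obj S₁.obj ≅ S₂.obj,
    F.map S₁.form.hom ≫ (F.commShiftIso n).hom.app (𝒟₁.dual S₁.obj) ≫
        (η.hom.app (op S₁.obj))⟦n⟧' =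
      e.hom ≫ S₂.form.hom ≫ (𝒟₂.shift n).dualMap e.hom

end Morphism

end DualityData
end Duality

/-! ### Duals of complexes -/

section Complex

universe v u

lemma bidual_app_naturality {A : Type u} [Category.{v} A] {V : Aᵒᵖ ⥤ A}
    (e : 𝟭 A ⟶ V.rightOp ⋙ V) {X Y : A} (f : X ⟶ Y) :
    f ≫ (show Y ⟶ V.obj (op (V.obj (op Y))) from e.app Y) =
      (show X ⟶ V.obj (op (V.obj (op X))) from e.app X) ≫ V.map (V.map f.op).op :=
  e.naturality f

variable {A : Type u} [Category.{v} A] [Preadditive A] (V : Aᵒᵖ ⥤ A) [V.Additive]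

/-- The termwise dual of a cochain complex: `(K^V)^n = V (K^{-n})`, with differentials `V d`. -/
def dualComplex : (CochainComplex A ℤ)ᵒᵖ ⥤ CochainComplex A ℤ :=
  (CochainComplex.opEquivalence A).functor ⋙ V.mapHomologicalComplex (ComplexShape.up ℤ)

lemma dualComplex_X (K : CochainComplex A ℤ) (i : ℤ) :
    ((dualComplex V).obj (op K)).X i = V.obj (op (K.X (-i))) := rfl

lemma dualComplex_d (K : CochainComplex A ℤ) (i j : ℤ) :
    ((dualComplex V).obj (op K)).d i j = V.map (K.d (-j) (-i)).op := rfl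

lemma dualComplex_map {K L : CochainComplex A ℤ} (f : K ⟶ L) (i : ℤ) :
    ((dualComplex V).map f.op).f i = V.map (f.f (-i)).op := rfl

/-- The identification `(T^n K)^V ≅ T^m (K^V)`, `n + m = 0`, given by identity maps. -/
def dualComplexShift (K : CochainComplex A ℤ) (n m : ℤ) (h : n + m = 0) :
    (dualComplex V).obj (op (K⟦n⟧)) ≅ ((dualComplex V).obj (op K))⟦m⟧ :=
  HomologicalComplex.Hom.isoOfComponents
    (fun i ↦ V.mapIso (K.XIsoOfEq (show -(i + m) = -i + n by lia)).op)
    (fun i j hij ↦ by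
      obtain rfl : m = -n := by lia
      have h1 : (K.XIsoOfEq (show -(j + -n) = -j + n by lia)).hom ≫ K.d (-j + n) (-i + n) =
          K.d (-(j + -n)) (-(i + -n)) ≫ (K.XIsoOfEq (show -(i + -n) = -i + n by lia)).hom := by
        simp
      have h2 : V.map (K.XIsoOfEq (show -(i + -n) = -i + n by lia)).hom.op ≫
          V.map (K.d (-(j + -n)) (-(i + -n))).op = V.map (K.d (-j + n) (-i + n)).op ≫
            V.map (K.XIsoOfEq (show -(j + -n) = -j + n by lia)).hom.op := by
        simp only [← Functor.map_comp, ← op_comp, h1]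
      have h3 : V.map (n.negOnePow • K.d (-j + n) (-i + n)).op =
          n.negOnePow • V.map (K.d (-j + n) (-i + n)).op := by
        rw [Units.smul_def, Units.smul_def, op_zsmul, Functor.map_zsmul]
      change V.map (K.XIsoOfEq (show -(i + -n) = -i + n by lia)).hom.op ≫
          ((-n).negOnePow • V.map (K.d (-(j + -n)) (-(i + -n))).op) =
        V.map (n.negOnePow • K.d (-j + n) (-i + n)).op ≫
            V.map (K.XIsoOfEq (show -(j + -n) = -j + n by lia)).hom.op
      rw [h3, Linear.comp_units_smul, Linear.units_smul_comp, h2, Int.negOnePow_neg])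

lemma dualComplexShift_naturality {K L : CochainComplex A ℤ} (f : K ⟶ L) (n m : ℤ)
    (h : n + m = 0) :
    (dualComplex V).map (f⟦n⟧').op ≫ (dualComplexShift V K n m h).hom =
      (dualComplexShift V L n m h).hom ≫ ((dualComplex V).map f.op)⟦m⟧' := by
  ext i
  have h1 : (K.XIsoOfEq (show -(i + m) = -i + n by lia)).hom ≫ f.f (-i + n) =
      f.f (-(i + m)) ≫ (L.XIsoOfEq (show -(i + m) = -i + n by lia)).hom :=
    (HomologicalComplex.XIsoOfEq_hom_naturality _ _).symm
  have h2 : V.map (f.f (-i + n)).op ≫ V.map (K.XIsoOfEq (show -(i + m) = -i + n by lia)).hom.op =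
      V.map (L.XIsoOfEq (show -(i + m) = -i + n by lia)).hom.op ≫
        V.map (f.f (-(i + m))).op := by
    simp only [← Functor.map_comp, ← op_comp, h1]
  exact h2

variable {V} (e : 𝟭 A ⟶ V.rightOp ⋙ V)

/-- The termwise biduality morphism `K ⟶ K^V^V`, for `e : X ⟶ V (V X)`. -/
def bidualComplex (K : CochainComplex A ℤ) :
    K ⟶ (dualComplex V).obj (op ((dualComplex V).obj (op K))) where
  f i := (K.XIsoOfEq (show i = - -i by lia)).hom ≫ e.app (K.X (- -i))
  comm' i j hij := by
    have h := bidual_app_naturality e (K.d (- -i) (- -j))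
    have h' : (K.XIsoOfEq (show i = - -i by lia)).hom ≫ K.d (- -i) (- -j) =
      K.d i j ≫ (K.XIsoOfEq (show j = - -j by lia)).hom := by simp
    exact (Category.assoc _ _ _).trans ((congrArg _ h.symm).trans
      ((Category.assoc _ _ _).symm.trans ((congrArg (· ≫ _) h').trans (Category.assoc _ _ _))))

lemma bidualComplex_naturality {K L : CochainComplex A ℤ} (f : K ⟶ L) :
    f ≫ bidualComplex e L =
      bidualComplex e K ≫ (dualComplex V).map ((dualComplex V).map f.op).op := by
  ext i
  have h := bidual_app_naturality e (f.f (- -i))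
  have h' : (K.XIsoOfEq (show i = - -i by lia)).hom ≫ f.f (- -i) =
      f.f i ≫ (L.XIsoOfEq (show i = - -i by lia)).hom :=
    (HomologicalComplex.XIsoOfEq_hom_naturality _ _).symm
  exact ((Category.assoc _ _ _).trans ((congrArg _ h.symm).trans
      ((Category.assoc _ _ _).symm.trans
        ((congrArg (· ≫ _) h').trans (Category.assoc _ _ _))))).symm

end Complex

section Restrict

universe v u

lemma paste_squares {C : Type u} [Category.{v} C] {X₁ X₂ X₃ X₄ Y₁ Y₂ Y₃ Y₄ : C} {a : X₁ ⟶ Y₁}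
    {b : X₂ ⟶ Y₂} {c : X₃ ⟶ Y₃} {d : X₄ ⟶ Y₄} {i : X₁ ⟶ X₂} {j : X₂ ⟶ X₃} {k : X₃ ⟶ X₄}
    {i' : Y₁ ⟶ Y₂} {j' : Y₂ ⟶ Y₃} {k' : Y₃ ⟶ Y₄} (h₁ : a ≫ i' = i ≫ b) (h₂ : b ≫ j' = j ≫ c)
    (h₃ : c ≫ k' = k ≫ d) : a ≫ i' ≫ j' ≫ k' = (i ≫ j ≫ k) ≫ d := by
  rw [reassoc_of% h₁, reassoc_of% h₂, h₃, Category.assoc, Category.assoc]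

variable {K : Type u} [Category.{v} K] [Preadditive K] [HasShift K ℤ]

/-- The restriction of a duality to a full subcategory that is stable under it. -/
def DualityData.restrict (𝒟 : DualityData K) (P : ObjectProperty K) [P.IsStableUnderShift ℤ]
    (hP : ∀ X, P X → P (𝒟.dual X)) : DualityData P.FullSubcategory where
  D := P.lift (P.ι.op ⋙ 𝒟.D) (fun X ↦ hP _ X.unop.property)
  additive := ⟨fun {X Y f g} ↦ by
    ext
    exact 𝒟.D.map_add (f := (P.ι.map f.unop).op) (g := (P.ι.map g.unop).op)⟩
  shiftIso n m h := NatIso.ofComponents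
    (fun X ↦ P.isoMk (𝒟.D.mapIso ((P.ι.commShiftIso n).app X.unop).symm.op ≪≫
      𝒟.dualShift X.unop.obj n m h ≪≫
        ((P.ι.commShiftIso m).app ⟨𝒟.dual X.unop.obj, hP _ X.unop.property⟩).symm))
    (fun {X Y} f ↦ by
      ext
      have h₁ := congrArg (fun g ↦ 𝒟.D.map g.op) ((P.ι.commShiftIso n).inv.naturality f.unop)
      have h₂ := (𝒟.shiftIso n m h).hom.naturality (P.ι.map f.unop).op
      have h₃ := (P.ι.commShiftIso m).inv.naturality
        (X := ⟨𝒟.dual X.unop.obj, hP _ X.unop.property⟩)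
        (Y := ⟨𝒟.dual Y.unop.obj, hP _ Y.unop.property⟩)
        (ObjectProperty.homMk (𝒟.D.map (P.ι.map f.unop).op))
      dsimp at h₁ h₂ h₃
      simp only [Functor.map_comp] at h₁
      exact paste_squares h₁.symm h₂ h₃)
  ω :=
    { app X := ObjectProperty.homMk (𝒟.bidual X.obj)
      naturality X Y f := by
        ext
        exact 𝒟.bidual_naturality f.hom }

end Restrict

/-! ### The bounded homotopy category and its duality -/

section Homotopy

open scoped ZeroObject

universe v u

variable (A : Type u) [Category.{v} A] [Preadditive A]

/-- The objects of the homotopy category given by bounded cochain complexes. -/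
def boundedComplexes : ObjectProperty (HomotopyCategory A (ComplexShape.up ℤ)) :=
  fun X ↦ ∃ a b : ℤ, ∀ n : ℤ, n < a ∨ b < n → IsZero (X.as.X n)

instance [HasZeroObject A] : (boundedComplexes A).ContainsZero where
  exists_zero :=
    ⟨(HomotopyCategory.quotient _ _).obj 0, Functor.map_isZero _ (isZero_zero _),
      0, 0, fun n _ ↦ (HomologicalComplex.eval A (ComplexShape.up ℤ) n).map_isZero (isZero_zero _)⟩

instance : (boundedComplexes A).IsStableUnderShift ℤ where
  isStableUnderShiftBy n :=
    { le_shift := by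
        intro K hK
        obtain ⟨K : CochainComplex _ _, rfl⟩ := K.quotient_obj_surjective
        obtain ⟨a, b, h⟩ := hK
        rw [ObjectProperty.prop_shift_iff, HomotopyCategory.shift_quotient_obj]
        exact ⟨a - n, b - n, fun i hi ↦ h (i + n) (by lia)⟩ }

instance [HasZeroObject A] [HasBinaryBiproducts A] :
    (boundedComplexes A).IsTriangulatedClosed₃ where
  ext₃' T hT h₁ h₂ := by
    obtain ⟨a₁, b₁, h₁⟩ := h₁
    obtain ⟨a₂, b₂, h₂⟩ := h₂
    obtain ⟨f : T.obj₁.as ⟶ T.obj₂.as, hf⟩ :=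
      (HomotopyCategory.quotient _ _).map_surjective T.mor₁
    refine ⟨_, ?_,
      ⟨Triangle.π₃.mapIso (isoTriangleOfIso₁₂ T _ hT
        (HomotopyCategory.mappingCone_triangleh_distinguished f)
        (Iso.refl _) (Iso.refl _) ?_)⟩⟩
    · refine ⟨min (a₁ - 1) a₂, max b₁ b₂, fun n hn ↦ ?_⟩
      exact (CochainComplex.mappingCone.isZero_X_iff f n).2
        ⟨h₁ _ (by lia), h₂ _ (by lia)⟩
    · exact (Category.comp_id _).trans (hf.symm.trans (Category.id_comp _).symm)

instance [HasZeroObject A] [HasBinaryBiproducts A] : (boundedComplexes A).IsTriangulated where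
  toIsTriangulatedClosed₂ := .of_isTriangulatedClosed₃

/-- The bounded homotopy category `K^b(A)` of an additive category. -/
abbrev BoundedHomotopyCategory := (boundedComplexes A).FullSubcategory

variable {A} (V : Aᵒᵖ ⥤ A) [V.Additive]

/-- The termwise dual on the homotopy category, as a covariant functor to the opposite category. -/
def dualHomotopyOp : HomotopyCategory A (ComplexShape.up ℤ) ⥤
    (HomotopyCategory A (ComplexShape.up ℤ))ᵒᵖ :=
  CategoryTheory.Quotient.lift _ ((dualComplex V).rightOp ⋙ (HomotopyCategory.quotient _ _).op)
    (by
      rintro K L f g ⟨h⟩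
      exact Quiver.Hom.unop_inj (HomotopyCategory.eq_of_homotopy _ _
        (V.mapHomotopy (CochainComplex.homotopyOp h))))

/-- The termwise dual `K ↦ K^V` on the homotopy category. -/
def dualHomotopy : (HomotopyCategory A (ComplexShape.up ℤ))ᵒᵖ ⥤
    HomotopyCategory A (ComplexShape.up ℤ) :=
  (dualHomotopyOp V).leftOp

lemma dualHomotopy_map {K L : CochainComplex A ℤ} (f : K ⟶ L) :
    (dualHomotopy V).map ((HomotopyCategory.quotient _ _).map f).op =
      (HomotopyCategory.quotient _ _).map ((dualComplex V).map f.op) := rfl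

instance : (dualHomotopy V).Additive where
  map_add {X Y f g} := by
    obtain ⟨⟨X⟩⟩ := X
    obtain ⟨⟨Y⟩⟩ := Y
    obtain ⟨f', hf⟩ := (HomotopyCategory.quotient _ _).map_surjective f.unop
    obtain ⟨g', hg⟩ := (HomotopyCategory.quotient _ _).map_surjective g.unop
    obtain rfl : ((HomotopyCategory.quotient _ _).map f').op = f := Quiver.Hom.unop_inj hf
    obtain rfl : ((HomotopyCategory.quotient _ _).map g').op = g := Quiver.Hom.unop_inj hg
    have h : (dualComplex V).map (f' + g').op =
        (dualComplex V).map f'.op + (dualComplex V).map g'.op := by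
      ext i
      exact V.map_add (f := (f'.f (-i)).op) (g := (g'.f (-i)).op)
    exact (congrArg (HomotopyCategory.quotient A (ComplexShape.up ℤ)).map h).trans
      ((HomotopyCategory.quotient A (ComplexShape.up ℤ)).map_add)

/-- The identification `(T^n K)^V ≅ T^m (K^V)` in the homotopy category. -/
def dualHomotopyShift (n m : ℤ) (h : n + m = 0) :
    (shiftFunctor (HomotopyCategory A (ComplexShape.up ℤ)) n).op ⋙ dualHomotopy V ≅
      dualHomotopy V ⋙ shiftFunctor (HomotopyCategory A (ComplexShape.up ℤ)) m :=
  NatIso.ofComponents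
    (fun X ↦ (dualHomotopy V).mapIso
        (((HomotopyCategory.quotient _ _).commShiftIso n).app X.unop.as).op ≪≫
      (HomotopyCategory.quotient _ _).mapIso (dualComplexShift V X.unop.as n m h) ≪≫
      ((HomotopyCategory.quotient _ _).commShiftIso m).app ((dualComplex V).obj (op X.unop.as)))
    (fun {X Y} f ↦ by
      obtain ⟨⟨X⟩⟩ := X
      obtain ⟨⟨Y⟩⟩ := Y
      obtain ⟨f', hf⟩ := (HomotopyCategory.quotient _ _).map_surjective f.unop
      obtain rfl : ((HomotopyCategory.quotient _ _).map f').op = f := Quiver.Hom.unop_inj hf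
      have h₁ := congrArg (fun g ↦ (dualHomotopy V).map g.op)
        (((HomotopyCategory.quotient A (ComplexShape.up ℤ)).commShiftIso n).hom.naturality f')
      have h₂ := congrArg (HomotopyCategory.quotient _ _).map
        (dualComplexShift_naturality V f' n m h)
      have h₃ := ((HomotopyCategory.quotient A (ComplexShape.up ℤ)).commShiftIso m).hom.naturality
        ((dualComplex V).map f'.op)
      dsimp at h₁ h₂ h₃ ⊢
      simp only [Functor.map_comp] at h₁ h₂
      exact paste_squares h₁.symm h₂ h₃)

/-- The duality on the homotopy category given by the termwise dual. -/
def homotopyDuality (e : 𝟭 A ⟶ V.rightOp ⋙ V) :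
    DualityData (HomotopyCategory A (ComplexShape.up ℤ)) where
  D := dualHomotopy V
  additive := inferInstance
  shiftIso := dualHomotopyShift V
  ω :=
    { app X := (HomotopyCategory.quotient _ _).map (bidualComplex e X.as)
      naturality X Y f := by
        obtain ⟨f', rfl⟩ := (HomotopyCategory.quotient _ _).map_surjective f
        exact congrArg (HomotopyCategory.quotient A (ComplexShape.up ℤ)).map
          (bidualComplex_naturality e f') }

/-- The duality on the bounded homotopy category given by the termwise dual. -/
def boundedHomotopyDuality (e : 𝟭 A ⟶ V.rightOp ⋙ V) [HasZeroObject A] [HasBinaryBiproducts A] :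
    DualityData (BoundedHomotopyCategory A) :=
  (homotopyDuality V e).restrict (boundedComplexes A) (by
    rintro ⟨K⟩ ⟨a, b, h⟩
    exact ⟨-b, -a, fun n hn ↦ V.map_isZero (h (-n) (by lia)).op⟩)

end Homotopy

/-! ### Duals in symmetric monoidal closed categories -/

section InternalHom

universe v u

variable {C : Type u} [Category.{v} C] [MonoidalCategory C] [MonoidalClosed C]

/-- The functor `X ↦ 𝓗om(X, d)`. -/
abbrev internalDual (d : C) : Cᵒᵖ ⥤ C := MonoidalClosed.internalHom.flip.obj d

lemma internalBidual_naturality [SymmetricCategory C] (d : C) {X Y : C} (f : X ⟶ Y) :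
    f ≫ MonoidalClosed.curry (X := d) ((β_ ((ihom Y).obj d) Y).hom ≫ (ihom.ev Y).app d) =
      MonoidalClosed.curry (X := d) ((β_ ((ihom X).obj d) X).hom ≫ (ihom.ev X).app d) ≫
        (MonoidalClosed.pre ((MonoidalClosed.pre f).app d)).app d := by
  rw [← MonoidalClosed.curry_natural_left, MonoidalClosed.curry_pre_app,
    BraidedCategory.braiding_naturality_right_assoc,
    BraidedCategory.braiding_naturality_left_assoc, MonoidalClosed.id_tensor_pre_app_comp_ev]

/-- The biduality morphism `X ⟶ 𝓗om(𝓗om(X, d), d)`, given by evaluation. -/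
def internalBidual [SymmetricCategory C] (d : C) :
    𝟭 C ⟶ (internalDual d).rightOp ⋙ internalDual d where
  app X := MonoidalClosed.curry (X := d) ((β_ ((ihom X).obj d) X).hom ≫ (ihom.ev X).app d)
  naturality _ _ f := internalBidual_naturality d f

lemma pre_app_add [Preadditive C] [MonoidalPreadditive C] (d : C) {X Y : C} (f g : X ⟶ Y) :
    (MonoidalClosed.pre (f + g)).app d =
      (MonoidalClosed.pre f).app d + (MonoidalClosed.pre g).app d := by
  apply MonoidalClosed.uncurry_injective
  simp only [MonoidalClosed.uncurry_eq, MonoidalPreadditive.whiskerLeft_add,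
    Preadditive.add_comp, MonoidalClosed.id_tensor_pre_app_comp_ev,
    MonoidalPreadditive.add_whiskerRight]

instance [Preadditive C] [MonoidalPreadditive C] (d : C) : (internalDual d).Additive where
  map_add {_ _ f g} := pre_app_add d f.unop g.unop

end InternalHom

/-! ### Closedness of tensor products of sheaves -/

section Closed

universe w v u v' u' v'' u''

lemma preservesColimitsOfShape_of_adjunction {C : Type u} [Category.{v} C] {D : Type u'}
    [Category.{v'} D] {E : Type u''} [Category.{v''} E] {L : C ⥤ D} {R : D ⥤ C} (adj : L ⊣ R)
    [IsIso adj.counit] (J : Type w) [Category.{w} J] [HasColimitsOfShape J C] (G : D ⥤ E)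
    [PreservesColimitsOfShape J (L ⋙ G)] : PreservesColimitsOfShape J G where
  preservesColimit {K} := by
    have := adj.leftAdjoint_preservesColimits
    have : PreservesColimit ((K ⋙ R) ⋙ L) G :=
      preservesColimit_of_preserves_colimit_cocone
        (isColimitOfPreserves L (colimit.isColimit (K ⋙ R)))
        (isColimitOfPreserves (L ⋙ G) (colimit.isColimit (K ⋙ R)))
    exact preservesColimit_of_iso_diagram G
      (Functor.associator _ _ _ ≪≫ Functor.isoWhiskerLeft K (asIso adj.counit) ≪≫
        Functor.rightUnitor K)

lemma isLeftAdjoint_of_isGrothendieckAbelian {C : Type u} [Category.{v} C] [Abelian C]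
    [IsGrothendieckAbelian.{w} C] (F : C ⥤ C) [PreservesColimitsOfSize.{w, w} F] :
    F.IsLeftAdjoint := by
  let e := ShrinkHoms.equivalence.{w} C
  have : (e.inverse ⋙ F ⋙ e.functor).IsLeftAdjoint :=
    isLeftAdjoint_of_preservesColimits_of_isSeparating.{w} (C := ShrinkHoms C)
      (isSeparator_separator (ShrinkHoms C)) _
  have : (e.functor ⋙ (e.inverse ⋙ F ⋙ e.functor) ⋙ e.inverse).IsLeftAdjoint := inferInstance
  exact Functor.isLeftAdjoint_of_iso
    (show e.functor ⋙ (e.inverse ⋙ F ⋙ e.functor) ⋙ e.inverse ≅ F from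
      NatIso.ofComponents (fun X ↦
          (e.unitIso.app (F.obj (e.inverse.obj (e.functor.obj X)))).symm ≪≫
            F.mapIso (e.unitIso.app X).symm)
        (fun {X Y} f ↦ by
          have h := e.unitIso.inv.naturality (F.map (e.inverse.map (e.functor.map f)))
          have h' := congrArg F.map (e.unitIso.inv.naturality f)
          simp only [Functor.map_comp] at h'
          dsimp at h h' ⊢
          rw [reassoc_of% h, h', Category.assoc]))

lemma monoidalPreadditive_of_closed (C : Type u) [Category.{v} C] [Preadditive C]
    [HasBinaryBiproducts C] [MonoidalCategory C] [SymmetricCategory C] [MonoidalClosed C] :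
    MonoidalPreadditive C := by
  have h (F : C) : (tensorLeft F).Additive := by
    have := preservesBinaryBiproducts_of_preservesBinaryCoproducts (tensorLeft F)
    exact Functor.additive_of_preservesBinaryBiproducts _
  have h' {F G H : C} (f : G ⟶ H) : f ▷ F = (β_ _ _).hom ≫ F ◁ f ≫ (β_ _ _).hom := by
    simp
  have h₁ {F G H : C} : F ◁ (0 : G ⟶ H) = 0 := (tensorLeft F).map_zero _ _
  have h₂ {F G H : C} (f g : G ⟶ H) : F ◁ (f + g) = F ◁ f + F ◁ g := (tensorLeft F).map_add
  refine ⟨h₁, ?_, h₂, ?_⟩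
  · intro X Y Z
    rw [h', h₁, zero_comp, comp_zero]
  · intro X Y Z f g
    rw [h', h₂, h' f, h' g, Preadditive.add_comp, Preadditive.comp_add]

end Closed

/-! ### Étale sheaves of `Λ`-modules on the spectrum of the real numbers -/

section Etale

/-- The spectrum of the real numbers. -/
abbrev SpecReal : Scheme.{0} := Spec (CommRingCat.of ℝ)

variable (Λ : Type) [CommRing Λ]

/-- Sheaves of `Λ`-modules on the small étale site of `Spec ℝ`. -/
abbrev EtSheaf := Sheaf SpecReal.smallEtaleTopology (ModuleCat.{0} Λ)

instance : IsGrothendieckAbelian.{0} (EtSheaf Λ) := 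
  Scheme.isGrothendieckAbelian_sheaf_smallEtaleTopology _ _
instance : MonoidalCategory (EtSheaf Λ) := Sheaf.monoidalCategory _ _
instance : SymmetricCategory (EtSheaf Λ) := Sheaf.symmetricCategory _ _
instance : HasDerivedCategory.{1} (EtSheaf Λ) := HasDerivedCategory.standard _

instance (F : SpecReal.Etaleᵒᵖ ⥤ ModuleCat.{0} Λ) :
    PreservesColimitsOfSize.{0, 0} (tensorLeft F) where
  preservesColimitsOfShape {J} _ := preservesColimitsOfShape_of_evaluation _ _ fun X ↦
    inferInstanceAs (PreservesColimitsOfShape J ((evaluation _ _).obj X ⋙ tensorLeft (F.obj X)))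

/-- Sheafification of presheaves of `Λ`-modules on the small étale site. -/
abbrev etSheafification : (SpecReal.Etaleᵒᵖ ⥤ ModuleCat.{0} Λ) ⥤ EtSheaf Λ :=
  presheafToSheaf SpecReal.smallEtaleTopology (ModuleCat.{0} Λ)

/-- `(F ⊗ P)^a ≅ F ⊗ P^a` for a sheaf `F` and a presheaf `P`. -/
def tensorSheafificationIso (F : EtSheaf Λ) :
    tensorLeft F.obj ⋙ etSheafification Λ ≅ etSheafification Λ ⋙ tensorLeft F :=
  NatIso.ofComponents (fun P ↦ (Functor.Monoidal.μIso (etSheafification Λ) F.obj P).symm ≪≫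
      whiskerRightIso (sheafificationIso F).symm ((etSheafification Λ).obj P))
    (fun {P Q} f ↦ by
      have h := Functor.OplaxMonoidal.δ_natural_right (etSheafification Λ) F.obj f
      have h' := whisker_exchange (sheafificationIso F).inv ((etSheafification Λ).map f)
      exact (Category.assoc _ _ _).symm.trans ((congrArg (· ≫ _) h.symm).trans
        ((Category.assoc _ _ _).trans ((congrArg _ h').trans (Category.assoc _ _ _).symm))))

instance (F : EtSheaf Λ) : PreservesColimitsOfSize.{0, 0} (tensorLeft F) where
  preservesColimitsOfShape {J} _ :=
    have : PreservesColimitsOfShape J (etSheafification Λ ⋙ tensorLeft F) :=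
      preservesColimitsOfShape_of_natIso (tensorSheafificationIso Λ F)
    preservesColimitsOfShape_of_adjunction
      (sheafificationAdjunction SpecReal.smallEtaleTopology (ModuleCat.{0} Λ)) J _

instance : MonoidalClosed (EtSheaf Λ) where
  closed F :=
    have := isLeftAdjoint_of_isGrothendieckAbelian.{0} (tensorLeft F)
    { rightAdj := (tensorLeft F).rightAdjoint
      adj := Adjunction.ofIsLeftAdjoint _ }


instance : MonoidalPreadditive (EtSheaf Λ) := monoidalPreadditive_of_closed _

end Etale

/-! ### The category `D^b_ctf` -/

section Ctf

/-- The geometric point of `Spec ℝ` given by `Spec ℂ`. -/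
def geometricPoint : SpecReal.smallEtaleTopology.Point :=
  Scheme.pointSmallEtale (Ω := ℂ) (Spec.map (CommRingCat.ofHom (algebraMap ℝ ℂ)))

variable {Λ : Type} [CommRing Λ]

/-- The restriction of an étale sheaf to `V` is constant: it is the sheaf associated with a constant
presheaf on the étale site of `V`. -/
def EtSheaf.IsConstantOn (F : EtSheaf Λ) (V : SpecReal.Etale) : Prop :=
  ∃ (M : ModuleCat.{0} Λ) (f : (Functor.const _).obj M ⟶ (Over.forget V).op ⋙ F.obj),
    (SpecReal.smallEtaleTopology.over V).W f

/-- Locally constant étale sheaves. -/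
def EtSheaf.IsLocallyConstant (F : EtSheaf Λ) : Prop :=
  ∀ U : SpecReal.Etale, ∃ S ∈ SpecReal.smallEtaleTopology U, ∀ (V : SpecReal.Etale) (f : V ⟶ U),
    S f → F.IsConstantOn V

/-- Constructible étale sheaves. As `Spec ℝ` is a point, these are the locally constant sheaves
with finitely generated stalks. -/
def EtSheaf.IsConstructible (F : EtSheaf Λ) : Prop :=
  F.IsLocallyConstant ∧ Module.Finite Λ (geometricPoint.sheafFiber.obj F : ModuleCat.{0} Λ)

/-- Flat étale sheaves: tensoring with `F` preserves monomorphisms. -/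
def EtSheaf.IsFlat (F : EtSheaf Λ) : Prop :=
  ∀ ⦃G H : EtSheaf Λ⦄ (f : G ⟶ H), Mono f → Mono (F ◁ f)

/-- The constant étale sheaf associated with a `Λ`-module. -/
abbrev EtSheaf.const (M : ModuleCat.{0} Λ) : EtSheaf Λ :=
  (constantSheaf SpecReal.smallEtaleTopology (ModuleCat.{0} Λ)).obj M

variable (Λ) in
/-- The derived category of étale sheaves of `Λ`-modules on `Spec ℝ`. -/
abbrev EtDerived := DerivedCategory (EtSheaf Λ)

/-- Complexes with bounded cohomology. -/
def HasBoundedCohomology (X : EtDerived Λ) : Prop :=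
  ∃ a b : ℤ, ∀ n : ℤ, n < a ∨ b < n → IsZero ((DerivedCategory.homologyFunctor _ n).obj X)

/-- Complexes with constructible cohomology sheaves. -/
def HasConstructibleCohomology (X : EtDerived Λ) : Prop :=
  ∀ n : ℤ, EtSheaf.IsConstructible ((DerivedCategory.homologyFunctor (EtSheaf Λ) n).obj X)

/-- Complexes of finite Tor-dimension: for some `n`, `Tor_i(X, M) = H^{-i}(X ⊗ᴸ M)` vanishes for all
`i > n` and all constant sheaves of `Λ`-modules `M`. The derived tensor product is computed by a
bounded above resolution `P` of `X` by flat sheaves. -/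
def HasFiniteTorDimension (X : EtDerived Λ) : Prop :=
  ∃ (P : CochainComplex (EtSheaf Λ) ℤ) (b : ℤ), P.IsStrictlyLE b ∧ (∀ i, (P.X i).IsFlat) ∧
    Nonempty (DerivedCategory.Q.obj P ≅ X) ∧
    ∃ n : ℤ, ∀ (M : ModuleCat.{0} Λ) (i : ℤ), n < i →
      IsZero ((((tensorRight (EtSheaf.const M)).mapHomologicalComplex
        (ComplexShape.up ℤ)).obj P).homology (-i))

variable (Λ) in
/-- The objects of `D^b_ctf((Spec ℝ)_ét, Λ)`: bounded complexes of finite Tor-dimension with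
constructible cohomology sheaves. -/
def ctf : ObjectProperty (EtDerived Λ) := fun X ↦
  HasBoundedCohomology X ∧ HasConstructibleCohomology X ∧ HasFiniteTorDimension X

variable (Λ) in
/-- The category `D^b_ctf((Spec ℝ)_ét, Λ)`. -/
abbrev DbCtf := (ctf Λ).FullSubcategory

variable (Λ) in
/-- The functor `𝓗om(-, Λ)` on étale sheaves. -/
abbrev etDual : (EtSheaf Λ)ᵒᵖ ⥤ EtSheaf Λ := internalDual (EtSheaf.const (ModuleCat.of Λ Λ))

variable (Λ) in
/-- The biduality morphism `F ⟶ 𝓗om(𝓗om(F, Λ), Λ)`. -/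
abbrev etBidual : 𝟭 (EtSheaf Λ) ⟶ (etDual Λ).rightOp ⋙ etDual Λ :=
  internalBidual (EtSheaf.const (ModuleCat.of Λ Λ))

end Ctf

/-! ### Stalks as representations of `ℤ/2` -/

section Stalk

/-- The group `ℤ/2`, written multiplicatively. -/
def C₂ : Type := Multiplicative (ZMod 2)

instance : CommGroup C₂ := inferInstanceAs (CommGroup (Multiplicative (ZMod 2)))
instance : Fintype C₂ := inferInstanceAs (Fintype (Multiplicative (ZMod 2)))
instance : DecidableEq C₂ := inferInstanceAs (DecidableEq (Multiplicative (ZMod 2)))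

/-- The generator of `ℤ/2`. -/
def C₂.generator : C₂ := Multiplicative.ofAdd (1 : ZMod 2)

/-- The isomorphism from `ℤ/2` to the absolute Galois group of `ℝ`, sending the generator to complex
conjugation. -/
def toGalois : C₂ →* (ℂ ≃ₐ[ℝ] ℂ) :=
  AddMonoidHom.toMultiplicativeLeft (ZMod.lift 2
    ⟨zmultiplesHom (Additive (ℂ ≃ₐ[ℝ] ℂ)) (Additive.ofMul Complex.conjAe), by
      refine Additive.toMul.injective (AlgEquiv.ext fun z ↦ ?_)
      simp [pow_two]⟩)

lemma toGalois_generator : toGalois C₂.generator = Complex.conjAe := by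
  refine (congrArg Additive.toMul ((congrArg _ Int.cast_one.symm).trans
    (ZMod.lift_coe 2 _ 1))).trans ?_
  simp

/-- The automorphism of the geometric point `Spec ℂ ⟶ Spec ℝ` given by a Galois automorphism `σ`:
on geometric points of étale schemes `U` over `ℝ` it is `u ↦ u ∘ Spec σ`. -/
def pointHom (σ : ℂ ≃ₐ[ℝ] ℂ) : geometricPoint ⟶ geometricPoint where
  hom := Functor.whiskerLeft (Scheme.Etale.forget SpecReal) (coyoneda.map
    (Over.homMk (Spec.map (CommRingCat.ofHom (σ : ℂ →+* ℂ))) (by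
      dsimp
      rw [← Spec.map_comp, ← CommRingCat.ofHom_comp]
      congr 2
      ext x
      exact σ.commutes x) : Over.mk (Spec.map (CommRingCat.ofHom (algebraMap ℝ ℂ))) ⟶
        Over.mk (Spec.map (CommRingCat.ofHom (algebraMap ℝ ℂ)))).op)

lemma pointHom_one : pointHom 1 = 𝟙 _ := by
  ext X x
  refine Over.OverMorphism.ext ?_
  change Spec.map (CommRingCat.ofHom (RingHom.id ℂ)) ≫ x.left = x.left
  rw [CommRingCat.ofHom_id, Spec.map_id, Category.id_comp]

lemma pointHom_mul (σ τ : ℂ ≃ₐ[ℝ] ℂ) : pointHom (σ * τ) = pointHom σ ≫ pointHom τ := by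
  ext X x
  refine Over.OverMorphism.ext ?_
  change Spec.map (CommRingCat.ofHom ((σ : ℂ →+* ℂ).comp (τ : ℂ →+* ℂ))) ≫ x.left =
    Spec.map (CommRingCat.ofHom (σ : ℂ →+* ℂ)) ≫
      Spec.map (CommRingCat.ofHom (τ : ℂ →+* ℂ)) ≫ x.left
  rw [CommRingCat.ofHom_comp, Spec.map_comp, Category.assoc]

variable (Λ : Type) [CommRing Λ]

/-- The action of `ℤ/2` on the stalk at `Spec ℂ`. -/
def stalkρ (F : EtSheaf Λ) :
    Representation Λ C₂ (geometricPoint.sheafFiber.obj F : ModuleCat.{0} Λ) where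
  toFun g := ((pointHom (toGalois g)).sheafFiber.app F).hom
  map_one' := by
    rw [map_one, pointHom_one, GrothendieckTopology.Point.Hom.sheafFiber_id]
    rfl
  map_mul' g h := by
    rw [map_mul, pointHom_mul, GrothendieckTopology.Point.Hom.sheafFiber_comp]
    rfl

/-- The stalk functor at `Spec ℂ`, with values in representations of `ℤ/2` over `Λ`. -/
def stalkRep : EtSheaf Λ ⥤ Rep.{0} Λ C₂ where
  obj F := Rep.of (stalkρ Λ F)
  map {F G} f := Rep.ofHom ⟨(geometricPoint.sheafFiber.map f).hom, fun g ↦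
    congrArg ModuleCat.Hom.hom ((pointHom (toGalois g)).sheafFiber.naturality f).symm⟩
  map_id F := by
    ext x
    exact congrArg (fun f ↦ f.hom x) (geometricPoint.sheafFiber.map_id F)
  map_comp f g := by
    ext x
    exact congrArg (fun f ↦ f.hom x) (geometricPoint.sheafFiber.map_comp f g)

instance : HasDerivedCategory.{1} (Rep.{0} Λ C₂) := HasDerivedCategory.standard _

/-- Forgetting the action gives the stalk functor. -/
def stalkRepCompForget :
    stalkRep Λ ⋙ forget₂ (Rep.{0} Λ C₂) (ModuleCat.{0} Λ) ≅ geometricPoint.sheafFiber :=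
  NatIso.ofComponents (fun F ↦ Iso.refl _)

instance : PreservesFiniteLimits (stalkRep Λ) := by
  have : PreservesFiniteLimits (stalkRep Λ ⋙ forget₂ (Rep.{0} Λ C₂) (ModuleCat.{0} Λ)) :=
    preservesFiniteLimits_of_natIso (stalkRepCompForget Λ).symm
  exact preservesFiniteLimits_of_reflects_of_preserves _
    (forget₂ (Rep.{0} Λ C₂) (ModuleCat.{0} Λ))

instance : PreservesFiniteColimits (stalkRep Λ) := by
  have : PreservesFiniteColimits (stalkRep Λ ⋙ forget₂ (Rep.{0} Λ C₂) (ModuleCat.{0} Λ)) :=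
    preservesFiniteColimits_of_natIso (stalkRepCompForget Λ).symm
  exact preservesFiniteColimits_of_reflects_of_preserves _
    (forget₂ (Rep.{0} Λ C₂) (ModuleCat.{0} Λ))

instance : (stalkRep Λ).Additive := Functor.additive_of_preserves_binary_products _

/-- The stalk functor on derived categories. -/
abbrev derivedStalk : EtDerived Λ ⥤ DerivedCategory (Rep.{0} Λ C₂) :=
  (stalkRep Λ).mapDerivedCategory

end Stalk

/-! ### Finitely generated projective modules over a group ring and their duals -/

section Proj

variable {Λ : Type} [CommRing Λ] {G : Type} [CommGroup G] [Fintype G] [DecidableEq G]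

lemma sum_single_smul_of_finsupp {M : Type} [AddCommMonoid M] [Module Λ M]
    [Module (MonoidAlgebra Λ G) M] [IsScalarTower Λ (MonoidAlgebra Λ G) M]
    (T : (M →₀ MonoidAlgebra Λ G) →ₗ[Λ] M)
    (hT : ∀ (m : M) (g : G) (a : Λ), T (Finsupp.single m (MonoidAlgebra.single g a)) =
      if g = 1 then a • m else 0) (c : M →₀ MonoidAlgebra Λ G) :
    ∑ g : G, (MonoidAlgebra.single g 1 : MonoidAlgebra Λ G) •
      T ((MonoidAlgebra.single g⁻¹ 1 : MonoidAlgebra Λ G) • c) =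
        Finsupp.linearCombination (MonoidAlgebra Λ G) id c := by
  induction c using Finsupp.induction_linear with
  | zero => simp
  | add c d hc hd => simp only [smul_add, map_add, Finset.sum_add_distrib, hc, hd]
  | single m r =>
    induction r using MonoidAlgebra.induction_linear with
    | zero => simp
    | add r s hr hs => 
      simp only [Finsupp.single_add, smul_add, map_add, Finset.sum_add_distrib, hr, hs]
    | single h a =>
      have h1 (g : G) : T ((MonoidAlgebra.single g⁻¹ 1 : MonoidAlgebra Λ G) •
          Finsupp.single m (MonoidAlgebra.single h a)) = if g = h then a • m else 0 := by
        rw [Finsupp.smul_single, smul_eq_mul, MonoidAlgebra.single_mul_single, one_mul, hT]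
        simp only [inv_mul_eq_one]
      simp only [h1, smul_ite, smul_zero, Finset.sum_ite_eq', Finset.mem_univ, if_true]
      have h2 : a • m = (MonoidAlgebra.single 1 a : MonoidAlgebra Λ G) • m := by
        have h3 := smul_assoc a (1 : MonoidAlgebra Λ G) m
        rw [one_smul] at h3
        rw [← h3, MonoidAlgebra.one_def, MonoidAlgebra.smul_single, smul_eq_mul, mul_one]
      rw [Finsupp.linearCombination_single, id, h2, smul_smul, MonoidAlgebra.single_mul_single,
        one_mul, mul_one]

/-- Higman's criterion. -/
lemma finite_projective_iff {M : Type} [AddCommMonoid M] [Module Λ M]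
    [Module (MonoidAlgebra Λ G) M] [IsScalarTower Λ (MonoidAlgebra Λ G) M] :
    (Module.Finite (MonoidAlgebra Λ G) M ∧ Module.Projective (MonoidAlgebra Λ G) M) ↔
      Module.Finite Λ M ∧ Module.Projective Λ M ∧ ∃ θ : M →ₗ[Λ] M, ∀ x,
        ∑ g : G, (MonoidAlgebra.single g 1 : MonoidAlgebra Λ G) •
          θ ((MonoidAlgebra.single g⁻¹ 1 : MonoidAlgebra Λ G) • x) = x := by
  constructor
  · rintro ⟨h₁, h₂⟩
    refine ⟨Module.Finite.trans (MonoidAlgebra Λ G) M, ?_, ?_⟩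
    · obtain ⟨s, hs⟩ := Module.projective_def'.1 h₂
      exact Module.Projective.of_split (s.restrictScalars Λ)
        ((Finsupp.linearCombination (MonoidAlgebra Λ G) id).restrictScalars Λ)
        (LinearMap.ext fun x ↦ LinearMap.congr_fun hs x)
    · obtain ⟨s, hs⟩ := Module.projective_def'.1 h₂
      let T : (M →₀ MonoidAlgebra Λ G) →ₗ[Λ] M := Finsupp.linearCombination Λ id ∘ₗ
        Finsupp.mapRange.linearMap
          (Finsupp.lapply 1 ∘ₗ (MonoidAlgebra.coeffLinearEquiv Λ).toLinearMap)
      refine ⟨T ∘ₗ s.restrictScalars Λ, fun x ↦ ?_⟩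
      have h := sum_single_smul_of_finsupp T (fun m g a ↦ by
        simp [T, Finsupp.single_apply]) (s x)
      simp only [LinearMap.comp_apply, LinearMap.restrictScalars_apply, map_smul]
      exact h.trans (LinearMap.congr_fun hs x)
  · rintro ⟨h₁, h₂, θ, hθ⟩
    let σ : M →ₗ[MonoidAlgebra Λ G] TensorProduct Λ (MonoidAlgebra Λ G) M :=
      { toFun x := ∑ g : G, TensorProduct.tmul Λ (MonoidAlgebra.single g 1 : MonoidAlgebra Λ G)
          (θ ((MonoidAlgebra.single g⁻¹ 1 : MonoidAlgebra Λ G) • x))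
        map_add' x y := by
          simp only [smul_add, map_add, TensorProduct.tmul_add, Finset.sum_add_distrib]
        map_smul' r x := by
          dsimp only [RingHom.id_apply]
          induction r using MonoidAlgebra.induction_linear with
          | zero => simp
          | add r s hr hs =>
            simp only [add_smul, smul_add, map_add, TensorProduct.tmul_add,
              Finset.sum_add_distrib, hr, hs]
          | single h a =>
            rw [Finset.smul_sum]
            refine Fintype.sum_equiv (Equiv.mulLeft h⁻¹) _ _ fun g ↦ ?_
            have h1 : (MonoidAlgebra.single g⁻¹ 1 : MonoidAlgebra Λ G) •
                (MonoidAlgebra.single h a : MonoidAlgebra Λ G) • x =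
                  a • (MonoidAlgebra.single (h⁻¹ * g)⁻¹ 1 : MonoidAlgebra Λ G) • x := by
              rw [← smul_assoc, ← smul_assoc, smul_eq_mul, MonoidAlgebra.single_mul_single,
                MonoidAlgebra.smul_single, mul_inv_rev, inv_inv, one_mul, smul_eq_mul, mul_one]
            rw [h1, map_smul, Equiv.coe_mulLeft, TensorProduct.smul_tmul', smul_eq_mul,
              MonoidAlgebra.single_mul_single, TensorProduct.tmul_smul,
              TensorProduct.smul_tmul', MonoidAlgebra.smul_single, smul_eq_mul, mul_one,
              mul_inv_cancel_left] }
    let π : TensorProduct Λ (MonoidAlgebra Λ G) M →ₗ[MonoidAlgebra Λ G] M :=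
      LinearMap.liftBaseChange (MonoidAlgebra Λ G) LinearMap.id
    have h : π ∘ₗ σ = LinearMap.id := by
      ext x
      simpa [π, σ] using hθ x
    refine ⟨Module.Finite.of_surjective π fun x ↦ ⟨σ x, LinearMap.congr_fun h x⟩,
      Module.Projective.of_split σ π h⟩

variable (Λ) in
/-- The representations of `ℤ/2` that are finitely generated projective modules over the group
ring `Λ[ℤ/2]`. -/
def finProj : ObjectProperty (Rep.{0} Λ C₂) := fun P ↦
  Module.Finite (MonoidAlgebra Λ C₂) P.ρ.asModule ∧
    Module.Projective (MonoidAlgebra Λ C₂) P.ρ.asModule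

lemma finProj_iff (P : Rep.{0} Λ C₂) : finProj Λ P ↔
    Module.Finite Λ P.V ∧ Module.Projective Λ P.V ∧ ∃ θ : P.V →ₗ[Λ] P.V, ∀ x,
      ∑ g : C₂, P.ρ g (θ (P.ρ g⁻¹ x)) = x := by
  have h (g : C₂) (x : P.V) :
      (MonoidAlgebra.single g 1 : MonoidAlgebra Λ C₂) • (show P.ρ.asModule from x) = P.ρ g x :=
    (Representation.single_smul (ρ := P.ρ) 1 g x).trans (one_smul _ _)
  refine (@finite_projective_iff Λ _ C₂ _ _ _ P.ρ.asModule _ _ _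
    ⟨fun t r x ↦ LinearMap.congr_fun (map_smul P.ρ.asAlgebraHom t r) (show P.V from x)⟩).trans (and_congr_right fun _ ↦
    and_congr_right fun _ ↦ exists_congr fun θ ↦ forall_congr' fun x ↦ ?_)
  have h' : ∑ g : C₂, (MonoidAlgebra.single g 1 : MonoidAlgebra Λ C₂) •
      θ ((MonoidAlgebra.single g⁻¹ 1 : MonoidAlgebra Λ C₂) • (show P.ρ.asModule from x)) =
        ∑ g : C₂, (show P.V →ₗ[Λ] P.V from P.ρ g)
          ((show P.V →ₗ[Λ] P.V from θ) (P.ρ g⁻¹ (show P.V from x))) :=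
    Finset.sum_congr rfl fun g _ ↦
      (h g _).trans (congrArg (fun y ↦ P.ρ g (θ y)) (h g⁻¹ x))
  rw [h']
  rfl

instance : HasZeroObject (finProj Λ).FullSubcategory := by
  have : (finProj Λ).ContainsZero :=
    ⟨Rep.of (Representation.trivial Λ C₂ PUnit), (Rep.isZero_iff _ _ _).2 (inferInstanceAs (Subsingleton PUnit)),
      (finProj_iff _).2 ⟨inferInstance, inferInstance, 0, fun x ↦ Subsingleton.elim _ _⟩⟩
  infer_instance

instance : HasBinaryBiproducts (finProj Λ).FullSubcategory where
  has_binary_biproduct A B :=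
    have h : finProj Λ (Rep.of (A.obj.ρ.prod B.obj.ρ)) := by
      obtain ⟨h₁, h₂, θ, hθ⟩ := (finProj_iff _).1 A.property
      obtain ⟨h₁', h₂', θ', hθ'⟩ := (finProj_iff _).1 B.property
      refine (finProj_iff _).2 ⟨inferInstance, inferInstance, θ.prodMap θ', fun x ↦ ?_⟩
      refine Prod.ext ?_ ?_
      · exact (Prod.fst_sum ..).trans (hθ x.1)
      · exact (Prod.snd_sum ..).trans (hθ' x.2)
    hasBinaryBiproduct_of_total
    { pt := ⟨_, h⟩
      fst := ObjectProperty.homMk (Rep.ofHom (.fst Λ A.obj.ρ B.obj.ρ))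
      snd := ObjectProperty.homMk (Rep.ofHom (.snd Λ A.obj.ρ B.obj.ρ))
      inl := ObjectProperty.homMk (Rep.ofHom (.inl Λ A.obj.ρ B.obj.ρ))
      inr := ObjectProperty.homMk (Rep.ofHom (.inr Λ A.obj.ρ B.obj.ρ))
      inl_fst := by ext; rfl
      inl_snd := by ext; rfl
      inr_fst := by ext; rfl
      inr_snd := by ext; rfl } (by
        ext : 2
        refine Representation.IntertwiningMap.ext (LinearMap.ext fun x ↦ ?_)
        exact Prod.ext (add_zero x.1) (zero_add x.2))

variable (Λ) in
/-- The functor `Hom_Λ(-, Λ)` on representations, with the contragredient action. -/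
abbrev repDual : (Rep.{0} Λ C₂)ᵒᵖ ⥤ Rep.{0} Λ C₂ := internalDual (Rep.trivial Λ C₂ Λ)

lemma finProj_repDual (P : Rep.{0} Λ C₂) (hP : finProj Λ P) :
    finProj Λ ((repDual Λ).obj (op P)) := by
  obtain ⟨h₁, h₂, θ, hθ⟩ := (finProj_iff _).1 hP
  refine (finProj_iff _).2 ⟨inferInstanceAs (Module.Finite Λ (P.V →ₗ[Λ] Λ)),
    inferInstanceAs (Module.Projective Λ (P.V →ₗ[Λ] Λ)), LinearMap.lcomp Λ Λ θ,
    fun (φ : P.V →ₗ[Λ] Λ) ↦ ?_⟩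
  refine LinearMap.ext fun x ↦ ?_
  refine (LinearMap.sum_apply _ _ _).trans ((Finset.sum_congr rfl fun g _ ↦ ?_).trans
    ((map_sum φ (fun g : C₂ ↦ P.ρ g (θ (P.ρ g⁻¹ x))) Finset.univ).symm.trans (congrArg φ (hθ x))))
  change φ (P.ρ (g⁻¹)⁻¹ (θ (P.ρ g⁻¹ x))) = φ (P.ρ g (θ (P.ρ g⁻¹ x)))
  rw [inv_inv]

variable (Λ)

/-- The category of finitely generated projective `Λ[ℤ/2]`-modules. -/
abbrev FinProj := (finProj Λ).FullSubcategory

/-- The functor `Hom_Λ(-, Λ)` on finitely generated projective `Λ[ℤ/2]`-modules. -/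
def finProjDual : (FinProj Λ)ᵒᵖ ⥤ FinProj Λ :=
  (finProj Λ).lift ((finProj Λ).ι.op ⋙ repDual Λ) (fun P ↦ finProj_repDual _ P.unop.property)

instance : (finProjDual Λ).Additive where
  map_add {P Q f g} := by
    ext : 1
    exact (repDual Λ).map_add (f := f.unop.hom.op) (g := g.unop.hom.op)

/-- The biduality morphism `P ⟶ Hom_Λ(Hom_Λ(P, Λ), Λ)`. -/
def finProjBidual : 𝟭 (FinProj Λ) ⟶ (finProjDual Λ).rightOp ⋙ finProjDual Λ where
  app P := ObjectProperty.homMk ((internalBidual (Rep.trivial Λ C₂ Λ)).app P.obj)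
  naturality P Q f := by
    ext : 1
    exact (internalBidual (Rep.trivial Λ C₂ Λ)).naturality f.hom

lemma finProjBidual_apply (P : FinProj Λ) (x : P.obj) (φ : P.obj →ₗ[Λ] Λ) :
    (show (P.obj →ₗ[Λ] Λ) →ₗ[Λ] Λ from ((finProjBidual Λ).app P).hom.hom x) φ = φ x := rfl

/-- `D^b(Proj Λ[ℤ/2])`: the bounded homotopy category of finitely generated projective
`Λ[ℤ/2]`-modules. -/
abbrev DbProj := BoundedHomotopyCategory (FinProj Λ)

/-- The duality `Hom(-, Λ)` on `D^b(Proj Λ[ℤ/2])`. -/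
def projDuality : DualityData (DbProj Λ) :=
  boundedHomotopyDuality (finProjDual Λ) (finProjBidual Λ)

/-- The functor from `D^b(Proj Λ[ℤ/2])` to the derived category of `Λ[ℤ/2]`-modules. -/
abbrev DbProj.toDerived : DbProj Λ ⥤ DerivedCategory (Rep.{0} Λ C₂) :=
  (boundedComplexes (FinProj Λ)).ι ⋙ (finProj Λ).ι.mapHomotopyCategory (ComplexShape.up ℤ) ⋙
    DerivedCategory.Qh

end Proj

/-! ### The duality `R𝓗om(-, Λ)` on `D^b_ctf` -/

section RHom

variable (Λ : Type) [CommRing Λ]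

/-- The complexes of étale sheaves that belong to `D^b_ctf`. -/
abbrev ctfComplexes : ObjectProperty (CochainComplex (EtSheaf Λ) ℤ) :=
  (ctf Λ).inverseImage DerivedCategory.Q

/-- The localization functor from complexes to `D^b_ctf`. -/
def ctfQ : (ctfComplexes Λ).FullSubcategory ⥤ DbCtf Λ :=
  (ctf Λ).lift ((ctfComplexes Λ).ι ⋙ DerivedCategory.Q) (fun K ↦ K.property)

/-- The underived functor `𝓗om(-, Λ)` from complexes to the derived category. -/
def ctfHom : (ctfComplexes Λ).FullSubcategoryᵒᵖ ⥤ EtDerived Λ :=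
  (ctfComplexes Λ).ι.op ⋙ dualComplex (etDual Λ) ⋙ DerivedCategory.Q

/-- The duality `R𝓗om(-, Λ)` on `D^b_ctf`: its underlying functor is the total right derived functor
of `𝓗om(-, Λ)`, and the identifications `R𝓗om(T^n X, Λ) ≅ T^{-n} R𝓗om(X, Λ)` and the biduality
morphisms are induced by those for complexes. -/
structure RHomDuality [(ctf Λ).IsTriangulated] extends DualityData (DbCtf Λ) where
  /-- the canonical morphism `𝓗om(K, Λ) ⟶ R𝓗om(K, Λ)` -/
  α : ctfHom Λ ⟶ (ctfQ Λ).op ⋙ D ⋙ (ctf Λ).ι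
  isDerived : (D ⋙ (ctf Λ).ι).IsLeftKanExtension α
  shift_eq (K : CochainComplex (EtSheaf Λ) ℤ) (hK : ctfComplexes Λ K) (n m : ℤ) (h : n + m = 0)
    (hKn : ctfComplexes Λ (K⟦n⟧)) :
    α.app (op ⟨K⟦n⟧, hKn⟩) ≫
      (D.map (ObjectProperty.homMk (((ctf Λ).ι.commShiftIso n).hom.app ((ctfQ Λ).obj ⟨K, hK⟩) ≫
        (DerivedCategory.Q.commShiftIso n).inv.app K) :
          ((ctfQ Λ).obj ⟨K, hK⟩)⟦n⟧ ⟶ (ctfQ Λ).obj ⟨K⟦n⟧, hKn⟩).op).hom ≫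
      (toDualityData.dualShift ((ctfQ Λ).obj ⟨K, hK⟩) n m h).hom.hom ≫
      ((ctf Λ).ι.commShiftIso m).hom.app _ =
    DerivedCategory.Q.map (dualComplexShift (etDual Λ) K n m h).hom ≫
      (DerivedCategory.Q.commShiftIso m).hom.app ((dualComplex (etDual Λ)).obj (op K)) ≫
        (show DerivedCategory.Q.obj ((dualComplex (etDual Λ)).obj (op K)) ⟶
          (toDualityData.dual ((ctfQ Λ).obj ⟨K, hK⟩)).obj from α.app (op ⟨K, hK⟩))⟦m⟧'
  bidual_eq (K : CochainComplex (EtSheaf Λ) ℤ) (hK : ctfComplexes Λ K)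
    (hK' : ctfComplexes Λ ((dualComplex (etDual Λ)).obj (op K))) :
    DerivedCategory.Q.map (bidualComplex (etBidual Λ) K) ≫ α.app (op ⟨_, hK'⟩) =
      (toDualityData.bidual ((ctfQ Λ).obj ⟨K, hK⟩)).hom ≫
        (D.map (ObjectProperty.homMk (α.app (op ⟨K, hK⟩)) :
          (ctfQ Λ).obj ⟨_, hK'⟩ ⟶ toDualityData.dual ((ctfQ Λ).obj ⟨K, hK⟩)).op).hom

end RHom

end

/-! Everything rests on Galois theory for `ℂ/ℝ`. Every étale `ℝ`-scheme is covered by morphisms from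
`Spec ℂ`, every covering sieve of `Spec ℂ` is trivial, and the endomorphisms of `Spec ℂ` over `ℝ`
are the identity and conjugation. Hence `Spec ℂ` spans a dense subsite with trivial topology, and
the stalk functor `stalkRep` is an equivalence from étale sheaves to representations of `ℤ/2`. It is
braided monoidal, because the tensor product of sheaves is a localization of the termwise one, and a
braided equivalence of closed symmetric monoidal categories respects internal homs and evaluation
(`internalDualComparison`). So `𝓗om(-, Λ)` corresponds to `Hom_Λ(-, Λ)` with the contragredient
action.

The objects of `D^b_ctf` are identified in `ctf_eq_perfectSheaves`. All étale sheaves on `Spec ℝ`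
are locally constant, so constructibility means that the stalk is finitely generated. In a flat
resolution, finite Tor-dimension makes the cokernel of a low differential flat
(`flatSheaves_opcycles`), so truncation gives a bounded complex of flat sheaves, and dévissage
(`prop_Q_obj_of_bounded`) builds it from sheaves with flat and finitely generated stalks. Over the
noetherian ring `Λ` such stalks are projective, and averaging with `1/2` makes them projective over
`Λ[ℤ/2]` (`exists_finProjSheaf`). Bounded complexes of projectives are K-projective, so the bounded
homotopy category embeds fully faithfully in the derived category. This gives an equivalence onto
`D^b_ctf` (`boundedLift_isEquivalence`), and `Φ` is its quasi-inverse.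

The axioms of a duality hold on `D^b(Proj Λ[ℤ/2])` because finitely generated projective `Λ`-modules
are reflexive and termwise duals preserve degreewise split sequences. Transported to `D^b_ctf`, this
duality is a total right derived functor of the termwise dual, since every complex in question has a
resolution by projectives (`exists_derivedDuality`). For an arbitrary `RHomDuality`, uniqueness of
Kan extensions makes the canonical morphism from the underived dual invertible on complexes of
projectives, so the equivalence is compatible with that choice too (`exists_comparison`). The axioms
on `D^b_ctf` are then reflected along `Φ` (`IsMorphism.isDuality`). An exact equivalence with these
compatibilities matches symmetric spaces, isometries and lagrangians, and with them the shifted Witt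
groups (`wittGroupOfEquiv`). -/

noncomputable section

/-! ### Functoriality of symmetric spaces, lagrangians and Witt groups. -/

namespace DualityData

section

universe v u v' u'

variable {K : Type u} [Category.{v} K] [Preadditive K] [HasShift K ℤ] (𝒟 : DualityData K)

lemma dualShift_hom_naturality {X Y : K} (f : X ⟶ Y) (n m : ℤ) (h : n + m = 0) :
    𝒟.dualMap (f⟦n⟧') ≫ (𝒟.dualShift X n m h).hom =
      (𝒟.dualShift Y n m h).hom ≫ (𝒟.dualMap f)⟦m⟧' :=
  (𝒟.shiftIso n m h).hom.naturality f.op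

lemma dualShift_inv_naturality {X Y : K} (f : X ⟶ Y) (n m : ℤ) (h : n + m = 0) :
    (𝒟.dualMap f)⟦m⟧' ≫ (𝒟.dualShift X n m h).inv =
      (𝒟.dualShift Y n m h).inv ≫ 𝒟.dualMap (f⟦n⟧') :=
  (𝒟.shiftIso n m h).inv.naturality f.op

/-- The dual of an isomorphism. -/
@[simps]
def dualIso {X Y : K} (e : X ≅ Y) : 𝒟.dual Y ≅ 𝒟.dual X where
  hom := 𝒟.dualMap e.hom
  inv := 𝒟.dualMap e.inv
  hom_inv_id := by rw [← dualMap_comp, e.inv_hom_id, dualMap_id]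
  inv_hom_id := by rw [← dualMap_comp, e.hom_inv_id, dualMap_id]

instance {X Y : K} (f : X ⟶ Y) [IsIso f] : IsIso (𝒟.dualMap f) :=
  (𝒟.dualIso (asIso f)).isIso_hom

/-- Passing from `♯` to `T^n ∘ ♯` only commutes `T^b` past `T^n`. No sign enters here: the signs of
the shifted duality are carried by `ω` and `δ`. -/
lemma shift_dualShift_hom [∀ n : ℤ, (shiftFunctor K n).Additive] (n : ℤ) (X : K) (a b : ℤ)
    (h : a + b = 0) :
    ((𝒟.shift n).dualShift X a b h).hom =
      (𝒟.dualShift X a b h).hom⟦n⟧' ≫ (shiftFunctorComm K b n).hom.app (𝒟.dual X) := by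
  dsimp [dualShift, shift]
  simp

end

section Comparison

universe v u v' u'

variable {K₁ : Type u} [Category.{v} K₁] [Preadditive K₁] [HasShift K₁ ℤ]
  {K₂ : Type u'} [Category.{v'} K₂] [Preadditive K₂] [HasShift K₂ ℤ]
  {𝒟₁ : DualityData K₁} {𝒟₂ : DualityData K₂}
  (F : K₁ ⥤ K₂) [F.CommShift ℤ] (η : 𝒟₁.D ⋙ F ≅ F.op ⋙ 𝒟₂.D)

/-- The component `F (X^♯) ≅ (F X)^♯` of the comparison of two dualities. -/
def comparison {F : K₁ ⥤ K₂} (η : 𝒟₁.D ⋙ F ≅ F.op ⋙ 𝒟₂.D) (X : K₁) :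
    F.obj (𝒟₁.dual X) ≅ 𝒟₂.dual (F.obj X) :=
  η.app (op X)

lemma comparison_naturality {F : K₁ ⥤ K₂} (η : 𝒟₁.D ⋙ F ≅ F.op ⋙ 𝒟₂.D) {X Y : K₁} (f : X ⟶ Y) :
    F.map (𝒟₁.dualMap f) ≫ (comparison η X).hom =
      (comparison η Y).hom ≫ 𝒟₂.dualMap (F.map f) :=
  η.hom.naturality f.op

/-- Compatibility of a comparison of dualities with the shifts. -/
def ComparisonShift : Prop :=
  ∀ (X : K₁) (n m : ℤ) (h : n + m = 0),
    F.map (𝒟₁.dualShift X n m h).hom ≫ (F.commShiftIso m).hom.app (𝒟₁.dual X) ≫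
        (comparison η X).hom⟦m⟧' =
      (comparison η (X⟦n⟧)).hom ≫ 𝒟₂.dualMap ((F.commShiftIso n).inv.app X) ≫
        (𝒟₂.dualShift (F.obj X) n m h).hom

/-- Compatibility of a comparison of dualities with the biduality morphisms. -/
def ComparisonBidual {F : K₁ ⥤ K₂} (η : 𝒟₁.D ⋙ F ≅ F.op ⋙ 𝒟₂.D) : Prop :=
  ∀ X : K₁, F.map (𝒟₁.bidual X) ≫ (comparison η (𝒟₁.dual X)).hom =
      𝒟₂.bidual (F.obj X) ≫ 𝒟₂.dualMap (comparison η X).hom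

variable {F η} in
-- The biduality of `T^n ∘ ♯` is that of `♯` twisted by `shiftedBidualIso`, so
-- `ComparisonBidual.shift` needs the effect of `F` on the twist. The right side does not collapse
-- to the twist for `𝒟₂`, as its inner dual is still `F (X^♯)` and not `(F X)^♯`.
lemma ComparisonShift.map_shiftedBidualIso_hom (hη : ComparisonShift F η) (n : ℤ) (X : K₁) :
    F.map (𝒟₁.shiftedBidualIso n X).hom ≫ (comparison η (𝒟₁.dual X)).hom =
      (F.commShiftIso n).hom.app (𝒟₁.dual ((𝒟₁.dual X)⟦n⟧)) ≫
        (comparison η ((𝒟₁.dual X)⟦n⟧)).hom⟦n⟧' ≫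
        (𝒟₂.dualMap ((F.commShiftIso n).inv.app (𝒟₁.dual X)))⟦n⟧' ≫
        (𝒟₂.dualShift (F.obj (𝒟₁.dual X)) n (-n) (by lia)).hom⟦n⟧' ≫
        (shiftFunctorCompIsoId K₂ (-n) n (by lia)).hom.app _ := by
  have h₁ := congrArg (shiftFunctor K₂ n).map (hη (𝒟₁.dual X) n (-n) (by lia))
  have h₂ := (shiftFunctorCompIsoId K₂ (-n) n (by lia)).hom.naturality
    (comparison η (𝒟₁.dual X)).hom
  dsimp at h₂
  simp only [Functor.map_comp] at h₁
  rw [shiftedBidualIso]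
  dsimp only [Iso.trans_hom, Functor.mapIso_hom, Iso.app_hom]
  simp only [Functor.map_comp, Category.assoc, Functor.map_shiftFunctorCompIsoId_hom_app,
    Functor.commShiftIso_hom_naturality_assoc]
  rw [← reassoc_of% h₁, h₂]

variable [∀ n : ℤ, (shiftFunctor K₁ n).Additive] [∀ n : ℤ, (shiftFunctor K₂ n).Additive] [F.Additive]

/-- The comparison of the shifted dualities. -/
def shiftComparison (n : ℤ) : (𝒟₁.shift n).D ⋙ F ≅ F.op ⋙ (𝒟₂.shift n).D :=
  NatIso.ofComponents (fun X ↦ (F.commShiftIso n).app (𝒟₁.dual X.unop) ≪≫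
      (shiftFunctor K₂ n).mapIso (comparison η X.unop)) (fun {X Y} f ↦ by
    change F.map ((𝒟₁.dualMap f.unop)⟦n⟧') ≫ (F.commShiftIso n).hom.app (𝒟₁.dual Y.unop) ≫
      (comparison η Y.unop).hom⟦n⟧' = ((F.commShiftIso n).hom.app (𝒟₁.dual X.unop) ≫
      (comparison η X.unop).hom⟦n⟧') ≫ (𝒟₂.dualMap (F.map f.unop))⟦n⟧'
    rw [Functor.commShiftIso_hom_naturality_assoc, ← Functor.map_comp, comparison_naturality,
      Functor.map_comp, Category.assoc])

variable {F η}

omit [F.Additive] in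
-- The square is `T^n` of the original one, pasted with naturality of the swap of `T^b` and `T^n`,
-- which `F` respects.
lemma ComparisonShift.shift (hη : ComparisonShift F η) (n : ℤ) :
    ComparisonShift F (shiftComparison F η n) := by
  intro X a b h
  have h₁ := congrArg (shiftFunctor K₂ n).map (hη X a b h)
  have h₂ := (shiftFunctorComm K₂ b n).hom.naturality (comparison η X).hom
  have h₃ : F.map ((𝒟₁.dualShift X a b h).hom⟦n⟧' ≫
        (shiftFunctorComm K₁ b n).hom.app (𝒟₁.dual X)) ≫
      (F.commShiftIso b).hom.app ((𝒟₁.dual X)⟦n⟧) ≫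
        ((F.commShiftIso n).hom.app (𝒟₁.dual X) ≫ (comparison η X).hom⟦n⟧')⟦b⟧' =
      ((F.commShiftIso n).hom.app (𝒟₁.dual (X⟦a⟧)) ≫ (comparison η (X⟦a⟧)).hom⟦n⟧') ≫
        (𝒟₂.dualMap ((F.commShiftIso a).inv.app X))⟦n⟧' ≫
          (𝒟₂.dualShift (F.obj X) a b h).hom⟦n⟧' ≫
            (shiftFunctorComm K₂ b n).hom.app (𝒟₂.dual (F.obj X)) := by
    dsimp at h₂
    simp only [Functor.map_comp, Category.assoc] at h₁ ⊢
    rw [Functor.map_shiftFunctorComm, ← reassoc_of% h₁, h₂]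
    simp only [Category.assoc, Functor.commShiftIso_hom_naturality_assoc,
      Iso.inv_hom_id_app_assoc]
    congr 4
    rw [← Functor.map_comp_assoc, Iso.inv_hom_id_app]
    exact (congrArg (· ≫ _) ((shiftFunctor K₂ b).map_id _)).trans (Category.id_comp _)
  have h₄ := 𝒟₁.shift_dualShift_hom n X a b h
  have h₅ := 𝒟₂.shift_dualShift_hom n (F.obj X) a b h
  exact (congrArg (fun f ↦ F.map f ≫ (F.commShiftIso b).hom.app ((𝒟₁.dual X)⟦n⟧) ≫
        ((F.commShiftIso n).hom.app (𝒟₁.dual X) ≫ (comparison η X).hom⟦n⟧')⟦b⟧') h₄).trans (h₃.trans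
    (congrArg (fun f ↦ ((F.commShiftIso n).hom.app (𝒟₁.dual (X⟦a⟧)) ≫
      (comparison η (X⟦a⟧)).hom⟦n⟧') ≫
        (𝒟₂.dualMap ((F.commShiftIso a).inv.app X))⟦n⟧' ≫ f) h₅.symm))

/-- Both sides carry the same twist and the same sign. The twist is handled by
`map_shiftedBidualIso_hom`, the sign by additivity of `F`. -/
lemma ComparisonBidual.shift (hη : ComparisonShift F η) (hη' : ComparisonBidual η) (n : ℤ) :
    ComparisonBidual (shiftComparison F η n) := by
  intro X
  have h₁ := hη.map_shiftedBidualIso_hom n X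
  have h₂ := 𝒟₂.dualShift_hom_naturality (comparison η X).hom n (-n) (by lia)
  have h₃ : F.map (𝒟₁.bidual X ≫ (𝒟₁.shiftedBidualIso n X).inv) ≫
      (F.commShiftIso n).hom.app (𝒟₁.dual ((𝒟₁.dual X)⟦n⟧)) ≫
        (comparison η ((𝒟₁.dual X)⟦n⟧)).hom⟦n⟧' =
    (𝒟₂.bidual (F.obj X) ≫ (𝒟₂.shiftedBidualIso n (F.obj X)).inv) ≫
      (𝒟₂.dualMap ((F.commShiftIso n).hom.app (𝒟₁.dual X) ≫ (comparison η X).hom⟦n⟧'))⟦n⟧' := by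
    -- The tail of `map_shiftedBidualIso_hom` is an isomorphism. After composition with it the left
    -- side contains `F` of the twist next to `F` of its inverse.
    rw [← cancel_mono ((𝒟₂.dualMap ((F.commShiftIso n).inv.app (𝒟₁.dual X)))⟦n⟧' ≫
        (𝒟₂.dualShift (F.obj (𝒟₁.dual X)) n (-n) (by lia)).hom⟦n⟧' ≫
        (shiftFunctorCompIsoId K₂ (-n) n (by lia)).hom.app _)]
    simp only [Functor.map_comp, Category.assoc]
    rw [← h₁, ← F.map_comp_assoc (Iso.inv _), Iso.inv_hom_id, F.map_id, Category.id_comp, hη' X]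
    have h₄ := (𝒟₂.shiftedBidualIso n (F.obj X)).inv_hom_id_assoc
      (𝒟₂.dualMap (comparison η X).hom)
    have h₅ := (shiftFunctorCompIsoId K₂ (-n) n (by lia)).hom.naturality
      (𝒟₂.dualMap (comparison η X).hom)
    dsimp at h₅
    rw [← h₄, shiftedBidualIso]
    dsimp only [Iso.trans_hom, Functor.mapIso_hom, Iso.app_hom]
    rw [Category.assoc, ← h₅, ← Functor.map_comp_assoc, ← h₂, ← Functor.map_comp_assoc,
      ← Functor.map_comp_assoc, ← dualMap_comp, Iso.inv_hom_id_app_assoc]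
  have h₄ : F.map (shiftSign n • (𝒟₁.bidual X ≫ (𝒟₁.shiftedBidualIso n X).inv)) ≫
      (F.commShiftIso n).hom.app (𝒟₁.dual ((𝒟₁.dual X)⟦n⟧)) ≫
        (comparison η ((𝒟₁.dual X)⟦n⟧)).hom⟦n⟧' =
    (shiftSign n • (𝒟₂.bidual (F.obj X) ≫ (𝒟₂.shiftedBidualIso n (F.obj X)).inv)) ≫
      (𝒟₂.dualMap ((F.commShiftIso n).hom.app (𝒟₁.dual X) ≫
        (comparison η X).hom⟦n⟧'))⟦n⟧' := by
    rw [Linear.units_smul_comp, ← h₃]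
    obtain h | h := Int.units_eq_one_or (shiftSign n) <;> rw [h]
    · simp
    · simp only [Units.neg_smul, one_smul, Functor.map_neg, Preadditive.neg_comp]
  exact h₄

end Comparison

section Isometry

universe v u v' u'

variable {K₁ : Type u} [Category.{v} K₁] [Preadditive K₁] [HasShift K₁ ℤ]
  {K₂ : Type u'} [Category.{v'} K₂] [Preadditive K₂] [HasShift K₂ ℤ]
  {𝒟₁ : DualityData K₁} {𝒟₂ : DualityData K₂}
  {F : K₁ ⥤ K₂} {η : 𝒟₁.D ⋙ F ≅ F.op ⋙ 𝒟₂.D}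

namespace SymSpace

/-- The image of a symmetric space under a functor compatible with the dualities. -/
def map (hη : ComparisonBidual η) (S : 𝒟₁.SymSpace) : 𝒟₂.SymSpace where
  obj := F.obj S.obj
  form := F.mapIso S.form ≪≫ comparison η S.obj
  symm := by
    have h := congrArg F.map S.symm
    rw [Functor.map_comp] at h
    dsimp only [Iso.trans_hom, Functor.mapIso_hom]
    rw [dualMap_comp, ← reassoc_of% (hη S.obj), ← comparison_naturality, reassoc_of% h]

/-- By full faithfulness, isomorphisms `P ≅ Q` and `F P ≅ F Q` correspond. The isometry equation for
`F f` is `F` of the equation for `f` followed by a comparison isomorphism, which cancels. -/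
lemma map_isometric_iff [F.Full] [F.Faithful] (hη : ComparisonBidual η) (S T : 𝒟₁.SymSpace) :
    (S.map hη).Isometric (T.map hη) ↔ S.Isometric T := by
  have key (f : S.obj ≅ T.obj) :
      F.map f.hom ≫ (F.map T.form.hom ≫ (comparison η T.obj).hom) ≫ 𝒟₂.dualMap (F.map f.hom) =
        F.map S.form.hom ≫ (comparison η S.obj).hom ↔
      f.hom ≫ T.form.hom ≫ 𝒟₁.dualMap f.hom = S.form.hom := by
    rw [Category.assoc, ← comparison_naturality, ← Functor.map_comp_assoc, ← Functor.map_comp_assoc,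
      cancel_mono]
    exact ⟨fun h ↦ F.map_injective ((by simp : F.map _ = F.map _).trans h),
      fun h ↦ (by simp : F.map _ = F.map _).trans (congrArg F.map h)⟩
  constructor
  · rintro ⟨f, hf⟩
    obtain ⟨f, rfl⟩ : ∃ f' : S.obj ≅ T.obj, f = F.mapIso f' :=
      ⟨F.preimageIso f, by ext; exact (F.map_preimage f.hom).symm⟩
    exact ⟨f, (key f).1 hf⟩
  · rintro ⟨f, hf⟩
    exact ⟨F.mapIso f, (key f).2 hf⟩

/-- Transport of a symmetric space along an isomorphism of the underlying objects. -/
def ofIso (S : 𝒟₁.SymSpace) {X : K₁} (e : X ≅ S.obj) : 𝒟₁.SymSpace where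
  obj := X
  form := e ≪≫ S.form ≪≫ 𝒟₁.dualIso e
  symm := by
    have h := 𝒟₁.bidual_naturality e.hom
    rw [Iso.trans_hom, Iso.trans_hom, dualIso_hom, dualMap_comp, dualMap_comp, Category.assoc,
      ← reassoc_of% h, reassoc_of% S.symm]

lemma ofIso_isometric (S : 𝒟₁.SymSpace) {X : K₁} (e : X ≅ S.obj) : (S.ofIso e).Isometric S :=
  ⟨e, rfl⟩

/-- The preimage of a symmetric form on `F X`. -/
def preimage [F.Full] [F.Faithful] (hη : ComparisonBidual η) {X : K₁}
    (φ : F.obj X ≅ 𝒟₂.dual (F.obj X)) (hφ : 𝒟₂.bidual (F.obj X) ≫ 𝒟₂.dualMap φ.hom = φ.hom) :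
    𝒟₁.SymSpace where
  obj := X
  form := F.preimageIso (φ ≪≫ (comparison η X).symm)
  symm := F.map_injective (by
    have h : F.map (F.preimage (φ.hom ≫ (comparison η X).inv)) ≫ (comparison η X).hom =
        φ.hom := by simp
    rw [Functor.preimageIso_hom, Iso.trans_hom, Iso.symm_hom, ← cancel_mono (comparison η X).hom,
      Functor.map_comp, Category.assoc, comparison_naturality, reassoc_of% (hη X), ← dualMap_comp,
      h, hφ])

/-- The underlying object is reached only up to isomorphism, so the form is moved to some `F X`
before it is pulled back. -/
lemma exists_map_isometric [F.IsEquivalence] (hη : ComparisonBidual η) (T : 𝒟₂.SymSpace) :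
    ∃ S : 𝒟₁.SymSpace, (S.map hη).Isometric T := by
  let T' := T.ofIso (F.objObjPreimageIso T.obj)
  refine ⟨preimage hη T'.form T'.symm, .trans ?_ (ofIso_isometric T (F.objObjPreimageIso T.obj))⟩
  have h : F.map (F.preimage (T'.form.hom ≫ (comparison η _).inv)) ≫ (comparison η _).hom =
        T'.form.hom := by
    rw [Functor.map_preimage]
    exact (Category.assoc _ _ _).trans ((congrArg _ (Iso.inv_hom_id _)).trans (Category.comp_id _))
  exact ⟨Iso.refl (F.obj (F.objPreimage T.obj)), (Category.id_comp _).trans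
    ((congrArg _ (𝒟₂.dualMap_id _)).trans ((Category.comp_id _).trans h.symm))⟩

end SymSpace

variable [HasZeroObject K₁] [HasBinaryBiproducts K₁] [HasZeroObject K₂] [HasBinaryBiproducts K₂]

lemma SymSpace.map_sum [F.Additive] (hη : ComparisonBidual η) (S T : 𝒟₁.SymSpace) :
    ((S.sum T).map hη).Isometric ((S.map hη).sum (T.map hη)) := by
  have := preservesBinaryBiproducts_of_preservesBiproducts F
  have h₁ := comparison_naturality η (biprod.fst : S.obj ⊞ T.obj ⟶ S.obj)
  have h₂ := comparison_naturality η (biprod.snd : S.obj ⊞ T.obj ⟶ T.obj)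
  have h₃ := 𝒟₂.dualMap_comp (F.mapBiprod S.obj T.obj).hom biprod.fst
  have h₄ := 𝒟₂.dualMap_comp (F.mapBiprod S.obj T.obj).hom biprod.snd
  simp only [Functor.mapBiprod_hom, biprod.lift_fst, biprod.lift_snd] at h₃ h₄
  have h : (F.mapBiprod S.obj T.obj).hom ≫
      (biprod.fst ≫ (F.map S.form.hom ≫ (comparison η S.obj).hom) ≫ 𝒟₂.dualMap biprod.fst +
        biprod.snd ≫ (F.map T.form.hom ≫ (comparison η T.obj).hom) ≫ 𝒟₂.dualMap biprod.snd) ≫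
        𝒟₂.dualMap (F.mapBiprod S.obj T.obj).hom =
      F.map (biprod.fst ≫ S.form.hom ≫ 𝒟₁.dualMap biprod.fst +
        biprod.snd ≫ T.form.hom ≫ 𝒟₁.dualMap biprod.snd) ≫
          (comparison η (S.obj ⊞ T.obj)).hom := by
    have h₅ : biprod.lift (F.map biprod.fst) (F.map biprod.snd) ≫ biprod.fst =
      F.map (biprod.fst : S.obj ⊞ T.obj ⟶ _) := biprod.lift_fst _ _
    have h₆ : biprod.lift (F.map biprod.fst) (F.map biprod.snd) ≫ biprod.snd =
      F.map (biprod.snd : S.obj ⊞ T.obj ⟶ _) := biprod.lift_snd _ _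
    simp only [Functor.mapBiprod_hom, Preadditive.add_comp, Preadditive.comp_add,
      Functor.map_add, Functor.map_comp, Category.assoc, ← h₃, ← h₄, reassoc_of% h₅,
      reassoc_of% h₆, h₁, h₂]
  exact ⟨F.mapBiprod S.obj T.obj, h⟩

/-- The isomorphism of Witt monoids induced by an equivalence compatible with the dualities. -/
def wittMonoidEquiv [F.Additive] [F.IsEquivalence] (hη : ComparisonBidual η) :
    𝒟₁.WittMonoid ≃+ 𝒟₂.WittMonoid :=
  AddEquiv.ofBijective
    (AddHom.mk (M := 𝒟₁.WittMonoid) (N := 𝒟₂.WittMonoid) (Quotient.map (SymSpace.map hη) (fun S T ↦ (SymSpace.map_isometric_iff hη S T).2))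
      (by
        rintro ⟨S⟩ ⟨T⟩
        exact Quotient.sound (SymSpace.map_sum hη S T)))
    ⟨by
      rintro ⟨S⟩ ⟨T⟩ h
      exact Quotient.sound ((SymSpace.map_isometric_iff hη S T).1 (Quotient.exact h)), by
      rintro ⟨T⟩
      obtain ⟨S, hS⟩ := SymSpace.exists_map_isometric hη T
      exact ⟨S.isometryClass, Quotient.sound hS⟩⟩

end Isometry

section Lagrangian

universe v u v' u'

variable {K : Type u} [Category.{v} K] [Preadditive K] [HasShift K ℤ] [HasZeroObject K]
  [∀ n : ℤ, (shiftFunctor K n).Additive] [Pretriangulated K] {𝒟 : DualityData K}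

/-- `(L, α, w)` is a lagrangian of the symmetric space `P`. -/
structure SymSpace.IsLagrangian (δ : ℤˣ) (P : 𝒟.SymSpace) {L : K} (α : L ⟶ P.obj)
    (w : (𝒟.dual L)⟦(-1 : ℤ)⟧ ⟶ L) : Prop where
  distinguished : Triangle.mk w α (P.form.hom ≫ 𝒟.dualMap α ≫
      (shiftFunctorCompIsoId K (-1) 1 (by lia)).inv.app (𝒟.dual L)) ∈ distTriang K
  transpose : 𝒟.lagrangianTranspose w = δ • (w ≫ 𝒟.bidual L)

lemma SymSpace.isMetabolic_iff (δ : ℤˣ) (P : 𝒟.SymSpace) :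
    P.IsMetabolic δ ↔ ∃ (L : K) (α : L ⟶ P.obj) (w : (𝒟.dual L)⟦(-1 : ℤ)⟧ ⟶ L),
      P.IsLagrangian δ α w :=
  ⟨fun ⟨L, α, w, h, h'⟩ ↦ ⟨L, α, w, h, h'⟩, fun ⟨L, α, w, h, h'⟩ ↦ ⟨L, α, w, h, h'⟩⟩

lemma lagrangianTranspose_ofIso {L L' : K} (j : L ≅ L') (w : (𝒟.dual L')⟦(-1 : ℤ)⟧ ⟶ L') :
    𝒟.lagrangianTranspose ((𝒟.dualMap j.inv)⟦(-1 : ℤ)⟧' ≫ w ≫ j.inv) =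
      (𝒟.dualMap j.inv)⟦(-1 : ℤ)⟧' ≫ 𝒟.lagrangianTranspose w ≫
        𝒟.dualMap (𝒟.dualMap j.inv) := by
  have h := 𝒟.dualShift_hom_naturality (𝒟.dualMap j.inv) (-1) 1 (by lia)
  have h' := (shiftFunctorCompIsoId K 1 (-1) (by lia)).hom.naturality
    (𝒟.dualMap (𝒟.dualMap j.inv))
  dsimp at h'
  simp only [lagrangianTranspose, dualMap_comp, Functor.map_comp, Category.assoc]
  rw [← h', ← Functor.map_comp_assoc _ (𝒟.dualMap ((𝒟.dualMap j.inv)⟦(-1 : ℤ)⟧')), h,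
    Functor.map_comp_assoc]

/-- Lagrangians move along an isomorphism of `L` and an isometry of `P` simultaneously. An
equivalence reaches both only up to isomorphism, so pulling a lagrangian back requires both. -/
lemma SymSpace.IsLagrangian.ofIso {δ : ℤˣ} {P P' : 𝒟.SymSpace} {L L' : K} {α : L' ⟶ P'.obj}
    {w : (𝒟.dual L')⟦(-1 : ℤ)⟧ ⟶ L'} (hw : P'.IsLagrangian δ α w) (j : L ≅ L')
    (f : P.obj ≅ P'.obj) (hf : f.hom ≫ P'.form.hom ≫ 𝒟.dualMap f.hom = P.form.hom) :
    P.IsLagrangian δ (j.hom ≫ α ≫ f.inv) ((𝒟.dualMap j.inv)⟦(-1 : ℤ)⟧' ≫ w ≫ j.inv) where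
  distinguished := by
    have h := (shiftFunctorCompIsoId K (-1) 1 (by lia)).inv.naturality (𝒟.dualMap j.inv)
    dsimp at h
    have h₁ : ((𝒟.dualMap j.inv)⟦(-1 : ℤ)⟧' ≫ w ≫ j.inv) ≫ j.hom =
        (𝒟.dualMap j.inv)⟦(-1 : ℤ)⟧' ≫ w := by simp
    have h₂ : (j.hom ≫ α ≫ f.inv) ≫ f.hom = j.hom ≫ α := by simp
    have h₃ : (P.form.hom ≫ 𝒟.dualMap (j.hom ≫ α ≫ f.inv) ≫
        (shiftFunctorCompIsoId K (-1) 1 (by lia)).inv.app (𝒟.dual L)) ≫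
          (𝒟.dualMap j.inv)⟦(-1 : ℤ)⟧'⟦(1 : ℤ)⟧' = f.hom ≫ P'.form.hom ≫ 𝒟.dualMap α ≫
            (shiftFunctorCompIsoId K (-1) 1 (by lia)).inv.app (𝒟.dual L') := by
      simp only [Category.assoc, ← hf]
      rw [← h, ← dualMap_comp_assoc, ← dualMap_comp_assoc]
      simp
    exact isomorphic_distinguished _ hw.distinguished _ (Triangle.isoMk _ _
      ((shiftFunctor K (-1 : ℤ)).mapIso (𝒟.dualIso j.symm)) j f h₁ h₂ h₃)
  transpose := by
    have h := 𝒟.bidual_naturality j.inv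
    rw [lagrangianTranspose_ofIso, hw.transpose, Linear.units_smul_comp, Linear.comp_units_smul,
      Category.assoc, Category.assoc, Category.assoc, h]

variable {K₁ : Type u} [Category.{v} K₁] [Preadditive K₁] [HasShift K₁ ℤ] [HasZeroObject K₁]
  [∀ n : ℤ, (shiftFunctor K₁ n).Additive] [Pretriangulated K₁]
  {K₂ : Type u'} [Category.{v'} K₂] [Preadditive K₂] [HasShift K₂ ℤ] [HasZeroObject K₂]
  [∀ n : ℤ, (shiftFunctor K₂ n).Additive] [Pretriangulated K₂]
  {𝒟₁ : DualityData K₁} {𝒟₂ : DualityData K₂}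
  {F : K₁ ⥤ K₂} [F.CommShift ℤ] {η : 𝒟₁.D ⋙ F ≅ F.op ⋙ 𝒟₂.D}

variable (F η) in
/-- The identification `F (T^n (X^♯)) ≅ T^n ((F X)^♯)`. -/
def shiftedComparison (n : ℤ) (X : K₁) :
    F.obj ((𝒟₁.dual X)⟦n⟧) ≅ (𝒟₂.dual (F.obj X))⟦n⟧ :=
  (F.commShiftIso n).app (𝒟₁.dual X) ≪≫ (shiftFunctor K₂ n).mapIso (comparison η X)

/-- Any `w'` that matches `F w` is allowed: pushing a lagrangian forward solves the matching
equation for `w'`, pulling it back solves it for `w`. -/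
lemma map_lagrangianTranspose (hη : ComparisonShift F η) {L : K₁}
    (w : (𝒟₁.dual L)⟦(-1 : ℤ)⟧ ⟶ L) (w' : (𝒟₂.dual (F.obj L))⟦(-1 : ℤ)⟧ ⟶ F.obj L)
    (hw : (shiftedComparison F η (-1) L).hom ≫ w' = F.map w) :
    F.map (𝒟₁.lagrangianTranspose w) ≫ (comparison η (𝒟₁.dual L)).hom =
      (shiftedComparison F η (-1) L).hom ≫ 𝒟₂.lagrangianTranspose w' ≫
        𝒟₂.dualMap (comparison η L).hom := by
  have h₁ := congrArg (shiftFunctor K₂ (-1)).map (hη (𝒟₁.dual L) (-1) 1 (by lia))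
  have h₂ := (shiftFunctorCompIsoId K₂ 1 (-1) (by lia)).hom.naturality
    (comparison η (𝒟₁.dual L)).hom
  have h₃ := congrArg (shiftFunctor K₂ (-1)).map (comparison_naturality η w)
  have h₄ := congrArg 𝒟₂.dualMap hw
  have h₅ := (shiftFunctorCompIsoId K₂ 1 (-1) (by lia)).hom.naturality
    (𝒟₂.dualMap (comparison η L).hom)
  have h₆ := congrArg (shiftFunctor K₂ (-1)).map
    (𝒟₂.dualShift_hom_naturality (comparison η L).hom (-1) 1 (by lia))
  have h₇ : 𝒟₂.dualMap ((F.commShiftIso (-1)).hom.app (𝒟₁.dual L)) ≫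
      𝒟₂.dualMap ((F.commShiftIso (-1)).inv.app (𝒟₁.dual L)) = 𝟙 _ := by
    rw [← dualMap_comp, Iso.inv_hom_id_app]
    exact 𝒟₂.dualMap_id _
  dsimp at h₂ h₅
  simp only [Functor.map_comp] at h₁ h₃ h₆
  dsimp [shiftedComparison] at h₄ ⊢
  simp only [dualMap_comp] at h₄
  simp only [lagrangianTranspose, Functor.map_comp, Category.assoc,
    Functor.map_shiftFunctorCompIsoId_hom_app, Functor.commShiftIso_hom_naturality_assoc]
  rw [← h₂, reassoc_of% h₁, reassoc_of% h₃, ← h₄, ← h₅, ← reassoc_of% h₆]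
  simp only [Functor.map_comp, Category.assoc]
  rw [← Functor.map_comp_assoc _ (𝒟₂.dualMap ((F.commShiftIso (-1)).hom.app (𝒟₁.dual L))), h₇]
  congr 4
  exact (congrArg (· ≫ (𝒟₂.dualShift (F.obj (𝒟₁.dual L)) (-1) 1 (by lia)).hom⟦(-1 : ℤ)⟧' ≫ _)
    ((shiftFunctor K₂ (-1)).map_id _)).trans (Category.id_comp _)

/-- Both conditions are preserved and reflected: a fully faithful exact functor reflects
distinguished triangles, and the two transposition equations are conjugate under isomorphisms. -/
lemma SymSpace.isLagrangian_map_iff [F.IsTriangulated] [F.Full] [F.Faithful]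
    (hη : ComparisonShift F η) (hη' : ComparisonBidual η) (δ : ℤˣ) (P : 𝒟₁.SymSpace) {L : K₁}
    (α : L ⟶ P.obj) (w : (𝒟₁.dual L)⟦(-1 : ℤ)⟧ ⟶ L)
    (w' : (𝒟₂.dual (F.obj L))⟦(-1 : ℤ)⟧ ⟶ F.obj L)
    (hw : (shiftedComparison F η (-1) L).hom ≫ w' = F.map w) :
    (P.map hη').IsLagrangian δ (F.map α) w' ↔ P.IsLagrangian δ α w := by
  have h₁ : (Triangle.mk w' (F.map α) ((F.map P.form.hom ≫ (comparison η P.obj).hom) ≫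
      𝒟₂.dualMap (F.map α) ≫
        (shiftFunctorCompIsoId K₂ (-1) 1 (by lia)).inv.app (𝒟₂.dual (F.obj L))) ∈ distTriang K₂) ↔
      (Triangle.mk w α (P.form.hom ≫ 𝒟₁.dualMap α ≫
        (shiftFunctorCompIsoId K₁ (-1) 1 (by lia)).inv.app (𝒟₁.dual L)) ∈ distTriang K₁) := by
    rw [← F.map_distinguished_iff]
    have h₂ := (shiftFunctorCompIsoId K₂ (-1) 1 (by lia)).inv.naturality (comparison η L).hom
    have h₃ := comparison_naturality η α
    dsimp at h₂
    have h₄ : (F.map (P.form.hom ≫ 𝒟₁.dualMap α ≫ (shiftFunctorCompIsoId K₁ (-1) 1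
        (by lia)).inv.app (𝒟₁.dual L)) ≫ (F.commShiftIso 1).hom.app ((𝒟₁.dual L)⟦(-1 : ℤ)⟧)) ≫
          ((F.commShiftIso (-1)).hom.app (𝒟₁.dual L) ≫
            (comparison η L).hom⟦(-1 : ℤ)⟧')⟦(1 : ℤ)⟧' =
        𝟙 _ ≫ (F.map P.form.hom ≫ (comparison η P.obj).hom) ≫ 𝒟₂.dualMap (F.map α) ≫
          (shiftFunctorCompIsoId K₂ (-1) 1 (by lia)).inv.app (𝒟₂.dual (F.obj L)) := by
      simp only [Functor.map_comp, Category.assoc, Functor.map_shiftFunctorCompIsoId_inv_app,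
        Category.id_comp, Iso.inv_hom_id_app_assoc]
      rw [← reassoc_of% h₃, h₂]
      congr 4
      rw [← Functor.map_comp_assoc, Iso.inv_hom_id_app]
      exact (congrArg (· ≫ _) ((shiftFunctor K₂ 1).map_id _)).trans (Category.id_comp _)
    exact distinguished_iff_of_iso (Triangle.isoMk (F.mapTriangle.obj (Triangle.mk w α _))
      (Triangle.mk w' (F.map α) _) (shiftedComparison F η (-1) L) (Iso.refl _) (Iso.refl _)
        ((Category.comp_id _).trans hw.symm)
        ((Category.comp_id _).trans (Category.id_comp _).symm) h₄).symm
  have h₂ : 𝒟₂.lagrangianTranspose w' = δ • (w' ≫ 𝒟₂.bidual (F.obj L)) ↔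
      𝒟₁.lagrangianTranspose w = δ • (w ≫ 𝒟₁.bidual L) := by
    rw [← cancel_epi (shiftedComparison F η (-1) L).hom,
      ← cancel_mono (𝒟₂.dualMap (comparison η L).hom), Category.assoc,
      ← map_lagrangianTranspose hη w w' hw, Linear.comp_units_smul, Linear.units_smul_comp,
      reassoc_of% hw, Category.assoc, ← hη' L, ← Functor.map_comp_assoc,
      ← Linear.units_smul_comp, cancel_mono]
    have h₃ : F.map (δ • (w ≫ 𝒟₁.bidual L)) = δ • F.map (w ≫ 𝒟₁.bidual L) := by
      obtain rfl | rfl := Int.units_eq_one_or δ <;> simp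
    rw [← h₃]
    exact ⟨fun h ↦ F.map_injective h, fun h ↦ congrArg F.map h⟩
  exact ⟨fun h ↦ ⟨h₁.1 h.1, h₂.1 h.2⟩, fun h ↦ ⟨h₁.2 h.1, h₂.2 h.2⟩⟩

lemma SymSpace.isMetabolic_of_map_isometric [F.IsTriangulated] [F.IsEquivalence]
    (hη : ComparisonShift F η) (hη' : ComparisonBidual η) {δ : ℤˣ} {P : 𝒟₁.SymSpace}
    {Q : 𝒟₂.SymSpace} (h : (P.map hη').Isometric Q) (hQ : Q.IsMetabolic δ) : P.IsMetabolic δ := by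
  obtain ⟨L, α, w, hw⟩ := (isMetabolic_iff _ _).1 hQ
  obtain ⟨f, hf⟩ := h
  have h' := hw.ofIso (P := P.map hη') (F.objObjPreimageIso L) f hf
  obtain ⟨α', hα'⟩ := F.map_surjective ((F.objObjPreimageIso L).hom ≫ α ≫ f.inv)
  obtain ⟨w', hw'⟩ := F.map_surjective ((shiftedComparison F η (-1) (F.objPreimage L)).hom ≫
    (𝒟₂.dualMap (F.objObjPreimageIso L).inv)⟦(-1 : ℤ)⟧' ≫ w ≫ (F.objObjPreimageIso L).inv)
  refine (isMetabolic_iff _ _).2 ⟨F.objPreimage L, α', w',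
    (isLagrangian_map_iff hη hη' δ P _ _ _ hw'.symm).1 ?_⟩
  rw [hα']
  exact h'

lemma SymSpace.IsMetabolic.map [F.IsTriangulated] [F.Full] [F.Faithful]
    (hη : ComparisonShift F η) (hη' : ComparisonBidual η) {δ : ℤˣ} {P : 𝒟₁.SymSpace}
    (hP : P.IsMetabolic δ) : (P.map hη').IsMetabolic δ := by
  obtain ⟨L, α, w, hw⟩ := (isMetabolic_iff _ _).1 hP
  exact (isMetabolic_iff _ _).2 ⟨_, F.map α, _, (isLagrangian_map_iff hη hη' δ P α w
    ((shiftedComparison F η (-1) L).inv ≫ F.map w) (Iso.hom_inv_id_assoc _ _)).2 hw⟩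

/-- The Witt group is a quotient by a generated congruence, so the isomorphism of monoids descends
once the generating relations agree exactly. The direction from right to left is where metabolic
spaces must be reflected. -/
lemma wittMonoid_relation_iff [F.IsTriangulated] [F.IsEquivalence]
    (hη : ComparisonShift F η) (hη' : ComparisonBidual η) (δ : ℤˣ) (x y : 𝒟₁.WittMonoid) :
    ((∃ P : 𝒟₁.SymSpace, P.IsMetabolic δ ∧ x = P.isometryClass) ∧ y = 0) ↔
      (∃ P : 𝒟₂.SymSpace, P.IsMetabolic δ ∧ wittMonoidEquiv hη' x = P.isometryClass) ∧
        wittMonoidEquiv hη' y = 0 := by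
  refine and_congr ⟨?_, ?_⟩ (by simp)
  · rintro ⟨P, hP, rfl⟩
    exact ⟨_, hP.map hη hη', rfl⟩
  · rintro ⟨Q, hQ, h⟩
    obtain ⟨P, rfl⟩ := Quotient.exists_rep x
    exact ⟨P, SymSpace.isMetabolic_of_map_isometric hη hη' (Quotient.exact h) hQ, rfl⟩

/-- The isomorphism of Witt groups induced by an equivalence compatible with the dualities. -/
def wittGroupOfEquiv [F.IsTriangulated] [F.IsEquivalence]
    (hη : ComparisonShift F η) (hη' : ComparisonBidual η) (δ : ℤˣ) :
    𝒟₁.WittGroupOf δ ≃+ 𝒟₂.WittGroupOf δ :=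
  AddCon.congr (wittMonoidEquiv hη') (by
    rw [AddCon.comap_addConGen_equiv]
    congr 1
    ext x y
    exact wittMonoid_relation_iff hη hη' δ x y)

lemma wittGroupOfEquiv_wittClass [F.IsTriangulated] [F.IsEquivalence]
    (hη : ComparisonShift F η) (hη' : ComparisonBidual η) (δ : ℤˣ) (S : 𝒟₁.SymSpace) :
    wittGroupOfEquiv hη hη' δ (S.wittClass δ) = (S.map hη').wittClass δ := rfl

end Lagrangian

end DualityData

/-! ### Transport and reflection of dualities along functors. -/

namespace DualityData

lemma map_comp_eq_id {C D : Type*} [Category* C] [Category* D] (F : C ⥤ D) {X Y : C} {f : X ⟶ Y}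
    {g : Y ⟶ X} (h : f ≫ g = 𝟙 X) : F.map f ≫ F.map g = 𝟙 (F.obj X) := by
  rw [← F.map_comp, h, F.map_id]

lemma dualMap_comp_eq_id {C : Type*} [Category* C] [Preadditive C] [HasShift C ℤ]
    (𝒟 : DualityData C) {X Y : C} {f : X ⟶ Y} {g : Y ⟶ X} (h : g ≫ f = 𝟙 Y) :
    𝒟.dualMap f ≫ 𝒟.dualMap g = 𝟙 (𝒟.dual Y) := by
  rw [← dualMap_comp, h, dualMap_id]

/-- This cancellation and similar ones below concern arbitrary morphisms, so that they apply to
composites whose objects agree only after unfolding definitions. -/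
lemma comp_eq_of_cancel {C : Type*} [Category* C] {X Y Z W : C} {u : X ⟶ W} {a : X ⟶ Y}
    {b : Y ⟶ Z} {i : Z ⟶ W} {k : W ⟶ Z} (h : u = a ≫ b ≫ i) (e : i ≫ k = 𝟙 Z) :
    u ≫ k = a ≫ b := by
  rw [h, Category.assoc, Category.assoc, e, Category.comp_id]

lemma comp_eq_of_cancel₂ {C : Type*} [Category* C] {X₁ X₂ X₃ X₄ X₅ X₆ : C} {u : X₁ ⟶ X₆}
    {a : X₁ ⟶ X₂} {b : X₂ ⟶ X₃} {c : X₃ ⟶ X₄} {i : X₄ ⟶ X₅} {j : X₅ ⟶ X₆} {k : X₆ ⟶ X₅}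
    {l : X₅ ⟶ X₄} (h : u = a ≫ b ≫ c ≫ i ≫ j) (e : j ≫ k = 𝟙 X₅) (e' : i ≫ l = 𝟙 X₄) :
    u ≫ k ≫ l = a ≫ b ≫ c := by
  rw [h]
  simp only [Category.assoc]
  rw [reassoc_of% e, e', Category.comp_id]

/-- An equation is invariant under conjugation by fixed isomorphisms. The axioms on shift
identifications are compared between source and target in this way. -/
lemma eq_iff_of_intertwine {C C' : Type*} [Category* C] [Category* C'] {X Y : C} {X' Y' Z' : C'}
    (F : C ⥤ C') {f g : X ⟶ Y} {f' g' : X' ⟶ Y'} {c : F.obj Y ⟶ Z'} {u : F.obj X ⟶ X'}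
    {w : Y' ⟶ Z'} [IsIso c] [IsIso u] [IsIso w] (hf : F.map f ≫ c = u ≫ f' ≫ w)
    (hg : F.map g ≫ c = u ≫ g' ≫ w) : F.map f = F.map g ↔ f' = g' := by
  rw [← cancel_mono c, hf, hg, cancel_epi, cancel_mono]

section DualTriangle

universe v u

variable {K : Type u} [Category.{v} K] [Preadditive K] [HasShift K ℤ] (𝒟 : DualityData K)

/-- The dual of a triangle. -/
abbrev dualTriangle (Δ : Triangle K) : Triangle K :=
  Triangle.mk (𝒟.dualMap Δ.mor₂) (𝒟.dualMap Δ.mor₁)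
    ((shiftFunctorCompIsoId K (-1) 1 (by lia)).inv.app (𝒟.dual Δ.obj₁) ≫
      ((𝒟.dualShift Δ.obj₁ 1 (-1) (by lia)).inv)⟦(1 : ℤ)⟧' ≫
        (𝒟.dualMap Δ.mor₃)⟦(1 : ℤ)⟧')

/-- Isomorphic triangles have isomorphic duals. -/
def dualTriangleIso {Δ Δ' : Triangle K} (e : Δ ≅ Δ') : 𝒟.dualTriangle Δ' ≅ 𝒟.dualTriangle Δ := by
  refine Triangle.isoMk _ _ (𝒟.dualIso (Triangle.π₃.mapIso e)) (𝒟.dualIso (Triangle.π₂.mapIso e))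
    (𝒟.dualIso (Triangle.π₁.mapIso e)) ?_ ?_ ?_
  · change 𝒟.dualMap Δ'.mor₂ ≫ 𝒟.dualMap e.hom.hom₂ = 𝒟.dualMap e.hom.hom₃ ≫ 𝒟.dualMap Δ.mor₂
    rw [← dualMap_comp, ← dualMap_comp, e.hom.comm₂]
  · change 𝒟.dualMap Δ'.mor₁ ≫ 𝒟.dualMap e.hom.hom₁ = 𝒟.dualMap e.hom.hom₂ ≫ 𝒟.dualMap Δ.mor₁
    rw [← dualMap_comp, ← dualMap_comp, e.hom.comm₁]
  · have h₁ := (shiftFunctorCompIsoId K (-1) 1 (by lia)).inv.naturality (𝒟.dualMap e.hom.hom₁)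
    have h₂ := congrArg (shiftFunctor K (1 : ℤ)).map
      (𝒟.dualShift_inv_naturality e.hom.hom₁ 1 (-1) (by lia))
    have h₃ := congrArg (shiftFunctor K (1 : ℤ)).map (congrArg 𝒟.dualMap e.hom.comm₃)
    dsimp at h₁
    simp only [Functor.map_comp, dualMap_comp] at h₂ h₃
    change (_ ≫ _ ≫ _) ≫ (𝒟.dualMap e.hom.hom₃)⟦(1 : ℤ)⟧' = 𝒟.dualMap e.hom.hom₁ ≫ _ ≫ _ ≫ _
    rw [reassoc_of% h₁, reassoc_of% h₂]
    simp only [Category.assoc, h₃]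

end DualTriangle

section Intertwine

universe v u v' u'

variable {K₁ : Type u} [Category.{v} K₁] [Preadditive K₁] [HasShift K₁ ℤ]
  {K₂ : Type u'} [Category.{v'} K₂] [Preadditive K₂] [HasShift K₂ ℤ]
  {𝒟₁ : DualityData K₁} {𝒟₂ : DualityData K₂}
  {F : K₁ ⥤ K₂} [F.CommShift ℤ] {η : 𝒟₁.D ⋙ F ≅ F.op ⋙ 𝒟₂.D}

lemma ComparisonShift.dualShift_inv (hη : ComparisonShift F η) (X : K₁) (n m : ℤ) (h : n + m = 0) :
    (F.commShiftIso m).hom.app (𝒟₁.dual X) ≫ (comparison η X).hom⟦m⟧' ≫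
        (𝒟₂.dualShift (F.obj X) n m h).inv ≫ 𝒟₂.dualMap ((F.commShiftIso n).hom.app X) =
      F.map (𝒟₁.dualShift X n m h).inv ≫ (comparison η (X⟦n⟧)).hom := by
  have e : 𝒟₂.dualMap ((F.commShiftIso n).inv.app X) ≫
      𝒟₂.dualMap ((F.commShiftIso n).hom.app X) = 𝟙 (𝒟₂.dual (F.obj (X⟦n⟧))) :=
    dualMap_comp_eq_id 𝒟₂ (Iso.hom_inv_id_app _ _)
  have h₁ := hη X n m h
  rw [← cancel_epi (F.map (𝒟₁.dualShift X n m h).hom), reassoc_of% h₁, Iso.hom_inv_id_assoc, e,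
    Category.comp_id, ← Functor.map_comp_assoc, Iso.hom_inv_id, F.map_id, Category.id_comp]

/-- The left side is an equation between images under `F` because the lemma is used in two
directions. For faithful `F` it pulls the axiom back; for the quotient functor from complexes to the
homotopy category, where faithfulness fails, it pushes the axiom forward. The two equivalences that
follow have the same purpose. -/
lemma ComparisonShift.dualShift_zero_iff (hη : ComparisonShift F η) (X : K₁) :
    F.map (𝒟₁.dualShift X 0 0 (by lia)).hom =
      F.map (𝒟₁.dualMap ((shiftFunctorZero K₁ ℤ).inv.app X) ≫
        (shiftFunctorZero K₁ ℤ).inv.app (𝒟₁.dual X)) ↔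
    (𝒟₂.dualShift (F.obj X) 0 0 (by lia)).hom =
      𝒟₂.dualMap ((shiftFunctorZero K₂ ℤ).inv.app (F.obj X)) ≫
        (shiftFunctorZero K₂ ℤ).inv.app (𝒟₂.dual (F.obj X)) := by
  refine eq_iff_of_intertwine F
    (c := (F.commShiftIso 0).hom.app (𝒟₁.dual X) ≫ (comparison η X).hom⟦(0 : ℤ)⟧')
    (u := (comparison η (X⟦(0 : ℤ)⟧)).hom ≫ 𝒟₂.dualMap ((F.commShiftIso 0).inv.app X)) (w := 𝟙 _)
    (by rw [hη X 0 0 (by lia), Category.comp_id, Category.assoc]) ?_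
  have h₂ := (shiftFunctorZero K₂ ℤ).inv.naturality (comparison η X).hom
  have h₃ := comparison_naturality η ((shiftFunctorZero K₁ ℤ).inv.app X)
  dsimp at h₂ h₃
  rw [Category.comp_id]
  simp only [Functor.commShiftIso_zero, Functor.CommShift.isoZero_hom_app,
    Functor.CommShift.isoZero_inv_app, Functor.map_comp, Category.assoc, dualMap_comp]
  have e₁ : F.map ((shiftFunctorZero K₁ ℤ).inv.app (𝒟₁.dual X)) ≫
      F.map ((shiftFunctorZero K₁ ℤ).hom.app (𝒟₁.dual X)) = 𝟙 (F.obj (𝒟₁.dual X)) :=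
    map_comp_eq_id F (Iso.inv_hom_id_app _ _)
  have e₂ : 𝒟₂.dualMap ((shiftFunctorZero K₂ ℤ).hom.app (F.obj X)) ≫
      𝒟₂.dualMap ((shiftFunctorZero K₂ ℤ).inv.app (F.obj X)) = 𝟙 (𝒟₂.dual (F.obj X)) :=
    dualMap_comp_eq_id 𝒟₂ (Iso.inv_hom_id_app _ _)
  rw [reassoc_of% e₁, reassoc_of% e₂, ← h₂, reassoc_of% h₃]

lemma ComparisonShift.dualShift_add_iff (hη : ComparisonShift F η) (X : K₁)
    (a b a' b' : ℤ) (ha : a + a' = 0) (hb : b + b' = 0) :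
    F.map (𝒟₁.dualShift X (a + b) (a' + b') (by lia)).hom =
      F.map (𝒟₁.dualMap ((shiftFunctorAdd K₁ a b).inv.app X) ≫
        (𝒟₁.dualShift (X⟦a⟧) b b' hb).hom ≫ ((𝒟₁.dualShift X a a' ha).hom)⟦b'⟧' ≫
          (shiftFunctorAdd K₁ a' b').inv.app (𝒟₁.dual X)) ↔
    (𝒟₂.dualShift (F.obj X) (a + b) (a' + b') (by lia)).hom =
      𝒟₂.dualMap ((shiftFunctorAdd K₂ a b).inv.app (F.obj X)) ≫
        (𝒟₂.dualShift ((F.obj X)⟦a⟧) b b' hb).hom ≫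
        ((𝒟₂.dualShift (F.obj X) a a' ha).hom)⟦b'⟧' ≫
          (shiftFunctorAdd K₂ a' b').inv.app (𝒟₂.dual (F.obj X)) := by
  refine eq_iff_of_intertwine F
    (c := (F.commShiftIso (a' + b')).hom.app (𝒟₁.dual X) ≫ (comparison η X).hom⟦a' + b'⟧')
    (u := (comparison η (X⟦a + b⟧)).hom ≫ 𝒟₂.dualMap ((F.commShiftIso (a + b)).inv.app X))
    (w := 𝟙 _)
    (by rw [hη X (a + b) (a' + b') (by lia), Category.comp_id, Category.assoc]) ?_
  have h₂ := (shiftFunctorAdd K₂ a' b').inv.naturality (comparison η X).hom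
  have h₃ := comparison_naturality η ((shiftFunctorAdd K₁ a b).inv.app X)
  have h₄ := congrArg (shiftFunctor K₂ b').map (hη X a a' ha)
  have h₅ := hη (X⟦a⟧) b b' hb
  have h₆ := 𝒟₂.dualShift_hom_naturality ((F.commShiftIso a).inv.app X) b b' hb
  dsimp at h₂ h₃ h₆
  simp only [Functor.map_comp] at h₄
  rw [Category.comp_id]
  simp only [Functor.commShiftIso_add, Functor.CommShift.isoAdd_hom_app,
    Functor.CommShift.isoAdd_inv_app, Functor.map_comp, Category.assoc, dualMap_comp]
  have e₁ : F.map ((shiftFunctorAdd K₁ a' b').inv.app (𝒟₁.dual X)) ≫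
      F.map ((shiftFunctorAdd K₁ a' b').hom.app (𝒟₁.dual X)) =
        𝟙 (F.obj ((𝒟₁.dual X)⟦a'⟧⟦b'⟧)) :=
    map_comp_eq_id F (Iso.inv_hom_id_app _ _)
  have e₂ : 𝒟₂.dualMap ((shiftFunctorAdd K₂ a b).hom.app (F.obj X)) ≫
      𝒟₂.dualMap ((shiftFunctorAdd K₂ a b).inv.app (F.obj X)) =
        𝟙 (𝒟₂.dual ((F.obj X)⟦a⟧⟦b⟧)) :=
    dualMap_comp_eq_id 𝒟₂ (Iso.inv_hom_id_app _ _)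
  rw [reassoc_of% e₁, reassoc_of% e₂, ← h₂, Functor.commShiftIso_hom_naturality_assoc,
    reassoc_of% h₄, reassoc_of% h₅, ← reassoc_of% h₆, reassoc_of% h₃]

lemma ComparisonShift.bidual_shift_iff (hη : ComparisonShift F η) (hη' : ComparisonBidual η)
    (X : K₁) :
    F.map (𝒟₁.bidual (X⟦(1 : ℤ)⟧)) =
      F.map ((𝒟₁.bidual X)⟦(1 : ℤ)⟧' ≫ (𝒟₁.dualShift (𝒟₁.dual X) (-1) 1 (by lia)).inv ≫
        𝒟₁.dualMap (𝒟₁.dualShift X 1 (-1) (by lia)).hom) ↔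
    𝒟₂.bidual ((F.obj X)⟦(1 : ℤ)⟧) =
      (𝒟₂.bidual (F.obj X))⟦(1 : ℤ)⟧' ≫
        (𝒟₂.dualShift (𝒟₂.dual (F.obj X)) (-1) 1 (by lia)).inv ≫
        𝒟₂.dualMap (𝒟₂.dualShift (F.obj X) 1 (-1) (by lia)).hom := by
  have h₁ : F.map (𝒟₁.bidual X) ≫ (comparison η (𝒟₁.dual X)).hom =
    𝒟₂.bidual (F.obj X) ≫ 𝒟₂.dualMap (comparison η X).hom := hη' X
  have h₂ : F.map (𝒟₁.bidual (X⟦(1 : ℤ)⟧)) ≫ (comparison η (𝒟₁.dual (X⟦(1 : ℤ)⟧))).hom =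
    𝒟₂.bidual (F.obj (X⟦(1 : ℤ)⟧)) ≫ 𝒟₂.dualMap (comparison η (X⟦(1 : ℤ)⟧)).hom :=
    hη' (X⟦(1 : ℤ)⟧)
  have h₃ := ComparisonShift.dualShift_inv hη (𝒟₁.dual X) (-1) 1 (by lia)
  have h₄ := congrArg (shiftFunctor K₂ (1 : ℤ)).map h₁
  have h₅ := congrArg 𝒟₂.dualMap (hη X 1 (-1) (by lia))
  have h₆ := 𝒟₂.dualShift_inv_naturality (comparison η X).hom (-1) 1 (by lia)
  have h₇ := 𝒟₂.bidual_naturality ((F.commShiftIso (1 : ℤ)).inv.app X)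
  have h₈ := comparison_naturality η (𝒟₁.dualShift X 1 (-1) (by lia)).hom
  have e₃ : (F.commShiftIso (1 : ℤ)).hom.app X ≫ (F.commShiftIso (1 : ℤ)).inv.app X =
    𝟙 (F.obj (X⟦(1 : ℤ)⟧)) := Iso.hom_inv_id_app _ _
  dsimp at h₇ h₈
  simp only [Functor.map_comp, dualMap_comp, Category.assoc] at h₄ h₅
  refine eq_iff_of_intertwine F (c := (comparison η (𝒟₁.dual (X⟦(1 : ℤ)⟧))).hom)
    (u := (F.commShiftIso (1 : ℤ)).hom.app X)
    (w := 𝒟₂.dualMap (𝒟₂.dualMap ((F.commShiftIso (1 : ℤ)).inv.app X)) ≫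
      𝒟₂.dualMap (comparison η (X⟦(1 : ℤ)⟧)).hom) ?_ ?_
  · rw [h₂, ← reassoc_of% h₇, reassoc_of% e₃]
  · simp only [Functor.map_comp, Category.assoc]
    rw [h₈, ← reassoc_of% h₃, Functor.commShiftIso_hom_naturality_assoc, reassoc_of% h₄,
      reassoc_of% h₆, h₅]

/-- The comparison between the dual of the image and the image of the dual of a triangle. -/
def mapDualTriangleIso (hη : ComparisonShift F η) (Δ : Triangle K₁) :
    F.mapTriangle.obj (𝒟₁.dualTriangle Δ) ≅ 𝒟₂.dualTriangle (F.mapTriangle.obj Δ) := by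
  have h₁ : F.map (𝒟₁.dualMap Δ.mor₂) ≫ (comparison η Δ.obj₂).hom =
      (comparison η Δ.obj₃).hom ≫ 𝒟₂.dualMap (F.map Δ.mor₂) := comparison_naturality η _
  have h₂ : F.map (𝒟₁.dualMap Δ.mor₁) ≫ (comparison η Δ.obj₁).hom =
      (comparison η Δ.obj₂).hom ≫ 𝒟₂.dualMap (F.map Δ.mor₁) := comparison_naturality η _
  have h₃ : (F.map ((shiftFunctorCompIsoId K₁ (-1) 1 (by lia)).inv.app (𝒟₁.dual Δ.obj₁) ≫
        ((𝒟₁.dualShift Δ.obj₁ 1 (-1) (by lia)).inv)⟦(1 : ℤ)⟧' ≫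
          (𝒟₁.dualMap Δ.mor₃)⟦(1 : ℤ)⟧') ≫ (F.commShiftIso 1).hom.app (𝒟₁.dual Δ.obj₃)) ≫
          (comparison η Δ.obj₃).hom⟦(1 : ℤ)⟧' =
      (comparison η Δ.obj₁).hom ≫
      ((shiftFunctorCompIsoId K₂ (-1) 1 (by lia)).inv.app (𝒟₂.dual (F.obj Δ.obj₁)) ≫
        ((𝒟₂.dualShift (F.obj Δ.obj₁) 1 (-1) (by lia)).inv)⟦(1 : ℤ)⟧' ≫
          (𝒟₂.dualMap (F.map Δ.mor₃ ≫ (F.commShiftIso 1).hom.app Δ.obj₁))⟦(1 : ℤ)⟧') := by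
    have h₅ := comparison_naturality η Δ.mor₃
    have h₆ := (shiftFunctorCompIsoId K₂ (-1) 1 (by lia)).inv.naturality (comparison η Δ.obj₁).hom
    have h₈ := congrArg (shiftFunctor K₂ (1 : ℤ)).map
      (ComparisonShift.dualShift_inv hη Δ.obj₁ 1 (-1) (by lia))
    dsimp at h₆
    simp only [Functor.map_comp] at h₈
    simp only [Functor.map_comp, Category.assoc, dualMap_comp,
      Functor.map_shiftFunctorCompIsoId_inv_app, Functor.commShiftIso_hom_naturality,
      Functor.commShiftIso_hom_naturality_assoc]
    have e : ((F.commShiftIso 1).inv.app ((𝒟₁.dual Δ.obj₁)⟦(-1 : ℤ)⟧)) ≫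
        ((F.commShiftIso 1).hom.app ((𝒟₁.dual Δ.obj₁)⟦(-1 : ℤ)⟧)) =
          𝟙 ((F.obj ((𝒟₁.dual Δ.obj₁)⟦(-1 : ℤ)⟧))⟦(1 : ℤ)⟧) := Iso.inv_hom_id_app _ _
    rw [reassoc_of% e, ← Functor.map_comp _ (F.map (𝒟₁.dualMap Δ.mor₃)), h₅, Functor.map_comp,
      ← reassoc_of% h₈, reassoc_of% h₆]
    have e' : (F.commShiftIso (-1)).inv.app (𝒟₁.dual Δ.obj₁) ≫
        (F.commShiftIso (-1)).hom.app (𝒟₁.dual Δ.obj₁) =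
          𝟙 ((F.obj (𝒟₁.dual Δ.obj₁))⟦(-1 : ℤ)⟧) := Iso.inv_hom_id_app _ _
    rw [reassoc_of% (map_comp_eq_id (shiftFunctor K₂ (1 : ℤ)) e')]
  exact Triangle.isoMk (F.mapTriangle.obj (𝒟₁.dualTriangle Δ)) _ (comparison η Δ.obj₃)
    (comparison η Δ.obj₂) (comparison η Δ.obj₁) h₁ h₂ h₃

end Intertwine

section Reflect

universe v u v' u'

variable {K₁ : Type u} [Category.{v} K₁] [Preadditive K₁] [HasShift K₁ ℤ] [HasZeroObject K₁]
  [∀ n : ℤ, (shiftFunctor K₁ n).Additive] [Pretriangulated K₁]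
  {K₂ : Type u'} [Category.{v'} K₂] [Preadditive K₂] [HasShift K₂ ℤ] [HasZeroObject K₂]
  [∀ n : ℤ, (shiftFunctor K₂ n).Additive] [Pretriangulated K₂]
  {𝒟₁ : DualityData K₁} {𝒟₂ : DualityData K₂}
  {F : K₁ ⥤ K₂} [F.CommShift ℤ] {η : 𝒟₁.D ⋙ F ≅ F.op ⋙ 𝒟₂.D}

lemma isMorphism_iff : IsMorphism F η ↔
    F.IsTriangulated ∧ ComparisonShift F η ∧ ComparisonBidual η :=
  ⟨fun h ↦ ⟨h.1, h.2, h.3⟩, fun h ↦ ⟨h.1, h.2.1, h.2.2⟩⟩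

/-- A fully faithful morphism reflects the axioms of a triangulated category with duality. -/
lemma IsMorphism.isDuality [F.Full] [F.Faithful] (hF : IsMorphism F η) (h : 𝒟₂.IsDuality) :
    𝒟₁.IsDuality where
  half X := by
    have := hF.isTriangulated
    obtain ⟨f, hf⟩ := h.half (F.obj X)
    exact ⟨F.preimage f, F.map_injective (by simp [hf])⟩
  dualShift_zero X := F.map_injective
    ((ComparisonShift.dualShift_zero_iff hF.shift X).2 (h.dualShift_zero _))
  dualShift_add X a b a' b' ha hb := F.map_injective
    ((ComparisonShift.dualShift_add_iff hF.shift X a b a' b' ha hb).2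
      (h.dualShift_add _ _ _ _ _ _ _))
  -- `F` reflects distinguished triangles and turns the dual of a triangle into the dual of its
  -- image, up to isomorphism.
  exact Δ hΔ := by
    have := hF.isTriangulated
    exact (F.map_distinguished_iff _).1 (isomorphic_distinguished _
      (h.exact _ (F.map_distinguished Δ hΔ)) _ (mapDualTriangleIso hF.shift Δ))
  isIso_bidual X := by
    have := h.isIso_bidual (F.obj X)
    have h₁ : F.map (𝒟₁.bidual X) ≫ (comparison η (𝒟₁.dual X)).hom =
      𝒟₂.bidual (F.obj X) ≫ 𝒟₂.dualMap (comparison η X).hom := hF.bidual X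
    have : IsIso (F.map (𝒟₁.bidual X) ≫ (comparison η (𝒟₁.dual X)).hom) := by
      rw [h₁]; infer_instance
    have := IsIso.of_isIso_comp_right (F.map (𝒟₁.bidual X)) (comparison η (𝒟₁.dual X)).hom
    exact isIso_of_reflects_iso _ F
  bidual_shift X := F.map_injective
    ((ComparisonShift.bidual_shift_iff hF.shift hF.bidual X).2 (h.bidual_shift _))
  bidual_dual X := by
    apply F.map_injective
    have h₁ : F.map (𝒟₁.bidual X) ≫ (comparison η (𝒟₁.dual X)).hom =
      𝒟₂.bidual (F.obj X) ≫ 𝒟₂.dualMap (comparison η X).hom := hF.bidual X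
    have h₂ : F.map (𝒟₁.bidual (𝒟₁.dual X)) ≫ (comparison η (𝒟₁.dual (𝒟₁.dual X))).hom =
      𝒟₂.bidual (F.obj (𝒟₁.dual X)) ≫ 𝒟₂.dualMap (comparison η (𝒟₁.dual X)).hom :=
      hF.bidual (𝒟₁.dual X)
    have h₃ := 𝒟₂.bidual_naturality (comparison η X).hom
    rw [← cancel_mono (comparison η X).hom, Functor.map_comp, Category.assoc,
      comparison_naturality, reassoc_of% h₂, ← dualMap_comp, h₁, dualMap_comp,
      ← reassoc_of% h₃, h.bidual_dual]
    simp

end Reflect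

section Inverse

universe v u v' u'

variable {K₁ : Type u} [Category.{v} K₁] [Preadditive K₁] [HasShift K₁ ℤ]
  {K₂ : Type u'} [Category.{v'} K₂] [Preadditive K₂] [HasShift K₂ ℤ]
  {𝒟₁ : DualityData K₁} {𝒟₂ : DualityData K₂}
  {F : K₁ ⥤ K₂} {G : K₂ ⥤ K₁}

/-- The comparison for a right inverse `G` of `F` that is obtained from a comparison for `F`. -/
def inverseComparison [F.Full] [F.Faithful] (ζ : 𝒟₁.D ⋙ F ≅ F.op ⋙ 𝒟₂.D) (τ : G ⋙ F ≅ 𝟭 K₂) :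
    𝒟₂.D ⋙ G ≅ G.op ⋙ 𝒟₁.D :=
  NatIso.ofComponents
    (fun X ↦ F.preimageIso (τ.app (𝒟₂.dual X.unop) ≪≫ 𝒟₂.dualIso (τ.app X.unop) ≪≫
      (comparison ζ (G.obj X.unop)).symm))
    (fun {X Y} f ↦ by
      apply F.map_injective
      have h₁ := τ.hom.naturality (𝒟₂.D.map f)
      have h₂ : 𝒟₂.dualMap f.unop ≫ 𝒟₂.dualMap (τ.hom.app Y.unop) =
          𝒟₂.dualMap (τ.hom.app X.unop) ≫ 𝒟₂.dualMap (F.map (G.map f.unop)) := by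
        rw [← dualMap_comp, ← dualMap_comp]
        exact congrArg _ (τ.hom.naturality f.unop).symm
      have h₃ : 𝒟₂.dualMap (F.map (G.map f.unop)) ≫ (comparison ζ (G.obj Y.unop)).inv =
          (comparison ζ (G.obj X.unop)).inv ≫ F.map (𝒟₁.dualMap (G.map f.unop)) := by
        rw [Iso.comp_inv_eq, Category.assoc, comparison_naturality, Iso.inv_hom_id_assoc]
      dsimp at h₁
      have h₄ : F.map (G.map (𝒟₂.D.map f)) ≫ τ.hom.app (𝒟₂.dual Y.unop) ≫
          𝒟₂.dualMap (τ.hom.app Y.unop) ≫ (comparison ζ (G.obj Y.unop)).inv =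
          (τ.hom.app (𝒟₂.dual X.unop) ≫
          𝒟₂.dualMap (τ.hom.app X.unop) ≫ (comparison ζ (G.obj X.unop)).inv) ≫
          F.map (𝒟₁.dualMap (G.map f.unop)) := by
        rw [reassoc_of% h₁, Category.assoc, Category.assoc, ← h₃, ← reassoc_of% h₂]
        rfl
      rw [F.map_comp, F.map_comp]
      refine Eq.trans ?_ (h₄.trans ?_)
      · exact congrArg (F.map (G.map (𝒟₂.D.map f)) ≫ ·) (F.map_preimage _)
      · exact (congrArg (· ≫ F.map (𝒟₁.dualMap (G.map f.unop))) (F.map_preimage _)).symm)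

variable [F.Full] [F.Faithful] (ζ : 𝒟₁.D ⋙ F ≅ F.op ⋙ 𝒟₂.D) (τ : G ⋙ F ≅ 𝟭 K₂)

/-- The comparison for `G` is a preimage under `F`; this equation characterises it and is what the
two compatibility proofs use. -/
lemma map_inverseComparison_hom (X : K₂) :
    F.map (comparison (inverseComparison ζ τ) X).hom ≫ (comparison ζ (G.obj X)).hom =
      τ.hom.app (𝒟₂.dual X) ≫ 𝒟₂.dualMap (τ.hom.app X) := by
  have h : F.map (comparison (inverseComparison ζ τ) X).hom = τ.hom.app (𝒟₂.dual X) ≫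
      𝒟₂.dualMap (τ.hom.app X) ≫ (comparison ζ (G.obj X)).inv := F.map_preimage _
  rw [h, Category.assoc, Category.assoc, Iso.inv_hom_id, Category.comp_id]

variable [F.CommShift ℤ] [G.CommShift ℤ] [NatTrans.CommShift τ.hom ℤ] {ζ}

/-- After applying the faithful `F`, the square becomes naturality of the shift identification of
`𝒟₂` at `τ`. Compatibility of `τ` with the shifts enters through `h₅` and `h₆`. -/
lemma ComparisonShift.inverse (hζ : ComparisonShift F ζ) :
    ComparisonShift G (inverseComparison ζ τ) := by
  intro X n m h
  apply F.map_injective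
  have h₁ := comparison_naturality ζ ((G.commShiftIso n).inv.app X)
  have h₂ := congrArg (shiftFunctor K₂ m).map (map_inverseComparison_hom ζ τ X)
  have h₃ := map_inverseComparison_hom ζ τ (X⟦n⟧)
  have h₄ := hζ (G.obj X) n m h
  have h₅ : F.map ((G.commShiftIso m).hom.app (𝒟₂.dual X)) ≫
      (F.commShiftIso m).hom.app (G.obj (𝒟₂.dual X)) ≫ (τ.hom.app (𝒟₂.dual X))⟦m⟧' =
        τ.hom.app ((𝒟₂.dual X)⟦m⟧) := by
    have := NatTrans.shift_app_comm τ.hom m (𝒟₂.dual X)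
    simpa [Functor.commShiftIso_comp_hom_app] using this
  have h₆ : (F.commShiftIso n).inv.app (G.obj X) ≫ F.map ((G.commShiftIso n).inv.app X) ≫
      τ.hom.app (X⟦n⟧) = (τ.hom.app X)⟦n⟧' := by
    have := NatTrans.shift_app_comm τ.hom n X
    simp [Functor.commShiftIso_comp_hom_app] at this
    have e : F.map ((G.commShiftIso n).inv.app X) ≫ F.map ((G.commShiftIso n).hom.app X) =
      𝟙 (F.obj ((G.obj X)⟦n⟧)) := map_comp_eq_id F (Iso.inv_hom_id_app _ _)
    have e' : (F.commShiftIso n).inv.app (G.obj X) ≫ (F.commShiftIso n).hom.app (G.obj X) =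
      𝟙 ((F.obj (G.obj X))⟦n⟧) := Iso.inv_hom_id_app _ _
    rw [← this, reassoc_of% e, reassoc_of% e']
  have h₇ := congrArg 𝒟₂.dualMap h₆
  have h₈ := τ.hom.naturality (𝒟₂.dualShift X n m h).hom
  have h₉ := 𝒟₂.dualShift_hom_naturality (τ.hom.app X) n m h
  simp only [Functor.map_comp, dualMap_comp, Category.assoc] at h₂ h₇
  dsimp at h₈ h₉
  rw [← cancel_mono ((F.commShiftIso m).hom.app (𝒟₁.dual (G.obj X)) ≫
    (comparison ζ (G.obj X)).hom⟦m⟧')]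
  simp only [Functor.map_comp, Category.assoc]
  rw [Functor.commShiftIso_hom_naturality_assoc, h₂, reassoc_of% h₅, h₄, reassoc_of% h₁,
    reassoc_of% h₃, reassoc_of% h₇, reassoc_of% h₈, h₉]

omit [F.CommShift ℤ] [G.CommShift ℤ] [NatTrans.CommShift τ.hom ℤ] in
lemma ComparisonBidual.inverse (hζ : ComparisonBidual ζ) :
    ComparisonBidual (inverseComparison ζ τ) := by
  intro X
  apply F.map_injective
  have h₁ := map_inverseComparison_hom ζ τ (𝒟₂.dual X)
  have h₂ := congrArg 𝒟₂.dualMap (map_inverseComparison_hom ζ τ X)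
  have h₃ := comparison_naturality ζ (comparison (inverseComparison ζ τ) X).hom
  have h₄ : F.map (𝒟₁.bidual (G.obj X)) ≫ (comparison ζ (𝒟₁.dual (G.obj X))).hom = _ := hζ (G.obj X)
  have h₅ := τ.hom.naturality (𝒟₂.bidual X)
  have h₆ := 𝒟₂.bidual_naturality (τ.hom.app X)
  simp only [dualMap_comp] at h₂
  dsimp at h₅ h₆
  have h₇ : F.map (G.map (𝒟₂.bidual X) ≫ (comparison (inverseComparison ζ τ) (𝒟₂.dual X)).hom) =
      F.map (𝒟₁.bidual (G.obj X) ≫ 𝒟₁.dualMap (comparison (inverseComparison ζ τ) X).hom) := by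
    rw [← cancel_mono (comparison ζ (G.obj (𝒟₂.dual X))).hom]
    simp only [Functor.map_comp, Category.assoc]
    rw [h₁, h₃, reassoc_of% h₄, h₂, reassoc_of% h₅, ← reassoc_of% h₆]
  exact h₇

end Inverse

section Pullback

universe v u v' u'

variable {K₁ : Type u} [Category.{v} K₁] [Preadditive K₁] [HasShift K₁ ℤ]
  {K₂ : Type u'} [Category.{v'} K₂] [Preadditive K₂] [HasShift K₂ ℤ]
  {F : K₁ ⥤ K₂} [F.CommShift ℤ] [F.Full] [F.Faithful] (𝒟₂ : DualityData K₂)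
  (D : K₁ᵒᵖ ⥤ K₁) [D.Additive] (η : D ⋙ F ≅ F.op ⋙ 𝒟₂.D)

/-- Given a fully faithful functor `F` and a lift `D` of a duality along `F`, the duality on the
source such that `F` is a morphism of categories with duality. -/
def pullback : DualityData K₁ where
  D := D
  additive := inferInstance
  shiftIso n m h := ((Functor.FullyFaithful.ofFullyFaithful F).whiskeringRight _).preimageIso
    (Functor.isoWhiskerLeft (shiftFunctor K₁ n).op η ≪≫
      Functor.isoWhiskerRight (NatIso.op (F.commShiftIso n)).symm 𝒟₂.D ≪≫
      Functor.isoWhiskerLeft F.op (𝒟₂.shiftIso n m h) ≪≫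
      Functor.isoWhiskerRight η.symm (shiftFunctor K₂ m) ≪≫
      Functor.isoWhiskerLeft D (F.commShiftIso m).symm)
  ω := ((Functor.FullyFaithful.ofFullyFaithful F).whiskeringRight _).preimage
    (X := 𝟭 K₁) (Y := D.rightOp ⋙ D)
    { app X := 𝒟₂.bidual (F.obj X) ≫ 𝒟₂.dualMap (η.hom.app (op X)) ≫ η.inv.app (op (D.obj (op X)))
      naturality X Y f := by
        have h₁ := 𝒟₂.bidual_naturality (F.map f)
        have h₂ := congrArg 𝒟₂.dualMap (η.hom.naturality f.op)
        have h₃ := η.inv.naturality (D.map f.op).op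
        change _ = 𝒟₂.dualMap (η.hom.app (op Y) ≫ 𝒟₂.dualMap (F.map f)) at h₂
        change 𝒟₂.dualMap (F.map (D.map f.op)) ≫ _ = _ ≫ F.map (D.map (D.map f.op).op) at h₃
        change 𝒟₂.dualMap (F.map (D.map f.op) ≫ _) = _ at h₂
        rw [dualMap_comp, dualMap_comp] at h₂
        change F.map f ≫ 𝒟₂.bidual (F.obj Y) ≫ 𝒟₂.dualMap (η.hom.app (op Y)) ≫
          η.inv.app (op (D.obj (op Y))) = (𝒟₂.bidual (F.obj X) ≫ 𝒟₂.dualMap (η.hom.app (op X)) ≫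
            η.inv.app (op (D.obj (op X)))) ≫ F.map (D.map (D.map f.op).op)
        rw [Category.assoc, Category.assoc, ← h₃, reassoc_of% h₂, reassoc_of% h₁] }

lemma pullback_shift : ComparisonShift (𝒟₁ := pullback 𝒟₂ D η) F η := by
  intro X n m h
  have e : F.map ((pullback 𝒟₂ D η).dualShift X n m h).hom =
    η.hom.app (op (X⟦n⟧)) ≫ 𝒟₂.dualMap ((F.commShiftIso n).inv.app X) ≫
      (𝒟₂.dualShift (F.obj X) n m h).hom ≫ (η.inv.app (op X))⟦m⟧' ≫
        (F.commShiftIso m).inv.app (D.obj (op X)) := F.map_preimage _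
  have e₁ : (F.commShiftIso m).inv.app (D.obj (op X)) ≫
      (F.commShiftIso m).hom.app (D.obj (op X)) = 𝟙 ((F.obj (D.obj (op X)))⟦m⟧) :=
    Iso.inv_hom_id_app _ _
  have e₂ : (η.inv.app (op X))⟦m⟧' ≫ (η.hom.app (op X))⟦m⟧' = 𝟙 ((𝒟₂.dual (F.obj X))⟦m⟧) :=
    map_comp_eq_id _ (Iso.inv_hom_id_app _ _)
  exact comp_eq_of_cancel₂ e e₁ e₂

lemma pullback_bidual : ComparisonBidual (𝒟₁ := pullback 𝒟₂ D η) η := by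
  intro X
  have e : F.map ((pullback 𝒟₂ D η).bidual X) =
    𝒟₂.bidual (F.obj X) ≫ 𝒟₂.dualMap (η.hom.app (op X)) ≫ η.inv.app (op (D.obj (op X))) :=
    F.map_preimage _
  have e₁ : η.inv.app (op (D.obj (op X))) ≫ η.hom.app (op (D.obj (op X))) =
    𝟙 (𝒟₂.dual (F.obj (D.obj (op X)))) := Iso.inv_hom_id_app _ _
  exact comp_eq_of_cancel e e₁

end Pullback

section Transport

universe v u v' u'

variable {K₁ : Type u} [Category.{v} K₁] [Preadditive K₁] [HasShift K₁ ℤ]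
  {K₂ : Type u'} [Category.{v'} K₂] [Preadditive K₂] [HasShift K₂ ℤ]

/-- A duality can be transported along an equivalence that commutes with the shifts. -/
lemma exists_transport (𝒟₁ : DualityData K₁) (e : K₁ ≌ K₂) [e.functor.CommShift ℤ]
    [e.inverse.CommShift ℤ] [e.CommShift ℤ] [e.functor.Additive] :
    ∃ (𝒟₂ : DualityData K₂) (ζ : 𝒟₁.D ⋙ e.functor ≅ e.functor.op ⋙ 𝒟₂.D),
      ComparisonShift e.functor ζ ∧ ComparisonBidual ζ := by
  have : e.inverse.Additive := e.inverse_additive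
  have : (e.inverse.op ⋙ 𝒟₁.D ⋙ e.functor).Additive := inferInstance
  -- The transported duality is `e ∘ ♯ ∘ e⁻¹`. It is a pullback along the fully faithful `e⁻¹`, so
  -- the comparison for `e` is obtained by inverting the one for `e⁻¹`, with the inverse of the unit
  -- as `τ`.
  let η : (e.inverse.op ⋙ 𝒟₁.D ⋙ e.functor) ⋙ e.inverse ≅ e.inverse.op ⋙ 𝒟₁.D :=
    Functor.isoWhiskerLeft (e.inverse.op ⋙ 𝒟₁.D) e.unitIso.symm
  have : NatTrans.CommShift e.unitIso.symm.hom ℤ := inferInstance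
  exact ⟨pullback 𝒟₁ _ η, inverseComparison (𝒟₁ := pullback 𝒟₁ _ η) η e.unitIso.symm,
    (pullback_shift 𝒟₁ _ η).inverse _, (pullback_bidual 𝒟₁ _ η).inverse _⟩

end Transport

end DualityData

/-! ### Termwise duals of complexes and the duality on the homotopy category. -/

section ComplexDuality

universe v u

variable {A : Type u} [Category.{v} A] [Preadditive A] (V : Aᵒᵖ ⥤ A) [V.Additive]

/-- Reindexing isomorphisms dualise to reindexings in the opposite direction. As `dualComplexShift`
consists of such maps, the identities about shifts of duals become, degree by degree, compositions
of reindexings without signs. -/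
lemma dualComplex_XIsoOfEq_hom (K : CochainComplex A ℤ) {i j : ℤ} (h : i = j) :
    (((dualComplex V).obj (op K)).XIsoOfEq h).hom =
      V.map (K.XIsoOfEq (show -j = -i by rw [h])).hom.op := by
  subst h
  rw [HomologicalComplex.XIsoOfEq_rfl, HomologicalComplex.XIsoOfEq_rfl]
  exact (V.map_id _).symm

instance : (dualComplex V).Additive where
  map_add {K L f g} := by
    ext i
    exact V.map_add (f := (f.unop.f (-i)).op) (g := (g.unop.f (-i)).op)

/-- The duality on cochain complexes given by the termwise dual. -/
def complexDuality (e : 𝟭 A ⟶ V.rightOp ⋙ V) : DualityData (CochainComplex A ℤ) where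
  D := dualComplex V
  additive := inferInstance
  shiftIso n m h := NatIso.ofComponents (fun K ↦ dualComplexShift V K.unop n m h)
    (fun f ↦ dualComplexShift_naturality V f.unop n m h)
  ω :=
    { app := bidualComplex e
      naturality _ _ f := bidualComplex_naturality e f }

lemma map_XIsoOfEq_op_comp (K : CochainComplex A ℤ) {i j k : ℤ} (h : i = j) (h' : j = k) :
    V.map (K.XIsoOfEq h').hom.op ≫ V.map (K.XIsoOfEq h).hom.op =
      V.map (K.XIsoOfEq (h.trans h')).hom.op := by
  rw [← V.map_comp, ← op_comp, HomologicalComplex.XIsoOfEq_hom_comp_XIsoOfEq_hom]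

lemma map_XIsoOfEq_op_comp₄ (K : CochainComplex A ℤ) {i j k l m : ℤ} (h₁ : i = j) (h₂ : j = k)
    (h₃ : k = l) (h₄ : l = m) :
    V.map (K.XIsoOfEq (h₁.trans (h₂.trans (h₃.trans h₄)))).hom.op =
      V.map (K.XIsoOfEq h₄).hom.op ≫ V.map (K.XIsoOfEq h₃).hom.op ≫ V.map (K.XIsoOfEq h₂).hom.op ≫
        V.map (K.XIsoOfEq h₁).hom.op := by
  rw [map_XIsoOfEq_op_comp, map_XIsoOfEq_op_comp, map_XIsoOfEq_op_comp]

lemma dualComplexShift_hom_f (K : CochainComplex A ℤ) (n m : ℤ) (h : n + m = 0) (i : ℤ) :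
    (dualComplexShift V K n m h).hom.f i =
      V.map (K.XIsoOfEq (show -(i + m) = -i + n by lia)).hom.op := rfl

lemma dualComplexShift_inv_f (K : CochainComplex A ℤ) (n m : ℤ) (h : n + m = 0) (i : ℤ) :
    (dualComplexShift V K n m h).inv.f i =
      V.map (K.XIsoOfEq (show -i + n = -(i + m) by lia)).hom.op := rfl

lemma dualComplexShift_zero (K : CochainComplex A ℤ) :
    (dualComplexShift V K 0 0 (by lia)).hom =
      (dualComplex V).map ((shiftFunctorZero (CochainComplex A ℤ) ℤ).inv.app K).op ≫
        (shiftFunctorZero (CochainComplex A ℤ) ℤ).inv.app ((dualComplex V).obj (op K)) := by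
  ext i
  rw [HomologicalComplex.comp_f, dualComplexShift_hom_f, dualComplex_map,
    CochainComplex.shiftFunctorZero_inv_app_f, CochainComplex.shiftFunctorZero_inv_app_f,
    dualComplex_XIsoOfEq_hom]
  exact (map_XIsoOfEq_op_comp V K _ _).symm

lemma dualComplexShift_add (K : CochainComplex A ℤ) (a b a' b' : ℤ) (ha : a + a' = 0)
    (hb : b + b' = 0) :
    (dualComplexShift V K (a + b) (a' + b') (by lia)).hom =
      (dualComplex V).map ((shiftFunctorAdd (CochainComplex A ℤ) a b).inv.app K).op ≫
        (dualComplexShift V (K⟦a⟧) b b' hb).hom ≫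
        ((dualComplexShift V K a a' ha).hom)⟦b'⟧' ≫
          (shiftFunctorAdd (CochainComplex A ℤ) a' b').inv.app ((dualComplex V).obj (op K)) := by
  ext i
  rw [HomologicalComplex.comp_f, HomologicalComplex.comp_f, HomologicalComplex.comp_f,
    dualComplexShift_hom_f, dualComplex_map, dualComplexShift_hom_f,
    CochainComplex.shiftFunctorAdd_inv_app_f, CochainComplex.shiftFunctorAdd_inv_app_f,
    dualComplex_XIsoOfEq_hom]
  exact map_XIsoOfEq_op_comp₄ V K (show -(i + (a' + b')) = -(i + b' + a') by lia)
    (show -(i + b' + a') = -(i + b') + a by lia) (show -(i + b') + a = -i + b + a by lia)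
    (show -i + b + a = -i + (a + b) by lia)

variable {V} (e : 𝟭 A ⟶ V.rightOp ⋙ V)

/-- The biduality morphism `X ⟶ V (V X)`. -/
abbrev bidualApp (X : A) : X ⟶ V.obj (op (V.obj (op X))) := e.app X

lemma bidualComplex_f (K : CochainComplex A ℤ) (i : ℤ) : (bidualComplex e K).f i =
    (K.XIsoOfEq (show i = - -i by lia)).hom ≫ bidualApp e (K.X (- -i)) := rfl

/-- The indices are arbitrary so that their equalities can be substituted, after which every
reindexing is an identity. In the application they are expressions such as `i + 1` and `- -(i + 1)`.
-/
lemma XIsoOfEq_bidualApp (K : CochainComplex A ℤ) {i j k l : ℤ} (h₁ : i = j) (h₂ : j = k)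
    (h₃ : k = l) :
    (K.XIsoOfEq (h₁.trans (h₂.trans h₃))).hom ≫ bidualApp e (K.X l) =
      (K.XIsoOfEq h₁).hom ≫ bidualApp e (K.X j) ≫ V.map (V.map (K.XIsoOfEq h₂).hom.op).op ≫
        V.map (V.map (K.XIsoOfEq h₃).hom.op).op := by
  subst h₁ h₂ h₃
  simp

lemma bidualComplex_shift (K : CochainComplex A ℤ) :
    bidualComplex e (K⟦(1 : ℤ)⟧) = (bidualComplex e K)⟦(1 : ℤ)⟧' ≫
      (dualComplexShift V ((dualComplex V).obj (op K)) (-1) 1 (by lia)).inv ≫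
        (dualComplex V).map (dualComplexShift V K 1 (-1) (by lia)).hom.op := by
  ext i
  have h := XIsoOfEq_bidualApp e K (show i + 1 = - -(i + 1) by lia)
    (show - -(i + 1) = -(-i + -1) by lia) (show -(-i + -1) = - -i + 1 by lia)
  rw [HomologicalComplex.comp_f, HomologicalComplex.comp_f, dualComplexShift_inv_f,
    dualComplex_XIsoOfEq_hom]
  refine h.trans ?_
  rw [← Category.assoc]
  rfl

lemma XIsoOfEq_bidualApp_dual (he : ∀ X : A, bidualApp e (V.obj (op X)) ≫
    V.map (bidualApp e X).op = 𝟙 _) (K : CochainComplex A ℤ) {i j : ℤ} (h : i = j) :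
    V.map (K.XIsoOfEq h.symm).hom.op ≫ bidualApp e (V.obj (op (K.X j))) ≫
      V.map ((K.XIsoOfEq h).hom ≫ bidualApp e (K.X j)).op = 𝟙 (V.obj (op (K.X i))) := by
  subst h
  simp [he]

lemma bidualComplex_dual (he : ∀ X : A, bidualApp e (V.obj (op X)) ≫
      V.map (bidualApp e X).op = 𝟙 _) (K : CochainComplex A ℤ) :
    bidualComplex e ((dualComplex V).obj (op K)) ≫ (dualComplex V).map (bidualComplex e K).op =
      𝟙 _ := by
  ext i
  have h := XIsoOfEq_bidualApp_dual e he K (show -i = - - -i by lia)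
  rw [HomologicalComplex.comp_f, bidualComplex_f, dualComplex_XIsoOfEq_hom]
  exact (Category.assoc _ _ _).trans h

lemma isIso_bidualComplex [∀ X, IsIso (e.app X)] (K : CochainComplex A ℤ) :
    IsIso (bidualComplex e K) := by
  have : ∀ i, IsIso ((bidualComplex e K).f i) := fun i ↦ by
    have : IsIso (e.app (K.X (- -i))) := inferInstance
    exact IsIso.comp_isIso (f := (K.XIsoOfEq (show i = - -i by lia)).hom) (h := e.app (K.X (- -i)))
  exact HomologicalComplex.Hom.isIso_of_components _

/-- The halves are chosen object by object, without naturality. They commute with the differential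
nevertheless: twice the commutator vanishes, and a morphism is determined by its double when its
target has a half. -/
lemma exists_half_complex (h : ∀ X : A, ∃ f : X ⟶ X, f + f = 𝟙 X) (K : CochainComplex A ℤ) :
    ∃ f : K ⟶ K, f + f = 𝟙 K := by
  choose f hf using h
  refine ⟨⟨fun i ↦ f (K.X i), fun i j _ ↦ ?_⟩, by ext i; exact hf _⟩
  have h₁ : (f (K.X i) ≫ K.d i j - K.d i j ≫ f (K.X j)) +
      (f (K.X i) ≫ K.d i j - K.d i j ≫ f (K.X j)) = 0 := by
    have h₂ := congrArg (· ≫ K.d i j) (hf (K.X i))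
    have h₃ := congrArg (K.d i j ≫ ·) (hf (K.X j))
    simp only [Preadditive.add_comp, Preadditive.comp_add, Category.id_comp,
      Category.comp_id] at h₂ h₃
    rw [sub_add_sub_comm, h₂, h₃, sub_self]
  -- Composing with the half of `K.X j` divides the doubled commutator by two.
  have h₄ := congrArg (· ≫ f (K.X j)) h₁
  simp only [← Preadditive.comp_add, Preadditive.add_comp, zero_comp, hf] at h₄
  rw [Category.comp_id] at h₄
  exact sub_eq_zero.1 h₄

lemma shiftFunctorCompIsoId_inv_app_f (K : CochainComplex A ℤ) (a b : ℤ) (h : a + b = 0) (i : ℤ) :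
    ((shiftFunctorCompIsoId (CochainComplex A ℤ) a b h).inv.app K).f i =
      (K.XIsoOfEq (show i = i + b + a by lia)).hom := by
  simp [shiftFunctorCompIsoId, CochainComplex.shiftFunctorAdd'_hom_app_f',
    CochainComplex.shiftFunctorZero_inv_app_f]

section DegreewiseSplit

variable (V) (S : ShortComplex (CochainComplex A ℤ))

/-- The dual of a short complex of cochain complexes. -/
abbrev dualShortComplex : ShortComplex (CochainComplex A ℤ) :=
  ShortComplex.mk ((dualComplex V).map S.g.op) ((dualComplex V).map S.f.op) (by
    rw [← Functor.map_comp, ← op_comp, S.zero, op_zero, Functor.map_zero])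

variable {S} (σ : ∀ n, (S.map (HomologicalComplex.eval A (ComplexShape.up ℤ) n)).Splitting)

/-- The dual of a degreewise splitting. -/
def dualSplitting (n : ℤ) :
    ((dualShortComplex V S).map (HomologicalComplex.eval A (ComplexShape.up ℤ) n)).Splitting where
  r := V.map (σ (-n)).s.op
  s := V.map (σ (-n)).r.op
  f_r := by
    have := congrArg (fun f ↦ V.map f.op) (σ (-n)).s_g
    rw [op_comp, V.map_comp, op_id, V.map_id] at this
    exact this
  s_g := by
    have := congrArg (fun f ↦ V.map f.op) (σ (-n)).f_r
    rw [op_comp, V.map_comp, op_id, V.map_id] at this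
    exact this
  id := by
    have := congrArg (fun f ↦ V.map f.op) (σ (-n)).id
    rw [op_add, V.map_add, op_comp, op_comp, V.map_comp, V.map_comp, op_id, V.map_id,
      add_comm] at this
    exact this

omit [V.Additive] in
lemma map_op_comp₃ {X Y Z W : A} (f : X ⟶ Y) (g : Y ⟶ Z) (h : Z ⟶ W) :
    V.map (f ≫ g ≫ h).op = V.map h.op ≫ V.map g.op ≫ V.map f.op := by
  rw [op_comp, op_comp, V.map_comp, V.map_comp, Category.assoc]

omit [V.Additive] in
variable {V} in
lemma cocycleOfDegreewiseSplit_v_comp {i j k l : ℤ} (h : i + 1 = j) (h' : j = k) (h'' : k = l) :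
    (CochainComplex.cocycleOfDegreewiseSplit S σ).1.v i j h ≫ (S.X₁.XIsoOfEq h').hom ≫
      (S.X₁.XIsoOfEq h'').hom = (σ i).s ≫ S.X₂.d i l ≫ (σ l).r := by
  subst h' h''
  rw [HomologicalComplex.XIsoOfEq_rfl]
  exact (congrArg _ (Category.comp_id _)).trans (Category.comp_id _)

/-- The connecting morphism of a degreewise split sequence is `s ≫ d ≫ r`. Dualising exchanges
section and retraction, so its dual is the connecting morphism of the dual sequence on the nose,
with no sign. For this reason exactness of the duality is tested on degreewise split triangles
instead of mapping cones. -/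
lemma homOfDegreewiseSplit_dualSplitting (e : 𝟭 A ⟶ V.rightOp ⋙ V) :
    (complexDuality V e).dualTriangle (CochainComplex.triangleOfDegreewiseSplit S σ) =
      CochainComplex.triangleOfDegreewiseSplit _ (dualSplitting V σ) := by
  have : (shiftFunctorCompIsoId (CochainComplex A ℤ) (-1) 1 (by lia)).inv.app
        ((dualComplex V).obj (op S.X₁)) ≫ ((dualComplexShift V S.X₁ 1 (-1) (by lia)).inv)⟦(1 : ℤ)⟧' ≫
        ((dualComplex V).map (CochainComplex.homOfDegreewiseSplit S σ).op)⟦(1 : ℤ)⟧' =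
      CochainComplex.homOfDegreewiseSplit _ (dualSplitting V σ) := by
    ext i
    rw [HomologicalComplex.comp_f, HomologicalComplex.comp_f, shiftFunctorCompIsoId_inv_app_f,
      CochainComplex.homOfDegreewiseSplit_f, CochainComplex.shiftFunctor_map_f',
      CochainComplex.shiftFunctor_map_f', dualComplex_map, CochainComplex.homOfDegreewiseSplit_f,
      dualComplexShift_inv_f, dualComplex_XIsoOfEq_hom]
    have h := cocycleOfDegreewiseSplit_v_comp σ (show -(i + 1) + 1 = -(i + 1) + 1 by rfl)
      (show -(i + 1) + 1 = -(i + 1 + -1) by lia) (show -(i + 1 + -1) = -i by lia)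
    refine Eq.trans ?_ ((congrArg (fun f ↦ V.map (Quiver.Hom.op f)) h).trans ?_)
    · exact (map_op_comp₃ V _ _ _).symm
    · exact map_op_comp₃ V _ _ _
  exact congrArg (Triangle.mk ((dualComplex V).map S.g.op) ((dualComplex V).map S.f.op)) this

end DegreewiseSplit

end ComplexDuality

section HomotopyDuality

universe v u

variable {A : Type u} [Category.{v} A] [Preadditive A] (V : Aᵒᵖ ⥤ A) [V.Additive]
  (e : 𝟭 A ⟶ V.rightOp ⋙ V)

open DualityData

lemma comp_comp_id_eq {C : Type*} [Category* C] {X Y Z W : C} {p : X ⟶ Y} {q : Y ⟶ X}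
    {a : X ⟶ Z} {b : Z ⟶ W} {t : Y ⟶ W} {c : W ⟶ W} (h₁ : t = q ≫ a ≫ b) (h₂ : p ≫ q = 𝟙 X)
    (h₃ : c = 𝟙 W) : a ≫ b ≫ c = 𝟙 X ≫ p ≫ t := by
  rw [h₁, h₃, reassoc_of% h₂, Category.comp_id, Category.id_comp]

/-- The termwise duals on complexes and on the homotopy category agree. -/
def quotientComparison : (complexDuality V e).D ⋙ HomotopyCategory.quotient A (ComplexShape.up ℤ) ≅
    (HomotopyCategory.quotient A (ComplexShape.up ℤ)).op ⋙ (homotopyDuality V e).D :=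
  Iso.refl _

lemma quotientComparison_shift : ComparisonShift _ (quotientComparison V e) := by
  intro K n m h
  let Q := HomotopyCategory.quotient A (ComplexShape.up ℤ)
  have h₁ : ((homotopyDuality V e).dualShift (Q.obj K) n m h).hom =
    (homotopyDuality V e).dualMap ((Q.commShiftIso n).hom.app K) ≫
      Q.map (dualComplexShift V K n m h).hom ≫
        (Q.commShiftIso m).hom.app ((dualComplex V).obj (op K)) := rfl
  have h₂ : (homotopyDuality V e).dualMap ((Q.commShiftIso n).inv.app K) ≫
      (homotopyDuality V e).dualMap ((Q.commShiftIso n).hom.app K) =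
        𝟙 ((homotopyDuality V e).dual (Q.obj (K⟦n⟧))) :=
    dualMap_comp_eq_id _ (Iso.hom_inv_id_app _ _)
  exact comp_comp_id_eq h₁ h₂ (CategoryTheory.Functor.map_id _ _)

lemma quotientComparison_bidual : ComparisonBidual (quotientComparison V e) := by
  intro K
  let Q := HomotopyCategory.quotient A (ComplexShape.up ℤ)
  exact congrArg (Q.map (bidualComplex e K) ≫ ·)
    ((homotopyDuality V e).dualMap_id (Q.obj ((dualComplex V).obj (op K)))).symm

variable [HasZeroObject A] [HasBinaryBiproducts A]

/-- The termwise dual of a strong duality on an additive category is a duality on its homotopy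
category. -/
lemma homotopyDuality_isDuality (h : ∀ X : A, ∃ f : X ⟶ X, f + f = 𝟙 X) [∀ X, IsIso (e.app X)]
    (he : ∀ X : A, bidualApp e (V.obj (op X)) ≫ V.map (bidualApp e X).op = 𝟙 _) :
    (homotopyDuality V e).IsDuality where
  half X := by
    obtain ⟨K⟩ := X
    obtain ⟨f, hf⟩ := exists_half_complex h K
    exact ⟨(HomotopyCategory.quotient A _).map f, (Functor.map_add _).symm.trans
      ((congrArg _ hf).trans (CategoryTheory.Functor.map_id _ _))⟩
  dualShift_zero X := by
    obtain ⟨K⟩ := X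
    -- The axioms on shift identifications hold for complexes and are pushed forward along the
    -- quotient functor.
    exact (ComparisonShift.dualShift_zero_iff (quotientComparison_shift V e) K).1
      (congrArg _ (dualComplexShift_zero V K))
  dualShift_add X a b a' b' ha hb := by
    obtain ⟨K⟩ := X
    exact (ComparisonShift.dualShift_add_iff (quotientComparison_shift V e) K a b a' b' ha hb).1
      (congrArg _ (dualComplexShift_add V K a b a' b' ha hb))
  exact Δ hΔ := by
    -- Every distinguished triangle comes from a degreewise split sequence up to isomorphism, and
    -- its dual comes from the dual sequence.
    obtain ⟨S, σ, ⟨i⟩⟩ := (HomotopyCategory.distinguished_iff_iso_trianglehOfDegreewiseSplit Δ).1 hΔ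
    refine (HomotopyCategory.distinguished_iff_iso_trianglehOfDegreewiseSplit _).2
      ⟨_, dualSplitting V σ, ⟨(dualTriangleIso _ i).symm ≪≫
        (mapDualTriangleIso (quotientComparison_shift V e) _).symm ≪≫
          (Functor.mapTriangle _).mapIso (eqToIso (homOfDegreewiseSplit_dualSplitting V σ e))⟩⟩
  isIso_bidual X := by
    obtain ⟨K⟩ := X
    have := isIso_bidualComplex e K
    exact Functor.map_isIso (HomotopyCategory.quotient A (ComplexShape.up ℤ)) (bidualComplex e K)
  bidual_shift X := by
    obtain ⟨K⟩ := X
    exact (ComparisonShift.bidual_shift_iff (quotientComparison_shift V e)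
      (quotientComparison_bidual V e) K).1 (congrArg _ (bidualComplex_shift e K))
  bidual_dual X := by
    obtain ⟨K⟩ := X
    exact (Functor.map_comp (HomotopyCategory.quotient A (ComplexShape.up ℤ)) _ _).symm.trans
      ((congrArg _ (bidualComplex_dual e he K)).trans (CategoryTheory.Functor.map_id _ _))

lemma comp_comp_eq_of_cancel {C : Type*} [Category* C] {X Y Z W : C} {u : X ⟶ W} {a : X ⟶ Y}
    {b : Y ⟶ Z} {i : Z ⟶ W} {k : W ⟶ Z} {l : Z ⟶ Z} (h : u = a ≫ b ≫ i) (e : i ≫ k = 𝟙 Z)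
    (e' : l = 𝟙 Z) : u ≫ k ≫ l = 𝟙 X ≫ a ≫ b := by
  rw [h, e', Category.comp_id, Category.assoc, Category.assoc, e, Category.comp_id,
    Category.id_comp]

section Restrict

variable {K : Type u} [Category.{v} K] [Preadditive K] [HasShift K ℤ] (𝒟 : DualityData K)
  (P : ObjectProperty K) [P.IsStableUnderShift ℤ] (hP : ∀ X, P X → P (𝒟.dual X))

/-- The inclusion of a full subcategory that is stable under a duality preserves the dualities. -/
def restrictComparison : (𝒟.restrict P hP).D ⋙ P.ι ≅ P.ι.op ⋙ 𝒟.D := Iso.refl _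

lemma restrictComparison_shift : ComparisonShift P.ι (restrictComparison 𝒟 P hP) :=
  fun X n m h ↦ comp_comp_eq_of_cancel
    (u := P.ι.map ((𝒟.restrict P hP).dualShift X n m h).hom) rfl
    (Iso.inv_hom_id_app (P.ι.commShiftIso m) ((𝒟.restrict P hP).dual X))
    (CategoryTheory.Functor.map_id _ _)

lemma restrictComparison_bidual : ComparisonBidual (restrictComparison 𝒟 P hP) :=
  fun X ↦ congrArg (𝒟.bidual X.obj ≫ ·) (𝒟.dualMap_id (𝒟.dual X.obj)).symm

/-- The restriction of a duality to a stable triangulated subcategory is a duality. -/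
lemma DualityData.IsDuality.restrict {𝒟 : DualityData K}
    [HasZeroObject K] [∀ n : ℤ, (shiftFunctor K n).Additive] [Pretriangulated K]
    (h : 𝒟.IsDuality) (P : ObjectProperty K) [P.IsTriangulated]
    (hP : ∀ X, P X → P (𝒟.dual X)) : (𝒟.restrict P hP).IsDuality :=
  (⟨inferInstance, restrictComparison_shift 𝒟 P hP, restrictComparison_bidual 𝒟 P hP⟩ :
    IsMorphism P.ι (restrictComparison 𝒟 P hP)).isDuality h

end Restrict

/-- The termwise dual of a strong duality on an additive category is a duality on its bounded
homotopy category. -/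
lemma boundedHomotopyDuality_isDuality (h : ∀ X : A, ∃ f : X ⟶ X, f + f = 𝟙 X)
    [∀ X, IsIso (e.app X)]
    (he : ∀ X : A, bidualApp e (V.obj (op X)) ≫ V.map (bidualApp e X).op = 𝟙 _) :
    (boundedHomotopyDuality V e).IsDuality :=
  (homotopyDuality_isDuality V e h he).restrict _ _

end HomotopyDuality

/-! ### The duality on finitely generated projective `Λ[ℤ/2]`-modules. -/

section FinProj

variable (Λ : Type) [CommRing Λ]

lemma exists_half_rep (h2 : IsUnit (2 : Λ)) (P : Rep.{0} Λ C₂) : ∃ f : P ⟶ P, f + f = 𝟙 P := by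
  obtain ⟨u, hu⟩ := h2
  refine ⟨(↑u⁻¹ : Λ) • 𝟙 P, ?_⟩
  rw [← two_smul Λ, smul_smul, ← hu, Units.mul_inv, one_smul]

lemma exists_half_finProj (h2 : IsUnit (2 : Λ)) (P : FinProj Λ) : ∃ f : P ⟶ P, f + f = 𝟙 P := by
  obtain ⟨f, hf⟩ := exists_half_rep Λ h2 P.obj
  exact ⟨ObjectProperty.homMk f, by ext : 1; exact hf⟩

lemma finProjBidual_dual (P : FinProj Λ) :
    bidualApp (finProjBidual Λ) ((finProjDual Λ).obj (op P)) ≫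
      (finProjDual Λ).map (bidualApp (finProjBidual Λ) P).op = 𝟙 _ := by
  ext : 2
  refine Representation.IntertwiningMap.ext (LinearMap.ext fun (φ : P.obj →ₗ[Λ] Λ) ↦ ?_)
  refine LinearMap.ext fun x ↦ ?_
  rfl

/-- The forgetful functors reflect isomorphisms, and by `finProj_iff` the underlying `Λ`-module is
finitely generated and projective, hence reflexive. -/
instance (P : FinProj Λ) : IsIso ((finProjBidual Λ).app P) := by
  have h₁ : IsIso ((finProj Λ).ι.map ((finProjBidual Λ).app P)) := by
    obtain ⟨h₁, h₂, -⟩ := (finProj_iff _).1 P.property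
    have : IsIso ((forget₂ (Rep.{0} Λ C₂) (ModuleCat.{0} Λ)).map
        ((finProj Λ).ι.map ((finProjBidual Λ).app P))) := by
      rw [ConcreteCategory.isIso_iff_bijective]
      exact Module.bijective_dual_eval Λ P.obj.V
    exact isIso_of_reflects_iso _ (forget₂ (Rep.{0} Λ C₂) (ModuleCat.{0} Λ))
  exact isIso_of_reflects_iso _ (finProj Λ).ι

lemma projDuality_isDuality (h2 : IsUnit (2 : Λ)) : (projDuality Λ).IsDuality :=
  have (P : FinProj Λ) : IsIso ((finProjBidual Λ).app P) := inferInstance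
  boundedHomotopyDuality_isDuality _ _ (exists_half_finProj Λ h2) (finProjBidual_dual Λ)

end FinProj

/-! ### Composition and cancellation of comparisons of dualities. -/

namespace DualityData

section CompComparison

universe v u v' u' v'' u''

variable {K₁ : Type u} [Category.{v} K₁] [Preadditive K₁] [HasShift K₁ ℤ]
  {K₂ : Type u'} [Category.{v'} K₂] [Preadditive K₂] [HasShift K₂ ℤ]
  {K₃ : Type u''} [Category.{v''} K₃] [Preadditive K₃] [HasShift K₃ ℤ]
  {𝒟₁ : DualityData K₁} {𝒟₂ : DualityData K₂} {𝒟₃ : DualityData K₃}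
  {F F' : K₁ ⥤ K₂} {G : K₂ ⥤ K₃}

/-- The composition of two comparisons of dualities. -/
def compComparison (a : 𝒟₁.D ⋙ F ≅ F.op ⋙ 𝒟₂.D) (b : 𝒟₂.D ⋙ G ≅ G.op ⋙ 𝒟₃.D) :
    𝒟₁.D ⋙ F ⋙ G ≅ (F ⋙ G).op ⋙ 𝒟₃.D :=
  Functor.isoWhiskerRight a G ≪≫ Functor.isoWhiskerLeft F.op b

lemma compComparison_hom (a : 𝒟₁.D ⋙ F ≅ F.op ⋙ 𝒟₂.D) (b : 𝒟₂.D ⋙ G ≅ G.op ⋙ 𝒟₃.D) (X : K₁) :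
    (comparison (compComparison a b) X).hom = G.map (comparison a X).hom ≫
      (comparison b (F.obj X)).hom := rfl

variable {a : 𝒟₁.D ⋙ F ≅ F.op ⋙ 𝒟₂.D} {b : 𝒟₂.D ⋙ G ≅ G.op ⋙ 𝒟₃.D}

section Shift

variable [F.CommShift ℤ] [G.CommShift ℤ]

variable (a) in
/-- Compatibility of a comparison of dualities with the shifts on an object. -/
def ComparisonShiftAt (X : K₁) (n m : ℤ) (h : n + m = 0) : Prop :=
  F.map (𝒟₁.dualShift X n m h).hom ≫ (F.commShiftIso m).hom.app (𝒟₁.dual X) ≫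
      (comparison a X).hom⟦m⟧' =
    (comparison a (X⟦n⟧)).hom ≫ 𝒟₂.dualMap ((F.commShiftIso n).inv.app X) ≫
      (𝒟₂.dualShift (F.obj X) n m h).hom

/-- Working at a single object lets the condition be verified on representatives, as the descent
along essentially surjective functors requires. -/
lemma comparisonShiftAt_iff_of_iso {X Y : K₁} (e : X ≅ Y) (n m : ℤ) (h : n + m = 0) :
    ComparisonShiftAt a X n m h ↔ ComparisonShiftAt a Y n m h := by
  have h₁ := congrArg F.map (𝒟₁.dualShift_hom_naturality e.hom n m h)
  have h₂ := congrArg (shiftFunctor K₂ m).map (comparison_naturality a e.hom)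
  have h₃ := comparison_naturality a (e.hom⟦n⟧')
  have h₄ := congrArg 𝒟₂.dualMap ((F.commShiftIso n).inv.naturality e.hom)
  have h₅ := 𝒟₂.dualShift_hom_naturality (F.map e.hom) n m h
  have h₆ := (F.commShiftIso m).hom.naturality (𝒟₁.dualMap e.hom)
  dsimp at h₄ h₆
  simp only [Functor.map_comp, dualMap_comp] at h₁ h₂ h₄
  dsimp only [ComparisonShiftAt]
  rw [← cancel_epi (F.map (𝒟₁.dualMap (e.hom⟦n⟧'))), reassoc_of% h₁, reassoc_of% h₆, h₂,
    reassoc_of% h₃, ← reassoc_of% h₄, h₅, ← Category.assoc, ← Category.assoc, ← Category.assoc,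
    ← Category.assoc, cancel_mono]
  simp only [Category.assoc]

/-- The condition for the composite is regrouped around `G` of the condition for `a`. Once `a` or
`b` is known to be compatible the remaining factors cancel, which gives the two cancellation
statements that follow. -/
lemma comparisonShiftAt_comp (X : K₁) (n m : ℤ) (h : n + m = 0) :
    ComparisonShiftAt (compComparison a b) X n m h ↔
      G.map (F.map (𝒟₁.dualShift X n m h).hom ≫ (F.commShiftIso m).hom.app (𝒟₁.dual X) ≫
        (comparison a X).hom⟦m⟧') ≫ (G.commShiftIso m).hom.app (𝒟₂.dual (F.obj X)) ≫
          (comparison b (F.obj X)).hom⟦m⟧' =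
      G.map ((comparison a (X⟦n⟧)).hom ≫ 𝒟₂.dualMap ((F.commShiftIso n).inv.app X)) ≫
        (comparison b ((F.obj X)⟦n⟧)).hom ≫
          𝒟₃.dualMap ((G.commShiftIso n).inv.app (F.obj X)) ≫
            (𝒟₃.dualShift (G.obj (F.obj X)) n m h).hom := by
  have h₁ := comparison_naturality b ((F.commShiftIso n).inv.app X)
  dsimp only [ComparisonShiftAt]
  have e₁ : ((F ⋙ G).commShiftIso m).hom.app (𝒟₁.dual X) =
      G.map ((F.commShiftIso m).hom.app (𝒟₁.dual X)) ≫
        (G.commShiftIso m).hom.app (F.obj (𝒟₁.dual X)) := Functor.commShiftIso_comp_hom_app _ _ _ _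
  have e₂ : ((F ⋙ G).commShiftIso n).inv.app X =
      (G.commShiftIso n).inv.app (F.obj X) ≫ G.map ((F.commShiftIso n).inv.app X) :=
    Functor.commShiftIso_comp_inv_app _ _ _ _
  rw [e₁, e₂, dualMap_comp, compComparison_hom, compComparison_hom]
  simp only [Functor.map_comp, Category.assoc, Functor.commShiftIso_hom_naturality_assoc]
  rw [reassoc_of% h₁]
  rfl

lemma comparisonShiftAt_comp_iff_left (X : K₁) (n m : ℤ) (h : n + m = 0)
    (hb : ComparisonShiftAt b (F.obj X) n m h) [G.Faithful] :
    ComparisonShiftAt (compComparison a b) X n m h ↔ ComparisonShiftAt a X n m h := by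
  rw [comparisonShiftAt_comp]
  have : G.map ((comparison a (X⟦n⟧)).hom ≫ 𝒟₂.dualMap ((F.commShiftIso n).inv.app X)) ≫
        (comparison b ((F.obj X)⟦n⟧)).hom ≫
          𝒟₃.dualMap ((G.commShiftIso n).inv.app (F.obj X)) ≫
            (𝒟₃.dualShift (G.obj (F.obj X)) n m h).hom =
      G.map ((comparison a (X⟦n⟧)).hom ≫ 𝒟₂.dualMap ((F.commShiftIso n).inv.app X) ≫
        (𝒟₂.dualShift (F.obj X) n m h).hom) ≫ (G.commShiftIso m).hom.app (𝒟₂.dual (F.obj X)) ≫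
          (comparison b (F.obj X)).hom⟦m⟧' := by
    dsimp only [ComparisonShiftAt] at hb
    rw [← hb]
    simp only [Functor.map_comp, Category.assoc]
  rw [this, cancel_mono]
  exact G.map_injective.eq_iff

lemma comparisonShiftAt_comp_iff_right (X : K₁) (n m : ℤ) (h : n + m = 0)
    (ha : ComparisonShiftAt a X n m h) :
    ComparisonShiftAt (compComparison a b) X n m h ↔ ComparisonShiftAt b (F.obj X) n m h := by
  dsimp only [ComparisonShiftAt] at ha
  rw [comparisonShiftAt_comp, ha, ← Category.assoc (comparison a (X⟦n⟧)).hom,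
    Functor.map_comp _ (_ ≫ _) (𝒟₂.dualShift (F.obj X) n m h).hom, Category.assoc, cancel_epi]
  rfl

lemma ComparisonShift.comp (ha : ComparisonShift F a) (hb : ComparisonShift G b) :
    ComparisonShift (F ⋙ G) (compComparison a b) := fun X n m h ↦
  (comparisonShiftAt_comp_iff_right X n m h (ha X n m h)).2 (hb _ n m h)

/-- Compatibility with shifts may be checked after composition with a faithful functor. -/
lemma ComparisonShift.of_comp_faithful [G.Faithful] (hb : ComparisonShift G b)
    (h : ComparisonShift (F ⋙ G) (compComparison a b)) : ComparisonShift F a := fun X n m hnm ↦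
  (comparisonShiftAt_comp_iff_left X n m hnm (hb _ n m hnm)).1 (h X n m hnm)

/-- Compatibility with shifts may be checked after precomposition with an essentially surjective
functor. -/
lemma ComparisonShift.of_comp_essSurj [F.EssSurj] (ha : ComparisonShift F a)
    (h : ComparisonShift (F ⋙ G) (compComparison a b)) : ComparisonShift G b := fun X n m hnm ↦
  (comparisonShiftAt_iff_of_iso (a := b) (F.objObjPreimageIso X) n m hnm).1
    ((comparisonShiftAt_comp_iff_right _ n m hnm (ha _ n m hnm)).1 (h _ n m hnm))

/-- Compatibility with shifts is invariant under isomorphisms of functors. -/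
lemma ComparisonShift.of_iso [F'.CommShift ℤ] {a' : 𝒟₁.D ⋙ F' ≅ F'.op ⋙ 𝒟₂.D} (σ : F ≅ F')
    [NatTrans.CommShift σ.hom ℤ] (h : ∀ X, (comparison a X).hom =
      σ.hom.app (𝒟₁.dual X) ≫ (comparison a' X).hom ≫ 𝒟₂.dualMap (σ.hom.app X))
    (ha : ComparisonShift F' a') : ComparisonShift F a := by
  intro X n m hnm
  have h₁ := ha X n m hnm
  have h₂ := congrArg (shiftFunctor K₂ m).map (h X)
  have h₃ := NatTrans.shift_app_comm σ.hom m (𝒟₁.dual X)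
  have h₄ := σ.hom.naturality (𝒟₁.dualShift X n m hnm).hom
  have h₅ := 𝒟₂.dualShift_hom_naturality (σ.hom.app X) n m hnm
  have h₆ : (F.commShiftIso n).inv.app X ≫ σ.hom.app (X⟦n⟧) =
      (σ.hom.app X)⟦n⟧' ≫ (F'.commShiftIso n).inv.app X := by
    have h₇ := NatTrans.shift_app_comm σ.hom n X
    have e₁ : (F.commShiftIso n).inv.app X ≫ (F.commShiftIso n).hom.app X =
      𝟙 ((F.obj X)⟦n⟧) := Iso.inv_hom_id_app _ _
    have e₂ : (F'.commShiftIso n).hom.app X ≫ (F'.commShiftIso n).inv.app X =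
      𝟙 (F'.obj (X⟦n⟧)) := Iso.hom_inv_id_app _ _
    have := congrArg (fun f ↦ (F.commShiftIso n).inv.app X ≫ f ≫ (F'.commShiftIso n).inv.app X) h₇
    dsimp at this
    simp only [Category.assoc, e₂] at this
    rw [reassoc_of% e₁] at this
    rw [this]
    exact congrArg _ (Category.comp_id _).symm
  have h₈ := congrArg 𝒟₂.dualMap h₆
  simp only [dualMap_comp, Functor.map_comp] at h₂ h₈
  rw [h₂, reassoc_of% h₃, reassoc_of% h₄, reassoc_of% h₁, h (X⟦n⟧)]
  simp only [Category.assoc]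
  rw [reassoc_of% h₈, h₅]

end Shift

lemma ComparisonBidual.comp_iff (X : K₁) :
    (G.map (F.map (𝒟₁.bidual X)) ≫ (comparison (compComparison a b) (𝒟₁.dual X)).hom =
      𝒟₃.bidual (G.obj (F.obj X)) ≫ 𝒟₃.dualMap (comparison (compComparison a b) X).hom) ↔
    G.map (F.map (𝒟₁.bidual X) ≫ (comparison a (𝒟₁.dual X)).hom) ≫
        (comparison b (F.obj (𝒟₁.dual X))).hom =
      (𝒟₃.bidual (G.obj (F.obj X)) ≫ 𝒟₃.dualMap (comparison b (F.obj X)).hom) ≫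
        𝒟₃.dualMap (G.map (comparison a X).hom) := by
  rw [compComparison_hom, compComparison_hom, dualMap_comp, Functor.map_comp]
  simp only [Category.assoc]

lemma ComparisonBidual.comp (ha : ComparisonBidual a) (hb : ComparisonBidual b) :
    ComparisonBidual (compComparison a b) := by
  intro X
  refine (comp_iff X).2 ?_
  have h₁ : F.map (𝒟₁.bidual X) ≫ (comparison a (𝒟₁.dual X)).hom =
    𝒟₂.bidual (F.obj X) ≫ 𝒟₂.dualMap (comparison a X).hom := ha X
  have h₂ : G.map (𝒟₂.bidual (F.obj X)) ≫ (comparison b (𝒟₂.dual (F.obj X))).hom =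
    𝒟₃.bidual (G.obj (F.obj X)) ≫ 𝒟₃.dualMap (comparison b (F.obj X)).hom := hb _
  rw [h₁, ← h₂, Functor.map_comp, Category.assoc, Category.assoc, comparison_naturality]

lemma ComparisonBidual.of_comp_faithful [G.Faithful] (hb : ComparisonBidual b)
    (h : ComparisonBidual (compComparison a b)) : ComparisonBidual a := by
  intro X
  have h₀ := (comp_iff X).1 (h X)
  have h₂ : G.map (𝒟₂.bidual (F.obj X)) ≫ (comparison b (𝒟₂.dual (F.obj X))).hom =
    𝒟₃.bidual (G.obj (F.obj X)) ≫ 𝒟₃.dualMap (comparison b (F.obj X)).hom := hb _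
  rw [← h₂, Category.assoc, ← comparison_naturality, ← Functor.map_comp_assoc, cancel_mono] at h₀
  exact G.map_injective h₀

lemma ComparisonBidual.of_comp_essSurj [F.EssSurj] (ha : ComparisonBidual a)
    (h : ComparisonBidual (compComparison a b)) : ComparisonBidual b := by
  intro Y
  let X := F.objPreimage Y
  let e : F.obj X ≅ Y := F.objObjPreimageIso Y
  have h₀ := (comp_iff X).1 (h X)
  have h₁ : F.map (𝒟₁.bidual X) ≫ (comparison a (𝒟₁.dual X)).hom =
    𝒟₂.bidual (F.obj X) ≫ 𝒟₂.dualMap (comparison a X).hom := ha X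
  rw [h₁, Functor.map_comp, Category.assoc, comparison_naturality, ← Category.assoc,
    cancel_mono] at h₀
  have h₂ := congrArg G.map (𝒟₂.bidual_naturality e.hom)
  have h₃ := comparison_naturality b (𝒟₂.dualMap e.hom)
  have h₄ := congrArg 𝒟₃.dualMap (comparison_naturality b e.hom)
  have h₅ := 𝒟₃.bidual_naturality (G.map e.hom)
  simp only [Functor.map_comp, dualMap_comp] at h₂ h₄
  have : G.map (𝒟₂.bidual Y) ≫ (comparison b (𝒟₂.dual Y)).hom =
      𝒟₃.bidual (G.obj Y) ≫ 𝒟₃.dualMap (comparison b Y).hom := by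
    rw [← cancel_epi (G.map e.hom), reassoc_of% h₂, h₃, reassoc_of% h₀, reassoc_of% h₅, h₄]
  exact this

lemma ComparisonBidual.of_iso {a' : 𝒟₁.D ⋙ F' ≅ F'.op ⋙ 𝒟₂.D} (σ : F ≅ F')
    (h : ∀ X, (comparison a X).hom =
      σ.hom.app (𝒟₁.dual X) ≫ (comparison a' X).hom ≫ 𝒟₂.dualMap (σ.hom.app X))
    (ha : ComparisonBidual a') : ComparisonBidual a := by
  intro X
  have h₁ : F'.map (𝒟₁.bidual X) ≫ (comparison a' (𝒟₁.dual X)).hom =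
    𝒟₂.bidual (F'.obj X) ≫ 𝒟₂.dualMap (comparison a' X).hom := ha X
  have h₂ := σ.hom.naturality (𝒟₁.bidual X)
  have h₃ := 𝒟₂.bidual_naturality (σ.hom.app X)
  have h₄ : F.map (𝒟₁.bidual X) ≫ (comparison a (𝒟₁.dual X)).hom =
    𝒟₂.bidual (F.obj X) ≫ 𝒟₂.dualMap (comparison a X).hom := by
    rw [h, h]
    rw [reassoc_of% h₂, reassoc_of% h₁, dualMap_comp, dualMap_comp, reassoc_of% h₃]
    simp only [Category.assoc]
  exact h₄

end CompComparison

end DualityData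

section

open DualityData

/-! ### Bounded complexes, their homotopy category and K-projectivity. -/

section BoundedCochain

universe v u

variable (B : Type u) [Category.{v} B] [Preadditive B]

/-- Bounded cochain complexes. -/
abbrev boundedCochain : ObjectProperty (CochainComplex B ℤ) :=
  (boundedComplexes B).inverseImage (HomotopyCategory.quotient B (ComplexShape.up ℤ))

instance : (boundedCochain B).IsStableUnderShift ℤ where
  isStableUnderShiftBy n :=
    { le_shift := by
        rintro K ⟨a, b, h⟩
        exact ⟨a - n, b - n, fun i hi ↦ h (i + n) (by lia)⟩ }

lemma boundedComplexes_quotient (K : (boundedCochain B).FullSubcategory) :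
    boundedComplexes B (((boundedCochain B).ι ⋙
      HomotopyCategory.quotient B (ComplexShape.up ℤ)).obj K) := K.property

/-- The projection from bounded complexes to the bounded homotopy category. -/
abbrev boundedQuotient : (boundedCochain B).FullSubcategory ⥤ BoundedHomotopyCategory B :=
  (boundedComplexes B).lift ((boundedCochain B).ι ⋙ HomotopyCategory.quotient B _)
    (boundedComplexes_quotient B)

instance : (boundedQuotient B).EssSurj where
  mem_essImage X := by
    obtain ⟨⟨K⟩, hK⟩ := X
    exact ⟨⟨K, hK⟩, ⟨Iso.refl _⟩⟩

variable {B} (V : Bᵒᵖ ⥤ B) [V.Additive] (e : 𝟭 B ⟶ V.rightOp ⋙ V)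

/-- The termwise duality on bounded complexes. -/
abbrev boundedCochainDuality : DualityData (boundedCochain B).FullSubcategory :=
  (complexDuality V e).restrict (boundedCochain B) (by
    rintro K ⟨a, b, h⟩
    exact ⟨-b, -a, fun n hn ↦ V.map_isZero (h (-n) (by lia)).op⟩)

variable [HasZeroObject B] [HasBinaryBiproducts B]

/-- The dualities on bounded complexes and on the bounded homotopy category agree. -/
def boundedQuotientComparison : (boundedCochainDuality V e).D ⋙ boundedQuotient B ≅
    (boundedQuotient B).op ⋙ (boundedHomotopyDuality V e).D := Iso.refl _

lemma comp_id_eq_id_comp_comp {C : Type*} [Category* C] {X : C} {f g h : X ⟶ X} (hf : f = 𝟙 X)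
    (hg : g = 𝟙 X) (hh : h = 𝟙 X) : f ≫ 𝟙 X = 𝟙 X ≫ (g ≫ 𝟙 X) ≫ h := by
  simp [hf, hg, hh]

/-- The inclusion into the full homotopy category is faithful, and after it the functor becomes the
inclusion into all complexes followed by the quotient functor. Both of these are already known to be
compatible. -/
lemma boundedQuotientComparison_shift : ComparisonShift _ (boundedQuotientComparison V e) := by
  refine ComparisonShift.of_comp_faithful (G := (boundedComplexes B).ι)
    (b := restrictComparison (homotopyDuality V e) _ _) (restrictComparison_shift _ _ _) ?_
  refine ComparisonShift.of_iso ((boundedComplexes B).liftCompιIso _ _)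
    (a' := compComparison (restrictComparison (complexDuality V e) _ _)
      (quotientComparison V e)) (fun K ↦ ?_)
    ((restrictComparison_shift _ _ _).comp (quotientComparison_shift V e))
  exact comp_id_eq_id_comp_comp (CategoryTheory.Functor.map_id (boundedComplexes B).ι _)
    (CategoryTheory.Functor.map_id (HomotopyCategory.quotient B (ComplexShape.up ℤ)) _)
    (dualMap_id _ _)

lemma boundedQuotientComparison_bidual : ComparisonBidual (boundedQuotientComparison V e) := by
  refine ComparisonBidual.of_comp_faithful (G := (boundedComplexes B).ι)
    (b := restrictComparison (homotopyDuality V e) _ _) (restrictComparison_bidual _ _ _) ?_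
  refine ComparisonBidual.of_iso ((boundedComplexes B).liftCompιIso _ _)
    (a' := compComparison (restrictComparison (complexDuality V e) _ _)
      (quotientComparison V e)) (fun K ↦ ?_)
    ((restrictComparison_bidual _ _ _).comp (quotientComparison_bidual V e))
  exact comp_id_eq_id_comp_comp (CategoryTheory.Functor.map_id (boundedComplexes B).ι _)
    (CategoryTheory.Functor.map_id (HomotopyCategory.quotient B (ComplexShape.up ℤ)) _)
    (dualMap_id _ _)

end BoundedCochain

section MapComplex

universe v u v' u'

variable {A : Type u} [Category.{v} A] [Preadditive A] {V : Aᵒᵖ ⥤ A} [V.Additive]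
  {B : Type u'} [Category.{v'} B] [Preadditive B] {W : Bᵒᵖ ⥤ B} [W.Additive]
  {H : B ⥤ A} [H.Additive] (θ : W ⋙ H ≅ H.op ⋙ V) (e : 𝟭 A ⟶ V.rightOp ⋙ V)
  (e' : 𝟭 B ⟶ W.rightOp ⋙ W)

/-- The comparison of dualities on complexes induced by a comparison of dualities. -/
def mapComplexComparison : (complexDuality W e').D ⋙ H.mapHomologicalComplex (ComplexShape.up ℤ) ≅
    (H.mapHomologicalComplex (ComplexShape.up ℤ)).op ⋙ (complexDuality V e).D :=
  NatIso.ofComponents (fun K ↦ HomologicalComplex.Hom.isoOfComponents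
      (fun i ↦ θ.app (op (K.unop.X (-i))))
      (fun i j _ ↦ (θ.hom.naturality (K.unop.d (-j) (-i)).op).symm))
    (fun {K L} f ↦ by
      ext i
      exact θ.hom.naturality (f.unop.f (-i)).op)

lemma map_XIsoOfEq_hom (H : B ⥤ A) [H.Additive] (K : CochainComplex B ℤ) {i j : ℤ} (h : i = j) :
    H.map (K.XIsoOfEq h).hom =
      (HomologicalComplex.XIsoOfEq ((H.mapHomologicalComplex (ComplexShape.up ℤ)).obj K) h).hom := by
  subst h
  rw [HomologicalComplex.XIsoOfEq_rfl, HomologicalComplex.XIsoOfEq_rfl]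
  exact H.map_id _

lemma comp_square_of_eq_id {C : Type*} [Category* C] {X Y Z W : C} {p : X ⟶ Y} {q : Y ⟶ W}
    {r : X ⟶ Z} {s : Z ⟶ W} (h : p ≫ q = r ≫ s) {u : Y ⟶ Y} {w : Z ⟶ Z} {s' : Z ⟶ W}
    (hu : u = 𝟙 Y) (hw : w = 𝟙 Z) (hs : s = s') : p ≫ u ≫ q = r ≫ w ≫ s' := by
  rw [hu, hw, ← hs, Category.id_comp, Category.id_comp, h]

lemma comp_comp_eq_of_eq {C : Type*} [Category* C] {X Y Z W U : C} {p p' : X ⟶ Y} {q : Y ⟶ Z}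
    {r : Z ⟶ U} {q' : Y ⟶ W} {r' : W ⟶ U} (hp : p = p') (h : q ≫ r = q' ≫ r') {f : X ⟶ Z}
    (hf : f = p ≫ q) : f ≫ r = (p' ≫ q') ≫ r' := by
  rw [hf, ← hp, Category.assoc, Category.assoc, h]

/-- In each degree this is naturality of `θ` at a reindexing isomorphism. -/
lemma mapComplexComparison_shift :
    ComparisonShift _ (mapComplexComparison θ e e') := by
  intro K n m h
  ext i
  exact comp_square_of_eq_id (θ.hom.naturality (K.XIsoOfEq (show -(i + m) = -i + n by lia)).hom.op)
    (H.mapHomologicalComplex_commShiftIso_hom_app_f ((dualComplex W).obj (op K)) m i)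
    ((congrArg (fun f ↦ V.map (Quiver.Hom.op f))
      (H.mapHomologicalComplex_commShiftIso_inv_app_f K n (-i))).trans (V.map_id _))
    (congrArg (fun f ↦ V.map (Quiver.Hom.op f)) (map_XIsoOfEq_hom H K _))

variable {θ e e'}

lemma mapComplexComparison_bidual
    (hθ : ∀ X, H.map (bidualApp e' X) ≫ θ.hom.app (op (W.obj (op X))) =
      bidualApp e (H.obj X) ≫ V.map (θ.hom.app (op X)).op) :
    ComparisonBidual (mapComplexComparison θ e e') := by
  intro K
  ext i
  exact comp_comp_eq_of_eq (map_XIsoOfEq_hom H K (show i = - -i by lia)) (hθ _) (H.map_comp _ _)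

end MapComplex

section DerivedFunctor

universe w v u v' u'

variable {A : Type u} [Category.{v} A] [Abelian A] [HasDerivedCategory.{w} A]
  {B : Type u'} [Category.{v'} B] [Preadditive B] [HasZeroObject B] [HasBinaryBiproducts B]
  (H : B ⥤ A) [H.Additive]

/-- The functor from the bounded homotopy category to the derived category induced by an additive
functor. -/
abbrev boundedToDerived : BoundedHomotopyCategory B ⥤ DerivedCategory A :=
  (boundedComplexes B).ι ⋙ H.mapHomotopyCategory (ComplexShape.up ℤ) ⋙ DerivedCategory.Qh

omit [HasDerivedCategory A] in
lemma isKProjective_of_isZero (K : CochainComplex A ℤ) (hK : ∀ i, Projective (K.X i)) (b : ℤ)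
    (hb : ∀ i, b < i → IsZero (K.X i)) : K.IsKProjective := by
  have : K.IsStrictlyLE b := by
    rw [CochainComplex.isStrictlyLE_iff]
    exact hb
  exact CochainComplex.isKProjective_of_projective K b

variable {H} in
lemma isKProjective_map (hH : ∀ b, Projective (H.obj b)) {K : CochainComplex B ℤ}
    (hK : boundedCochain B K) :
    CochainComplex.IsKProjective ((H.mapHomologicalComplex (ComplexShape.up ℤ)).obj K) := by
  obtain ⟨a, b, h⟩ := hK
  exact isKProjective_of_isZero _ (fun i ↦ hH _) b (fun i hi ↦ H.map_isZero (h i (Or.inr hi)))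

variable {H} in
-- Bounded complexes of projectives are K-projective, so morphisms out of them in the derived
-- category are homotopy classes. All lifting and uniqueness arguments for resolutions rest on this.
lemma map_Qh_bijective (hH : ∀ b, Projective (H.obj b)) (P : BoundedHomotopyCategory B)
    (L : HomotopyCategory A (ComplexShape.up ℤ)) :
    Function.Bijective (DerivedCategory.Qh.map :
      ((H.mapHomotopyCategory (ComplexShape.up ℤ)).obj P.obj ⟶ L) → _) := by
  obtain ⟨⟨K⟩, hK⟩ := P
  have := isKProjective_map hH hK
  exact CochainComplex.IsKProjective.Qh_map_bijective
    ((H.mapHomologicalComplex (ComplexShape.up ℤ)).obj K) L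

lemma boundedToDerived_faithful [H.Full] [H.Faithful] (hH : ∀ b, Projective (H.obj b)) :
    (boundedToDerived H).Faithful where
  map_injective {P _} _ _ h := (boundedComplexes B).ι.map_injective
    ((H.mapHomotopyCategory (ComplexShape.up ℤ)).map_injective
      ((map_Qh_bijective hH P _).injective h))

lemma boundedToDerived_full [H.Full] [H.Faithful] (hH : ∀ b, Projective (H.obj b)) :
    (boundedToDerived H).Full where
  map_surjective {P _} f := by
    obtain ⟨g, hg⟩ := (map_Qh_bijective hH P _).surjective f
    obtain ⟨g', rfl⟩ := (H.mapHomotopyCategory (ComplexShape.up ℤ)).map_surjective g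
    exact ⟨ObjectProperty.homMk g', hg⟩

end DerivedFunctor

/-! ### The canonical morphism from the underived to the derived dual. -/

section DerivedDual

universe w v u v' u'

variable {A : Type u} [Category.{v} A] [Abelian A] [HasDerivedCategory.{w} A]
  (V : Aᵒᵖ ⥤ A) [V.Additive] {e : 𝟭 A ⟶ V.rightOp ⋙ V}
  (T : ObjectProperty (DerivedCategory A))

open DerivedCategory

/-- The localization functor from complexes to a full subcategory of the derived category. -/
abbrev derivedQ : (T.inverseImage Q).FullSubcategory ⥤ T.FullSubcategory :=
  T.lift ((T.inverseImage Q).ι ⋙ Q) (fun K ↦ K.property)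

/-- The underived termwise dual. -/
abbrev derivedDual : (T.inverseImage Q).FullSubcategoryᵒᵖ ⥤ DerivedCategory A :=
  (T.inverseImage Q).ι.op ⋙ dualComplex V ⋙ Q

variable {T}

/-- The object of a full subcategory of the derived category that is given by a complex. -/
abbrev derivedObj (K : CochainComplex A ℤ) (hK : T (Q.obj K)) : T.FullSubcategory := ⟨Q.obj K, hK⟩

/-- The morphism in a full subcategory of the derived category given by a morphism of complexes. -/
abbrev derivedMap {K L : CochainComplex A ℤ} (f : K ⟶ L) (hK : T (Q.obj K)) (hL : T (Q.obj L)) :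
    derivedObj K hK ⟶ derivedObj L hL := ObjectProperty.homMk (Q.map f)

/-- The compatibility of the localization functor with shifts. -/
def shiftQ (K : CochainComplex A ℤ) (n : ℤ) : Q.obj (K⟦n⟧) ≅ (Q.obj K)⟦n⟧ :=
  (Q.commShiftIso n).app K

lemma shiftQ_hom_naturality {K L : CochainComplex A ℤ} (f : K ⟶ L) (n : ℤ) :
    Q.map (f⟦n⟧') ≫ (shiftQ L n).hom = (shiftQ K n).hom ≫ (Q.map f)⟦n⟧' :=
  (Q.commShiftIso n).hom.naturality f

section

variable [T.IsStableUnderShift ℤ]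

/-- The compatibility of the inclusion of a full subcategory with shifts. -/
def shiftObj (X : T.FullSubcategory) (n : ℤ) : (X⟦n⟧).obj ≅ X.obj⟦n⟧ := (T.ι.commShiftIso n).app X

lemma shiftObj_hom_naturality {X Y : T.FullSubcategory} (f : X ⟶ Y) (n : ℤ) :
    (f⟦n⟧').hom ≫ (shiftObj Y n).hom = (shiftObj X n).hom ≫ f.hom⟦n⟧' :=
  (T.ι.commShiftIso n).hom.naturality f

/-- The identification of the shift of an object with the object given by the shifted complex. -/
def shiftDerivedObj (K : CochainComplex A ℤ) (n : ℤ) (hK : T (Q.obj K)) (hKn : T (Q.obj (K⟦n⟧))) :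
    (derivedObj K hK)⟦n⟧ ⟶ derivedObj (K⟦n⟧) hKn :=
  ObjectProperty.homMk ((shiftObj (derivedObj K hK) n).hom ≫ (shiftQ K n).inv)

lemma shiftDerivedObj_naturality {K L : CochainComplex A ℤ} (f : K ⟶ L) (n : ℤ)
    (hK : T (Q.obj K)) (hKn : T (Q.obj (K⟦n⟧))) (hL : T (Q.obj L)) (hLn : T (Q.obj (L⟦n⟧))) :
    shiftDerivedObj K n hK hKn ≫ derivedMap (f⟦n⟧') hKn hLn =
      (derivedMap f hK hL)⟦n⟧' ≫ shiftDerivedObj L n hL hLn := by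
  have h₁ := shiftObj_hom_naturality (derivedMap f hK hL) n
  have h₂ : (shiftQ K n).inv ≫ Q.map (f⟦n⟧') = (Q.map f)⟦n⟧' ≫ (shiftQ L n).inv := by
    rw [Iso.inv_comp_eq, ← Category.assoc, ← shiftQ_hom_naturality, Category.assoc, Iso.hom_inv_id,
      Category.comp_id]
  have h₃ : ((shiftObj (derivedObj K hK) n).hom ≫ (shiftQ K n).inv) ≫ Q.map (f⟦n⟧') =
      ((derivedMap f hK hL)⟦n⟧').hom ≫ (shiftObj (derivedObj L hL) n).hom ≫ (shiftQ L n).inv := by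
    rw [reassoc_of% h₁, Category.assoc, h₂]
    rfl
  ext : 1
  exact h₃

end

variable {V} [T.IsStableUnderShift ℤ] {𝒟 : DualityData T.FullSubcategory}
  (α : derivedDual V T ⟶ (derivedQ T).op ⋙ 𝒟.D ⋙ T.ι)

/-- The canonical morphism from the underived dual to the derived dual. -/
def toDerivedDual (K : CochainComplex A ℤ) (hK : T (Q.obj K)) :
    Q.obj ((dualComplex V).obj (op K)) ⟶ (𝒟.dual (derivedObj K hK)).obj :=
  α.app (op ⟨K, hK⟩)

lemma toDerivedDual_naturality {K L : CochainComplex A ℤ} (f : K ⟶ L) (hK : T (Q.obj K))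
    (hL : T (Q.obj L)) :
    Q.map ((dualComplex V).map f.op) ≫ toDerivedDual α K hK =
      toDerivedDual α L hL ≫ (𝒟.dualMap (derivedMap f hK hL)).hom :=
  α.naturality (Quiver.Hom.op (X := (⟨K, hK⟩ : (T.inverseImage Q).FullSubcategory)) (Y := ⟨L, hL⟩)
    (ObjectProperty.homMk f))

/-- The canonical morphism from the underived dual to the derived dual, in the subcategory. -/
abbrev toDerivedDual' (K : CochainComplex A ℤ) (hK : T (Q.obj K))
    (hK' : T (Q.obj ((dualComplex V).obj (op K)))) :
    derivedObj ((dualComplex V).obj (op K)) hK' ⟶ 𝒟.dual (derivedObj K hK) :=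
  ObjectProperty.homMk (toDerivedDual α K hK)

/-- The compatibility of the derived dual with the shifts on a complex. -/
def DerivedShiftAt (K : CochainComplex A ℤ) (hK : T (Q.obj K)) (n m : ℤ) (h : n + m = 0) : Prop :=
  ∀ hKn : T (Q.obj (K⟦n⟧)),
    toDerivedDual α (K⟦n⟧) hKn ≫ (𝒟.dualMap (shiftDerivedObj K n hK hKn)).hom ≫
      (𝒟.dualShift (derivedObj K hK) n m h).hom.hom ≫ (shiftObj _ m).hom =
    Q.map (dualComplexShift V K n m h).hom ≫ (shiftQ _ m).hom ≫ (toDerivedDual α K hK)⟦m⟧'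

variable (e) in
/-- The compatibility of the derived dual with the biduality morphism on a complex. -/
def DerivedBidualAt (K : CochainComplex A ℤ) (hK : T (Q.obj K)) : Prop :=
  ∀ hK' : T (Q.obj ((dualComplex V).obj (op K))),
    Q.map (bidualComplex e K) ≫ toDerivedDual α _ hK' =
      (𝒟.bidual (derivedObj K hK)).hom ≫ (𝒟.dualMap (toDerivedDual' α K hK hK')).hom

variable {α}

lemma isIso_derivedMap {K L : CochainComplex A ℤ} (f : K ⟶ L) [IsIso (Q.map f)] (hK : T (Q.obj K))
    (hL : T (Q.obj L)) : IsIso (derivedMap f hK hL) := by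
  have : IsIso (T.ι.map (derivedMap f hK hL)) := inferInstanceAs (IsIso (Q.map f))
  exact isIso_of_reflects_iso _ T.ι

lemma isIso_hom {X Y : T.FullSubcategory} (f : X ⟶ Y) [IsIso f] : IsIso f.hom :=
  inferInstanceAs (IsIso (T.ι.map f))

/-- All terms are natural in the complex, and the derived dual turns `f` into an isomorphism that
can be cancelled, so the condition only has to be verified on resolutions. The implication goes one
way, because the underived dual of `f` need not be invertible in the derived category. -/
lemma DerivedShiftAt.of_isIso [T.IsClosedUnderIsomorphisms] {K L : CochainComplex A ℤ} (f : K ⟶ L)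
    [IsIso (Q.map f)] {hK : T (Q.obj K)} (hL : T (Q.obj L)) {n m : ℤ} {h : n + m = 0}
    (hα : DerivedShiftAt α K hK n m h) : DerivedShiftAt α L hL n m h := by
  intro hLn
  have hKn : T (Q.obj (K⟦n⟧)) := T.prop_of_iso (shiftQ K n).symm (T.le_shift n _ hK)
  have h₁ := hα hKn
  have := isIso_derivedMap f hK hL
  have := isIso_hom (𝒟.dualMap (derivedMap f hK hL))
  have h₂ := toDerivedDual_naturality α (f⟦n⟧') hKn hLn
  have h₃ := toDerivedDual_naturality α f hK hL
  have h₄ := congrArg (fun g ↦ (𝒟.dualMap g).hom) (shiftDerivedObj_naturality f n hK hKn hL hLn)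
  have h₅ := congrArg T.ι.map
    (𝒟.dualShift_hom_naturality (derivedMap f hK hL) n m h)
  have h₆ := shiftObj_hom_naturality (𝒟.dualMap (derivedMap f hK hL)) m
  have h₇ := congrArg Q.map (dualComplexShift_naturality V f n m h)
  have h₈ := shiftQ_hom_naturality ((dualComplex V).map f.op) m
  have h₉ := congrArg (shiftFunctor (DerivedCategory A) m).map h₃
  simp only [dualMap_comp, ObjectProperty.ι_map, ObjectProperty.FullSubcategory.comp_hom, Functor.map_comp]
    at h₄ h₅ h₇ h₉
  rw [← cancel_mono ((𝒟.dualMap (derivedMap f hK hL)).hom⟦m⟧')]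
  simp only [Category.assoc]
  rw [← h₆, ← reassoc_of% h₅, ← reassoc_of% h₄, ← reassoc_of% h₂, h₁, reassoc_of% h₇,
    reassoc_of% h₈, h₉]

/-- Here `Q.map f` itself is cancelled; the dual of the source has to lie in `T` for the condition
on the source to say anything. -/
lemma DerivedBidualAt.of_isIso {K L : CochainComplex A ℤ} (f : K ⟶ L)
    [IsIso (Q.map f)] {hK : T (Q.obj K)} (hL : T (Q.obj L))
    (hK' : T (Q.obj ((dualComplex V).obj (op K))))
    (hα : DerivedBidualAt e α K hK) : DerivedBidualAt e α L hL := by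
  intro hL'
  have h₁ := hα hK'
  have h₂ := congrArg Q.map (bidualComplex_naturality e f)
  have h₃ := toDerivedDual_naturality α ((dualComplex V).map f.op) hL' hK'
  have h₄ : Q.map f ≫ (𝒟.bidual (derivedObj L hL)).hom = (𝒟.bidual (derivedObj K hK)).hom ≫
      (𝒟.dualMap (𝒟.dualMap (derivedMap f hK hL))).hom :=
    congrArg T.ι.map (𝒟.bidual_naturality (derivedMap f hK hL))
  have h₅ : derivedMap ((dualComplex V).map f.op) hL' hK' ≫ toDerivedDual' α K hK hK' =
      toDerivedDual' α L hL hL' ≫ 𝒟.dualMap (derivedMap f hK hL) := by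
    ext : 1
    exact toDerivedDual_naturality α f hK hL
  have h₆ := congrArg (fun g ↦ (𝒟.dualMap g).hom) h₅
  simp only [dualMap_comp, ObjectProperty.FullSubcategory.comp_hom, Functor.map_comp] at h₂ h₆
  rw [← cancel_epi (Q.map f), reassoc_of% h₂, h₃, reassoc_of% h₁, h₆, reassoc_of% h₄]

section

universe v'' u''

variable {C₀ : Type u''} [Category.{v''} C₀] [Preadditive C₀] [HasShift C₀ ℤ] {𝒟₀ : DualityData C₀}
  {R : C₀ ⥤ CochainComplex A ℤ} (hR : ∀ X, T ((R ⋙ Q).obj X))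

/-- The functor to a full subcategory of the derived category that is induced by a functor to
complexes. -/
abbrev derivedLift : C₀ ⥤ T.FullSubcategory := T.lift (R ⋙ Q) hR

variable {hR} {τ : 𝒟₀.D ⋙ R ≅ R.op ⋙ (complexDuality V e).D}
  {a : 𝒟₀.D ⋙ derivedLift hR ≅ (derivedLift hR).op ⋙ 𝒟.D}

variable (τ) in
/-- The components of a comparison with the termwise duality on complexes. -/
def complexComparison (X : C₀) : R.obj (𝒟₀.dual X) ≅ (dualComplex V).obj (op (R.obj X)) :=
  comparison τ X

variable (α τ a) in
/-- A comparison of dualities is induced by a comparison on complexes and the canonical morphism to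
the derived dual. -/
def IsDerivedComparison : Prop := ∀ X : C₀, (comparison a X).hom.hom =
  Q.map (complexComparison τ X).hom ≫ toDerivedDual α (R.obj X) (hR X)

/-- The comparison `a` is the comparison `τ` of complexes followed by `α`. Since `τ` respects
biduality, compatibility of `a` amounts to compatibility of `α`. From left to right this yields the
conditions on `α` for resolutions; from right to left it yields a comparison from an arbitrary
derived duality. -/
lemma bidual_iff_derivedBidualAt [T.IsClosedUnderIsomorphisms] (hτ : ComparisonBidual τ)
    (ha : IsDerivedComparison α τ a) (X : C₀) :
    (derivedLift hR).map (𝒟₀.bidual X) ≫ (comparison a (𝒟₀.dual X)).hom =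
      𝒟.bidual _ ≫ 𝒟.dualMap (comparison a X).hom ↔ DerivedBidualAt e α (R.obj X) (hR X) := by
  have hK' : T (Q.obj ((dualComplex V).obj (op (R.obj X)))) :=
    T.prop_of_iso (Q.mapIso (complexComparison τ X)) (hR (𝒟₀.dual X))
  let t : derivedObj (R.obj (𝒟₀.dual X)) (hR _) ⟶ derivedObj _ hK' :=
    derivedMap (complexComparison τ X).hom (hR (𝒟₀.dual X)) hK'
  have : IsIso t := isIso_derivedMap _ _ _
  have := isIso_hom (𝒟.dualMap t)
  have h₁ : (comparison a X).hom = t ≫ toDerivedDual' α (R.obj X) (hR X) hK' := by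
    ext : 1
    exact ha X
  have h₂ : Q.map (R.map (𝒟₀.bidual X)) ≫ Q.map (complexComparison τ (𝒟₀.dual X)).hom =
      Q.map (bidualComplex e (R.obj X)) ≫
        Q.map ((dualComplex V).map (complexComparison τ X).hom.op) :=
    (Q.map_comp _ _).symm.trans ((congrArg Q.map (hτ X)).trans (Q.map_comp _ _))
  have h₃ : Q.map ((dualComplex V).map (complexComparison τ X).hom.op) ≫
      toDerivedDual α (R.obj (𝒟₀.dual X)) (hR _) = toDerivedDual α _ hK' ≫ (𝒟.dualMap t).hom :=
    toDerivedDual_naturality α (complexComparison τ X).hom (hR (𝒟₀.dual X)) hK'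
  have h₄ : Q.map (R.map (𝒟₀.bidual X)) ≫ (comparison a (𝒟₀.dual X)).hom.hom =
      (Q.map (bidualComplex e (R.obj X)) ≫ toDerivedDual α _ hK') ≫ (𝒟.dualMap t).hom := by
    rw [Category.assoc, ← h₃, ha, reassoc_of% h₂]
  have h₅ : (𝒟.bidual (derivedObj _ (hR X))).hom ≫ (𝒟.dualMap (comparison a X).hom).hom =
      ((𝒟.bidual (derivedObj _ (hR X))).hom ≫
        (𝒟.dualMap (toDerivedDual' α (R.obj X) (hR X) hK')).hom) ≫ (𝒟.dualMap t).hom := by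
    rw [h₁, dualMap_comp, ObjectProperty.FullSubcategory.comp_hom, Category.assoc]
  constructor
  · intro h _
    have h₆ : Q.map (R.map (𝒟₀.bidual X)) ≫ (comparison a (𝒟₀.dual X)).hom.hom =
      (𝒟.bidual (derivedObj _ (hR X))).hom ≫ (𝒟.dualMap (comparison a X).hom).hom :=
      congrArg T.ι.map h
    rwa [h₄, h₅, cancel_mono] at h₆
  · intro h
    ext : 1
    refine h₄.trans (Eq.trans ?_ h₅.symm)
    rw [h hK']

variable [R.CommShift ℤ]

variable (R) in
/-- The compatibility of a functor with shifts. -/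
def commShiftApp (X : C₀) (n : ℤ) : R.obj (X⟦n⟧) ≅ (R.obj X)⟦n⟧ := (R.commShiftIso n).app X

variable (hR) in
/-- The compatibility of the functor induced by a functor to complexes with shifts. -/
def derivedLiftShift (X : C₀) (n : ℤ) :
    derivedObj (R.obj (X⟦n⟧)) (hR _) ≅ (derivedObj (R.obj X) (hR X))⟦n⟧ :=
  ((derivedLift hR).commShiftIso n).app X

lemma comp_comp_eq_of_id {C : Type*} [Category* C] {X Y Z W : C} {f : X ⟶ Y} {g : Y ⟶ Z}
    {i : Z ⟶ Z} {j : X ⟶ X} {k : X ⟶ W} {l : W ⟶ Z} (h : (f ≫ g) ≫ i = j ≫ k ≫ l)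
    (hi : i = 𝟙 Z) (hj : j = 𝟙 X) : f ≫ g = k ≫ l := by
  rwa [hi, hj, Category.comp_id, Category.id_comp] at h

lemma derivedLiftShift_hom (X : C₀) (n : ℤ) :
    (derivedLiftShift hR X n).hom.hom ≫ (shiftObj (derivedObj (R.obj X) (hR X)) n).hom =
      Q.map (commShiftApp R X n).hom ≫ (shiftQ (R.obj X) n).hom := by
  have h₁ := NatTrans.shift_app_comm (T.liftCompιIso (R ⋙ Q) hR).hom n X
  rw [Functor.commShiftIso_comp_hom_app, Functor.commShiftIso_comp_hom_app] at h₁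
  exact comp_comp_eq_of_id h₁
    (CategoryTheory.Functor.map_id (shiftFunctor (DerivedCategory A) n) _) rfl

lemma derivedLiftShift_hom_comp (X : C₀) (n : ℤ) (hn : T (Q.obj ((R.obj X)⟦n⟧))) :
    (derivedLiftShift hR X n).hom ≫ shiftDerivedObj (R.obj X) n (hR X) hn =
      derivedMap (commShiftApp R X n).hom (hR _) hn := by
  have h : (derivedLiftShift hR X n).hom.hom ≫
      (shiftObj (derivedObj (R.obj X) (hR X)) n).hom ≫ (shiftQ (R.obj X) n).inv =
        Q.map (commShiftApp R X n).hom := by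
    rw [reassoc_of% derivedLiftShift_hom, Iso.hom_inv_id, Category.comp_id]
  ext : 1
  exact h

/-- The principle is that of `bidual_iff_derivedBidualAt`. In addition, the identifications of `R
(T^n X)` with `T^n (R X)` have to be stripped off, by means of `derivedLiftShift_hom_comp`. -/
lemma shift_iff_derivedShiftAt [T.IsClosedUnderIsomorphisms] (hτ : ComparisonShift R τ)
    (ha : IsDerivedComparison α τ a) (X : C₀) (n m : ℤ) (h : n + m = 0) :
    ComparisonShiftAt a X n m h ↔ DerivedShiftAt α (R.obj X) (hR X) n m h := by
  have hn : T (Q.obj ((R.obj X)⟦n⟧)) := T.prop_of_iso (shiftQ (R.obj X) n).symm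
    (T.le_shift n _ (hR X))
  have h₁ := derivedLiftShift_hom_comp (hR := hR) X n hn
  have h₂ := derivedLiftShift_hom (hR := hR) (𝒟₀.dual X) m
  have h₃ := toDerivedDual_naturality α (commShiftApp R X n).hom (hR _) hn
  have h₄ : ((comparison a X).hom⟦m⟧').hom ≫ (shiftObj (𝒟.dual (derivedObj _ (hR X))) m).hom =
      (shiftObj (derivedObj _ (hR (𝒟₀.dual X))) m).hom ≫ (comparison a X).hom.hom⟦m⟧' :=
    shiftObj_hom_naturality (comparison a X).hom m
  have h₅ : (comparison a X).hom.hom⟦m⟧' = (Q.map (complexComparison τ X).hom)⟦m⟧' ≫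
      (toDerivedDual α (R.obj X) (hR X))⟦m⟧' :=
    (congrArg _ (ha X)).trans (CategoryTheory.Functor.map_comp _ _ _)
  have h₆ := shiftQ_hom_naturality (complexComparison τ X).hom m
  have h₇ : R.map (𝒟₀.dualShift X n m h).hom ≫
      (commShiftApp R (𝒟₀.dual X) m).hom ≫ (complexComparison τ X).hom⟦m⟧' =
    (complexComparison τ (X⟦n⟧)).hom ≫
      (dualComplex V).map (commShiftApp R X n).inv.op ≫
        (dualComplexShift V (R.obj X) n m h).hom := hτ X n m h
  have h₈ := congrArg Q.map h₇
  simp only [Functor.map_comp] at h₈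
  -- left hand side
  have h₉ : Q.map (R.map (𝒟₀.dualShift X n m h).hom) ≫
      (derivedLiftShift hR (𝒟₀.dual X) m).hom.hom ≫ ((comparison a X).hom⟦m⟧').hom ≫
        (shiftObj (𝒟.dual (derivedObj _ (hR X))) m).hom =
      Q.map (complexComparison τ (X⟦n⟧)).hom ≫
        Q.map ((dualComplex V).map (commShiftApp R X n).inv.op) ≫
        Q.map (dualComplexShift V (R.obj X) n m h).hom ≫ (shiftQ _ m).hom ≫
          (toDerivedDual α (R.obj X) (hR X))⟦m⟧' := by
    rw [h₄, reassoc_of% h₂, h₅, ← reassoc_of% h₆, reassoc_of% h₈]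
  have h₁₀ : (comparison a (X⟦n⟧)).hom.hom ≫ (𝒟.dualMap (derivedLiftShift hR X n).inv).hom =
      Q.map (complexComparison τ (X⟦n⟧)).hom ≫
        Q.map ((dualComplex V).map (commShiftApp R X n).inv.op) ≫
          toDerivedDual α _ hn ≫ (𝒟.dualMap (shiftDerivedObj (R.obj X) n (hR X) hn)).hom := by
    have e₁ : shiftDerivedObj (R.obj X) n (hR X) hn =
        (derivedLiftShift hR X n).inv ≫ derivedMap (commShiftApp R X n).hom (hR _) hn := by
      rw [← h₁, Iso.inv_hom_id_assoc]
    have e₂ : Q.map ((dualComplex V).map (commShiftApp R X n).inv.op) ≫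
        Q.map ((dualComplex V).map (commShiftApp R X n).hom.op) = 𝟙 _ := by
      rw [← Q.map_comp, ← Functor.map_comp, ← op_comp, Iso.hom_inv_id, op_id,
        CategoryTheory.Functor.map_id, CategoryTheory.Functor.map_id]
    rw [e₁, dualMap_comp, ObjectProperty.FullSubcategory.comp_hom, ← reassoc_of% h₃,
      reassoc_of% e₂, ha, Category.assoc]
  have h₁₁ : IsIso (Q.map (complexComparison τ (X⟦n⟧)).hom ≫
        Q.map ((dualComplex V).map (commShiftApp R X n).inv.op)) := inferInstance
  have h₁₂ : ((comparison a (X⟦n⟧)).hom.hom ≫ (𝒟.dualMap (derivedLiftShift hR X n).inv).hom) ≫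
      (𝒟.dualShift (derivedObj (R.obj X) (hR X)) n m h).hom.hom ≫ (shiftObj _ m).hom =
      (Q.map (complexComparison τ (X⟦n⟧)).hom ≫
        Q.map ((dualComplex V).map (commShiftApp R X n).inv.op)) ≫
          toDerivedDual α _ hn ≫ (𝒟.dualMap (shiftDerivedObj (R.obj X) n (hR X) hn)).hom ≫
      (𝒟.dualShift (derivedObj (R.obj X) (hR X)) n m h).hom.hom ≫ (shiftObj _ m).hom := by
    rw [h₁₀]
    simp only [Category.assoc]
  constructor
  · intro h' _
    have h₁₃ : Q.map (R.map (𝒟₀.dualShift X n m h).hom) ≫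
      (derivedLiftShift hR (𝒟₀.dual X) m).hom.hom ≫ ((comparison a X).hom⟦m⟧').hom =
        (comparison a (X⟦n⟧)).hom.hom ≫ (𝒟.dualMap (derivedLiftShift hR X n).inv).hom ≫
          (𝒟.dualShift (derivedObj (R.obj X) (hR X)) n m h).hom.hom := congrArg T.ι.map h'
    refine Eq.symm ((cancel_epi (Q.map (complexComparison τ (X⟦n⟧)).hom ≫
        Q.map ((dualComplex V).map (commShiftApp R X n).inv.op))).1
          ((Category.assoc _ _ _).trans (h₉.symm.trans (Eq.trans ?_ h₁₂))))
    simp only [reassoc_of% h₁₃, Category.assoc]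
  · intro h'
    have h₁₃ : Q.map (R.map (𝒟₀.dualShift X n m h).hom) ≫
      (derivedLiftShift hR (𝒟₀.dual X) m).hom.hom ≫ ((comparison a X).hom⟦m⟧').hom =
        (comparison a (X⟦n⟧)).hom.hom ≫ (𝒟.dualMap (derivedLiftShift hR X n).inv).hom ≫
          (𝒟.dualShift (derivedObj (R.obj X) (hR X)) n m h).hom.hom := by
      rw [← cancel_mono (shiftObj (𝒟.dual (derivedObj _ (hR X))) m).hom]
      simp only [Category.assoc] at h₁₂ ⊢
      rw [h₉, h₁₂, h' hn]
    ext : 1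
    exact h₁₃

end

end DerivedDual

/-! ### Kan extensions detected on sufficiently many objects. -/

section KanExtension

variable {C T D : Type*} [Category* C] [Category* T] [Category* D] {L : C ⥤ T} {F : C ⥤ D}
  {E : T ⥤ D} {α : F ⟶ L ⋙ E} {S : ObjectProperty C}

lemma hom_ext_of_isIso_app (h₁ : ∀ X : T, ∃ K, S K ∧ Nonempty (L.obj K ≅ X))
    (h₄ : ∀ K, S K → IsIso (α.app K)) {G : T ⥤ D} {γ γ' : E ⟶ G}
    (h : ∀ K, S K → α.app K ≫ γ.app (L.obj K) = α.app K ≫ γ'.app (L.obj K)) : γ = γ' := by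
  ext X
  obtain ⟨K, hK, ⟨e⟩⟩ := h₁ X
  have := h₄ K hK
  rw [← cancel_epi (E.map e.hom), γ.naturality, γ'.naturality, (cancel_epi (α.app K)).1 (h K hK)]

/-- In the application `C` is opposite to a category of complexes and `S` consists of bounded
complexes of projectives, so that `h₃` provides resolutions. The value of `γ` at `X` is dictated by
`β` at a chosen object of `S` representing `X`, since `α` is invertible there. -/
lemma exists_desc_of_isIso_app (h₁ : ∀ X : T, ∃ K, S K ∧ Nonempty (L.obj K ≅ X))
    (h₂ : ∀ K K', S K → S K' → ∀ g : L.obj K ⟶ L.obj K', ∃ f : K ⟶ K', L.map f = g)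
    (h₃ : ∀ K, ∃ K', S K' ∧ ∃ f : K ⟶ K', IsIso (L.map f))
    (h₄ : ∀ K, S K → IsIso (α.app K)) {G : T ⥤ D} (β : F ⟶ L ⋙ G) :
    ∃ γ : E ⟶ G, ∀ K, α.app K ≫ γ.app (L.obj K) = β.app K := by
  choose K hK e using h₁
  let e (X : T) : L.obj (K X) ≅ X := (e X).some
  have (X : T) : IsIso (α.app (K X)) := h₄ _ (hK X)
  let γ : E ⟶ G :=
    { app X := E.map (e X).inv ≫ inv (α.app (K X)) ≫ β.app (K X) ≫ G.map (e X).hom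
      naturality X Y f := by
        obtain ⟨g, hg⟩ := h₂ _ _ (hK X) (hK Y) ((e X).hom ≫ f ≫ (e Y).inv)
        have hg' : f ≫ (e Y).inv = (e X).inv ≫ L.map g := by
          rw [hg, Iso.inv_hom_id_assoc]
        have hg'' : L.map g ≫ (e Y).hom = (e X).hom ≫ f := by
          rw [hg, Category.assoc, Category.assoc, Iso.inv_hom_id, Category.comp_id]
        have h₅ : E.map (L.map g) ≫ inv (α.app (K Y)) = inv (α.app (K X)) ≫ F.map g := by
          rw [IsIso.comp_inv_eq, Category.assoc, α.naturality, IsIso.inv_hom_id_assoc]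
          rfl
        have h₆ : F.map g ≫ β.app (K Y) = β.app (K X) ≫ G.map (L.map g) := β.naturality g
        rw [← E.map_comp_assoc, hg', E.map_comp_assoc, reassoc_of% h₅, reassoc_of% h₆,
          ← G.map_comp, hg'', G.map_comp]
        simp only [Category.assoc] }
  -- For `K'` in `S` the choice of representative does not matter: by `h₂` the identification of the
  -- chosen one with `L K'` lifts to a morphism in `C`.
  have hγ (K' : C) (hK' : S K') : α.app K' ≫ γ.app (L.obj K') = β.app K' := by
    obtain ⟨g, hg⟩ := h₂ _ _ (hK (L.obj K')) hK' (e (L.obj K')).hom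
    have := h₄ K' hK'
    have : IsIso (L.map g) := by rw [hg]; infer_instance
    have h₅ : F.map g ≫ α.app K' = α.app (K (L.obj K')) ≫ E.map (L.map g) := α.naturality g
    have : IsIso (F.map g) := by
      have : IsIso (F.map g ≫ α.app K') := by rw [h₅]; infer_instance
      exact IsIso.of_isIso_comp_right _ (α.app K')
    have h₆ : F.map g ≫ β.app K' = β.app _ ≫ G.map (L.map g) := β.naturality g
    rw [← cancel_epi (F.map g), h₆, reassoc_of% h₅, hg]
    dsimp only [γ]
    rw [← E.map_comp_assoc, Iso.hom_inv_id, E.map_id, Category.id_comp, IsIso.hom_inv_id_assoc]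
  refine ⟨γ, fun K' ↦ ?_⟩
  -- For general `K'` the equation is checked after mapping to an object of `S` along a morphism
  -- that `L` inverts.
  obtain ⟨K'', hK'', f, hf⟩ := h₃ K'
  have h₅ : F.map f ≫ α.app K'' = α.app K' ≫ E.map (L.map f) := α.naturality f
  have h₆ : F.map f ≫ β.app K'' = β.app K' ≫ G.map (L.map f) := β.naturality f
  rw [← cancel_mono (G.map (L.map f)), Category.assoc, ← γ.naturality, ← reassoc_of% h₅, hγ _ hK'',
    h₆]

/-- A natural transformation is a Kan extension if it is invertible on sufficiently many objects. -/
lemma isLeftKanExtension_of_isIso_app (h₁ : ∀ X : T, ∃ K, S K ∧ Nonempty (L.obj K ≅ X))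
    (h₂ : ∀ K K', S K → S K' → ∀ g : L.obj K ⟶ L.obj K', ∃ f : K ⟶ K', L.map f = g)
    (h₃ : ∀ K, ∃ K', S K' ∧ ∃ f : K ⟶ K', IsIso (L.map f))
    (h₄ : ∀ K, S K → IsIso (α.app K)) : E.IsLeftKanExtension α where
  nonempty_isUniversal := by
    choose γ hγ using fun Y : L.LeftExtension F ↦ exists_desc_of_isIso_app h₁ h₂ h₃ h₄ Y.hom
    exact ⟨IsInitial.ofUniqueHom
      (fun Y ↦ StructuredArrow.homMk (γ Y) (NatTrans.ext (funext fun K ↦ hγ Y K)))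
      (fun Y f ↦ StructuredArrow.hom_ext _ _ (hom_ext_of_isIso_app h₁ h₄ fun K _ ↦
        (NatTrans.congr_app (StructuredArrow.w f) K).trans (hγ Y K).symm))⟩

/-- Two Kan extensions of `F` along `L` are isomorphic compatibly with their units, so invertibility
of the unit at `K` does not depend on the choice. -/
lemma isIso_app_of_isLeftKanExtension {E' : T ⥤ D} {α' : F ⟶ L ⋙ E'} [E.IsLeftKanExtension α]
    [E'.IsLeftKanExtension α'] (K : C) [IsIso (α.app K)] : IsIso (α'.app K) := by
  have h := E.descOfIsLeftKanExtension_fac_app α E' α' K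
  have : IsIso (E.descOfIsLeftKanExtension α E' α') :=
    (Functor.isLeftKanExtension_iff_isIso _ α α'
      (NatTrans.ext (funext (E.descOfIsLeftKanExtension_fac_app α E' α')))).1 inferInstance
  rw [← h]
  infer_instance

end KanExtension

lemma commShift_of_whiskerRight {C D E : Type*} [Category* C] [Category* D] [Category* E]
    [HasShift C ℤ] [HasShift D ℤ] [HasShift E ℤ] {F F' : C ⥤ D} {G : D ⥤ E} [F.CommShift ℤ]
    [F'.CommShift ℤ] [G.CommShift ℤ] [G.Faithful] (τ : F ⟶ F')
    [NatTrans.CommShift (Functor.whiskerRight τ G) ℤ] : NatTrans.CommShift τ ℤ := ⟨fun n ↦ by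
  ext X
  have h := NatTrans.shift_app_comm (Functor.whiskerRight τ G) n X
  simp only [Functor.commShiftIso_comp_hom_app, Functor.whiskerRight_app, Category.assoc] at h
  have h' : G.map ((F.commShiftIso n).hom.app X ≫ (τ.app X)⟦n⟧') =
      G.map (τ.app (X⟦n⟧) ≫ (F'.commShiftIso n).hom.app X) := by
    rw [← cancel_mono ((G.commShiftIso n).hom.app _), G.map_comp, G.map_comp, Category.assoc,
      Category.assoc, ← h]
    simp
  exact G.map_injective h'⟩

lemma eq_comp_of_id {C : Type*} [Category* C] {X Y : C} (f : X ⟶ Y) {i j : X ⟶ X} {k : Y ⟶ Y}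
    (hi : i = 𝟙 X) (hj : j = 𝟙 X) (hk : k = 𝟙 Y) : f = (i ≫ j ≫ f) ≫ k := by
  simp [hi, hj, hk]

lemma comp_comp_eq_comp_comp {C : Type*} [Category* C] {X₁ X₂ X₃ Y₁ Y₂ Y₃ : C} {a : X₁ ⟶ Y₁}
    {b : X₂ ⟶ Y₂} {c : X₃ ⟶ Y₃} {i : X₁ ⟶ X₂} {j : X₂ ⟶ X₃} {i' : Y₁ ⟶ Y₂} {j' : Y₂ ⟶ Y₃}
    (h₁ : a ≫ i' = i ≫ b) (h₂ : b ≫ j' = j ≫ c) : a ≫ i' ≫ j' = (i ≫ j) ≫ c := by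
  rw [reassoc_of% h₁, h₂, Category.assoc]

/-- This is `exists_transport` for a functor instead of an equivalence. The quasi-inverse receives
its commutation with shifts from `F`, and the instances are explicit so that the given structure on
`F` is the one used. -/
lemma exists_transport_functor {K₁ K₂ : Type*} [Category* K₁] [Preadditive K₁] [HasShift K₁ ℤ]
    [Category* K₂] [Preadditive K₂] [HasShift K₂ ℤ] (𝒟₁ : DualityData K₁) (F : K₁ ⥤ K₂)
    [hF : F.CommShift ℤ] [hF' : F.Additive] [F.IsEquivalence] :
    ∃ (𝒟₂ : DualityData K₂) (ζ : 𝒟₁.D ⋙ F ≅ F.op ⋙ 𝒟₂.D), ComparisonShift F ζ ∧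
      ComparisonBidual ζ := by
  have : F.asEquivalence.functor.Additive := hF'
  exact @exists_transport _ _ _ _ _ _ _ _ 𝒟₁ F.asEquivalence hF
    (@Equivalence.commShiftInverse _ _ _ _ F.asEquivalence ℤ _ _ _ hF)
    (@Equivalence.commShift_of_functor _ _ _ _ F.asEquivalence ℤ _ _ _ hF) this

/-! ### The derived duality on the bounded homotopy category of projectives. -/

section DerivedEquivalence

universe w v u v' u'

variable {A : Type u} [Category.{v} A] [Abelian A] [HasDerivedCategory.{w} A]
  {V : Aᵒᵖ ⥤ A} [V.Additive] {e : 𝟭 A ⟶ V.rightOp ⋙ V}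
  {B : Type u'} [Category.{v'} B] [Preadditive B] [HasZeroObject B] [HasBinaryBiproducts B]
  {W : Bᵒᵖ ⥤ B} [W.Additive] {e' : 𝟭 B ⟶ W.rightOp ⋙ W}
  {H : B ⥤ A} [H.Additive] [H.Full] [H.Faithful] {θ : W ⋙ H ≅ H.op ⋙ V}
  {T : ObjectProperty (DerivedCategory A)}

open DerivedCategory

variable (H) in
/-- The functor from bounded complexes induced by an additive functor. -/
abbrev boundedMap : (boundedCochain B).FullSubcategory ⥤ CochainComplex A ℤ :=
  (boundedCochain B).ι ⋙ H.mapHomologicalComplex (ComplexShape.up ℤ)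

variable (e e' θ) in
/-- The comparison of the dualities on bounded complexes and on complexes. -/
def boundedMapComparison : (boundedCochainDuality W e').D ⋙ boundedMap H ≅
    (boundedMap H).op ⋙ (complexDuality V e).D :=
  compComparison (restrictComparison _ _ _) (mapComplexComparison θ e e')

lemma boundedMapComparison_shift :
    ComparisonShift (boundedMap H) (boundedMapComparison e e' θ) :=
  (restrictComparison_shift _ _ _).comp (mapComplexComparison_shift θ e e')

lemma boundedMapComparison_bidual
    (hθ : ∀ X, H.map (bidualApp e' X) ≫ θ.hom.app (op (W.obj (op X))) =
      bidualApp e (H.obj X) ≫ V.map (θ.hom.app (op X)).op) :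
    ComparisonBidual (boundedMapComparison e e' θ) :=
  (restrictComparison_bidual _ _ _).comp (mapComplexComparison_bidual hθ)

/-- A morphism to the derived category from a bounded complex of projectives comes from a morphism
of complexes. -/
lemma exists_map_Q_eq (hH : ∀ b, Projective (H.obj b)) (P : (boundedCochain B).FullSubcategory)
    {L : CochainComplex A ℤ} (g : Q.obj ((boundedMap H).obj P) ⟶ Q.obj L) :
    ∃ f : (boundedMap H).obj P ⟶ L, Q.map f = g := by
  obtain ⟨f, hf⟩ := (map_Qh_bijective hH ((boundedQuotient B).obj P)
    ((HomotopyCategory.quotient _ _).obj L)).surjective g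
  obtain ⟨f, rfl⟩ := (HomotopyCategory.quotient _ _).map_surjective f
  exact ⟨f, hf⟩

omit [H.Full] [H.Faithful] in
variable (V) in
/-- The termwise dual is compatible with equality in the derived category of morphisms from a
bounded complex of projectives. -/
lemma map_dual_eq (hH : ∀ b, Projective (H.obj b)) (P : (boundedCochain B).FullSubcategory)
    {L : CochainComplex A ℤ} {f g : (boundedMap H).obj P ⟶ L} (h : Q.map f = Q.map g) :
    Q.map ((dualComplex V).map f.op) = Q.map ((dualComplex V).map g.op) :=
  -- The source is K-projective, so morphisms that agree in the derived category are homotopic, and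
  -- the termwise dual preserves homotopies although it need not preserve quasi-isomorphisms.
  congrArg (fun k ↦ Qh.map ((dualHomotopy V).map (Quiver.Hom.op k)))
    ((map_Qh_bijective hH ((boundedQuotient B).obj P)
      ((HomotopyCategory.quotient _ _).obj L)).injective
        (a₁ := (HomotopyCategory.quotient _ _).map f) (a₂ := (HomotopyCategory.quotient _ _).map g) h)

variable [T.IsTriangulated] [T.IsClosedUnderIsomorphisms] (hT : ∀ P, T ((boundedToDerived H).obj P))

/-- The functor from the bounded homotopy category to a full subcategory of the derived category. -/
abbrev boundedLift : BoundedHomotopyCategory B ⥤ T.FullSubcategory := T.lift (boundedToDerived H) hT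

omit [H.Full] [H.Faithful] in
include hT in
lemma boundedMap_mem (P : (boundedCochain B).FullSubcategory) : T ((boundedMap H ⋙ Q).obj P) :=
  hT ((boundedQuotient B).obj P)

omit [H.Full] [H.Faithful] in
variable (H) in
/-- The two functors from bounded complexes to the derived category agree. -/
def boundedMapQIso : boundedQuotient B ⋙ boundedToDerived H ≅ boundedMap H ⋙ Q :=
  (Functor.associator _ _ _).symm ≪≫
    Functor.isoWhiskerRight ((boundedComplexes B).liftCompιIso _ (boundedComplexes_quotient B)) _ ≪≫
    Functor.associator _ _ _ ≪≫
    Functor.isoWhiskerLeft (boundedCochain B).ι ((Functor.associator _ _ _).symm ≪≫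
      Functor.isoWhiskerRight (H.mapHomotopyCategoryFactors (ComplexShape.up ℤ)) Qh ≪≫
      Functor.associator _ _ _ ≪≫
      Functor.isoWhiskerLeft (H.mapHomologicalComplex _) (quotientCompQhIso A)) ≪≫
    (Functor.associator _ _ _).symm

instance : NatTrans.CommShift (boundedMapQIso H).hom ℤ := by
  dsimp only [boundedMapQIso, Iso.trans_hom, Functor.isoWhiskerRight_hom,
    Functor.isoWhiskerLeft_hom]
  infer_instance

/-- The two functors from bounded complexes to the subcategory of the derived category agree. -/
def boundedLiftIso : boundedQuotient B ⋙ boundedLift hT ≅ derivedLift (boundedMap_mem hT) :=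
  NatIso.ofComponents (fun P ↦ T.isoMk ((boundedMapQIso H).app P)) (fun {P P'} f ↦ by
    ext
    exact (boundedMapQIso H).hom.naturality f)

instance : NatTrans.CommShift (boundedLiftIso hT).hom ℤ := by
  have : NatTrans.CommShift (Functor.whiskerRight (boundedLiftIso hT).hom T.ι) ℤ := by
    have : Functor.whiskerRight (boundedLiftIso hT).hom T.ι =
        ((Functor.associator _ _ _).hom ≫
          Functor.whiskerLeft _ (T.liftCompιIso (boundedToDerived H) hT).hom ≫
          (boundedMapQIso H).hom) ≫
          (T.liftCompιIso (boundedMap H ⋙ Q) (boundedMap_mem hT)).inv := by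
      ext P
      exact eq_comp_of_id (boundedMapQIso H |>.hom.app P) rfl rfl rfl
    rw [this]
    infer_instance
  exact commShift_of_whiskerRight (G := T.ι) _

variable {hT} {𝒟 : DualityData T.FullSubcategory}

/-- A comparison on bounded complexes induces a comparison on the bounded homotopy category. -/
def comparisonOfComplexes
    (a : (boundedCochainDuality W e').D ⋙ derivedLift (boundedMap_mem hT) ≅
      (derivedLift (boundedMap_mem hT)).op ⋙ 𝒟.D) :
    (boundedHomotopyDuality W e').D ⋙ boundedLift hT ≅ (boundedLift hT).op ⋙ 𝒟.D :=
  NatIso.ofComponents (fun X ↦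
      (boundedLiftIso hT).app ((boundedCochainDuality W e').dual ⟨X.unop.obj.as, X.unop.property⟩)
        ≪≫ comparison a ⟨X.unop.obj.as, X.unop.property⟩ ≪≫
        𝒟.D.mapIso ((boundedLiftIso hT).app ⟨X.unop.obj.as, X.unop.property⟩).op)
    (fun {X Y} f ↦ by
      obtain ⟨⟨⟨X⟩, hX⟩⟩ := X
      obtain ⟨⟨⟨Y⟩, hY⟩⟩ := Y
      obtain ⟨f', hf⟩ := (HomotopyCategory.quotient _ _).map_surjective f.unop.hom
      let F : (⟨Y, hY⟩ : (boundedCochain B).FullSubcategory) ⟶ ⟨X, hX⟩ := ObjectProperty.homMk f'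
      obtain rfl : ((boundedQuotient B).map F).op = f :=
        Quiver.Hom.unop_inj (ObjectProperty.hom_ext _ hf)
      have h := congrArg 𝒟.dualMap ((boundedLiftIso hT).hom.naturality F)
      rw [dualMap_comp, dualMap_comp] at h
      exact paste_squares ((boundedLiftIso hT).hom.naturality
        ((boundedCochainDuality W e').dualMap F)) (comparison_naturality a F) h.symm)

lemma comparisonOfComplexes_comp
    (a : (boundedCochainDuality W e').D ⋙ derivedLift (boundedMap_mem hT) ≅
      (derivedLift (boundedMap_mem hT)).op ⋙ 𝒟.D) (P : (boundedCochain B).FullSubcategory) :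
    (comparison (compComparison (boundedQuotientComparison W e') (comparisonOfComplexes a)) P).hom =
      (boundedLiftIso hT).hom.app _ ≫ (comparison a P).hom ≫
        𝒟.dualMap ((boundedLiftIso hT).hom.app P) :=
  (congrArg (· ≫ _) (CategoryTheory.Functor.map_id (boundedLift hT) _)).trans (Category.id_comp _)

/-- The comparison induced by a canonical morphism to the derived dual that is invertible on bounded
complexes of projectives. -/
def derivedComparison (θ : W ⋙ H ≅ H.op ⋙ V) (α : derivedDual V T ⟶ (derivedQ T).op ⋙ 𝒟.D ⋙ T.ι)
    (hα : ∀ P, IsIso (toDerivedDual α ((boundedMap H).obj P) (boundedMap_mem hT P))) :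
    (boundedCochainDuality W e').D ⋙ derivedLift (boundedMap_mem hT) ≅
      (derivedLift (boundedMap_mem hT)).op ⋙ 𝒟.D :=
  NatIso.ofComponents (fun P ↦ T.isoMk (Q.mapIso (complexComparison
      (boundedMapComparison e e' θ) P.unop) ≪≫ asIso (toDerivedDual α _ (boundedMap_mem hT P.unop))))
    (fun {P P'} f ↦ by
      have h₁ := congrArg Q.map (comparison_naturality (boundedMapComparison e e' θ) f.unop)
      rw [Functor.map_comp, Functor.map_comp] at h₁
      have h₂ := toDerivedDual_naturality α ((boundedMap H).map f.unop) (boundedMap_mem hT _)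
        (boundedMap_mem hT _)
      ext
      exact comp_comp_eq_comp_comp h₁ h₂)

/-- Compatibility is verified on bounded complexes, where the comparison is explicit, and descends
along the essentially surjective functor to the bounded homotopy category. -/
lemma exists_comparison_of_isIso (hθ : ∀ X, H.map (bidualApp e' X) ≫ θ.hom.app (op (W.obj (op X))) =
      bidualApp e (H.obj X) ≫ V.map (θ.hom.app (op X)).op)
    (α : derivedDual V T ⟶ (derivedQ T).op ⋙ 𝒟.D ⋙ T.ι)
    (hα : ∀ P, IsIso (toDerivedDual α ((boundedMap H).obj P) (boundedMap_mem hT P)))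
    (hα₁ : ∀ K hK n m h, DerivedShiftAt α K hK n m h) (hα₂ : ∀ K hK, DerivedBidualAt e α K hK) :
    ∃ ζ : (boundedHomotopyDuality W e').D ⋙ boundedLift hT ≅ (boundedLift hT).op ⋙ 𝒟.D,
      ComparisonShift (boundedLift hT) ζ ∧ ComparisonBidual ζ := by
  let a := derivedComparison (hT := hT) (e := e) (e' := e') θ α hα
  have ha : IsDerivedComparison α (boundedMapComparison e e' θ) a := fun P ↦ rfl
  have h₁ : ComparisonShift _ a := fun P n m h ↦
    (shift_iff_derivedShiftAt boundedMapComparison_shift ha P n m h).2 (hα₁ _ _ n m h)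
  have h₂ : ComparisonBidual a := fun P ↦
    (bidual_iff_derivedBidualAt (boundedMapComparison_bidual hθ) ha P).2 (hα₂ _ _)
  exact ⟨comparisonOfComplexes a,
    (boundedQuotientComparison_shift W e').of_comp_essSurj
      (h₁.of_iso (boundedLiftIso hT) (comparisonOfComplexes_comp a)),
    (boundedQuotientComparison_bidual W e').of_comp_essSurj
      (h₂.of_iso (boundedLiftIso hT) (comparisonOfComplexes_comp a))⟩

omit [H.Full] [H.Faithful] in
/-- A comparison on the bounded homotopy category induces a comparison on bounded complexes. -/
def comparisonOfHomotopy
    (ζ : (boundedHomotopyDuality W e').D ⋙ boundedLift hT ≅ (boundedLift hT).op ⋙ 𝒟.D) :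
    (boundedCochainDuality W e').D ⋙ derivedLift (boundedMap_mem hT) ≅
      (derivedLift (boundedMap_mem hT)).op ⋙ 𝒟.D :=
  Functor.isoWhiskerLeft _ (boundedLiftIso hT).symm ≪≫
    compComparison (boundedQuotientComparison W e') ζ ≪≫
    Functor.isoWhiskerRight (NatIso.op (boundedLiftIso hT)).symm 𝒟.D

/-- Every complex whose image lies in the subcategory has a resolution by a bounded complex of
projectives. -/
lemma exists_resolution (hH : ∀ b, Projective (H.obj b))
    (hT' : ∀ X, T X → ∃ P, Nonempty ((boundedToDerived H).obj P ≅ X)) (K : CochainComplex A ℤ)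
    (hK : T (Q.obj K)) :
    ∃ (P : (boundedCochain B).FullSubcategory) (f : (boundedMap H).obj P ⟶ K), IsIso (Q.map f) := by
  obtain ⟨P, ⟨i⟩⟩ := hT' _ hK
  obtain ⟨⟨P⟩, hP⟩ := P
  obtain ⟨f, hf⟩ := exists_map_Q_eq hH ⟨P, hP⟩ i.hom
  exact ⟨⟨P, hP⟩, f, by rw [hf]; exact i.isIso_hom⟩

/-- The criterion for Kan extensions asks that every object has a resolution, that morphisms between
resolutions come from complexes, that every complex receives a quasi-isomorphism from a resolution,
and that `α` is invertible on resolutions. -/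
lemma isLeftKanExtension_of_isIso (hH : ∀ b, Projective (H.obj b))
    (hT : ∀ P, T ((boundedToDerived H).obj P))
    (hT' : ∀ X, T X → ∃ P, Nonempty ((boundedToDerived H).obj P ≅ X))
    {𝒟 : DualityData T.FullSubcategory} (α : derivedDual V T ⟶ (derivedQ T).op ⋙ 𝒟.D ⋙ T.ι)
    (hα : ∀ P, IsIso (toDerivedDual α ((boundedMap H).obj P) (boundedMap_mem hT P))) :
    (𝒟.D ⋙ T.ι).IsLeftKanExtension α := by
  have h₃ (K) (hK : T (Q.obj K)) := exists_resolution (B := B) hH hT' K hK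
  refine isLeftKanExtension_of_isIso_app (S := fun K ↦
    ∃ P, K = op ⟨(boundedMap H).obj P, boundedMap_mem hT P⟩) ?_ ?_ ?_ ?_
  · rintro ⟨X⟩
    obtain ⟨⟨⟨P⟩, hP⟩, ⟨i⟩⟩ := hT' _ X.property
    have j : derivedObj ((boundedMap H).obj ⟨P, hP⟩) (boundedMap_mem hT _) ≅ X := T.isoMk i
    exact ⟨_, ⟨⟨P, hP⟩, rfl⟩, ⟨j.symm.op⟩⟩
  · rintro _ _ ⟨P, rfl⟩ ⟨P', rfl⟩ g
    obtain ⟨f, hf⟩ := exists_map_Q_eq hH P' g.unop.hom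
    exact ⟨Quiver.Hom.op (ObjectProperty.homMk f), Quiver.Hom.unop_inj (ObjectProperty.hom_ext _ hf)⟩
  · rintro ⟨K⟩
    obtain ⟨P, f, hf⟩ := h₃ K.obj K.property
    refine ⟨_, ⟨P, rfl⟩, Quiver.Hom.op (ObjectProperty.homMk f), ?_⟩
    have := isIso_derivedMap f (boundedMap_mem hT P) K.property
    exact inferInstanceAs (IsIso (Quiver.Hom.op (derivedMap f (boundedMap_mem hT P) K.property)))
  · rintro _ ⟨P, rfl⟩
    exact hα P

/-- A comparison on bounded complexes of projectives extends to a canonical morphism to the derived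
dual. -/
lemma exists_toDerivedDual (hH : ∀ b, Projective (H.obj b))
    (hT' : ∀ X, T X → ∃ P, Nonempty ((boundedToDerived H).obj P ≅ X))
    (τ : (boundedCochainDuality W e').D ⋙ boundedMap H ≅
      (boundedMap H).op ⋙ (complexDuality V e).D)
    (a : (boundedCochainDuality W e').D ⋙ derivedLift (boundedMap_mem hT) ≅
      (derivedLift (boundedMap_mem hT)).op ⋙ 𝒟.D) :
    ∃ α : derivedDual V T ⟶ (derivedQ T).op ⋙ 𝒟.D ⋙ T.ι, IsDerivedComparison α τ a := by
  -- On complexes of projectives `α` is forced by the requirement that `τ` followed by `α` be `a`.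
  let β (P : (boundedCochain B).FullSubcategory) : Q.obj ((dualComplex V).obj (op ((boundedMap H).obj P))) ⟶
      (𝒟.dual (derivedObj ((boundedMap H).obj P) (boundedMap_mem hT P))).obj :=
    Q.map (complexComparison τ P).inv ≫ (comparison a P).hom.hom
  have hβ {P P' : (boundedCochain B).FullSubcategory} (g : (boundedMap H).obj P ⟶ (boundedMap H).obj P') :
      Q.map ((dualComplex V).map g.op) ≫ β P =
        β P' ≫ (𝒟.dualMap (derivedMap g (boundedMap_mem hT P) (boundedMap_mem hT P'))).hom := by
    obtain ⟨f, hf⟩ := (boundedMap H).map_surjective g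
    obtain ⟨r, hr⟩ : ∃ r, r = (boundedMap H).map ((boundedCochainDuality W e').dualMap f) :=
      ⟨_, rfl⟩
    have h₁ : r ≫ (complexComparison τ P).hom = (complexComparison τ P').hom ≫
        (dualComplex V).map g.op := by
      subst hr hf
      exact comparison_naturality τ f
    have h₂ : Q.map r ≫ (comparison a P).hom.hom = (comparison a P').hom.hom ≫ (𝒟.dualMap
        (derivedMap g (boundedMap_mem hT P) (boundedMap_mem hT P'))).hom := by
      subst hr hf
      exact congrArg T.ι.map (comparison_naturality a f)
    have h₃ := congrArg Q.map h₁
    rw [Q.map_comp, Q.map_comp] at h₃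
    have h₄ : Q.map (complexComparison τ P).hom ≫ Q.map (complexComparison τ P).inv = 𝟙 _ := by
      rw [← Q.map_comp, Iso.hom_inv_id, Q.map_id]
    have h₅ : Q.map (complexComparison τ P').hom ≫ Q.map (complexComparison τ P').inv = 𝟙 _ := by
      rw [← Q.map_comp, Iso.hom_inv_id, Q.map_id]
    dsimp only [β]
    rw [← cancel_epi (Q.map (complexComparison τ P').hom), ← reassoc_of% h₃, reassoc_of% h₄, h₂,
      Category.assoc, reassoc_of% h₅]
  choose P f hf using exists_resolution (B := B) hH hT'
  have hf' (K) (hK : T (Q.obj K)) : IsIso (𝒟.dualMap (derivedMap (f K hK) (boundedMap_mem hT (P K hK)) hK)).hom := by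
    have := isIso_derivedMap (f K hK) (boundedMap_mem hT (P K hK)) hK
    exact isIso_hom _
  -- Naturality for arbitrary resolutions of source and target. The morphism `k` lifts to some `g`
  -- between the resolutions, but the square commutes only in the derived category; `map_dual_eq`
  -- ensures that the dual square commutes there as well.
  have hV {K L : CochainComplex A ℤ} (k : K ⟶ L) (hK : T (Q.obj K)) (hL : T (Q.obj L))
      {P P' : (boundedCochain B).FullSubcategory} (f : (boundedMap H).obj P ⟶ K) (f' : (boundedMap H).obj P' ⟶ L)
      [IsIso (Q.map f')] [IsIso (𝒟.dualMap (derivedMap f (boundedMap_mem hT P) hK)).hom]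
      [IsIso (𝒟.dualMap (derivedMap f' (boundedMap_mem hT P') hL)).hom] :
      Q.map ((dualComplex V).map k.op) ≫ Q.map ((dualComplex V).map f.op) ≫ β P ≫
        inv (𝒟.dualMap (derivedMap f (boundedMap_mem hT P) hK)).hom =
      (Q.map ((dualComplex V).map f'.op) ≫ β P' ≫
        inv (𝒟.dualMap (derivedMap f' (boundedMap_mem hT P') hL)).hom) ≫ (𝒟.dualMap (derivedMap k hK hL)).hom := by
    obtain ⟨g, hg⟩ := exists_map_Q_eq hH P (Q.map f ≫ Q.map k ≫ inv (Q.map f'))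
    have h₁ : Q.map (f ≫ k) = Q.map (g ≫ f') := by
      rw [Q.map_comp, Q.map_comp, hg, Category.assoc, Category.assoc, IsIso.inv_hom_id,
        Category.comp_id]
    have h₂ : Q.map ((dualComplex V).map k.op) ≫ Q.map ((dualComplex V).map f.op) =
        Q.map ((dualComplex V).map f'.op) ≫ Q.map ((dualComplex V).map g.op) := by
      rw [← Q.map_comp, ← Q.map_comp, ← Functor.map_comp, ← Functor.map_comp, ← op_comp, ← op_comp]
      exact map_dual_eq V hH P h₁
    have h₃ : derivedMap f (boundedMap_mem hT P) hK ≫ derivedMap k hK hL =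
        derivedMap g (boundedMap_mem hT P) (boundedMap_mem hT P') ≫
          derivedMap f' (boundedMap_mem hT P') hL := by
      ext : 1
      exact (Q.map_comp _ _).symm.trans (h₁.trans (Q.map_comp _ _))
    have h₄ := congrArg (fun k ↦ (𝒟.dualMap k).hom) h₃
    simp only [dualMap_comp, ObjectProperty.FullSubcategory.comp_hom] at h₄
    rw [← Category.assoc, ← Category.assoc, IsIso.comp_inv_eq, h₂]
    simp only [Category.assoc]
    rw [h₄, IsIso.inv_hom_id_assoc, hβ]
  let γ (K) (hK : T (Q.obj K)) : Q.obj ((dualComplex V).obj (op K)) ⟶ (𝒟.dual (derivedObj K hK)).obj :=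
    Q.map ((dualComplex V).map (f K hK).op) ≫ β _ ≫
      inv (𝒟.dualMap (derivedMap (f K hK) (boundedMap_mem hT _) hK)).hom
  refine ⟨{
    app K := γ K.unop.obj K.unop.property
    naturality K L k :=
      have := hf K.unop.obj K.unop.property
      have := hf' K.unop.obj K.unop.property
      have := hf' L.unop.obj L.unop.property
      hV k.unop.hom L.unop.property K.unop.property _ _ }, fun P' ↦ ?_⟩
  -- The resolution chosen for a complex of projectives need not be the identity; `hβ` absorbs the
  -- difference.
  have h₁ : γ _ (boundedMap_mem hT P') = β P' := by
    dsimp only [γ]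
    rw [← Category.assoc, IsIso.comp_inv_eq]
    exact hβ _
  have h₂ : (comparison a P').hom.hom = Q.map (complexComparison τ P').hom ≫ β P' := by
    dsimp only [β]
    rw [← Q.map_comp_assoc, Iso.hom_inv_id, Q.map_id, Category.id_comp]
  exact h₂.trans (congrArg _ h₁.symm)

variable (hT) in
-- Full faithfulness comes from K-projectivity, essential surjectivity from `hT'`.
lemma boundedLift_isEquivalence (hH : ∀ b, Projective (H.obj b))
    (hT' : ∀ X, T X → ∃ P, Nonempty ((boundedToDerived H).obj P ≅ X)) :
    (boundedLift hT).IsEquivalence := by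
  have := boundedToDerived_faithful H hH
  have := boundedToDerived_full H hH
  have : (boundedLift hT).EssSurj := ⟨fun X ↦ by
    obtain ⟨P, ⟨i⟩⟩ := hT' _ X.property
    exact ⟨P, ⟨T.isoMk i⟩⟩⟩
  exact { }

variable (hT) in
/-- The total right derived functor of a duality exists if the duality is represented by bounded
complexes of projectives. -/
lemma exists_derivedDuality (hH : ∀ b, Projective (H.obj b))
    (hT' : ∀ X, T X → ∃ P, Nonempty ((boundedToDerived H).obj P ≅ X))
    (hθ : ∀ X, H.map (bidualApp e' X) ≫ θ.hom.app (op (W.obj (op X))) =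
      bidualApp e (H.obj X) ≫ V.map (θ.hom.app (op X)).op) :
    ∃ (𝒟 : DualityData T.FullSubcategory) (α : derivedDual V T ⟶ (derivedQ T).op ⋙ 𝒟.D ⋙ T.ι),
      (𝒟.D ⋙ T.ι).IsLeftKanExtension α ∧
      (∀ P, IsIso (toDerivedDual α ((boundedMap H).obj P) (boundedMap_mem hT P))) ∧
      (∀ K hK n m h, DerivedShiftAt α K hK n m h) ∧ ∀ K hK, DerivedBidualAt e α K hK := by
  have := boundedLift_isEquivalence hT hH hT'
  -- The duality of the homotopy category is transported to `T`, and the canonical morphism `α` is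
  -- then built to match it. That the result is a derived functor is a consequence of the
  -- invertibility of `α` on projectives.
  obtain ⟨𝒟, ζ, h₁, h₂⟩ := exists_transport_functor (boundedHomotopyDuality W e') (boundedLift hT)
  let a := comparisonOfHomotopy (hT := hT) ζ
  have ha₁ : ComparisonShift _ a :=
    ((boundedQuotientComparison_shift W e').comp h₁).of_iso (boundedLiftIso hT).symm (fun P ↦ rfl)
  have ha₂ : ComparisonBidual a :=
    ((boundedQuotientComparison_bidual W e').comp h₂).of_iso (boundedLiftIso hT).symm
      (fun P ↦ rfl)
  obtain ⟨α, hα⟩ := exists_toDerivedDual (hT := hT) hH hT' (boundedMapComparison e e' θ) a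
  have hα' (P) : IsIso (toDerivedDual α ((boundedMap H).obj P) (boundedMap_mem hT P)) := by
    have : IsIso (comparison a P).hom.hom := isIso_hom _
    have : IsIso (Q.map (complexComparison (boundedMapComparison e e' θ) P).hom ≫
      toDerivedDual α ((boundedMap H).obj P) (boundedMap_mem hT P)) := by
      rw [← hα P]
      exact this
    exact IsIso.of_isIso_comp_left (Q.map (complexComparison (boundedMapComparison e e' θ) P).hom) _
  refine ⟨𝒟, α, isLeftKanExtension_of_isIso hH hT hT' α hα', hα', fun K hK n m h ↦ ?_,
    fun K hK ↦ ?_⟩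
  -- An arbitrary complex inherits the condition from a resolution, where it is equivalent to the
  -- compatibility of `a`.
  · obtain ⟨P, f, hf⟩ := exists_resolution (B := B) hH hT' K hK
    exact DerivedShiftAt.of_isIso f (hK := boundedMap_mem hT P) hK
      ((shift_iff_derivedShiftAt (hR := boundedMap_mem hT) boundedMapComparison_shift hα P n m h).1 (ha₁ P n m h))
  · obtain ⟨P, f, hf⟩ := exists_resolution (B := B) hH hT' K hK
    exact DerivedBidualAt.of_isIso f (hK := boundedMap_mem hT P) hK (T.prop_of_iso (Q.mapIso (complexComparison
      (boundedMapComparison e e' θ) P)) (boundedMap_mem hT _))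
      ((bidual_iff_derivedBidualAt (hR := boundedMap_mem hT) (boundedMapComparison_bidual hθ) hα P).1 (ha₂ P))

/-- The derived duality is arbitrary here, so invertibility of its `α` on complexes of projectives
is not given. It is inherited from the derived duality of `exists_derivedDuality`, because Kan
extensions are unique. -/
lemma exists_comparison (hH : ∀ b, Projective (H.obj b))
    (hT : ∀ P, T ((boundedToDerived H).obj P))
    (hT' : ∀ X, T X → ∃ P, Nonempty ((boundedToDerived H).obj P ≅ X))
    (hθ : ∀ X, H.map (bidualApp e' X) ≫ θ.hom.app (op (W.obj (op X))) =
      bidualApp e (H.obj X) ≫ V.map (θ.hom.app (op X)).op)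
    (α : derivedDual V T ⟶ (derivedQ T).op ⋙ 𝒟.D ⋙ T.ι) [(𝒟.D ⋙ T.ι).IsLeftKanExtension α]
    (hα₁ : ∀ K hK n m h, DerivedShiftAt α K hK n m h) (hα₂ : ∀ K hK, DerivedBidualAt e α K hK) :
    ∃ ζ : (boundedHomotopyDuality W e').D ⋙ boundedLift hT ≅ (boundedLift hT).op ⋙ 𝒟.D,
      ComparisonShift (boundedLift hT) ζ ∧ ComparisonBidual ζ := by
  obtain ⟨𝒟', α', h, h', -⟩ := exists_derivedDuality hT hH hT' hθ
  refine exists_comparison_of_isIso hθ α (fun P ↦ ?_) hα₁ hα₂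
  have : IsIso (α'.app (op ⟨(boundedMap H).obj P, boundedMap_mem hT P⟩)) := h' P
  exact isIso_app_of_isLeftKanExtension (α := α') _

end DerivedEquivalence

end

/-! ### The étale site of `Spec ℝ` and Galois descent along `Spec ℂ`. -/

section Point

lemma etale_specComplex : Etale (Spec.map (CommRingCat.ofHom (algebraMap ℝ ℂ))) := by
  rw [HasRingHomProperty.Spec_iff (P := @Etale)]
  have : Algebra.FormallyEtale ℝ ℂ := Algebra.FormallyEtale.of_isSeparable ℝ ℂ
  have : Algebra.FinitePresentation ℝ ℂ := Algebra.FinitePresentation.of_finiteType.1 inferInstance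
  have : Algebra.Etale ℝ ℂ := { }
  exact (RingHom.etale_algebraMap (R := ℝ) (S := ℂ)).2 this

/-- The étale `ℝ`-scheme `Spec ℂ`. -/
def etComplex : SpecReal.Etale :=
  have := etale_specComplex
  Scheme.Etale.mk (Spec.map (CommRingCat.ofHom (algebraMap ℝ ℂ)))

/-- Geometric points of an étale `ℝ`-scheme are morphisms from `Spec ℂ`. -/
def pointEquiv (U : SpecReal.Etale) : (etComplex ⟶ U) ≃ geometricPoint.fiber.obj U :=
  (Scheme.Etale.forgetFullyFaithful SpecReal).homEquiv

lemma pointEquiv_comp {U V : SpecReal.Etale} (x : etComplex ⟶ U) (f : U ⟶ V) :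
    pointEquiv V (x ≫ f) = geometricPoint.fiber.map f (pointEquiv U x) := rfl

/-- The automorphism of `Spec ℂ` given by an element of the Galois group. -/
def galoisHom (σ : ℂ ≃ₐ[ℝ] ℂ) : etComplex ⟶ etComplex :=
  (pointEquiv etComplex).symm
    ((pointHom σ).hom.app etComplex (pointEquiv etComplex (𝟙 etComplex)))

/-- By naturality the action on geometric points is determined by its effect on the identity of
`Spec ℂ`, hence it is precomposition. -/
lemma pointHom_app (σ : ℂ ≃ₐ[ℝ] ℂ) (U : SpecReal.Etale) (x : etComplex ⟶ U) :
    (pointHom σ).hom.app U (pointEquiv U x) = pointEquiv U (galoisHom σ ≫ x) := by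
  rw [pointEquiv_comp, galoisHom, Equiv.apply_symm_apply]
  have h := congrArg (fun f ↦ f (pointEquiv etComplex (𝟙 etComplex)))
    ((pointHom σ).hom.naturality x)
  refine Eq.trans ?_ h
  change _ = (pointHom σ).hom.app U (geometricPoint.fiber.map x (pointEquiv _ (𝟙 _)))
  rw [← pointEquiv_comp, Category.id_comp]

lemma galoisHom_one : galoisHom 1 = 𝟙 _ := by
  rw [galoisHom, pointHom_one]
  exact Equiv.symm_apply_apply _ _

lemma galoisHom_mul (σ τ : ℂ ≃ₐ[ℝ] ℂ) : galoisHom (σ * τ) = galoisHom σ ≫ galoisHom τ := by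
  apply (pointEquiv _).injective
  rw [← pointHom_app, galoisHom, Equiv.apply_symm_apply, pointHom_mul]
  exact congrArg ((pointHom σ).hom.app etComplex)
    (Equiv.apply_symm_apply (pointEquiv etComplex) _).symm

lemma toGalois_surjective : Function.Surjective toGalois := by
  intro σ
  rcases Complex.real_algHom_eq_id_or_conj (σ : ℂ →ₐ[ℝ] ℂ) with h | h
  · refine ⟨1, ?_⟩
    rw [map_one]
    ext z
    exact (DFunLike.congr_fun h z).symm
  · refine ⟨C₂.generator, ?_⟩
    rw [toGalois_generator]
    ext z
    exact (DFunLike.congr_fun h z).symm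

lemma galoisHom_injective : Function.Injective galoisHom := by
  intro σ τ h
  have h₁ := congrArg (fun f ↦ (pointEquiv etComplex f).left) h
  simp only [galoisHom, Equiv.apply_symm_apply] at h₁
  have h₂ : Spec.map (CommRingCat.ofHom (σ : ℂ →+* ℂ)) = Spec.map (CommRingCat.ofHom (τ : ℂ →+* ℂ)) :=
    (Category.comp_id _).symm.trans (h₁.trans (Category.comp_id _))
  ext z
  exact congrArg (fun k ↦ k.hom z) (Spec.map_injective h₂)

/-- An endomorphism of `Spec ℂ` over `ℝ` is an `ℝ`-algebra endomorphism of `ℂ`, that is, the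
identity or conjugation. -/
lemma galoisHom_surjective : Function.Surjective galoisHom := by
  intro f
  obtain ⟨φ, hφ⟩ := Spec.map_surjective (pointEquiv etComplex f).left
  have h₁ : CommRingCat.ofHom (algebraMap ℝ ℂ) ≫ φ = CommRingCat.ofHom (algebraMap ℝ ℂ) := by
    apply Spec.map_injective
    rw [Spec.map_comp, hφ]
    exact Over.w (pointEquiv etComplex f)
  let φ' : ℂ →ₐ[ℝ] ℂ :=
    { φ.hom with commutes' := fun r ↦ congrArg (fun k ↦ k.hom r) h₁ }
  obtain ⟨σ, hσ⟩ : ∃ σ : ℂ ≃ₐ[ℝ] ℂ, (σ : ℂ →ₐ[ℝ] ℂ) = φ' := by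
    rcases Complex.real_algHom_eq_id_or_conj φ' with h | h
    · exact ⟨AlgEquiv.refl, h.symm⟩
    · exact ⟨Complex.conjAe, h.symm⟩
  have h₂ : CommRingCat.ofHom (σ : ℂ →+* ℂ) = φ := by
    ext z
    exact DFunLike.congr_fun hσ z
  refine ⟨σ, (pointEquiv etComplex).injective (Over.OverMorphism.ext ?_)⟩
  rw [galoisHom, Equiv.apply_symm_apply, ← hφ, ← h₂]
  exact Category.comp_id _

lemma exists_toGalois_eq (f : etComplex ⟶ etComplex) : ∃ g : C₂, galoisHom (toGalois g) = f := by
  obtain ⟨σ, rfl⟩ := galoisHom_surjective f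
  obtain ⟨g, rfl⟩ := toGalois_surjective σ
  exact ⟨g, rfl⟩

lemma isIso_etComplex (f : etComplex ⟶ etComplex) : IsIso f := by
  obtain ⟨σ, rfl⟩ := galoisHom_surjective f
  exact ⟨galoisHom σ⁻¹, by rw [← galoisHom_mul, mul_inv_cancel, galoisHom_one],
    by rw [← galoisHom_mul, inv_mul_cancel, galoisHom_one]⟩

/-- Geometric points lift through covers. Lifting the identity point of `Spec ℂ` gives a section of
some member of the sieve, so the sieve contains the identity. -/
lemma eq_top_of_mem_smallEtaleTopology {S : Sieve etComplex}
    (hS : S ∈ SpecReal.smallEtaleTopology etComplex) : S = ⊤ := by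
  obtain ⟨Y, f, hf, y, hy⟩ := geometricPoint.jointly_surjective S hS (pointEquiv _ (𝟙 _))
  obtain ⟨y, rfl⟩ := (pointEquiv Y).surjective y
  rw [← pointEquiv_comp] at hy
  rw [← Sieve.id_mem_iff_eq_top, ← (pointEquiv etComplex).injective hy]
  exact S.downward_closed hf y

/-- Every point of `U` lies over the single point of `Spec ℝ` and is therefore the image of a
geometric point, which is the same as a morphism from `Spec ℂ`. -/
lemma ofArrows_point_mem (U : SpecReal.Etale) :
    Sieve.ofArrows _ (fun x : etComplex ⟶ U ↦ x) ∈ SpecReal.smallEtaleTopology U := by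
  rw [Scheme.ofArrows_mem_smallEtaleTopology_iff]
  ext y
  simp only [Set.mem_iUnion, Set.mem_range, Set.mem_univ, iff_true]
  obtain ⟨t, ht⟩ := Scheme.pointSmallEtaleFiberObjToPreimage_surjective
    (Spec.map (CommRingCat.ofHom (algebraMap ℝ ℂ))) rfl U
    ⟨y, Subsingleton.elim (α := (Spec (CommRingCat.of ℝ) : Scheme)) _ _⟩
  obtain ⟨x, rfl⟩ := (pointEquiv U).surjective t
  exact ⟨x, (default : (Spec (CommRingCat.of ℂ) : Scheme)), congrArg Subtype.val ht⟩

/-- The full subcategory of the étale site with `Spec ℂ` as its only object. -/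
def PointSite := InducedCategory SpecReal.Etale (fun _ : PUnit.{1} ↦ etComplex)

instance : SmallCategory PointSite :=
  inferInstanceAs (Category.{0} (InducedCategory SpecReal.Etale (fun _ : PUnit.{1} ↦ etComplex)))

/-- The object of `PointSite`. -/
def pointObj : PointSite := PUnit.unit

/-- The inclusion of `Spec ℂ` into the étale site. -/
def pointInclusion : PointSite ⥤ SpecReal.Etale :=
  inducedFunctor (fun _ : PUnit.{1} ↦ etComplex)

instance : pointInclusion.Full :=
  inferInstanceAs (inducedFunctor (fun _ : PUnit.{1} ↦ etComplex)).Full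

instance : pointInclusion.Faithful :=
  inferInstanceAs (inducedFunctor (fun _ : PUnit.{1} ↦ etComplex)).Faithful

instance : pointInclusion.IsCoverDense SpecReal.smallEtaleTopology where
  is_cover U := by
    refine SpecReal.smallEtaleTopology.superset_covering ?_ (ofArrows_point_mem U)
    rw [Sieve.ofArrows, Sieve.generate_le_iff]
    rintro _ _ ⟨x⟩
    exact Presieve.in_coverByImage (Y := pointObj) pointInclusion x

/-- Covering sieves of `Spec ℂ` are trivial, so the topology induced on the one-object subcategory
is trivial and all its presheaves are sheaves. -/
instance : pointInclusion.IsDenseSubsite ⊥ SpecReal.smallEtaleTopology where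
  functorPushforward_mem_iff {X S} := by
    refine ⟨fun h ↦ ?_, ?_⟩
    · have h' : Sieve.functorPushforward pointInclusion S = ⊤ := eq_top_of_mem_smallEtaleTopology h
      obtain ⟨Z, g, f, hg, h⟩ : Sieve.functorPushforward pointInclusion S (𝟙 etComplex) := by
        rw [h']
        trivial
      obtain ⟨f, rfl⟩ := pointInclusion.map_surjective (X := X) f
      have h'' : 𝟙 X = f ≫ g :=
        pointInclusion.map_injective (h.trans (pointInclusion.map_comp f g).symm)
      rw [GrothendieckTopology.bot_covering, ← Sieve.id_mem_iff_eq_top, h'']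
      exact S.downward_closed hg f
    · intro h
      rw [GrothendieckTopology.bot_covering] at h
      rw [h, Sieve.functorPushforward_top]
      exact SpecReal.smallEtaleTopology.top_mem _

variable (Λ : Type) [CommRing Λ]

instance : (pointInclusion.sheafPushforwardContinuous (ModuleCat.{0} Λ) ⊥
    SpecReal.smallEtaleTopology).IsEquivalence := inferInstance

/-- The action of `ℤ/2` on the value of a presheaf at `Spec ℂ`. -/
def valueρ (F : SpecReal.Etaleᵒᵖ ⥤ ModuleCat.{0} Λ) :
    Representation Λ C₂ (F.obj (op etComplex)) where
  toFun g := (F.map (galoisHom (toGalois g)).op).hom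
  map_one' := by
    rw [map_one, galoisHom_one, op_id, F.map_id]
    rfl
  map_mul' g h := by
    rw [map_mul, galoisHom_mul, op_comp, F.map_comp]
    rfl

/-- The value of a presheaf at `Spec ℂ`, with the action of `ℤ/2`. -/
def valueRep : (SpecReal.Etaleᵒᵖ ⥤ ModuleCat.{0} Λ) ⥤ Rep.{0} Λ C₂ where
  obj F := Rep.of (valueρ Λ F)
  map {F G} f := Rep.ofHom ⟨(f.app (op etComplex)).hom, fun g ↦
    congrArg ModuleCat.Hom.hom (f.naturality (galoisHom (toGalois g)).op)⟩

variable {Λ} in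
/-- The endomorphism of the object of the site of `Spec ℂ` given by an element of `ℤ/2`. -/
def pointSiteEnd (g : C₂) : pointObj ⟶ pointObj :=
  InducedCategory.homMk (galoisHom (toGalois g))

lemma pointSiteEnd_one : pointSiteEnd 1 = 𝟙 _ := by
  rw [pointSiteEnd, map_one, galoisHom_one]
  rfl

lemma pointSiteEnd_mul (g h : C₂) : pointSiteEnd (g * h) = pointSiteEnd g ≫ pointSiteEnd h := by
  rw [pointSiteEnd, map_mul, galoisHom_mul]
  rfl

lemma C₂.eq_one_or (g : C₂) : g = 1 ∨ g = C₂.generator := by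
  revert g
  decide

lemma pointSiteEnd_bijective : Function.Bijective pointSiteEnd := by
  constructor
  · intro g h e
    have e' : toGalois g = toGalois h := galoisHom_injective (congrArg (fun f ↦ f.hom) e)
    have h' : toGalois C₂.generator ≠ 1 := by
      rw [toGalois_generator]
      intro h
      have := congrArg Complex.im (DFunLike.congr_fun h Complex.I)
      norm_num at this
    rcases C₂.eq_one_or g with rfl | rfl <;> rcases C₂.eq_one_or h with rfl | rfl
    · rfl
    · exact absurd (e'.symm.trans (map_one _)) h'
    · exact absurd (e'.trans (map_one _)) h'
    · rfl
  · intro f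
    obtain ⟨g, hg⟩ := exists_toGalois_eq f.hom
    exact ⟨g, InducedCategory.hom_ext hg⟩

/-- The elements of `ℤ/2` as endomorphisms. -/
def pointSiteEquiv : C₂ ≃ (pointObj ⟶ pointObj) :=
  Equiv.ofBijective _ pointSiteEnd_bijective

lemma pointSiteEquiv_symm_id : pointSiteEquiv.symm (𝟙 _) = 1 :=
  pointSiteEquiv.injective ((Equiv.apply_symm_apply _ _).trans pointSiteEnd_one.symm)

lemma pointSiteEquiv_symm_comp (f g : pointObj ⟶ pointObj) :
    pointSiteEquiv.symm (f ≫ g) = pointSiteEquiv.symm f * pointSiteEquiv.symm g := by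
  apply pointSiteEquiv.injective
  refine (Equiv.apply_symm_apply _ _).trans (Eq.trans ?_ (pointSiteEnd_mul _ _).symm)
  exact congrArg₂ _ (pointSiteEquiv.apply_symm_apply f).symm
    (pointSiteEquiv.apply_symm_apply g).symm

/-- Representations as presheaves on the site of `Spec ℂ`. -/
def pointRep : (PointSiteᵒᵖ ⥤ ModuleCat.{0} Λ) ⥤ Rep.{0} Λ C₂ where
  obj F := Rep.of (X := F.obj (op pointObj))
    { toFun g := (F.map (pointSiteEnd g).op).hom
      map_one' := by
        rw [pointSiteEnd_one, op_id, F.map_id]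
        rfl
      map_mul' g h := by
        rw [pointSiteEnd_mul, op_comp, F.map_comp]
        rfl }
  map {F G} f := Rep.ofHom ⟨(f.app (op pointObj)).hom, fun g ↦
    congrArg ModuleCat.Hom.hom (f.naturality (pointSiteEnd g).op)⟩

instance : (pointRep Λ).Faithful where
  map_injective {F G f g} h := by
    refine NatTrans.ext (funext fun _ ↦ ?_)
    ext x
    exact congrArg (fun k : (pointRep Λ).obj F ⟶ (pointRep Λ).obj G ↦
      k.hom (show (pointRep Λ).obj F from x)) h

instance : (pointRep Λ).Full where
  map_surjective {F G} f := by
    let φ : F.obj (op pointObj) →ₗ[Λ] G.obj (op pointObj) := f.hom.toLinearMap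
    refine ⟨{ app := fun _ ↦ ModuleCat.ofHom φ, naturality := ?_ }, rfl⟩
    rintro _ _ ⟨k⟩
    obtain ⟨g, rfl⟩ := pointSiteEnd_bijective.2 k
    ext x
    exact LinearMap.congr_fun (f.hom.isIntertwining' g) x

instance : (pointRep Λ).EssSurj where
  mem_essImage M := by
    refine ⟨{ obj := fun _ ↦ ModuleCat.of Λ M.V
              map := fun {X Y} f ↦ ModuleCat.ofHom (M.ρ (pointSiteEquiv.symm f.unop))
              map_id := fun X ↦ ?_
              map_comp := fun {X Y Z} f g ↦ ?_ }, ⟨Rep.mkIso ?_⟩⟩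
    · have h := pointSiteEquiv_symm_id
      change ModuleCat.ofHom (M.ρ (pointSiteEquiv.symm (𝟙 pointObj))) = _
      rw [h, map_one]
      rfl
    · refine congrArg ModuleCat.ofHom ((congrArg M.ρ (pointSiteEquiv_symm_comp g.unop f.unop)).trans
        (map_mul M.ρ _ _))
    · refine Representation.Equiv.mk (LinearEquiv.refl Λ M.V) fun g ↦ LinearMap.ext fun x ↦ ?_
      exact congrArg (fun k ↦ M.ρ k x) (pointSiteEquiv.symm_apply_apply g)

instance : (pointRep Λ).IsEquivalence where

/-- The value of a sheaf at `Spec ℂ`. -/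
abbrev sheafValueRep : EtSheaf Λ ⥤ Rep.{0} Λ C₂ :=
  sheafToPresheaf SpecReal.smallEtaleTopology _ ⋙ valueRep Λ

/-- The value of a sheaf at `Spec ℂ`, through the dense subsite. -/
def sheafValueIso : (pointInclusion.sheafPushforwardContinuous (ModuleCat.{0} Λ) ⊥
    SpecReal.smallEtaleTopology ⋙ (sheafBotEquivalence _).functor ⋙ pointRep Λ) ≅
      sheafValueRep Λ :=
  NatIso.ofComponents (fun _ ↦ Iso.refl _)

/-- Galois descent: étale sheaves are sheaves on the dense subsite, these are presheaves on a
category with one object, and such presheaves are modules with an action of its endomorphisms, which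
form `ℤ/2`. -/
instance : (sheafValueRep Λ).IsEquivalence :=
  Functor.isEquivalence_of_iso (sheafValueIso Λ)

end Point

/-! ### The stalk functor as a braided monoidal equivalence. -/

section StalkValue

/-- The pair `(Spec ℂ, id)` is an initial object of the category of elements. -/
def isInitialElements :
    IsInitial (geometricPoint.fiber.elementsMk etComplex (pointEquiv _ (𝟙 _))) :=
  IsInitial.ofUniqueHom
    (fun X ↦ CategoryOfElements.homMk _ _ ((pointEquiv _).symm X.2) (by
      refine (pointEquiv_comp (𝟙 _) ((pointEquiv _).symm X.2)).symm.trans ?_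
      rw [Category.id_comp, Equiv.apply_symm_apply]))
    (fun X m ↦ by
      refine CategoryOfElements.ext _ _ _ ((pointEquiv _).injective ?_)
      have h : pointEquiv _ (𝟙 _ ≫ m.1) = X.2 := m.2
      rw [Category.id_comp] at h
      exact h.trans (Equiv.apply_symm_apply _ _).symm)

variable {Λ : Type} [CommRing Λ]

/-- The value of a presheaf at `Spec ℂ` as its stalk. -/
def valueToStalk (F : SpecReal.Etaleᵒᵖ ⥤ ModuleCat.{0} Λ) :
    F.obj (op etComplex) ⟶ geometricPoint.presheafFiber.obj F :=
  geometricPoint.toPresheafFiber etComplex (pointEquiv _ (𝟙 _)) F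

/-- The stalk is a colimit over the opposite of the category of elements, where `(Spec ℂ, id)` is
terminal, so the colimit is the value there. -/
instance (F : SpecReal.Etaleᵒᵖ ⥤ ModuleCat.{0} Λ) : IsIso (valueToStalk F) :=
  isIso_ι_of_isTerminal (terminalOpOfInitial isInitialElements)
    ((CategoryOfElements.π geometricPoint.fiber).op ⋙ F)

lemma valueToStalk_naturality {F G : SpecReal.Etaleᵒᵖ ⥤ ModuleCat.{0} Λ} (f : F ⟶ G) :
    valueToStalk F ≫ geometricPoint.presheafFiber.map f = f.app (op etComplex) ≫ valueToStalk G :=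
  geometricPoint.toPresheafFiber_naturality f _ _

/-- Moving the geometric point by `σ` and moving the section along `galoisHom σ` give the same germ,
by the relations defining the colimit. -/
lemma valueToStalk_pointHom (F : SpecReal.Etaleᵒᵖ ⥤ ModuleCat.{0} Λ) (σ : ℂ ≃ₐ[ℝ] ℂ) :
    valueToStalk F ≫ (pointHom σ).presheafFiber.app F =
      F.map (galoisHom σ).op ≫ valueToStalk F := by
  have h := geometricPoint.toPresheafFiber_w (galoisHom σ) (pointEquiv _ (𝟙 _)) F
  rw [← pointEquiv_comp, Category.id_comp] at h
  refine Eq.trans ?_ h.symm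
  have h' := GrothendieckTopology.Point.toPresheafFiber_presheafFiberDesc geometricPoint
    (fun X x ↦ geometricPoint.toPresheafFiber X ((pointHom σ).hom.app X x) F)
    (fun X Y f x ↦ by
      rw [geometricPoint.toPresheafFiber_w]
      exact congrArg (fun y ↦ geometricPoint.toPresheafFiber Y y F)
        (congrArg (fun k ↦ k x) ((pointHom σ).hom.naturality f)).symm)
    etComplex (pointEquiv _ (𝟙 _))
  refine h'.trans ?_
  rw [pointHom_app, Category.comp_id]

/-- The stalk of a sheaf is its value at `Spec ℂ`. -/
def valueRepStalkIso : sheafValueRep Λ ≅ stalkRep Λ :=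
  NatIso.ofComponents (fun F ↦ Rep.mkIso (Representation.Equiv.mk
    (asIso (valueToStalk F.obj)).toLinearEquiv fun g ↦
      (congrArg ModuleCat.Hom.hom (valueToStalk_pointHom F.obj (toGalois g))).symm))
    (fun {F G} f ↦ by
      ext x
      exact congrArg (fun k ↦ k.hom x) (valueToStalk_naturality f.hom).symm)

instance : (stalkRep Λ).IsEquivalence := Functor.isEquivalence_of_iso valueRepStalkIso

/-- The value at `Spec ℂ` is the stalk, and stalks invert local isomorphisms. Hence the termwise
monoidal structure of `valueRep` descends along sheafification to `stalkRep`. -/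
lemma isInvertedBy_valueRep : SpecReal.smallEtaleTopology.W.IsInvertedBy (valueRep Λ) := by
  intro F G f hf
  have h₁ := geometricPoint.W_isInvertedBy_presheafFiber f hf
  have h₂ : IsIso (f.app (op etComplex)) := by
    have h := valueToStalk_naturality f
    have : IsIso (f.app (op etComplex) ≫ valueToStalk G) := by
      rw [← h]
      infer_instance
    exact IsIso.of_isIso_comp_right _ (valueToStalk G)
  have : IsIso ((forget₂ (Rep.{0} Λ C₂) (ModuleCat.{0} Λ)).map ((valueRep Λ).map f)) := h₂
  exact isIso_of_reflects_iso _ (forget₂ (Rep.{0} Λ C₂) (ModuleCat.{0} Λ))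

variable (Λ) in
/-- The stalk of the sheaf associated with a presheaf. -/
def sheafificationStalkIso : etSheafification Λ ⋙ stalkRep Λ ≅ valueRep Λ :=
  (Functor.isoWhiskerLeft _ valueRepStalkIso).symm ≪≫
    (NatIso.ofComponents (fun F ↦
      have := isInvertedBy_valueRep _ (SpecReal.smallEtaleTopology.W_toSheafify F)
      asIso ((valueRep Λ).map (toSheafify SpecReal.smallEtaleTopology F)))
      (fun {F G} f ↦ by
        dsimp only [asIso_hom]
        exact ((valueRep Λ).map_comp _ _).symm.trans ((congrArg (valueRep Λ).map
          (toSheafify_naturality SpecReal.smallEtaleTopology f)).trans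
            ((valueRep Λ).map_comp _ _))) :
        valueRep Λ ≅ etSheafification Λ ⋙ sheafValueRep Λ).symm

instance : Localization.Lifting (etSheafification Λ) SpecReal.smallEtaleTopology.W
    (valueRep Λ) (stalkRep Λ) := ⟨sheafificationStalkIso Λ⟩

/-- The tensor product of presheaves is computed termwise. -/
def valueRepμ (F G : SpecReal.Etaleᵒᵖ ⥤ ModuleCat.{0} Λ) :
    (valueRep Λ).obj F ⊗ (valueRep Λ).obj G ≅ (valueRep Λ).obj (F ⊗ G) := Iso.refl _

instance : (valueRep Λ).Monoidal :=
  Functor.CoreMonoidal.toMonoidal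
    { εIso := Iso.refl _
      μIso F G := valueRepμ F G
      μIso_hom_natural_left f X := by
        ext : 2
        rfl
      μIso_hom_natural_right X f := by
        ext : 2
        rfl
      associativity X Y Z := by
        ext : 2
        exact TensorProduct.ext_threefold fun x y z ↦ rfl
      left_unitality X := by
        ext : 2
        exact TensorProduct.ext' fun x y ↦ rfl
      right_unitality X := by
        ext : 2
        exact TensorProduct.ext' fun x y ↦ rfl }

instance : (valueRep Λ).Braided where
  braided F G := by
    ext : 2
    rfl

instance : (stalkRep Λ).Monoidal :=
  Localization.Monoidal.functorMonoidalOfComp (etSheafification Λ)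
    SpecReal.smallEtaleTopology.W (stalkRep Λ) (valueRep Λ)

instance : (etSheafification Λ).Braided :=
  inferInstanceAs (Localization.Monoidal.toMonoidalCategory
    (L := etSheafification Λ) (W := SpecReal.smallEtaleTopology.W) (Iso.refl _)).Braided

lemma braided_of_iso {C D : Type*} [Category* C] [Category* D] [MonoidalCategory C]
    [MonoidalCategory D] [BraidedCategory C] [BraidedCategory D] (F : C ⥤ D) [F.Monoidal]
    {X X' Y Y' : C} (e : X ≅ X') (e' : Y ≅ Y')
    (h : Functor.LaxMonoidal.μ F X' Y' ≫ F.map (β_ X' Y').hom =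
      (β_ _ _).hom ≫ Functor.LaxMonoidal.μ F Y' X') :
    Functor.LaxMonoidal.μ F X Y ≫ F.map (β_ X Y).hom =
      (β_ _ _).hom ≫ Functor.LaxMonoidal.μ F Y X := by
  rw [← cancel_mono (F.map (e'.hom ⊗ₘ e.hom)), Category.assoc, ← F.map_comp,
    ← BraidedCategory.braiding_naturality, F.map_comp, Category.assoc,
    ← Functor.LaxMonoidal.μ_natural, ← BraidedCategory.braiding_naturality_assoc,
    ← h, Functor.LaxMonoidal.μ_natural_assoc]

/-- The hypothesis `h` says that the tensor structure of `F` is induced from that of `G` along `L`,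
so on objects in the image of `L` the braiding square reduces to those of `L` and `G`. By
`braided_of_iso` this suffices for all sheaves. -/
lemma braided_of_lifting {C D E : Type*} [Category* C] [Category* D] [Category* E]
    [MonoidalCategory C] [MonoidalCategory D] [MonoidalCategory E] [BraidedCategory C]
    [BraidedCategory D] [BraidedCategory E] (L : C ⥤ D) [L.Braided] (F : D ⥤ E) [F.Monoidal]
    (G : C ⥤ E) [G.Braided] (e : L ⋙ F ≅ G)
    (h : ∀ X Y : C, Functor.LaxMonoidal.μ F (L.obj X) (L.obj Y) =
      (e.hom.app X ⊗ₘ e.hom.app Y) ≫ Functor.LaxMonoidal.μ G X Y ≫ e.inv.app (X ⊗ Y) ≫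
        F.map (Functor.OplaxMonoidal.δ L X Y)) (X Y : C) :
    Functor.LaxMonoidal.μ F (L.obj X) (L.obj Y) ≫ F.map (β_ (L.obj X) (L.obj Y)).hom =
      (β_ _ _).hom ≫ Functor.LaxMonoidal.μ F (L.obj Y) (L.obj X) := by
  have h₁ : Functor.OplaxMonoidal.δ L X Y ≫ (β_ (L.obj X) (L.obj Y)).hom =
      L.map (β_ X Y).hom ≫ Functor.OplaxMonoidal.δ L Y X := by
    rw [Functor.map_braiding, Category.assoc, Category.assoc, Functor.Monoidal.μ_δ,
      Category.comp_id]
  have h₂ : e.inv.app (X ⊗ Y) ≫ F.map (L.map (β_ X Y).hom) =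
      G.map (β_ X Y).hom ≫ e.inv.app (Y ⊗ X) := (e.inv.naturality (β_ X Y).hom).symm
  have h₃ := Functor.LaxBraided.braided (F := G) X Y
  rw [h, h]
  simp only [Category.assoc]
  rw [← F.map_comp, h₁, F.map_comp, reassoc_of% h₂, reassoc_of% h₃]
  exact BraidedCategory.braiding_naturality_assoc _ _ _

instance : (stalkRep Λ).Braided where
  braided X Y := by
    refine braided_of_iso (stalkRep Λ) (sheafificationIso X) (sheafificationIso Y) ?_
    exact braided_of_lifting (etSheafification Λ) (stalkRep Λ) (valueRep Λ)
      (sheafificationStalkIso Λ) (fun X Y ↦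
        Localization.Monoidal.functorMonoidalOfComp_μ (etSheafification Λ)
          SpecReal.smallEtaleTopology.W (stalkRep Λ) (valueRep Λ) X Y) X.obj Y.obj

end StalkValue

/-! ### Internal homs under a braided equivalence. -/

section InternalHom

universe v u v' u'

variable {C : Type u} [Category.{v} C] [MonoidalCategory C] [SymmetricCategory C]
  [MonoidalClosed C] {D : Type u'} [Category.{v'} D] [MonoidalCategory D] [SymmetricCategory D]
  [MonoidalClosed D] (F : C ⥤ D) [F.Braided] {d : C} {d' : D} (t : F.obj d ≅ d')

open Functor.LaxMonoidal in
/-- The comparison of internal homs for a monoidal functor. -/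
def internalHomComparison (X : C) :
    F.obj ((ihom X).obj d) ⟶ (ihom (F.obj X)).obj d' :=
  MonoidalClosed.curry (μ F X ((ihom X).obj d) ≫ F.map ((ihom.ev X).app d) ≫ t.hom)

open Functor.LaxMonoidal in
lemma whiskerLeft_internalHomComparison (X : C) :
    F.obj X ◁ internalHomComparison F t X ≫ (ihom.ev (F.obj X)).app d' =
      μ F X ((ihom X).obj d) ≫ F.map ((ihom.ev X).app d) ≫ t.hom := by
  rw [← MonoidalClosed.uncurry_eq]
  exact MonoidalClosed.uncurry_curry _

open Functor.LaxMonoidal in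
lemma map_internalHomComparison (X : C) {Y : C} (h : Y ⟶ (ihom X).obj d) :
    F.map h ≫ internalHomComparison F t X =
      MonoidalClosed.curry (μ F X Y ≫ F.map (MonoidalClosed.uncurry h) ≫ t.hom) := by
  rw [internalHomComparison, ← MonoidalClosed.curry_natural_left, μ_natural_right_assoc,
    ← F.map_comp_assoc, ← MonoidalClosed.uncurry_eq]

open Functor.LaxMonoidal in
-- Yoneda: on test objects `F Y`, composition with the comparison is the chain of bijections `Hom(F
-- Y, F [X, d]) = Hom(Y, [X, d]) = Hom(X ⊗ Y, d) = Hom(F X ⊗ F Y, d') = Hom(F Y, [F X, d'])`.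
-- Essential surjectivity supplies the remaining test objects.
lemma isIso_internalHomComparison [F.IsEquivalence] (X : C) :
    IsIso (internalHomComparison F t X) := by
  have h (Y : C) : Function.Bijective (fun k : F.obj Y ⟶ F.obj ((ihom X).obj d) ↦
      k ≫ internalHomComparison F t X) := by
    rw [← Function.Bijective.of_comp_iff (g := (fun k : Y ⟶ (ihom X).obj d ↦ F.map k)) _
      ⟨F.map_injective, F.map_surjective⟩]
    have h₁ : Function.Bijective (fun k : F.obj (X ⊗ Y) ⟶ F.obj d ↦ μ F X Y ≫ k ≫ t.hom) :=
      ((Iso.homCongr (Functor.Monoidal.μIso F X Y).symm t)).bijective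
    have h₂ := (((ihom.adjunction (F.obj X)).homEquiv (F.obj Y) d').bijective.comp h₁).comp
      ((show Function.Bijective (fun k : X ⊗ Y ⟶ d ↦ F.map k) from
        ⟨F.map_injective, F.map_surjective⟩).comp ((ihom.adjunction X).homEquiv Y d).symm.bijective)
    convert! h₂ using 1
    ext k
    exact map_internalHomComparison F t X k
  rw [isIso_iff_yoneda_map_bijective]
  intro T
  let e := F.objObjPreimageIso T
  have h' := ((Iso.homCongr e (Iso.refl (F.obj ((ihom X).obj d)))).symm.bijective)
  have h'' := ((Iso.homCongr e (Iso.refl ((ihom (F.obj X)).obj d'))).bijective)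
  convert! (h''.comp (h (F.objPreimage T))).comp h' using 1
  ext k
  simp [e]

lemma internalHomComparison_naturality {X Y : C} (f : X ⟶ Y) :
    F.map ((MonoidalClosed.pre f).app d) ≫ internalHomComparison F t X =
      internalHomComparison F t Y ≫ (MonoidalClosed.pre (F.map f)).app d' := by
  rw [map_internalHomComparison]
  apply MonoidalClosed.uncurry_injective
  rw [MonoidalClosed.uncurry_curry, MonoidalClosed.uncurry_eq, MonoidalClosed.uncurry_eq,
    MonoidalCategory.whiskerLeft_comp, Category.assoc, MonoidalClosed.id_tensor_pre_app_comp_ev,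
    MonoidalClosed.id_tensor_pre_app_comp_ev, whisker_exchange_assoc,
    whiskerLeft_internalHomComparison, Functor.LaxMonoidal.μ_natural_left_assoc,
    F.map_comp, Category.assoc]

lemma uncurry_comp_pre {A B X Y : C} (f : B ⟶ A) (g : Y ⟶ (ihom A).obj X) :
    MonoidalClosed.uncurry (g ≫ (MonoidalClosed.pre f).app X) =
      f ▷ Y ≫ MonoidalClosed.uncurry g := by
  rw [MonoidalClosed.uncurry_eq, MonoidalClosed.uncurry_eq, MonoidalCategory.whiskerLeft_comp,
    Category.assoc, MonoidalClosed.id_tensor_pre_app_comp_ev, whisker_exchange_assoc]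

/-- Biduality is evaluation preceded by the symmetry, so this is where `F` must respect the braiding
and not only the tensor product. -/
lemma internalHomComparison_bidual (X : C) :
    F.map ((internalBidual d).app X) ≫ internalHomComparison F t ((ihom X).obj d) =
      (internalBidual d').app (F.obj X) ≫
        (MonoidalClosed.pre (internalHomComparison F t X)).app d' := by
  refine (map_internalHomComparison F t ((ihom X).obj d)
    (MonoidalClosed.curry ((β_ ((ihom X).obj d) X).hom ≫ (ihom.ev X).app d))).trans ?_
  apply MonoidalClosed.uncurry_injective
  refine (MonoidalClosed.uncurry_curry _).trans (Eq.trans ?_ (uncurry_comp_pre _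
    (MonoidalClosed.curry ((β_ ((ihom (F.obj X)).obj d') (F.obj X)).hom ≫
      (ihom.ev (F.obj X)).app d'))).symm)
  rw [MonoidalClosed.uncurry_curry, MonoidalClosed.uncurry_curry,
    BraidedCategory.braiding_naturality_left_assoc, whiskerLeft_internalHomComparison,
    F.map_comp, Category.assoc, Functor.LaxBraided.braided_assoc]

/-- An equivalence of closed symmetric monoidal categories commutes with duals. -/
def internalDualComparison [F.IsEquivalence] :
    internalDual d ⋙ F ≅ F.op ⋙ internalDual d' :=
  NatIso.ofComponents (fun X ↦
      @asIso _ _ _ _ (internalHomComparison F t X.unop)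
        (isIso_internalHomComparison F t X.unop))
    (fun f ↦ internalHomComparison_naturality F t f.unop)

lemma internalDualComparison_bidual [F.IsEquivalence] (X : C) :
    F.map (bidualApp (internalBidual d) X) ≫
        (internalDualComparison F t).hom.app (op ((internalDual d).obj (op X))) =
      bidualApp (internalBidual d') (F.obj X) ≫
        (internalDual d').map ((internalDualComparison F t).hom.app (op X)).op :=
  internalHomComparison_bidual F t X

end InternalHom

/-! ### Restriction of duals to finitely generated projective modules. -/

section Pullback

universe v u v' u'

variable {A : Type u} [Category.{v} A] {D : Type u'} [Category.{v'} D] {V : Aᵒᵖ ⥤ A}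
  {V' : Dᵒᵖ ⥤ D} {G : A ⥤ D} [G.Full] [G.Faithful] (θ : V ⋙ G ≅ G.op ⋙ V')
  {P : ObjectProperty D} (hP : ∀ X : P.FullSubcategoryᵒᵖ, P ((P.ι.op ⋙ V').obj X))
  {H : P.FullSubcategory ⥤ A} (τ : H ⋙ G ≅ P.ι)

/-- A comparison of dualities is transported to a full subcategory of the target. -/
def lowerComparison : P.lift (P.ι.op ⋙ V') hP ⋙ H ≅ H.op ⋙ V :=
  NatIso.ofComponents (fun X ↦ G.preimageIso (τ.app _ ≪≫ V'.mapIso (τ.app X.unop).op ≪≫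
      (θ.app (op (H.obj X.unop))).symm)) (fun {X Y} f ↦ by
        apply G.map_injective
        have h₁ := τ.hom.naturality ((P.lift (P.ι.op ⋙ V') hP).map f)
        have h₂ := congrArg (fun k ↦ V'.map k.op) (τ.hom.naturality f.unop)
        have h₃ := θ.inv.naturality (H.map f.unop).op
        dsimp at h₁ h₂ h₃ ⊢
        rw [V'.map_comp, V'.map_comp] at h₂
        rw [G.map_comp, G.map_comp]
        refine (congrArg (_ ≫ ·) (G.map_preimage _)).trans
          (Eq.trans ?_ (congrArg (· ≫ _) (G.map_preimage _)).symm)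
        dsimp [-Iso.app_hom]
        simp only [Iso.op_hom, Iso.app_hom, Category.assoc]
        rw [reassoc_of% h₁, ← reassoc_of% h₂, h₃])

lemma map_lowerComparison (X : P.FullSubcategory) :
    G.map ((lowerComparison θ hP τ).hom.app (op X)) =
      τ.hom.app ((P.lift (P.ι.op ⋙ V') hP).obj (op X)) ≫ V'.map (τ.hom.app X).op ≫
        θ.inv.app (op (H.obj X)) :=
  G.map_preimage _

variable {e : 𝟭 A ⟶ V.rightOp ⋙ V} {e' : 𝟭 D ⟶ V'.rightOp ⋙ V'}
  {e'' : 𝟭 P.FullSubcategory ⟶ (P.lift (P.ι.op ⋙ V') hP).rightOp ⋙ P.lift (P.ι.op ⋙ V') hP}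

/-- This is the diagram chase for `lowerComparison_bidual`, with all objects left free so that the
objects produced by `P.lift` need not be unfolded. -/
lemma bidual_lower {h w w₂ : A} {x : D} {t : G.obj h ⟶ x} {s : G.obj w ⟶ V'.obj (op x)}
    {s₂ : G.obj w₂ ⟶ V'.obj (op (V'.obj (op x)))} {l : w ⟶ V.obj (op h)}
    {l₂ : w₂ ⟶ V.obj (op w)} {b : h ⟶ w₂}
    (h₁ : G.map l = s ≫ V'.map t.op ≫ θ.inv.app (op h))
    (h₂ : G.map l₂ = s₂ ≫ V'.map s.op ≫ θ.inv.app (op w))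
    (h₃ : G.map b ≫ s₂ = t ≫ bidualApp e' x)
    (hθ : G.map (bidualApp e h) ≫ θ.hom.app (op (V.obj (op h))) =
      bidualApp e' (G.obj h) ≫ V'.map (θ.hom.app (op h)).op) :
    b ≫ l₂ = bidualApp e h ≫ V.map l.op := by
  apply G.map_injective
  have h₄ : V'.map (G.map l).op ≫ θ.inv.app (op w) =
      θ.inv.app (op (V.obj (op h))) ≫ G.map (V.map l.op) := θ.inv.naturality l.op
  have h₅ : t ≫ bidualApp e' x = bidualApp e' (G.obj h) ≫ V'.map (V'.map t.op).op :=
    bidual_app_naturality e' t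
  have h₆ : G.map (bidualApp e h) = bidualApp e' (G.obj h) ≫ V'.map (θ.hom.app (op h)).op ≫
      θ.inv.app (op (V.obj (op h))) := by
    rw [← Category.assoc, ← hθ, Category.assoc]
    exact (Category.comp_id _).symm.trans (congrArg (_ ≫ ·) (θ.hom_inv_id_app _).symm)
  have h₇ : V'.map (θ.hom.app (op h)).op ≫ V'.map (θ.inv.app (op h)).op = 𝟙 _ := by
    rw [← V'.map_comp, ← op_comp]
    exact (congrArg (fun k ↦ V'.map k.op) (θ.inv_hom_id_app (op h))).trans (V'.map_id _)
  rw [G.map_comp, G.map_comp, h₂, reassoc_of% h₃, reassoc_of% h₅, h₆, Category.assoc,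
    Category.assoc, ← h₄, h₁, op_comp, op_comp, V'.map_comp, V'.map_comp]
  simp only [Category.assoc]
  rw [reassoc_of% h₇]

lemma lowerComparison_bidual (he : ∀ X, (bidualApp e'' X).hom = bidualApp e' X.obj)
    (hθ : ∀ X, G.map (bidualApp e X) ≫ θ.hom.app (op (V.obj (op X))) =
      bidualApp e' (G.obj X) ≫ V'.map (θ.hom.app (op X)).op) (X : P.FullSubcategory) :
    H.map (bidualApp e'' X) ≫
        (lowerComparison θ hP τ).hom.app (op ((P.lift (P.ι.op ⋙ V') hP).obj (op X))) =
      bidualApp e (H.obj X) ≫ V.map ((lowerComparison θ hP τ).hom.app (op X)).op := by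
  have h₁ := map_lowerComparison θ hP τ X
  have h₂ := map_lowerComparison θ hP τ ((P.lift (P.ι.op ⋙ V') hP).obj (op X))
  have h₄ := τ.hom.naturality (bidualApp e'' X)
  exact bidual_lower θ (e := e) (e' := e') (h₁) h₂ (h₄.trans (congrArg (_ ≫ ·) (he X))) (hθ _)

end Pullback

section Dual

variable (Λ : Type) [CommRing Λ]

/-- The stalk of the constant sheaf `Λ` is the trivial representation. -/
def stalkConstIso : (stalkRep Λ).obj (EtSheaf.const (ModuleCat.of Λ Λ)) ≅ Rep.trivial Λ C₂ Λ :=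
  (sheafificationStalkIso Λ).app ((Functor.const _).obj (ModuleCat.of Λ Λ))

/-- The étale sheaf associated with a finitely generated projective `Λ[ℤ/2]`-module. -/
def finProjSheaf : FinProj Λ ⥤ EtSheaf Λ := (finProj Λ).ι ⋙ (stalkRep Λ).inv

/-- The stalk of the sheaf associated with a finitely generated projective module. -/
def finProjSheafStalkIso : finProjSheaf Λ ⋙ stalkRep Λ ≅ (finProj Λ).ι :=
  Functor.associator _ _ _ ≪≫
    Functor.isoWhiskerLeft _ (stalkRep Λ).asEquivalence.counitIso ≪≫ Functor.rightUnitor _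

instance : (finProjSheaf Λ).Full := inferInstanceAs ((finProj Λ).ι ⋙ (stalkRep Λ).inv).Full
instance : (finProjSheaf Λ).Faithful :=
  inferInstanceAs ((finProj Λ).ι ⋙ (stalkRep Λ).inv).Faithful
instance : (finProjSheaf Λ).Additive :=
  have : (stalkRep Λ).inv.Additive :=
    have : (stalkRep Λ).asEquivalence.functor.Additive := inferInstanceAs (stalkRep Λ).Additive
    inferInstanceAs (stalkRep Λ).asEquivalence.inverse.Additive
  inferInstanceAs ((finProj Λ).ι ⋙ (stalkRep Λ).inv).Additive

/-- The functor from modules to sheaves commutes with duals. -/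
def finProjSheafDual : finProjDual Λ ⋙ finProjSheaf Λ ≅ (finProjSheaf Λ).op ⋙ etDual Λ :=
  lowerComparison (internalDualComparison (stalkRep Λ) (stalkConstIso Λ))
    (fun P ↦ finProj_repDual _ P.unop.property) (finProjSheafStalkIso Λ)

lemma finProjSheafDual_bidual (P : FinProj Λ) :
    (finProjSheaf Λ).map (bidualApp (finProjBidual Λ) P) ≫
        (finProjSheafDual Λ).hom.app (op ((finProjDual Λ).obj (op P))) =
      bidualApp (etBidual Λ) ((finProjSheaf Λ).obj P) ≫
        (etDual Λ).map ((finProjSheafDual Λ).hom.app (op P)).op :=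
  lowerComparison_bidual (internalDualComparison (stalkRep Λ) (stalkConstIso Λ)) _
    (finProjSheafStalkIso Λ) (fun _ ↦ rfl)
    (internalDualComparison_bidual (stalkRep Λ) (stalkConstIso Λ)) P

end Dual

/-! ### Dévissage for bounded complexes. -/

section Devissage

universe w v u

variable {A : Type u} [Category.{v} A] [Abelian A]

open HomologicalComplex in
-- On homology in degree `n`, the map from the one-term complex is `q` followed by the projection
-- from cycles. In the top degree this makes the top cohomology of the cone vanish.
lemma epi_homologyMap_mkHomFromSingle {K : CochainComplex A ℤ} {n : ℤ} {Q : A}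
    (q : Q ⟶ K.cycles n) (h : Epi (q ≫ K.homologyπ n)) :
    Epi (homologyMap (mkHomFromSingle (q ≫ K.iCycles n) (fun k _ ↦ by simp)) n) := by
  set φ := mkHomFromSingle (c := ComplexShape.up ℤ) (q ≫ K.iCycles n) (fun k _ ↦ by simp) with hφ
  have h₁ : (singleObjCyclesSelfIso (ComplexShape.up ℤ) n Q).inv ≫ cyclesMap φ n = q := by
    rw [← cancel_mono (K.iCycles n), Category.assoc, cyclesMap_i,
      singleObjCyclesSelfIso_inv_iCycles_assoc, hφ, mkHomFromSingle_f, Iso.inv_hom_id_assoc]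
  have h₂ : (singleObjHomologySelfIso (ComplexShape.up ℤ) n Q).inv ≫ homologyMap φ n =
      q ≫ K.homologyπ n := by
    rw [← singleObjCyclesSelfIso_inv_homologyπ, Category.assoc, homologyπ_naturality,
      reassoc_of% h₁]
  have : Epi ((singleObjHomologySelfIso (ComplexShape.up ℤ) n Q).inv ≫ homologyMap φ n) := by
    rwa [h₂]
  exact epi_of_epi (singleObjHomologySelfIso (ComplexShape.up ℤ) n Q).inv _

lemma CochainComplex.shortExact_cycles (K : CochainComplex A ℤ) {n m : ℤ} (h : n + 1 = m)
    (hK : K.ExactAt m) [K.IsStrictlyLE m] :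
    (ShortComplex.mk (K.iCycles n) (K.d n m) (by simp)).ShortExact where
  exact := ShortComplex.exact_of_f_is_kernel _ (K.cyclesIsKernel n m (by simp [← h]))
  mono_f := inferInstanceAs (Mono (K.iCycles n))
  epi_g := by
    have := (K.exactAt_iff' n m (m + 1) (by simp [← h]) (by simp)).1 hK
    exact this.epi_f ((K.isZero_of_isStrictlyLE m (m + 1) (by lia)).eq_of_tgt _ _)

variable [HasDerivedCategory.{w} A] {ℱ 𝒢 : ObjectProperty A} [𝒢.IsSerreClass]
  [ℱ.IsClosedUnderIsomorphisms] [ℱ.ContainsZero] {T : ObjectProperty (DerivedCategory A)}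
  [T.IsTriangulated] [T.IsClosedUnderIsomorphisms]

open HomologicalComplex in
/-- A triangulated subcategory of the derived category contains the bounded complexes with terms in
`ℱ` and cohomology in `𝒢` if it contains the objects in `ℱ` and `𝒢` and if there are enough such
objects. -/
theorem prop_Q_obj_of_bounded
    (hker : ∀ S : ShortComplex A, S.ShortExact → ℱ S.X₂ → ℱ S.X₃ → ℱ S.X₁)
    (hsum : ∀ X Y, ℱ X → ℱ Y → ℱ (X ⊞ Y))
    (hT : ∀ X, ℱ X → 𝒢 X → ∀ n, T ((DerivedCategory.singleFunctor A n).obj X))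
    (hlift : ∀ {F Y : A} (e : F ⟶ Y) [Epi e], 𝒢 Y → ∃ (Q : A) (q : Q ⟶ F),
      ℱ Q ∧ 𝒢 Q ∧ Epi (q ≫ e)) (k : ℕ) (K : CochainComplex A ℤ) (c b : ℤ) (hb : c + k = b)
    [K.IsStrictlyGE c] [K.IsStrictlyLE b] (hK : ∀ i, ℱ (K.X i)) (hK' : ∀ i, 𝒢 (K.homology i)) :
    T (DerivedCategory.Q.obj K) := by
  -- The lower bound `c` stays fixed, and each step lowers the upper bound by one until a single
  -- degree remains.
  induction k generalizing K b with
  | zero =>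
    obtain rfl : c = b := by lia
    obtain ⟨M, ⟨e⟩⟩ := K.exists_iso_single c
    have h₁ : ℱ M := ℱ.prop_of_iso ((HomologicalComplex.eval A _ c).mapIso e ≪≫
      singleObjXSelf (ComplexShape.up ℤ) c M) (hK c)
    have h₂ : 𝒢 M := 𝒢.prop_of_iso ((homologyFunctor A _ c).mapIso e ≪≫
      singleObjHomologySelfIso (ComplexShape.up ℤ) c M) (hK' c)
    exact T.prop_of_iso (DerivedCategory.Q.mapIso e).symm (hT M h₁ h₂ c)
  | succ k ih =>
    -- `Q` lies in both classes and maps to the cycles so as to surject onto the top cohomology.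
    obtain ⟨Q, q, hQ, hQ', hq⟩ := hlift (K.homologyπ b) (hK' b)
    let φ : (single A (ComplexShape.up ℤ) b).obj Q ⟶ K :=
      mkHomFromSingle (q ≫ K.iCycles b) (fun k _ ↦ by simp)
    have hφ : Epi (homologyMap φ b) := epi_homologyMap_mkHomFromSingle q hq
    let C := CochainComplex.mappingCone φ
    have hC := DerivedCategory.mappingCone_triangle_distinguished φ
    have hs (i : ℤ) : 𝒢 (((single A (ComplexShape.up ℤ) b).obj Q).homology i) := by
      by_cases hi : i = b
      · subst hi
        exact 𝒢.prop_of_iso (singleObjHomologySelfIso (ComplexShape.up ℤ) i Q).symm hQ'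
      · exact 𝒢.prop_of_isZero (isZero_single_obj_homology _ _ _ _ hi)
    have hs' (i : ℤ) : ℱ (((single A (ComplexShape.up ℤ) b).obj Q).X i) := by
      by_cases hi : i = b
      · subst hi
        exact ℱ.prop_of_iso (singleObjXSelf (ComplexShape.up ℤ) i Q).symm hQ
      · exact ℱ.prop_of_isZero (isZero_single_obj_X _ _ _ _ hi)
    have hC₁ (i : ℤ) : ℱ (C.X i) :=
      ℱ.prop_of_iso (homotopyCofiber.XIsoBiprod φ i (i + 1) rfl).symm (hsum _ _ (hs' _) (hK _))
    have hC₂ (i : ℤ) : 𝒢 (C.homology i) :=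
      𝒢.prop_X₂_of_exact (CochainComplex.homologyMap_exact₃_of_distTriang _ hC i (i + 1))
        (hK' i) (hs (i + 1))
    have hC₃ : IsZero (C.homology b) := by
      have h₂ := CochainComplex.homologyMap_exact₃_of_distTriang _ hC b (b + 1)
      have h₃ : homologyMap (CochainComplex.mappingCone.triangle φ).mor₂ b = 0 := by
        have : Epi (homologyMap (CochainComplex.mappingCone.triangle φ).mor₁ b) := hφ
        rw [← cancel_epi (homologyMap (CochainComplex.mappingCone.triangle φ).mor₁ b)]
        exact (CochainComplex.homologyMap_comp_eq_zero_of_distTriang _ hC b).trans comp_zero.symm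
      have h₄ : Mono (CochainComplex.homologyδOfTriangle
        (CochainComplex.mappingCone.triangle φ) b (b + 1) rfl) := h₂.mono_g h₃
      have h₅ : IsZero (((single A (ComplexShape.up ℤ) b).obj Q).homology (b + 1)) :=
        isZero_single_obj_homology _ _ _ _ (by lia)
      exact @IsZero.of_mono _ _ _ _ _ (CochainComplex.homologyδOfTriangle
        (CochainComplex.mappingCone.triangle φ) b (b + 1) rfl) h₄ h₅
    -- The one-term complex contributes to the cone in degree `b - 1`, which is at least `c`, so the
    -- cone still lives in degrees from `c` to `b`.
    have hC₄ (i : ℤ) (hi : i < c ∨ b < i) : IsZero (C.X i) := by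
      refine IsZero.of_iso ?_ (homotopyCofiber.XIsoBiprod φ i (i + 1) rfl)
      refine biprod_isZero_iff _ _ |>.2 ⟨isZero_single_obj_X _ _ _ _ (by lia), ?_⟩
      rcases hi with hi | hi
      · exact K.isZero_of_isStrictlyGE c i
      · exact K.isZero_of_isStrictlyLE b i
    have hC₅ : C.IsStrictlyLE b := (C.isStrictlyLE_iff b).2 fun i hi ↦ hC₄ i (Or.inr hi)
    -- As its cohomology in degree `b` vanishes, the cone can be truncated to degrees at most `c + k
    -- = b - 1`.
    have hC₆ : C.IsLE (c + k) := (C.isLE_iff _).2 fun i hi ↦ by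
      rw [exactAt_iff_isZero_homology]
      by_cases hi' : i = b
      · subst hi'
        exact hC₃
      · exact C.isZero_of_isLE b i (by lia)
    have hC₇ : (C.truncLE (c + k)).IsStrictlyGE c :=
      (CochainComplex.isStrictlyGE_iff _ _).2 fun i hi ↦
        IsZero.of_iso (hC₄ i (Or.inl hi)) (C.truncLEXIso (c + k) i)
    have h := ih (C.truncLE (c + k)) (c + k) rfl (fun i ↦ by
        rcases lt_trichotomy i (c + k) with hi | rfl | hi
        · exact ℱ.prop_of_iso (C.truncLEXIso (c + k) i hi).symm (hC₁ i)
        -- The new top term is the kernel of the epimorphism from degree `b - 1` to degree `b` of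
        -- the cone, so it lies in `ℱ` by `hker`.
        · refine ℱ.prop_of_iso (C.truncLEXIsoCycles (c + k)).symm
            (hker _ (C.shortExact_cycles (show c + k + 1 = b by lia) ?_) (hC₁ _) (hC₁ _))
          rw [exactAt_iff_isZero_homology]
          exact hC₃
        · exact ℱ.prop_of_isZero (CochainComplex.isZero_of_isStrictlyLE _ (c + k) i hi))
      (fun i ↦ 𝒢.prop_of_iso (asIso (homologyMap (C.ιTruncLE (c + k)) i)).symm (hC₂ i))
    have h' : T (DerivedCategory.Q.obj C) :=
      T.prop_of_iso (asIso (DerivedCategory.Q.map (C.ιTruncLE (c + k)))) h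
    exact T.ext_of_isTriangulatedClosed₂ _ hC (hT Q hQ hQ' b) h'

end Devissage

/-! ### Local constancy of étale sheaves on `Spec ℝ`. -/

section LocallyConstant

/-- The full subcategory of the étale site of `V` formed by the morphisms from `Spec ℂ`. -/
def OverPointSite (V : SpecReal.Etale) :=
  InducedCategory (Over V) (fun x : etComplex ⟶ V ↦ Over.mk x)

instance (V : SpecReal.Etale) : SmallCategory (OverPointSite V) :=
  inferInstanceAs (Category.{0} (InducedCategory (Over V) (fun x : etComplex ⟶ V ↦ Over.mk x)))

/-- The inclusion into the étale site of `V`. -/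
def overPointInclusion (V : SpecReal.Etale) : OverPointSite V ⥤ Over V :=
  inducedFunctor (fun x : etComplex ⟶ V ↦ Over.mk x)

variable (V : SpecReal.Etale)

instance : (overPointInclusion V).Full :=
  inferInstanceAs (inducedFunctor (fun x : etComplex ⟶ V ↦ Over.mk x)).Full

instance : (overPointInclusion V).Faithful :=
  inferInstanceAs (inducedFunctor (fun x : etComplex ⟶ V ↦ Over.mk x)).Faithful

instance : (overPointInclusion V).IsCoverDense (SpecReal.smallEtaleTopology.over V) where
  is_cover U := by
    rw [GrothendieckTopology.mem_over_iff]
    refine SpecReal.smallEtaleTopology.superset_covering ?_ (ofArrows_point_mem U.left)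
    rw [Sieve.ofArrows, Sieve.generate_le_iff]
    rintro _ _ ⟨x⟩
    change Sieve.overEquiv _ _ x
    rw [Sieve.overEquiv_iff]
    exact Presieve.in_coverByImage (Y := (show OverPointSite V from x ≫ U.hom))
      (overPointInclusion V) (Over.homMk x : Over.mk (x ≫ U.hom) ⟶ U)

/-- This is the argument for `pointInclusion` relative to `V`: covers in the slice are covers of the
source, and covers of `Spec ℂ` are trivial. -/
instance : (overPointInclusion V).IsDenseSubsite ⊥ (SpecReal.smallEtaleTopology.over V) where
  functorPushforward_mem_iff {X S} := by
    refine ⟨fun h ↦ ?_, ?_⟩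
    · rw [GrothendieckTopology.mem_over_iff] at h
      have h' := eq_top_of_mem_smallEtaleTopology h
      have h'' : Sieve.functorPushforward (overPointInclusion V) S = ⊤ :=
        (Sieve.overEquiv _).injective (h'.trans (map_top _).symm)
      obtain ⟨Z, g, f, hg, h⟩ :
          Sieve.functorPushforward (overPointInclusion V) S (𝟙 ((overPointInclusion V).obj X)) := by
        rw [h'']
        trivial
      obtain ⟨f, rfl⟩ := (overPointInclusion V).map_surjective f
      have h'' : 𝟙 X = f ≫ g := (overPointInclusion V).map_injective
        (((overPointInclusion V).map_id X).trans
          (h.trans ((overPointInclusion V).map_comp f g).symm))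
      rw [GrothendieckTopology.bot_covering, ← Sieve.id_mem_iff_eq_top, h'']
      exact S.downward_closed hg f
    · intro h
      rw [GrothendieckTopology.bot_covering] at h
      rw [h, Sieve.functorPushforward_top]
      exact (SpecReal.smallEtaleTopology.over V).top_mem _

variable {V} {Λ : Type} [CommRing Λ]

/-- The map from the constant presheaf given by a morphism to `Spec ℂ`. -/
def constantOnHom (F : EtSheaf Λ) (g : V ⟶ etComplex) :
    (Functor.const _).obj (F.obj.obj (op etComplex)) ⟶ (Over.forget V).op ⋙ F.obj where
  app W := F.obj.map (W.unop.hom ≫ g).op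
  naturality W W' k := by
    refine (Category.id_comp _).trans (Eq.trans ?_ (F.obj.map_comp _ _))
    refine congrArg F.obj.map
      (congrArg Quiver.Hom.op (?_ : W'.unop.hom ≫ g = k.unop.left ≫ W.unop.hom ≫ g))
    rw [← Category.assoc, Over.w]

/-- Whether a map is a local isomorphism is decided on the dense subsite. There the map from the
constant presheaf is restriction along composites `Spec ℂ → V → Spec ℂ`, which are automorphisms. -/
lemma EtSheaf.isConstantOn (F : EtSheaf Λ) (g : V ⟶ etComplex) : F.IsConstantOn V := by
  refine ⟨_, constantOnHom F g, ?_⟩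
  rw [← (SpecReal.smallEtaleTopology.over V).W_inverseImage_whiskeringLeft ⊥
    (overPointInclusion V)]
  have : IsIso (((Functor.whiskeringLeft _ _ _).obj (overPointInclusion V).op).map
      (constantOnHom F g)) := by
    rw [NatTrans.isIso_iff_isIso_app]
    intro X
    let f : etComplex ⟶ etComplex := (show etComplex ⟶ V from X.unop) ≫ g
    have : IsIso f := isIso_etComplex f
    exact (inferInstance : IsIso (F.obj.map f.op))
  exact MorphismProperty.of_isIso (GrothendieckTopology.W _)
    (((Functor.whiskeringLeft _ _ _).obj _).map (constantOnHom F g))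

/-- The cover by morphisms from `Spec ℂ` trivialises every sheaf, so constructibility reduces to
finite generation of the stalk. -/
lemma EtSheaf.isLocallyConstant (F : EtSheaf Λ) : F.IsLocallyConstant := by
  intro U
  refine ⟨_, ofArrows_point_mem U, ?_⟩
  rintro V f ⟨W, g, x, ⟨x⟩, rfl⟩
  exact F.isConstantOn g

end LocallyConstant

/-! ### Flatness criteria for modules. -/

section Modules

universe u

variable {R : Type u} [CommRing R]

variable (R) in
/-- Finitely generated modules. -/
def finiteModules : ObjectProperty (ModuleCat.{u} R) := fun M ↦ Module.Finite R M

instance [IsNoetherianRing R] : (finiteModules R).IsSerreClass where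
  exists_zero := ⟨.of R PUnit, ModuleCat.isZero_of_subsingleton _,
    inferInstanceAs (Module.Finite R PUnit.{u + 1})⟩
  prop_of_mono {M N} f hf (hN : Module.Finite R N) :=
    Module.Finite.of_injective f.hom ((ModuleCat.mono_iff_injective f).1 hf)
  prop_of_epi {M N} f hf (hM : Module.Finite R M) :=
    Module.Finite.of_surjective f.hom ((ModuleCat.epi_iff_surjective f).1 hf)
  prop_X₂_of_shortExact {S} hS (h₁ : Module.Finite R S.X₁) (h₃ : Module.Finite R S.X₃) :=
    Module.Finite.of_exact
      ((ShortComplex.ShortExact.moduleCat_exact_iff_function_exact S).1 hS.exact)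
      hS.moduleCat_surjective_g

variable (R) in
/-- Flat modules. -/
def flatModules : ObjectProperty (ModuleCat.{u} R) := fun M ↦ Module.Flat R M

instance : (flatModules R).IsClosedUnderIsomorphisms where
  of_iso e (h : Module.Flat R _) := Module.Flat.of_linearEquiv e.toLinearEquiv.symm

/-- A module is flat if and only if its character module is injective. The dual sequence is exact
and begins with the injective dual of `M₃`, so it splits, and the dual of `M₁` is a direct summand
of the injective dual of `M₂`. -/
lemma Module.Flat.of_exact_of_flat {M₁ M₂ M₃ : Type u} [AddCommGroup M₁] [AddCommGroup M₂]
    [AddCommGroup M₃] [Module R M₁] [Module R M₂] [Module R M₃] {f : M₁ →ₗ[R] M₂}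
    {g : M₂ →ₗ[R] M₃} (hf : Function.Injective f) (hg : Function.Surjective g)
    (h : Function.Exact f g) [Module.Flat R M₂] [Module.Flat R M₃] : Module.Flat R M₁ := by
  have h₂ := (Module.Flat.iff_characterModule_injective (R := R) (M := M₂)).1 inferInstance
  have h₃ := (Module.Flat.iff_characterModule_injective (R := R) (M := M₃)).1 inferInstance
  rw [Module.Flat.iff_characterModule_injective]
  have hg' := CharacterModule.dual_injective_of_surjective g hg
  have hf' := CharacterModule.dual_surjective_of_injective f hf
  have h' : Function.Exact (CharacterModule.dual g) (CharacterModule.dual f) := by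
    intro (k : M₂ →+ _)
    refine ⟨fun hk ↦ ?_, ?_⟩
    · refine ⟨g.toAddMonoidHom.liftOfSurjective hg ⟨k, fun x hx ↦ ?_⟩, ?_⟩
      · obtain ⟨y, rfl⟩ := (h x).1 hx
        exact congrArg (fun k : M₁ →+ _ ↦ k y) hk
      · exact AddMonoidHom.liftOfRightInverse_comp _ _ _ _
    · rintro ⟨l, rfl⟩
      refine AddMonoidHom.ext fun x ↦ ?_
      exact (congrArg l (h.apply_apply_eq_zero x)).trans (map_zero l)
  obtain ⟨r, hr⟩ := h₃.out _ hg' LinearMap.id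
  obtain ⟨-, s, hs⟩ := ((h'.split_tfae').out 1 0 :).1 ⟨hf', r, LinearMap.ext hr⟩
  refine ⟨fun X Y _ _ _ _ i hi k ↦ ?_⟩
  obtain ⟨l, hl⟩ := h₂.out i hi (s ∘ₗ k)
  refine ⟨CharacterModule.dual f ∘ₗ l, fun x ↦ ?_⟩
  exact (congrArg (CharacterModule.dual f) (hl x)).trans (LinearMap.congr_fun hs (k x))

/-- The cokernel of a map of modules is flat if its first syzygies are computed by a complex that
stays exact modulo ideals. -/
lemma Module.Flat.of_exact_rTensor_quotient {N₂ N₁ N₀ C : Type u} [AddCommGroup N₂]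
    [AddCommGroup N₁] [AddCommGroup N₀] [AddCommGroup C] [Module R N₂] [Module R N₁] [Module R N₀]
    [Module R C] {f : N₂ →ₗ[R] N₁} {g : N₁ →ₗ[R] N₀} {p : N₀ →ₗ[R] C} [Module.Flat R N₀]
    (hfg : g ∘ₗ f = 0)
    (h : ∀ I : Ideal R, Function.Exact (f.rTensor (R ⧸ I)) (g.rTensor (R ⧸ I)))
    (hgp : Function.Exact g p) (hp : Function.Surjective p) : Module.Flat R C := by
  have comm {A B : Type u} [AddCommGroup A] [AddCommGroup B] [Module R A] [Module R B]
      (k : A →ₗ[R] B) {S T : Type u} [AddCommGroup S] [AddCommGroup T] [Module R S] [Module R T]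
      (l : S →ₗ[R] T) (x : TensorProduct R A S) :
      k.rTensor T (l.lTensor A x) = l.lTensor B (k.rTensor S x) := by
    rw [← LinearMap.comp_apply, ← LinearMap.comp_apply, LinearMap.rTensor_comp_lTensor,
      LinearMap.lTensor_comp_rTensor]
  rw [Module.Flat.iff_lTensor_injective']
  intro I
  rw [injective_iff_map_eq_zero]
  intro x hx
  -- The element is lifted to `y` in `N₀ ⊗ I`, whose image in `N₀` equals `g z` for some `z`. The
  -- class of `z` modulo `I` is a cycle, hence the boundary of some `w`, and `z - f w` comes from
  -- `v` in `N₁ ⊗ I`. Flatness of `N₀` gives `y = g v`, so `y` dies in `C ⊗ I`.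
  obtain ⟨y, rfl⟩ := LinearMap.rTensor_surjective I hp x
  rw [← comm] at hx
  obtain ⟨z, hz⟩ := (_root_.rTensor_exact R hgp hp _).1 hx
  have hI (N : Type u) [AddCommGroup N] [Module R N] :
      Function.Exact (I.subtype.lTensor N) (I.mkQ.lTensor N) :=
    _root_.lTensor_exact N (LinearMap.exact_subtype_mkQ I) (Submodule.mkQ_surjective I)
  have h₁ : g.rTensor (R ⧸ I) (I.mkQ.lTensor N₁ z) = 0 := by
    rw [comm, hz]
    exact (hI N₀).apply_apply_eq_zero y
  obtain ⟨w, hw⟩ := (h I _).1 h₁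
  obtain ⟨w, rfl⟩ := LinearMap.lTensor_surjective N₂ (Submodule.mkQ_surjective I) w
  have h₂ : I.mkQ.lTensor N₁ (z - f.rTensor R w) = 0 := by
    rw [map_sub, ← comm, hw, sub_self]
  obtain ⟨v, hv⟩ := (hI N₁ _).1 h₂
  have h₃ : I.subtype.lTensor N₀ (g.rTensor I v) = I.subtype.lTensor N₀ y := by
    rw [← comm, hv, map_sub, hz, ← LinearMap.rTensor_comp_apply, hfg, LinearMap.rTensor_zero,
      LinearMap.zero_apply, sub_zero]
  rw [← Module.Flat.lTensor_preserves_injective_linearMap I.subtype I.injective_subtype h₃,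
    ← LinearMap.rTensor_comp_apply, hgp.linearMap_comp_eq_zero, LinearMap.rTensor_zero,
    LinearMap.zero_apply]

end Modules

/-! ### Flatness and finiteness of sheaves in terms of stalks. -/

section StalkModule

variable (Λ : Type) [CommRing Λ]

/-- The stalk at `Spec ℂ` as a module. -/
abbrev stalkModule : EtSheaf Λ ⥤ ModuleCat.{0} Λ :=
  stalkRep Λ ⋙ forget₂ (Rep.{0} Λ C₂) (ModuleCat.{0} Λ)

variable {Λ}

/-- The stalk functor commutes with tensor products. -/
def stalkTensorIso (F G : EtSheaf Λ) :
    (stalkModule Λ).obj (F ⊗ G) ≅ (stalkModule Λ).obj F ⊗ (stalkModule Λ).obj G :=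
  (forget₂ (Rep.{0} Λ C₂) (ModuleCat.{0} Λ)).mapIso
    (Functor.Monoidal.μIso (stalkRep Λ) F G).symm

lemma stalkTensorIso_naturality_left {F F' : EtSheaf Λ} (f : F ⟶ F') (G : EtSheaf Λ) :
    (stalkModule Λ).map (f ▷ G) ≫ (stalkTensorIso F' G).hom =
      (stalkTensorIso F G).hom ≫ (stalkModule Λ).map f ▷ (stalkModule Λ).obj G :=
  congrArg (forget₂ (Rep.{0} Λ C₂) (ModuleCat.{0} Λ)).map
    (Functor.OplaxMonoidal.δ_natural_left (stalkRep Λ) f G).symm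

lemma stalkTensorIso_naturality_right (F : EtSheaf Λ) {G G' : EtSheaf Λ} (g : G ⟶ G') :
    (stalkModule Λ).map (F ◁ g) ≫ (stalkTensorIso F G').hom =
      (stalkTensorIso F G).hom ≫ (stalkModule Λ).obj F ◁ (stalkModule Λ).map g :=
  congrArg (forget₂ (Rep.{0} Λ C₂) (ModuleCat.{0} Λ)).map
    (Functor.OplaxMonoidal.δ_natural_right (stalkRep Λ) F g).symm

variable (Λ) in
/-- The stalk of a constant sheaf. -/
def constantSheafStalkIso :
    constantSheaf SpecReal.smallEtaleTopology (ModuleCat.{0} Λ) ⋙ stalkModule Λ ≅ 𝟭 _ :=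
  NatIso.ofComponents (fun M ↦ (forget₂ (Rep.{0} Λ C₂) (ModuleCat.{0} Λ)).mapIso
      ((sheafificationStalkIso Λ).app ((Functor.const _).obj M)))
    (fun f ↦ congrArg (forget₂ (Rep.{0} Λ C₂) (ModuleCat.{0} Λ)).map
      ((sheafificationStalkIso Λ).hom.naturality ((Functor.const _).map f)))

lemma mono_iff_stalk {F G : EtSheaf Λ} (f : F ⟶ G) :
    Mono f ↔ Function.Injective ((stalkModule Λ).map f).hom := by
  rw [← (ModuleCat.mono_iff_injective _)]
  exact ⟨fun _ ↦ inferInstance, fun _ ↦ (stalkModule Λ).mono_of_mono_map inferInstance⟩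

lemma epi_iff_stalk {F G : EtSheaf Λ} (f : F ⟶ G) :
    Epi f ↔ Function.Surjective ((stalkModule Λ).map f).hom := by
  rw [← (ModuleCat.epi_iff_surjective _)]
  exact ⟨fun _ ↦ inferInstance, fun _ ↦ (stalkModule Λ).epi_of_epi_map inferInstance⟩

lemma mono_iff_of_square {C : Type*} [Category* C] {X Y X' Y' : C} {f : X ⟶ Y} {g : X' ⟶ Y'}
    (a : X ≅ X') (b : Y ≅ Y') (h : f ≫ b.hom = a.hom ≫ g) : Mono f ↔ Mono g :=
  (MorphismProperty.monomorphisms C).arrow_mk_iso_iff (Arrow.isoMk a b h.symm)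

/-- Flat sheaves are those with flat stalks. -/
lemma EtSheaf.isFlat_iff (F : EtSheaf Λ) :
    F.IsFlat ↔ Module.Flat Λ ((stalkModule Λ).obj F) := by
  have key {G H : EtSheaf Λ} (f : G ⟶ H) : Mono (F ◁ f) ↔
      Function.Injective (((stalkModule Λ).map f).hom.lTensor ((stalkModule Λ).obj F)) := by
    rw [mono_iff_stalk, ← ModuleCat.mono_iff_injective,
      mono_iff_of_square _ _ (stalkTensorIso_naturality_right F f), ModuleCat.mono_iff_injective]
    rfl
  constructor
  · intro h
    rw [Module.Flat.iff_lTensor_injective']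
    intro I
    -- Flatness of the stalk is tested on ideals, realised as constant subsheaves of the constant
    -- sheaf `Λ`.
    let i : ModuleCat.of Λ I ⟶ ModuleCat.of Λ Λ := ModuleCat.ofHom I.subtype
    let f : EtSheaf.const (ModuleCat.of Λ I) ⟶ EtSheaf.const (ModuleCat.of Λ Λ) :=
      (constantSheaf _ _).map i
    have hi : Mono i := (ModuleCat.mono_iff_injective i).2 I.injective_subtype
    have sq := (constantSheafStalkIso Λ).hom.naturality i
    have hf : Mono f := (stalkModule Λ).mono_of_mono_map
      ((mono_iff_of_square ((constantSheafStalkIso Λ).app _) ((constantSheafStalkIso Λ).app _)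
        sq).2 hi)
    have h₁ := (key f).1 (h f hf)
    refine (ModuleCat.mono_iff_injective ((stalkModule Λ).obj F ◁ i)).1 ?_
    refine (mono_iff_of_square (f := (stalkModule Λ).obj F ◁ (stalkModule Λ).map f)
      (whiskerLeftIso _ ((constantSheafStalkIso Λ).app _))
      (whiskerLeftIso _ ((constantSheafStalkIso Λ).app _)) ?_).1
        ((ModuleCat.mono_iff_injective _).2 h₁)
    exact ((MonoidalCategory.whiskerLeft_comp _ _ _).symm.trans
      (congrArg ((stalkModule Λ).obj F ◁ ·) sq)).trans (MonoidalCategory.whiskerLeft_comp _ _ _)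
  · intro h G H f hf
    rw [key]
    exact Module.Flat.lTensor_preserves_injective_linearMap _ ((mono_iff_stalk f).1 hf)

/-- Exactness of `K ⊗ M` in terms of stalks. -/
lemma exactAt_tensor_const_iff (K : CochainComplex (EtSheaf Λ) ℤ) (M : ModuleCat.{0} Λ)
    (i j k : ℤ) (hij : i + 1 = j) (hjk : j + 1 = k) :
    (((tensorRight (EtSheaf.const M)).mapHomologicalComplex (ComplexShape.up ℤ)).obj K).ExactAt j ↔
      Function.Exact (((stalkModule Λ).map (K.d i j)).hom.rTensor M)
        (((stalkModule Λ).map (K.d j k)).hom.rTensor M) := by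
  rw [HomologicalComplex.exactAt_iff' _ i j k (by simp [← hij]) (by simp [hjk]),
    ← ShortComplex.exact_map_iff_of_faithful _ (stalkModule Λ)]
  let t (F : EtSheaf Λ) : (stalkModule Λ).obj (F ⊗ EtSheaf.const M) ≅
      (stalkModule Λ).obj F ⊗ M :=
    stalkTensorIso _ _ ≪≫ whiskerLeftIso _ ((constantSheafStalkIso Λ).app M)
  have ht {F G : EtSheaf Λ} (f : F ⟶ G) : (stalkModule Λ).map (f ▷ EtSheaf.const M) ≫ (t G).hom =
      (t F).hom ≫ (stalkModule Λ).map f ▷ M := by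
    dsimp only [t, Iso.trans_hom]
    rw [← Category.assoc, stalkTensorIso_naturality_left, Category.assoc, Category.assoc]
    exact congrArg (_ ≫ ·) (whisker_exchange ((stalkModule Λ).map f)
      ((constantSheafStalkIso Λ).hom.app M)).symm
  let S : ShortComplex (ModuleCat.{0} Λ) :=
    .mk ((stalkModule Λ).map (K.d i j) ▷ M) ((stalkModule Λ).map (K.d j k) ▷ M) (by
      rw [← comp_whiskerRight, ← Functor.map_comp, K.d_comp_d, Functor.map_zero,
        MonoidalPreadditive.zero_whiskerRight])
  rw [ShortComplex.exact_iff_of_iso (S₂ := S) (ShortComplex.isoMk (t _) (t _) (t _)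
    (ht _).symm (ht _).symm), ShortComplex.ShortExact.moduleCat_exact_iff_function_exact]
  rfl

end StalkModule

universe u in
lemma Module.Flat.prod_of_flat {R : Type u} [CommRing R] {M N : Type u} [AddCommGroup M]
    [AddCommGroup N] [Module R M] [Module R N] [Module.Flat R M] [Module.Flat R N] :
    Module.Flat R (M × N) := by
  rw [Module.Flat.iff_rTensor_injective']
  intro I
  have h (x : TensorProduct R I (M × N)) : TensorProduct.prodRight R R I M N x =
      ((LinearMap.fst R M N).lTensor I x, (LinearMap.snd R M N).lTensor I x) := by
    induction x with
    | zero =>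
      rw [map_zero, map_zero, map_zero]
      rfl
    | tmul x y => simp
    | add x y hx hy => rw [map_add, map_add, map_add, hx, hy, Prod.mk_add_mk]
  have h' {P : Type u} [AddCommGroup P] [Module R P] [Module.Flat R P] (f : M × N →ₗ[R] P)
      (x : TensorProduct R I (M × N)) (hx : I.subtype.rTensor (M × N) x = 0) :
      f.lTensor I x = 0 := by
    apply Module.Flat.rTensor_preserves_injective_linearMap I.subtype I.injective_subtype
    rw [← LinearMap.comp_apply, LinearMap.rTensor_comp_lTensor, ← LinearMap.lTensor_comp_rTensor,
      LinearMap.comp_apply, hx, map_zero, map_zero]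
  rw [injective_iff_map_eq_zero]
  intro x hx
  apply (TensorProduct.prodRight R R I M N).injective
  rw [h, h' _ x hx, h' _ x hx, map_zero]
  rfl

section SheafProperties

open scoped ZeroObject

variable (Λ : Type) [CommRing Λ]

/-- Sheaves with flat stalks. -/
abbrev flatSheaves : ObjectProperty (EtSheaf Λ) := (flatModules Λ).inverseImage (stalkModule Λ)

/-- Sheaves with finitely generated stalks. -/
abbrev finiteSheaves : ObjectProperty (EtSheaf Λ) :=
  (finiteModules Λ).inverseImage (stalkModule Λ)

instance : (flatSheaves Λ).ContainsZero where
  exists_zero := ⟨_, isZero_zero _, by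
    have : Subsingleton ((stalkModule Λ).obj (0 : EtSheaf Λ)) :=
      ModuleCat.subsingleton_of_isZero ((stalkModule Λ).map_isZero (isZero_zero _))
    exact (inferInstance : Module.Flat Λ ((stalkModule Λ).obj (0 : EtSheaf Λ)))⟩

variable {Λ}

lemma flatSheaves_of_shortExact (S : ShortComplex (EtSheaf Λ)) (hS : S.ShortExact)
    (h₂ : flatSheaves Λ S.X₂) (h₃ : flatSheaves Λ S.X₃) : flatSheaves Λ S.X₁ := by
  have hS' := hS.map_of_exact (stalkModule Λ)
  have h₂' : Module.Flat Λ (S.map (stalkModule Λ)).X₂ := h₂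
  have h₃' : Module.Flat Λ (S.map (stalkModule Λ)).X₃ := h₃
  exact Module.Flat.of_exact_of_flat (hS'.moduleCat_injective_f) (hS'.moduleCat_surjective_g)
    ((ShortComplex.ShortExact.moduleCat_exact_iff_function_exact _).1 hS'.exact)

lemma flatSheaves_biprod (F G : EtSheaf Λ) (hF : flatSheaves Λ F) (hG : flatSheaves Λ G) :
    flatSheaves Λ (F ⊞ G) := by
  have h₁ : Module.Flat Λ ((stalkModule Λ).obj F) := hF
  have h₂ : Module.Flat Λ ((stalkModule Λ).obj G) := hG
  have h : Module.Flat Λ ((stalkModule Λ).obj F × (stalkModule Λ).obj G) :=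
    Module.Flat.prod_of_flat
  have := preservesBinaryBiproducts_of_preservesBinaryProducts (stalkModule Λ)
  exact Module.Flat.of_linearEquiv
    ((stalkModule Λ).mapBiprod F G ≪≫ ModuleCat.biprodIsoProd _ _).toLinearEquiv

/-- Generators of `B` over `Λ` are lifted through `e`. As they generate without the group action,
the free representation on them surjects onto `B`. -/
lemma exists_free_epi {A B : Rep.{0} Λ C₂} (e : A ⟶ B) [Epi e] [Module.Finite Λ B.V] :
    ∃ (n : ℕ) (a : Rep.free Λ C₂ (Fin n) ⟶ A), Epi (a ≫ e) := by
  obtain ⟨n, s, hs⟩ := Module.Finite.exists_fin (R := Λ) (M := B.V)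
  choose t ht using (Rep.epi_iff_surjective e).1 inferInstance
  refine ⟨n, Rep.freeLift Λ C₂ A (fun i ↦ t (s i)), (Rep.epi_iff_surjective _).2 ?_⟩
  change Function.Surjective (Rep.freeLift Λ C₂ A (fun i ↦ t (s i)) ≫ e).hom.toLinearMap
  rw [← LinearMap.range_eq_top, eq_top_iff, ← hs, Submodule.span_le]
  rintro _ ⟨j, rfl⟩
  refine ⟨Finsupp.single j (MonoidAlgebra.single 1 1), ?_⟩
  have h := Representation.freeLift_single_single A.ρ j 1 1 (fun i ↦ t (s i))
  rw [map_one, one_smul] at h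
  exact (congrArg e.hom h).trans (ht (s j))

/-- A finitely generated quotient of a sheaf is the image of a sheaf with finitely generated free
stalks. -/
lemma exists_flat_finite_epi {F G : EtSheaf Λ} (e : F ⟶ G) [Epi e] (hG : finiteSheaves Λ G) :
    ∃ (Q : EtSheaf Λ) (q : Q ⟶ F), flatSheaves Λ Q ∧ finiteSheaves Λ Q ∧ Epi (q ≫ e) := by
  have hG' : Module.Finite Λ ((stalkRep Λ).obj G).V := hG
  obtain ⟨n, a, ha⟩ := exists_free_epi ((stalkRep Λ).map e)
  have hR₁ : Module.Finite Λ (Rep.free Λ C₂ (Fin n)).V :=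
    inferInstanceAs (Module.Finite Λ (Fin n →₀ MonoidAlgebra Λ C₂))
  have hR₂ : Module.Flat Λ (Rep.free Λ C₂ (Fin n)).V :=
    inferInstanceAs (Module.Flat Λ (Fin n →₀ MonoidAlgebra Λ C₂))
  let i := (stalkRep Λ).objObjPreimageIso (Rep.free Λ C₂ (Fin n))
  let i' := (forget₂ (Rep.{0} Λ C₂) (ModuleCat.{0} Λ)).mapIso i.symm
  refine ⟨_, (stalkRep Λ).preimage (i.hom ≫ a),
    (flatModules Λ).prop_of_iso i' hR₂, Module.Finite.equiv i'.toLinearEquiv, ?_⟩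
  refine (stalkRep Λ).epi_of_epi_map ?_
  rw [Functor.map_comp, Functor.map_preimage, Category.assoc]
  infer_instance

/-- Under the equivalence with `Λ[ℤ/2]`-modules the sheaf becomes a projective module. This supplies
the hypothesis `hH` of the derived equivalence. -/
lemma projective_finProjSheaf (P : FinProj Λ) : Projective ((finProjSheaf Λ).obj P) := by
  have h₁ : Projective P.obj := by
    rw [← Rep.equivalenceModuleMonoidAlgebra.map_projective_iff, ← IsProjective.iff_projective]
    exact P.property.2
  rw [← (stalkRep Λ).asEquivalence.map_projective_iff]
  exact Projective.of_iso ((finProjSheafStalkIso Λ).app P).symm h₁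

/-- If `2` is invertible, the sheaves given by finitely generated projective `Λ[ℤ/2]`-modules are
those with finitely generated flat stalks. -/
lemma exists_finProjSheaf [IsNoetherianRing Λ] (h2 : IsUnit (2 : Λ)) (F : EtSheaf Λ)
    (hF : flatSheaves Λ F) (hF' : finiteSheaves Λ F) :
    ∃ P : FinProj Λ, Nonempty ((finProjSheaf Λ).obj P ≅ F) := by
  have h₁ : Module.Flat Λ ((stalkRep Λ).obj F).V := hF
  have h₂ : Module.Finite Λ ((stalkRep Λ).obj F).V := hF'
  have h₃ := Module.finitePresentation_of_finite Λ ((stalkRep Λ).obj F).V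
  obtain ⟨u, hu⟩ := h2.exists_left_inv
  -- Higman's criterion is applied with `θ` half the identity: conjugation does not change it, and
  -- the sum over the two group elements is the identity. Over `Λ` the stalk is flat and finitely
  -- presented, hence projective.
  refine ⟨⟨(stalkRep Λ).obj F, (finProj_iff _).2
    ⟨h₂, Module.Flat.projective_of_finitePresentation, u • LinearMap.id, fun x ↦ ?_⟩⟩,
    ⟨(stalkRep Λ).preimageIso ((finProjSheafStalkIso Λ).app _)⟩⟩
  have h (g : C₂) : ((stalkRep Λ).obj F).ρ g
      ((u • LinearMap.id : _ →ₗ[Λ] _) (((stalkRep Λ).obj F).ρ g⁻¹ x)) = u • x := by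
    rw [LinearMap.smul_apply, map_smul, LinearMap.id_apply, Representation.self_inv_apply]
  rw [Finset.sum_congr rfl fun g _ ↦ h g, Finset.sum_const, ← Nat.cast_smul_eq_nsmul Λ, smul_smul]
  have h₄ : Finset.univ.card = Fintype.card C₂ := rfl
  have h₅ : Fintype.card C₂ = 2 := ZMod.card 2
  rw [h₄, h₅, mul_comm, Nat.cast_ofNat, hu, one_smul]

end SheafProperties

/-! ### The category `D^b_ctf` consists of perfect complexes. -/

section Ctf

variable (Λ : Type) [CommRing Λ]

/-- The complexes of étale sheaves that are represented by bounded complexes of finitely generated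
projective `Λ[ℤ/2]`-modules. -/
abbrev perfectSheaves : ObjectProperty (EtDerived Λ) :=
  (boundedToDerived (finProjSheaf Λ)).essImage

/-- K-projectivity makes the functor full, and the essential image of a full exact functor is closed
under cones. -/
instance : (perfectSheaves Λ).IsTriangulated :=
  have := boundedToDerived_full (finProjSheaf Λ) projective_finProjSheaf
  inferInstance

variable {Λ}

lemma perfectSheaves_single (P : FinProj Λ) (n : ℤ) :
    perfectSheaves Λ ((DerivedCategory.singleFunctor _ n).obj ((finProjSheaf Λ).obj P)) := by
  have h : boundedComplexes (FinProj Λ) ((HomotopyCategory.quotient _ _).obj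
      ((HomologicalComplex.single _ (ComplexShape.up ℤ) n).obj P)) :=
    ⟨n, n, fun i hi ↦ HomologicalComplex.isZero_single_obj_X _ _ _ _ (by lia)⟩
  exact ⟨⟨_, h⟩, ⟨DerivedCategory.Q.mapIso
    ((HomologicalComplex.singleMapHomologicalComplex (finProjSheaf Λ) (ComplexShape.up ℤ) n).app P) ≪≫
      ((DerivedCategory.singleFunctorIsoCompQ (EtSheaf Λ) n).app
        ((finProjSheaf Λ).obj P)).symm⟩⟩

lemma perfectSheaves_single_of_flat [IsNoetherianRing Λ] (h2 : IsUnit (2 : Λ)) (F : EtSheaf Λ)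
    (hF : flatSheaves Λ F) (hF' : finiteSheaves Λ F) (n : ℤ) :
    perfectSheaves Λ ((DerivedCategory.singleFunctor _ n).obj F) := by
  obtain ⟨P, ⟨i⟩⟩ := exists_finProjSheaf h2 F hF hF'
  exact (perfectSheaves Λ).prop_of_iso ((DerivedCategory.singleFunctor _ n).mapIso i)
    (perfectSheaves_single P n)

lemma ctf_Q_obj [IsNoetherianRing Λ] (K : CochainComplex (EtSheaf Λ) ℤ) (a b : ℤ)
    [K.IsStrictlyGE a] [K.IsStrictlyLE b] (hK : ∀ i, flatSheaves Λ (K.X i))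
    (hK' : ∀ i, finiteSheaves Λ (K.X i)) : ctf Λ (DerivedCategory.Q.obj K) := by
  have e (n : ℤ) : (DerivedCategory.homologyFunctor (EtSheaf Λ) n).obj (DerivedCategory.Q.obj K) ≅
      K.homology n := (DerivedCategory.homologyFunctorFactors (EtSheaf Λ) n).app K
  refine ⟨⟨a, b, fun n hn ↦ IsZero.of_iso ?_ (e n)⟩, fun n ↦ ⟨EtSheaf.isLocallyConstant _, ?_⟩,
    -- The complex serves as its own flat resolution. It vanishes below degree `a`, so Tor vanishes
    -- in degrees above `-a`.
    K, b, inferInstance, fun i ↦ (EtSheaf.isFlat_iff _).2 (hK i), ⟨Iso.refl _⟩,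
    -a, fun M i hi ↦ ?_⟩
  · rw [← HomologicalComplex.exactAt_iff_isZero_homology]
    refine HomologicalComplex.ExactAt.of_isZero ?_
    rcases hn with hn | hn
    · exact K.isZero_of_isStrictlyGE a n
    · exact K.isZero_of_isStrictlyLE b n
  · have h : finiteSheaves Λ (K.homology n) :=
      (finiteSheaves Λ).prop_of_epi (K.homologyπ n) ((finiteSheaves Λ).prop_of_mono (K.iCycles n) (hK' n))
    exact (finiteSheaves Λ).prop_of_iso (e n).symm h
  · rw [← HomologicalComplex.exactAt_iff_isZero_homology]
    refine HomologicalComplex.ExactAt.of_isZero ?_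
    exact (tensorRight (EtSheaf.const M)).map_isZero (K.isZero_of_isStrictlyGE a (-i))

instance : (ctf Λ).IsClosedUnderIsomorphisms where
  of_iso {X Y} i := by
    rintro ⟨⟨a, b, h₁⟩, h₂, ⟨P, b', h₃, h₄, ⟨j⟩, h₅⟩⟩
    refine ⟨⟨a, b, fun n hn ↦ IsZero.of_iso (h₁ n hn)
      ((DerivedCategory.homologyFunctor (EtSheaf Λ) n).mapIso i.symm)⟩, fun n ↦
      ⟨EtSheaf.isLocallyConstant _, ?_⟩, ⟨P, b', h₃, h₄, ⟨j ≪≫ i⟩, h₅⟩⟩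
    have h : Module.Finite Λ ((stalkModule Λ).obj
        ((DerivedCategory.homologyFunctor (EtSheaf Λ) n).obj X)) := (h₂ n).2
    exact Module.Finite.equiv ((stalkModule Λ).mapIso
      ((DerivedCategory.homologyFunctor (EtSheaf Λ) n).mapIso i)).toLinearEquiv

lemma perfectSheaves_le_ctf [IsNoetherianRing Λ] : perfectSheaves Λ ≤ ctf Λ := by
  rintro X ⟨⟨⟨K⟩, a, b, hK⟩, ⟨i⟩⟩
  refine (ctf Λ).prop_of_iso i ?_
  let L : CochainComplex (EtSheaf Λ) ℤ := ((finProjSheaf Λ).mapHomologicalComplex (ComplexShape.up ℤ)).obj K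
  have hP (P : FinProj Λ) := (finProj_iff _).1 P.property
  have h₁ : L.IsStrictlyGE a := (CochainComplex.isStrictlyGE_iff _ _).2 fun i hi ↦
    (finProjSheaf Λ).map_isZero (hK i (Or.inl hi))
  have h₂ : L.IsStrictlyLE b := (CochainComplex.isStrictlyLE_iff _ _).2 fun i hi ↦
    (finProjSheaf Λ).map_isZero (hK i (Or.inr hi))
  let t (P : FinProj Λ) : (stalkModule Λ).obj ((finProjSheaf Λ).obj P) ≃ₗ[Λ] P.obj.V :=
    ((forget₂ (Rep.{0} Λ C₂) (ModuleCat.{0} Λ)).mapIso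
      ((finProjSheafStalkIso Λ).app P)).toLinearEquiv
  refine ctf_Q_obj L a b (fun i ↦ ?_) (fun i ↦ ?_)
  · have := (hP (K.X i)).2.1
    exact Module.Flat.of_linearEquiv (t _)
  · have := (hP (K.X i)).1
    exact Module.Finite.equiv (t _).symm

lemma exactAt_iff_stalk (K : CochainComplex (EtSheaf Λ) ℤ) (i j k : ℤ) (hij : i + 1 = j)
    (hjk : j + 1 = k) : K.ExactAt j ↔ Function.Exact ((stalkModule Λ).map (K.d i j)).hom
      ((stalkModule Λ).map (K.d j k)).hom := by
  rw [HomologicalComplex.exactAt_iff' _ i j k (by simp [← hij]) (by simp [hjk]),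
    ← ShortComplex.exact_map_iff_of_faithful _ (stalkModule Λ),
    ShortComplex.ShortExact.moduleCat_exact_iff_function_exact]
  rfl

/-- Tensoring with the constant sheaf `Λ` does nothing on stalks, so the vanishing of Tor includes
the vanishing of cohomology. -/
lemma exactAt_of_tensor (K : CochainComplex (EtSheaf Λ) ℤ) (i : ℤ)
    (h : (((tensorRight (EtSheaf.const (ModuleCat.of Λ Λ))).mapHomologicalComplex
        (ComplexShape.up ℤ)).obj K).ExactAt i) : K.ExactAt i := by
  rw [exactAt_tensor_const_iff K _ (i - 1) i (i + 1) (by lia) rfl] at h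
  rw [exactAt_iff_stalk K (i - 1) i (i + 1) (by lia) rfl]
  exact Function.Exact.of_ladder_linearEquiv_of_exact (e₁ := TensorProduct.rid Λ _)
    (e₂ := TensorProduct.rid Λ _) (e₃ := TensorProduct.rid Λ _)
    (TensorProduct.ext' fun x y ↦ by simp) (TensorProduct.ext' fun x y ↦ by simp) h

/-- Exactness in degree `c - 1` after tensoring with each `Λ ⧸ I` plays the role of the vanishing of
`Tor₁` of the cokernel, and `Module.Flat.of_exact_rTensor_quotient` turns it into flatness. -/
lemma flatSheaves_opcycles (K : CochainComplex (EtSheaf Λ) ℤ) (c : ℤ)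
    (hK : flatSheaves Λ (K.X c))
    (h : ∀ M : ModuleCat.{0} Λ, (((tensorRight (EtSheaf.const M)).mapHomologicalComplex
        (ComplexShape.up ℤ)).obj K).ExactAt (c - 1)) : flatSheaves Λ (K.opcycles c) := by
  have h₀ : Module.Flat Λ ((stalkModule Λ).obj (K.X c)) := hK
  have h₁ : (ShortComplex.mk (K.d (c - 1) c) (K.pOpcycles c) (by simp)).Exact :=
    ShortComplex.exact_of_g_is_cokernel _ (K.opcyclesIsCokernel (c - 1) c (by simp))
  refine Module.Flat.of_exact_rTensor_quotient (g := ((stalkModule Λ).map (K.d (c - 1) c)).hom)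
    (f := ((stalkModule Λ).map (K.d (c - 2) (c - 1))).hom)
    (p := ((stalkModule Λ).map (K.pOpcycles c)).hom) ?_ (fun I ↦ ?_) ?_ ?_
  · rw [← ModuleCat.hom_comp, ← Functor.map_comp, K.d_comp_d, Functor.map_zero]
    rfl
  · exact (exactAt_tensor_const_iff K (ModuleCat.of Λ (Λ ⧸ I)) _ _ _ (by lia) (by lia)).1 (h _)
  · exact (ShortComplex.ShortExact.moduleCat_exact_iff_function_exact _).1
      (h₁.map (stalkModule Λ))
  · exact (epi_iff_stalk _).1 inferInstance

/-- A flat resolution is truncated from below at the bound given by the Tor-dimension. Its lowest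
term becomes a flat cokernel, and no cohomology is lost. Dévissage applies to the resulting bounded
complex of flat sheaves with finitely generated cohomology. -/
lemma ctf_le_perfectSheaves [IsNoetherianRing Λ] (h2 : IsUnit (2 : Λ)) :
    ctf Λ ≤ perfectSheaves Λ := by
  rintro X ⟨-, hX, P, b₀, hb₀, hP, ⟨i⟩, n, hn⟩
  -- `Tor_i` sits in degree `-i`, so its vanishing for `i > n` is exactness below degree `-n`.
  let c := -n
  have hP' (j : ℤ) : flatSheaves Λ (P.X j) := (EtSheaf.isFlat_iff _).1 (hP j)
  have hc (M : ModuleCat.{0} Λ) (j : ℤ) (hj : j < c) :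
      (((tensorRight (EtSheaf.const M)).mapHomologicalComplex
        (ComplexShape.up ℤ)).obj P).ExactAt j := by
    rw [HomologicalComplex.exactAt_iff_isZero_homology]
    simpa using hn M (-j) (by lia)
  have hPc : P.IsGE c := (P.isGE_iff c).2 fun j hj ↦ exactAt_of_tensor P j (hc _ j hj)
  -- The maximum ensures `c ≤ b`, so that `b - c` is a length and the truncation has no terms above
  -- `b`.
  let b := max b₀ c
  have hb : P.IsStrictlyLE b := P.isStrictlyLE_of_le b₀ b (le_max_left _ _)
  let K := P.truncGE c
  have hK : K.IsStrictlyLE b := (CochainComplex.isStrictlyLE_iff _ _).2 fun j hj ↦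
    IsZero.of_iso (P.isZero_of_isStrictlyLE b j) (P.truncGEXIso c j (by lia))
  let e : DerivedCategory.Q.obj P ≅ DerivedCategory.Q.obj K :=
    asIso (DerivedCategory.Q.map (P.πTruncGE c))
  have hK' (j : ℤ) : flatSheaves Λ (K.X j) := by
    rcases lt_trichotomy j c with hj | rfl | hj
    · exact (flatSheaves Λ).prop_of_isZero (K.isZero_of_isStrictlyGE c j)
    · exact (flatSheaves Λ).prop_of_iso (P.truncGEXIsoOpcycles c).symm
        (flatSheaves_opcycles P c (hP' c) fun M ↦ hc M _ (by lia))
    · exact (flatSheaves Λ).prop_of_iso (P.truncGEXIso c j hj).symm (hP' j)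
  have hK'' (j : ℤ) : finiteSheaves Λ (K.homology j) :=
    (finiteSheaves Λ).prop_of_iso
      ((DerivedCategory.homologyFunctor (EtSheaf Λ) j).mapIso (i.symm ≪≫ e) ≪≫
        (DerivedCategory.homologyFunctorFactors (EtSheaf Λ) j).app K) (hX j).2
  refine (perfectSheaves Λ).prop_of_iso (e.symm ≪≫ i) ?_
  exact prop_Q_obj_of_bounded flatSheaves_of_shortExact flatSheaves_biprod
    (perfectSheaves_single_of_flat h2) exists_flat_finite_epi (b - c).toNat K c b
    (by rw [Int.toNat_of_nonneg (by lia)]; lia) hK' hK''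

lemma ctf_eq_perfectSheaves [IsNoetherianRing Λ] (h2 : IsUnit (2 : Λ)) :
    ctf Λ = perfectSheaves Λ :=
  le_antisymm (ctf_le_perfectSheaves h2) perfectSheaves_le_ctf

end Ctf

/-! ### Equivalences of triangulated categories with duality. -/

namespace DualityData

section Equivalence

universe v u v' u'

variable {K₁ : Type u} [Category.{v} K₁] [Preadditive K₁] [HasShift K₁ ℤ] [HasZeroObject K₁]
  [∀ n : ℤ, (shiftFunctor K₁ n).Additive] [Pretriangulated K₁]
  {K₂ : Type u'} [Category.{v'} K₂] [Preadditive K₂] [HasShift K₂ ℤ] [HasZeroObject K₂]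
  [∀ n : ℤ, (shiftFunctor K₂ n).Additive] [Pretriangulated K₂]
  {𝒟₁ : DualityData K₁} {𝒟₂ : DualityData K₂}

/-- An equivalence of triangulated categories with duality induces isomorphisms of shifted Witt
groups. -/
lemma IsMorphism.exists_wittGroup_equiv [HasBinaryBiproducts K₁] [HasBinaryBiproducts K₂]
    {F : K₁ ⥤ K₂} [F.CommShift ℤ] [F.IsEquivalence] {η : 𝒟₁.D ⋙ F ≅ F.op ⋙ 𝒟₂.D}
    (hF : IsMorphism F η) (i : ℤ) :
    ∃ w : 𝒟₁.WittGroup i ≃+ 𝒟₂.WittGroup i, ∀ S : (𝒟₁.shift i).SymSpace,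
      ∃ S' : (𝒟₂.shift i).SymSpace, IsImage F η S S' ∧
        w (S.wittClass i.negOnePow) = S'.wittClass i.negOnePow := by
  obtain ⟨_, h₁, h₂⟩ := isMorphism_iff.1 hF
  refine ⟨wittGroupOfEquiv (h₁.shift i) (h₂.shift h₁ i) i.negOnePow, fun S ↦
    ⟨S.map (h₂.shift h₁ i), ⟨Iso.refl _, ?_⟩, wittGroupOfEquiv_wittClass _ _ _ S⟩⟩
  exact ((Category.id_comp _).trans ((congrArg ((S.map (h₂.shift h₁ i)).form.hom ≫ ·)
    ((𝒟₂.shift i).dualMap_id _)).trans (Category.comp_id _))).symm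

/-- A quasi-inverse of an equivalence of triangulated categories with duality. -/
lemma exists_inverse_morphism {G : K₂ ⥤ K₁} [hG : G.CommShift ℤ] [hG' : G.IsTriangulated]
    [G.IsEquivalence] {ζ : 𝒟₂.D ⋙ G ≅ G.op ⋙ 𝒟₁.D} (hζ : ComparisonShift G ζ)
    (hζ' : ComparisonBidual ζ) :
    ∃ (F : K₁ ⥤ K₂) (_ : F.CommShift ℤ) (η : 𝒟₁.D ⋙ F ≅ F.op ⋙ 𝒟₂.D) (τ : F ⋙ G ≅ 𝟭 K₁),
      F.IsEquivalence ∧ IsMorphism F η ∧ NatTrans.CommShift τ.hom ℤ := by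
  have h₁ := @Equivalence.commShift_of_functor _ _ _ _ G.asEquivalence ℤ _ _ _ hG
  -- The quasi-inverse is exact because it is right adjoint to the exact functor `G`.
  have h₂ := @Adjunction.isTriangulated_rightAdjoint _ _ _ _ _ _ _ _ _ _ _ _ _ _ _ _
    G.asEquivalence.toAdjunction hG
    (@Equivalence.commShiftInverse _ _ _ _ G.asEquivalence ℤ _ _ _ hG) h₁ hG'
  have h₃ := h₁.commShift_counit
  exact ⟨G.asEquivalence.inverse,
    @Equivalence.commShiftInverse _ _ _ _ G.asEquivalence ℤ _ _ _ hG,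
    inverseComparison ζ G.asEquivalence.counitIso, G.asEquivalence.counitIso,
    G.asEquivalence.isEquivalence_inverse,
    @isMorphism_iff _ _ _ _ _ _ _ _ _ _ _ _ _ _ _ _ _ (_) (_) |>.2 ⟨h₂,
      @ComparisonShift.inverse _ _ _ _ _ _ _ _ _ _ _ _ _ _ _ _ hG
        (@Equivalence.commShiftInverse _ _ _ _ G.asEquivalence ℤ _ _ _ hG) h₃ hζ, hζ'.inverse _⟩, h₃⟩

end Equivalence

end DualityData

/-! ### Shift compatibility of natural isomorphisms. -/

section ShiftIso

lemma comp_comp_eq_comp_of_id {C : Type*} [Category* C] {X Y : C} {f : X ⟶ Y} {i j : X ⟶ X}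
    {k : Y ⟶ Y} (hi : i = 𝟙 X) (hj : j = 𝟙 X) (hk : k = 𝟙 Y) : (i ≫ j) ≫ f = f ≫ k := by
  simp [hi, hj, hk]

lemma eq_comp_of_map_id {C : Type*} [Category* C] {X Y : C} (f : X ⟶ Y) {i : X ⟶ X}
    (hi : i = 𝟙 X) : f = 𝟙 X ≫ i ≫ 𝟙 X ≫ 𝟙 X ≫ 𝟙 X ≫ f ≫ 𝟙 Y := by
  simp [hi]

/-- Compatibility with shifts can be checked on the image of an essentially surjective functor. It
is used for the quotient functor, on whose source the isomorphisms are explicit in each degree. -/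
lemma commShift_of_whiskerLeft {C D E : Type*} [Category* C] [Category* D] [Category* E]
    [HasShift C ℤ] [HasShift D ℤ] [HasShift E ℤ] {L : C ⥤ D} {F F' : D ⥤ E} [L.CommShift ℤ]
    [F.CommShift ℤ] [F'.CommShift ℤ] [L.EssSurj] (τ : F ⟶ F')
    [NatTrans.CommShift (Functor.whiskerLeft L τ) ℤ] : NatTrans.CommShift τ ℤ := ⟨fun n ↦ by
  have key (X : C) : (F.commShiftIso n).hom.app (L.obj X) ≫ (τ.app (L.obj X))⟦n⟧' =
      τ.app ((L.obj X)⟦n⟧) ≫ (F'.commShiftIso n).hom.app (L.obj X) := by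
    have h := NatTrans.shift_app_comm (Functor.whiskerLeft L τ) n X
    simp only [Functor.commShiftIso_comp_hom_app, Functor.whiskerLeft_app, Category.assoc] at h
    rw [← cancel_epi (F.map ((L.commShiftIso n).hom.app X)), h]
    exact (τ.naturality_assoc _ _).symm
  ext Y
  let e := L.objObjPreimageIso Y
  have h₁ := key (L.objPreimage Y)
  have h₂ := (F.commShiftIso n).hom.naturality e.hom
  have h₃ := (F'.commShiftIso n).hom.naturality e.hom
  have h₄ := τ.naturality (e.hom⟦n⟧')
  have h₅ := congrArg (shiftFunctor E n).map (τ.naturality e.hom)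
  dsimp at h₁ h₂ h₃ h₅ ⊢
  rw [Functor.map_comp, Functor.map_comp] at h₅
  rw [← cancel_epi (F.map (e.hom⟦n⟧')), reassoc_of% h₂, h₅, reassoc_of% h₁, reassoc_of% h₄, h₃]⟩

variable {A B C : Type*} [Category* A] [Preadditive A] [Category* B] [Preadditive B] [Category* C]
  [Preadditive C] {F : A ⥤ B} {G : B ⥤ C} {H : A ⥤ C} [F.Additive] [G.Additive] [H.Additive]
  (e : F ⋙ G ≅ H)

instance : NatTrans.CommShift
    (Functor.mapHomologicalComplexCompIso e (ComplexShape.up ℤ)).hom ℤ := ⟨fun n ↦ by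
  ext K i
  simp only [Functor.commShiftIso_comp_hom_app, HomologicalComplex.comp_f, NatTrans.comp_app]
  exact comp_comp_eq_comp_of_id (f := e.hom.app (K.X (i + n))) (G.map_id _) rfl rfl⟩

instance : NatTrans.CommShift (Functor.mapHomotopyCategoryCompIso e (ComplexShape.up ℤ)).hom ℤ := by
  have : NatTrans.CommShift (Functor.whiskerLeft (HomotopyCategory.quotient A (ComplexShape.up ℤ))
      (Functor.mapHomotopyCategoryCompIso e (ComplexShape.up ℤ)).hom) ℤ := by
    have : Functor.whiskerLeft (HomotopyCategory.quotient A (ComplexShape.up ℤ))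
        (Functor.mapHomotopyCategoryCompIso e (ComplexShape.up ℤ)).hom =
        (Functor.associator _ _ _).inv ≫
          Functor.whiskerRight (F.mapHomotopyCategoryFactors _).hom _ ≫
          (Functor.associator _ _ _).hom ≫
          Functor.whiskerLeft _ (G.mapHomotopyCategoryFactors _).hom ≫
          (Functor.associator _ _ _).inv ≫
          Functor.whiskerRight (Functor.mapHomologicalComplexCompIso e (ComplexShape.up ℤ)).hom _ ≫
          (H.mapHomotopyCategoryFactors _).inv := by
      ext K
      exact eq_comp_of_map_id ((HomotopyCategory.quotient C (ComplexShape.up ℤ)).map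
        ((Functor.mapHomologicalComplexCompIso e (ComplexShape.up ℤ)).hom.app K)) ((G.mapHomotopyCategory _).map_id _)
    rw [this]
    infer_instance
  exact commShift_of_whiskerLeft (L := HomotopyCategory.quotient A (ComplexShape.up ℤ)) _

end ShiftIso

/-! ### The comparison of `D^b_ctf` with `D^b(Proj Λ[ℤ/2])`. -/

section Main

variable (Λ : Type) [CommRing Λ] [IsNoetherianRing Λ]

lemma ctf_boundedToDerived (P : DbProj Λ) : ctf Λ ((boundedToDerived (finProjSheaf Λ)).obj P) :=
  perfectSheaves_le_ctf _ ⟨P, ⟨Iso.refl _⟩⟩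

variable {Λ}

lemma exists_boundedToDerived_iso (h2 : IsUnit (2 : Λ)) (X : EtDerived Λ) (hX : ctf Λ X) :
    ∃ P, Nonempty ((boundedToDerived (finProjSheaf Λ)).obj P ≅ X) :=
  ctf_le_perfectSheaves h2 X hX

lemma ctf_isTriangulated (h2 : IsUnit (2 : Λ)) : (ctf Λ).IsTriangulated := by
  rw [ctf_eq_perfectSheaves h2]
  infer_instance

lemma nonempty_rHomDuality [(ctf Λ).IsTriangulated] (h2 : IsUnit (2 : Λ)) :
    Nonempty (RHomDuality Λ) := by
  obtain ⟨𝒟, α, hα, -, hα₁, hα₂⟩ := exists_derivedDuality (V := etDual Λ) (e := etBidual Λ)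
    (W := finProjDual Λ) (e' := finProjBidual Λ) (θ := finProjSheafDual Λ) (ctf_boundedToDerived Λ)
    projective_finProjSheaf (exists_boundedToDerived_iso h2) (finProjSheafDual_bidual Λ)
  exact ⟨{ 𝒟 with
    α := α
    isDerived := hα
    shift_eq := fun K hK n m h hKn ↦ hα₁ K hK n m h hKn
    bidual_eq := fun K hK hK' ↦ hα₂ K hK hK' }⟩

lemma RHomDuality.exists_comparison [(ctf Λ).IsTriangulated] (h2 : IsUnit (2 : Λ))
    (𝒟 : RHomDuality Λ) :
    ∃ ζ : (projDuality Λ).D ⋙ boundedLift (ctf_boundedToDerived Λ) ≅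
      (boundedLift (ctf_boundedToDerived Λ)).op ⋙ 𝒟.D,
      DualityData.ComparisonShift (𝒟₂ := 𝒟.toDualityData) (boundedLift (ctf_boundedToDerived Λ)) ζ ∧
        DualityData.ComparisonBidual (𝒟₂ := 𝒟.toDualityData) ζ := by
  have := 𝒟.isDerived
  exact @_root_.exists_comparison _ _ _ _ (etDual Λ) _ (etBidual Λ) _ _ _ _ _ (finProjDual Λ) _
    (finProjBidual Λ) (finProjSheaf Λ) _ _ _ (finProjSheafDual Λ) (ctf Λ) _ _ 𝒟.toDualityData
    projective_finProjSheaf (ctf_boundedToDerived Λ)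
    (exists_boundedToDerived_iso h2) (finProjSheafDual_bidual Λ) 𝒟.α 𝒟.isDerived
    (fun K hK n m h hKn ↦ 𝒟.shift_eq K hK n m h hKn) (fun K hK hK' ↦ 𝒟.bidual_eq K hK hK')

omit [IsNoetherianRing Λ] in
variable (Λ) in
/-- The stalks of the complexes of sheaves defined by complexes of projective modules. -/
def boundedToDerivedStalkIso :
    boundedToDerived (finProjSheaf Λ) ⋙ derivedStalk Λ ≅ DbProj.toDerived Λ :=
  Functor.associator _ _ _ ≪≫ Functor.isoWhiskerLeft _
    (Functor.associator _ _ _ ≪≫ Functor.isoWhiskerLeft _ (stalkRep Λ).mapDerivedCategoryFactorsh ≪≫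
      (Functor.associator _ _ _).symm ≪≫ Functor.isoWhiskerRight
        (Functor.mapHomotopyCategoryCompIso (finProjSheafStalkIso Λ) _) _)

omit [IsNoetherianRing Λ] in
instance : NatTrans.CommShift (boundedToDerivedStalkIso Λ).hom ℤ := by
  dsimp only [boundedToDerivedStalkIso, Iso.trans_hom, Iso.symm_hom, Functor.isoWhiskerLeft_hom,
    Functor.isoWhiskerRight_hom]
  infer_instance

end Main

end

theorem theorem5p6 (Λ : Type) [CommRing Λ] [IsNoetherianRing Λ] (p : ℕ) [CharP Λ p] (hp : p ≠ 0)
    (h2 : IsUnit (2 : Λ)) :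
    -- `D^b_ctf` is a triangulated subcategory of the derived category
    ∃ _ : (ctf Λ).IsTriangulated,
      -- `R𝓗om(-, Λ)` exists on it, and both sides are triangulated categories with duality
      Nonempty (RHomDuality Λ) ∧ (projDuality Λ).IsDuality ∧
      ∀ 𝒟 : RHomDuality Λ, 𝒟.toDualityData.IsDuality ∧
        -- there is an equivalence of triangulated categories with duality,
        ∃ (Φ : DbCtf Λ ⥤ DbProj Λ) (_ : Φ.CommShift ℤ)
          (η : 𝒟.D ⋙ Φ ≅ Φ.op ⋙ (projDuality Λ).D),
          Φ.IsEquivalence ∧ DualityData.IsMorphism Φ η ∧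
          -- which is given by passing to stalks at `Spec ℂ`
          (∃ e : Φ ⋙ DbProj.toDerived Λ ≅ (ctf Λ).ι ⋙ derivedStalk Λ,
            NatTrans.CommShift e.hom ℤ) ∧
          -- and which induces isomorphisms of Witt groups
          ∀ i : ℤ, ∃ w : 𝒟.toDualityData.WittGroup i ≃+ (projDuality Λ).WittGroup i,
            ∀ S : (𝒟.toDualityData.shift i).SymSpace, ∃ S' : ((projDuality Λ).shift i).SymSpace,
              DualityData.IsImage Φ η S S' ∧
                w (S.wittClass i.negOnePow) = S'.wittClass i.negOnePow := by
  have := ctf_isTriangulated h2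
  have hD := projDuality_isDuality Λ h2
  refine ⟨this, nonempty_rHomDuality h2, hD, fun 𝒟 ↦ ?_⟩
  have := boundedLift_isEquivalence (ctf_boundedToDerived Λ) projective_finProjSheaf
    (exists_boundedToDerived_iso h2)
  obtain ⟨ζ, hζ, hζ'⟩ := 𝒟.exists_comparison h2
  -- The comparison is constructed on the functor from complexes of projectives to `D^b_ctf`, which
  -- is explicit on complexes, and `Φ` is its quasi-inverse.
  obtain ⟨Φ, _, η, τ, hΦ, hη, hτ⟩ := DualityData.exists_inverse_morphism hζ hζ'
  -- The axioms for `R𝓗om(-, Λ)` are reflected along `Φ` from those for the termwise dual.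
  refine ⟨hη.isDuality hD, Φ, inferInstance, η, hΦ, hη, ?_, hη.exists_wittGroup_equiv⟩
  -- The complex of modules attached to `Φ X` is the stalk of the complex of sheaves that it
  -- defines, and `τ` identifies the latter with `X`.
  refine ⟨Functor.isoWhiskerLeft Φ ((boundedToDerivedStalkIso Λ).symm ≪≫
    Functor.isoWhiskerRight ((ctf Λ).liftCompιIso _ (ctf_boundedToDerived Λ)).symm _ ≪≫
    Functor.associator _ _ _) ≪≫ (Functor.associator _ _ _).symm ≪≫
    Functor.isoWhiskerRight τ _ ≪≫ Functor.leftUnitor _, ?_⟩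
  dsimp only [Iso.trans_hom, Iso.symm_hom, Functor.isoWhiskerLeft_hom,
    Functor.isoWhiskerRight_hom]
  infer_instance
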